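/- **Setting.** Let $d\in\{2,3\}$, let $\Omega,\Omega_s\subset\mathbb R^d$ be bounded domains (open, connected) with $C^\infty$ boundary such that $\overline{\Omega_s}\subset\Omega$ and $\Omega_f:=\Omega\setminus\overline{\Omega_s}$ is connected; put $\Gamma_s=\partial\Omega_s$, $\Gamma_f=\partial\Omega_f\setminus\Gamma_s$, and let $\nu$ be the unit normal on $\Gamma_s$ that is outward for $\Omega_f$ (so it points into $\Omega_s$). Let $\epsilon_{ij}(w)=\frac12(\partial_jw_i+\partial_iw_j)$ and $\sigma_{ij}(w)=\lambda\sum_{k=1}^d\epsilon_{kk}(w)\,\delta_{ij}+2\mu\,\epsilon_{ij}(w)$, with Lamé constants satisfying $\mu>0$ and $d\lambda+2\mu>0$. All function spaces are spaces of $\mathbb R^d$-valued functions. Consider the damped Stokes–Lamé system $$ \begin{cases} u_t-\operatorname{div}\epsilon(u)+\nabla p=0,\quad \operatorname{div}u=0 & \text{in }(0,T)\times\Omega_f,\\ w_{tt}-\operatorname{div}\sigma(w)+w=0 & \text{in }(0,T)\times\Omega_s,\\ u=0 & \text{on }(0,T)\times\Gamma_f,\\ \epsilon(u)\nu=\sigma(w)\nu+p\,\nu,\quad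 w_t-\sigma(w)\nu=u & \text{on }(0,T)\times\Gamma_s, \end{cases} $$ with $(u,w,w_t)(0)=y_0=(u_0,w_0,w_1)$. Let $$\mathcal H=\{u\in L^2(\Omega_f):\operatorname{div}u=0,\ u\cdot\nu|_{\Gamma_f}=0\},\quad V=\{v\in H^1(\Omega_f):\operatorname{div}v=0,\ v|_{\Gamma_f}=0\},\quad Y=\mathcal H\times H^1(\Omega_s)\times L^2(\Omega_s).$$ Let $A$ be the operator on $\mathcal H$ with $(Av,\phi)=-(\epsilon(v),\epsilon(\phi))_{L^2(\Omega_f)}$ for all $\phi\in V$, with domain the set $\mathcal D(A)$ of those $v\in V$ for which such an $Av\in\mathcal H$ exists; let $N:L^2(\Gamma_s)\to V$ be given by $(\epsilon(Nh),\epsilon(\phi))_{L^2(\Omega_f)}=\langle h,\phi\rangle_{L^2(\Gamma_s)}$ for all $\phi\in V$. For $w\in H^1(\Omega_s)$ with $\operatorname{div}\sigma(w)\in L^2(\Omega_s)$ the normal stress is defined by Green's formula $$\langle\sigma(w)\nu,\psi\rangle_{\Gamma_s}=-\int_{\Omega_s}\sigma(w):\epsilon(\psi)-\int_{\Omega_s}\operatorname{div}\sigma(w)\cdot\psi\qquad\forall\psi\in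 H^1(\Omega_s).$$ The generator of the system is $$\mathcal A(u,w,z)=\big(A(u-N\sigma(w)\nu),\ z,\ \operatorname{div}\sigma(w)-w\big),$$ and its domain $\mathcal D(\mathcal A)$ consists of those $(u,w,z)\in Y$ with $u\in V$, $\operatorname{div}\sigma(w)\in L^2(\Omega_s)$, $z\in H^1(\Omega_s)$, $\sigma(w)\nu\in L^2(\Gamma_s)$, $u-N\sigma(w)\nu\in\mathcal D(A)$ and $z-\sigma(w)\nu=u$ on $\Gamma_s$. For $y_0\in Y$ let $y(t)=(u(t),w(t),w_t(t))=e^{t\mathcal A}y_0$, $t\ge0$, be the semigroup solution, i.e. the mild solution of $y'=\mathcal Ay$, $y(0)=y_0$: $y\in C([0,\infty);Y)$, $\int_0^ty\,ds\in\mathcal D(\mathcal A)$ and $y(t)=y_0+\mathcal A\int_0^ty\,ds$ for all $t\ge0$. The function $h=\sigma(w)\nu$ of time is understood by $\sigma\big(\int_0^tw\,ds\big)\nu=\int_0^th\,ds$ for all $t\ge0$. For $0<\varepsilon<1$ let $\mathcal D(\mathcal A^\varepsilon)$ denote the domain of the fractional power $(-\mathcal A)^\varepsilon$, i.e. the range of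 $(-\mathcal A)^{-\varepsilon}=\Gamma(\varepsilon)^{-1}\int_0^\infty t^{\varepsilon-1}e^{t\mathcal A}\,dt$. Sobolev spaces of fractional order in $(0,1)$ on $\Gamma_s$ and on $(0,T)$ are Sobolev–Slobodeckij spaces. **Proposition.** (i) If $y_0\in Y$, then $\sigma(w)\nu\in L^2(0,T;L^2(\Gamma_s))$ for all $T>0$. (ii) If $y_0\in\mathcal D(\mathcal A)$, then $\sigma(w(t))\nu$ is defined for every $t\ge0$, and $\sigma(w)\nu\in C([0,T];H^{1/2}(\Gamma_s))\cap H^1(0,T;L^2(\Gamma_s))$ for all $T>0$. (iii) If $0<\varepsilon<1$ and $y_0\in\mathcal D(\mathcal A^\varepsilon)$, then $\sigma(w)\nu\in L^2(0,T;H^{\varepsilon/2}(\Gamma_s))\cap H^\varepsilon(0,T;L^2(\Gamma_s))$ for all $T>0$. -/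

import Mathlib

open MeasureTheory Filter Topology Set
open scoped ContDiff ENNReal

noncomputable section

namespace StokesLame

/-- The space `ℝ^d` with its Euclidean norm. -/
abbrev Vec (d : ℕ) := EuclideanSpace ℝ (Fin d)

/-- Real `d × d` matrices with the Frobenius inner product. -/
abbrev Mat (d : ℕ) := EuclideanSpace ℝ (Fin d × Fin d)

/-! ### Geometry -/

/-- A bounded connected open set which, near each point of its boundary, is the sublevel set of a
smooth function with nonvanishing differential. -/
structure IsSmoothDomain {d : ℕ} (D : Set (Vec d)) : Prop where
  isOpen : IsOpen D
  isBounded : Bornology.IsBounded D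
  isConnected : IsConnected D
  smooth_boundary : ∀ x ∈ frontier D, ∃ U ∈ 𝓝 x, ∃ ρ : Vec d → ℝ,
    ContDiff ℝ ∞ ρ ∧ fderiv ℝ ρ x ≠ 0 ∧ D ∩ U = {y | ρ y < 0} ∩ U

/-- The fluid-solid region `total`, the solid region `solid` fully immersed in it; the remaining
part is the fluid region, a domain as well. -/
structure Geometry (d : ℕ) where
  total : Set (Vec d)
  solid : Set (Vec d)
  total_smooth : IsSmoothDomain total
  solid_smooth : IsSmoothDomain solid
  immersed : closure solid ⊆ total
  fluid_connected : IsConnected (total \ closure solid)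

variable {d : ℕ}

/-- The fluid region `Ω_f`. -/
def Geometry.fluid (P : Geometry d) : Set (Vec d) := P.total \ closure P.solid

/-- The interface `Γ_s`. -/
def Geometry.interface (P : Geometry d) : Set (Vec d) := frontier P.solid

/-- The outer boundary `Γ_f` of the fluid region. -/
def Geometry.outer (P : Geometry d) : Set (Vec d) := frontier P.fluid \ frontier P.solid

/-- Surface measure on a hypersurface `S`. -/
def surface (S : Set (Vec d)) : Measure (Vec d) :=
  (Measure.euclideanHausdorffMeasure (d - 1)).restrict S

/-! ### Lebesgue and Sobolev spaces -/

/-- `[L²(D)]^d`. -/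
abbrev L2 (D : Set (Vec d)) := Lp (Vec d) 2 (volume.restrict D)

/-- `[L²(D)]^{d × d}`. -/
abbrev L2Mat (D : Set (Vec d)) := Lp (Mat d) 2 (volume.restrict D)

/-- `[L²(S)]^d` for a hypersurface `S`. -/
abbrev L2Surf (S : Set (Vec d)) := Lp (Vec d) 2 (surface S)

/-- Pairs (vector field, matrix field). The space `[H¹(D)]^d` is the closed subspace of those pairs
whose second entry is the weak Jacobian of the first, see `IsH1`. -/
abbrev Jet (D : Set (Vec d)) := L2 D × L2Mat D

/-- Scalar test functions with compact support inside `D`. -/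
def IsTest (D : Set (Vec d)) (φ : Vec d → ℝ) : Prop :=
  ContDiff ℝ ∞ φ ∧ HasCompactSupport φ ∧ tsupport φ ⊆ D

/-- The partial derivative `∂φ/∂x_j`. -/
def partialDeriv (j : Fin d) (φ : Vec d → ℝ) (x : Vec d) : ℝ :=
  fderiv ℝ φ x (EuclideanSpace.single j 1)

/-- The Jacobian of a differentiable vector field; its `(i, j)` entry is `∂φ_i/∂x_j`. -/
def jacobian (φ : Vec d → Vec d) (x : Vec d) : Mat d :=
  WithLp.toLp 2 fun ij => fderiv ℝ φ x (EuclideanSpace.single ij.2 1) ij.1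

/-- `p = (w, G)` with `w ∈ [H¹(D)]^d` and `G` the weak Jacobian of `w`, `G_ij = ∂w_i/∂x_j`. -/
def IsH1 (D : Set (Vec d)) (p : Jet D) : Prop :=
  ∀ φ, IsTest D φ → ∀ i j : Fin d,
    ∫ x in D, p.1 x i * partialDeriv j φ x = -∫ x in D, p.2 x (i, j) * φ x

/-- `g ∈ L²(S)` is the trace on the boundary portion `S` of the `H¹(D)` field `p`: graph closure of
the restriction map on smooth fields. -/
def HasTrace (D S : Set (Vec d)) (p : Jet D) (g : L2Surf S) : Prop :=
  ∃ φ : ℕ → Vec d → Vec d,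
    (∀ n, ContDiff ℝ ∞ (φ n) ∧ HasCompactSupport (φ n)) ∧
    Tendsto (fun n => eLpNorm (fun x => φ n x - p.1 x) 2 (volume.restrict D)) atTop (𝓝 0) ∧
    Tendsto (fun n => eLpNorm (fun x => jacobian (φ n) x - p.2 x) 2 (volume.restrict D))
      atTop (𝓝 0) ∧
    Tendsto (fun n => eLpNorm (fun x => φ n x - g x) 2 (surface S)) atTop (𝓝 0)

/-- Strain tensor `ε(w)`, as a function of the Jacobian of `w`. -/
def strain (G : Mat d) : Mat d :=
  WithLp.toLp 2 fun ij => (G (ij.1, ij.2) + G (ij.2, ij.1)) / 2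

/-- Elastic stress tensor `σ(w)` with Lamé constants `lam`, `mu`, as a function of the Jacobian. -/
def stress (lam mu : ℝ) (G : Mat d) : Mat d :=
  WithLp.toLp 2 fun ij =>
    lam * (∑ k, strain G (k, k)) * (if ij.1 = ij.2 then 1 else 0) + 2 * mu * strain G ij

/-- `div u = 0` in `D` in the sense of distributions. -/
def IsDivFree (D : Set (Vec d)) (u : L2 D) : Prop :=
  ∀ φ, IsTest D φ → ∫ x in D, ∑ j, u x j * partialDeriv j φ x = 0

/-- The space `𝓗 = {u ∈ L²(Ω_f) : div u = 0, u · ν = 0 on Γ_f}`. The normal trace on `Γ_f` of a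
divergence free field is the functional `φ ↦ ∫ u · ∇φ`, `φ` smooth and vanishing near `Γ_s`. -/
def InH (P : Geometry d) (u : L2 P.fluid) : Prop :=
  IsDivFree P.fluid u ∧
    ∀ φ : Vec d → ℝ, ContDiff ℝ ∞ φ → HasCompactSupport φ → Disjoint (tsupport φ) P.interface →
      ∫ x in P.fluid, ∑ j, u x j * partialDeriv j φ x = 0

/-- The space `V = {v ∈ H¹(Ω_f) : div v = 0, v = 0 on Γ_f}`. -/
def InV (P : Geometry d) (v : Jet P.fluid) : Prop :=
  IsH1 P.fluid v ∧ IsDivFree P.fluid v.1 ∧ HasTrace P.fluid P.outer v 0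

/-! ### Normal stress, fluid operator, Neumann map -/

/-- `F = div σ(w) ∈ L²(Ω_s)` in the sense of distributions. -/
def IsDivStress (P : Geometry d) (lam mu : ℝ) (w : Jet P.solid) (F : L2 P.solid) : Prop :=
  ∀ φ, IsTest P.solid φ → ∀ i : Fin d,
    ∫ x in P.solid, ∑ j, stress lam mu (w.2 x) (i, j) * partialDeriv j φ x
      = -∫ x in P.solid, F x i * φ x

/-- `w ∈ H¹(Ω_s)`, `F = div σ(w) ∈ L²(Ω_s)`, and the normal stress `σ(w) · ν` on `Γ_s` is
`h ∈ L²(Γ_s)`. It is defined through Green's formula; since `ν` is the outward unit normal of the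
fluid region, it points into the solid, whence
`⟨σ(w) · ν, ψ⟩ = -(σ(w), ε(ψ))_s - (div σ(w), ψ)_s` for all `ψ ∈ H¹(Ω_s)`. -/
def HasDivAndNormalStress (P : Geometry d) (lam mu : ℝ) (w : Jet P.solid) (F : L2 P.solid)
    (h : L2Surf P.interface) : Prop :=
  IsH1 P.solid w ∧ IsDivStress P lam mu w F ∧
    ∀ (ψ : Jet P.solid) (g : L2Surf P.interface), IsH1 P.solid ψ →
      HasTrace P.solid P.interface ψ g →
      ∫ x, inner ℝ (h x) (g x) ∂(surface P.interface)
        = -(∫ x in P.solid, inner ℝ (stress lam mu (w.2 x)) (strain (ψ.2 x)))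
          - ∫ x in P.solid, inner ℝ (F x) (ψ.1 x)

/-- The field `w ∈ H¹(Ω_s)` has `div σ(w) ∈ L²(Ω_s)` and normal stress `h ∈ L²(Γ_s)`. -/
def HasNormalStress (P : Geometry d) (lam mu : ℝ) (w : Jet P.solid)
    (h : L2Surf P.interface) : Prop :=
  ∃ F : L2 P.solid, HasDivAndNormalStress P lam mu w F h

/-- `v ∈ 𝓓(A)` and `A v = f ∈ 𝓗`, where `(A v, φ) = -(ε(v), ε(φ))_f` for all `φ ∈ V`. -/
def IsFluidOp (P : Geometry d) (v : Jet P.fluid) (f : L2 P.fluid) : Prop :=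
  InV P v ∧ InH P f ∧ ∀ φ : Jet P.fluid, InV P φ →
    ∫ x in P.fluid, inner ℝ (f x) (φ.1 x)
      = -∫ x in P.fluid, inner ℝ (strain (v.2 x)) (strain (φ.2 x))

/-- `n = N h`: `n ∈ V` and `(ε(n), ε(φ))_f = ⟨h, φ⟩` for all `φ ∈ V`. -/
def IsNeumann (P : Geometry d) (h : L2Surf P.interface) (n : Jet P.fluid) : Prop :=
  InV P n ∧ ∀ (φ : Jet P.fluid) (g : L2Surf P.interface), InV P φ →
    HasTrace P.fluid P.interface φ g →
    ∫ x in P.fluid, inner ℝ (strain (n.2 x)) (strain (φ.2 x))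
      = ∫ x, inner ℝ (h x) (g x) ∂(surface P.interface)

/-! ### The generator, its semigroup, and fractional powers -/

/-- Triples `(u, w, z)`; the energy space `Y = 𝓗 × H¹(Ω_s) × L²(Ω_s)` is the closed subspace
`InY`. -/
abbrev State (P : Geometry d) := L2 P.fluid × Jet P.solid × L2 P.solid

/-- Membership in the energy space `Y`. -/
def InY (P : Geometry d) (y : State P) : Prop :=
  InH P y.1 ∧ IsH1 P.solid y.2.1

/-- The graph of the generator: `(u, w, z) = y ∈ 𝓓(𝓐)` and
`𝓐 y = (A (u - N (σ(w) · ν)), z, div σ(w) - w) = f`. Here `Du`, `Dz` are the Jacobians of `u`, `z`,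
`F = div σ(w)`, `h = σ(w) · ν`, `n = N h`, and `gu`, `gz` are the traces of `u`, `z` on `Γ_s`. -/
def IsGenerator (P : Geometry d) (lam mu : ℝ) (y f : State P) : Prop :=
  InY P y ∧
  ∃ (Du : L2Mat P.fluid) (Dz : L2Mat P.solid) (F : L2 P.solid) (h : L2Surf P.interface)
    (n : Jet P.fluid) (gu gz : L2Surf P.interface),
    InV P (y.1, Du) ∧
    HasDivAndNormalStress P lam mu y.2.1 F h ∧
    IsH1 P.solid (y.2.2, Dz) ∧
    IsNeumann P h n ∧
    HasTrace P.fluid P.interface (y.1, Du) gu ∧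
    HasTrace P.solid P.interface (y.2.2, Dz) gz ∧
    gz - h = gu ∧
    IsFluidOp P ((y.1, Du) - n) f.1 ∧
    f.2.1 = (y.2.2, Dz) ∧
    f.2.2 = F - y.2.1.1

/-- Membership in `𝓓(𝓐)`. -/
def InDomain (P : Geometry d) (lam mu : ℝ) (y : State P) : Prop :=
  ∃ f, IsGenerator P lam mu y f

/-- `y(t) = e^{t𝓐} y₀`, `t ≥ 0`: the mild solution of `y' = 𝓐 y`, `y(0) = y₀`, that is the
continuous `Y`-valued `y` with `∫₀ᵗ y ∈ 𝓓(𝓐)` and `y(t) = y₀ + 𝓐 ∫₀ᵗ y` for all `t ≥ 0`. -/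
def IsSemigroupSolution (P : Geometry d) (lam mu : ℝ) (y₀ : State P) (y : ℝ → State P) : Prop :=
  y 0 = y₀ ∧ ContinuousOn y (Ici 0) ∧ (∀ t, 0 ≤ t → InY P (y t)) ∧
    ∀ t, 0 ≤ t → IsGenerator P lam mu (∫ s in (0 : ℝ)..t, y s) (y t - y₀)

/-- Membership in the domain of the fractional power `(-𝓐)^θ`, `0 < θ < 1`: the range of
`(-𝓐)^{-θ} = Γ(θ)⁻¹ ∫₀^∞ t^{θ-1} e^{t𝓐} dt`. -/
def InFracDomain (P : Geometry d) (lam mu θ : ℝ) (x : State P) : Prop :=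
  ∃ (z : State P) (y : ℝ → State P), IsSemigroupSolution P lam mu z y ∧
    IntegrableOn (fun t : ℝ => t ^ (θ - 1) • y t) (Ioi 0) ∧
    x = (Real.Gamma θ)⁻¹ • ∫ t in Ioi (0 : ℝ), t ^ (θ - 1) • y t

/-- The time dependent normal stress `h(t) = σ(w(t)) · ν` of `w : [0, ∞) → H¹(Ω_s)`, as a
distribution in time: `σ(∫₀ᵗ w) · ν = ∫₀ᵗ h` for all `t ≥ 0`. The spatial divergence of `σ(w(t))`
need not be square integrable for individual `t`. -/
def IsNormalStressOf (P : Geometry d) (lam mu : ℝ) (w : ℝ → Jet P.solid)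
    (h : ℝ → L2Surf P.interface) : Prop :=
  (∀ T, 0 < T → IntegrableOn h (Ioo 0 T)) ∧
    ∀ t, 0 ≤ t → HasNormalStress P lam mu (∫ s in (0 : ℝ)..t, w s) (∫ s in (0 : ℝ)..t, h s)

/-! ### Function spaces on `(0, T) × Γ_s` -/

/-- Squared Sobolev-Slobodeckij seminorm of order `s ∈ (0, 1)` on the hypersurface `S`. -/
def slobodeckij (S : Set (Vec d)) (s : ℝ) (g : L2Surf S) : ℝ≥0∞ :=
  ∫⁻ x, ∫⁻ x', ‖g x - g x'‖ₑ ^ 2 / ‖x - x'‖ₑ ^ ((d : ℝ) - 1 + 2 * s) ∂(surface S) ∂(surface S)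

/-- `h ∈ L²(0, T; L²(S))`. -/
def MemL2L2 (S : Set (Vec d)) (T : ℝ) (h : ℝ → L2Surf S) : Prop :=
  MemLp h 2 (volume.restrict (Ioo 0 T))

/-- `h ∈ C([0, T]; H^s(S))`, `s ∈ (0, 1)`. -/
def MemCHs (S : Set (Vec d)) (T s : ℝ) (h : ℝ → L2Surf S) : Prop :=
  ContinuousOn h (Icc 0 T) ∧ ∀ t ∈ Icc 0 T, slobodeckij S s (h t) < ⊤ ∧
    Tendsto (fun τ => slobodeckij S s (h τ - h t)) (𝓝[Icc 0 T] t) (𝓝 0)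

/-- `h ∈ H¹(0, T; L²(S))`. -/
def MemH1L2 (S : Set (Vec d)) (T : ℝ) (h : ℝ → L2Surf S) : Prop :=
  MemL2L2 S T h ∧ ∃ h' : ℝ → L2Surf S, MemL2L2 S T h' ∧
    ∀ θ : ℝ → ℝ, ContDiff ℝ ∞ θ → HasCompactSupport θ → tsupport θ ⊆ Ioo 0 T →
      ∫ t in Ioo 0 T, deriv θ t • h t = -∫ t in Ioo 0 T, θ t • h' t

/-- `h ∈ L²(0, T; H^s(S))`, `s ∈ (0, 1)`. -/
def MemL2Hs (S : Set (Vec d)) (T s : ℝ) (h : ℝ → L2Surf S) : Prop :=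
  MemL2L2 S T h ∧ ∫⁻ t in Ioo 0 T, slobodeckij S s (h t) < ⊤

/-- `h ∈ H^r(0, T; L²(S))`, `r ∈ (0, 1)`. -/
def MemHrL2 (S : Set (Vec d)) (T r : ℝ) (h : ℝ → L2Surf S) : Prop :=
  MemL2L2 S T h ∧
    ∫⁻ t in Ioo 0 T, ∫⁻ τ in Ioo 0 T, ‖h t - h τ‖ₑ ^ 2 / ‖t - τ‖ₑ ^ (1 + 2 * r) < ⊤

end StokesLame

end

open StokesLame

open scoped NNReal
set_option linter.unusedSectionVars false

/-! ### Dissipative linear relations with output, and their mild solutions -/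

/-! Everything rests on one energy identity. For y = (u, w, z) in the domain of 𝓐, pair 𝓐y with y in
the inner product (u, u) + (σ(w), ε(w)) + (w, w) + (z, z). Testing the fluid equation with u and
Green's formula for w with z, the interface contributes ⟨h, u⟩ - ⟨h, z⟩, where h = σ(w)ν; the
coupling z - h = u turns this into -‖h‖². Hence ⟨𝓐y, y⟩ = -‖ε(u)‖² - ‖h‖²
(`inner_energyMap_of_isWeakGeneratorWith`). The normal stress is thus an output k of a linear
relation x ↦ f with ‖k‖² ≤ -⟨f, x⟩, and the regularity in time follows from this inequality alone.
No generation theorem is needed: mild solutions are given, and the graph is merely closed up in the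
energy space, where it stays dissipative.

(i) A time average of a mild solution is a strong solution, so its output is bounded in L²(0, ∞) by
its initial value. For shrinking windows these outputs are difference quotients of the integrated
output K; they form a Cauchy sequence, and the limit h has primitive K (`IsMild.exists_isOutput`,
`IsOutput.integral_eq`). The same bound for the mild solution x(· + δ) - x gives the modulus of
continuity ‖h(· + δ) - h‖ ≤ ‖x(δ) - x(0)‖ in L²(0, ∞).

(ii) A mild solution that starts in the domain has a continuous derivative, which is again a mild
solution, with integrated output h - h(0) (`IsMild.exists_deriv`); so part (i) puts h' in L². In
space, h = z - u on the interface. The strain of z is controlled by the elastic component of 𝓐y,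
that of u by the energy identity, and a local Korn inequality joined to the trace theorem bounds the
H^{1/2} seminorm of a trace by the strain and the L² norm of the field
(`exists_slobodeckij_trace_le`). Korn's inequality is obtained in the whole space by finite
differences, in a half space by Nitsche's reflection, above a graph of small slope by absorption,
and is then localised by cutoffs.

(iii) If y₀ lies in the domain of the ε-th power, then δ^{-1-2ε}‖x(δ) - x(0)‖² is integrable on (0,
∞); this comes from a square function estimate for resolvents and Hardy's inequalities
(`IsMild.lintegral_modulus_lt_top`). With the modulus of (i) this is the H^ε regularity in time. For
the regularity in space, the difference quotients of K with step 2^{-j} approximate h in L² and have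
controlled H^{1/2} seminorm; comparing h with the j-th of them on pairs of points at distance about
4^{-j} interpolates to H^{ε/2} (`IsOutput.lintegral_interpolation_lt_top`). -/

/-- The integral of a function with values in a closed subspace lies in that subspace. -/
theorem Submodule.integral_mem_of_isClosed {α X : Type*} [MeasurableSpace α]
    [NormedAddCommGroup X] [NormedSpace ℝ X] [CompleteSpace X] {S : Submodule ℝ X}
    (hS : IsClosed (S : Set X)) {μ : Measure α} {f : α → X} (hf : Integrable f μ)
    (hmem : ∀ᵐ a ∂μ, f a ∈ S) : ∫ a, f a ∂μ ∈ S := by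
  have : IsClosed (S : Set X) := hS
  -- Closedness makes the quotient by `S` a normed space, and there the integrand vanishes almost
  -- everywhere.
  have h1 : S.mkQL (∫ a, f a ∂μ) = ∫ a, S.mkQL (f a) ∂μ :=
    (S.mkQL.integral_comp_comm hf).symm
  have h2 : ∫ a, S.mkQL (f a) ∂μ = 0 := by
    apply integral_eq_zero_of_ae
    filter_upwards [hmem] with a ha
    exact (Submodule.Quotient.mk_eq_zero S).2 ha
  rw [h2] at h1
  exact (Submodule.Quotient.mk_eq_zero S).1 h1

/-- A curve whose derivative satisfies `⟪e', e⟫ ≤ c ‖e‖` grows at most linearly with slope `c`. -/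
theorem norm_le_add_mul_of_inner_deriv_le {E : Type*} [NormedAddCommGroup E]
    [InnerProductSpace ℝ E] {e e' : ℝ → E} (he : ∀ t, HasDerivAt e (e' t) t) {c : ℝ} (hc : 0 ≤ c)
    (hle : ∀ t, 0 ≤ t → inner ℝ (e' t) (e t) ≤ c * ‖e t‖) {T : ℝ} (hT : 0 ≤ T) :
    ‖e T‖ ≤ ‖e 0‖ + c * T := by
  refine le_of_forall_pos_le_add fun η hη => ?_
  -- The norm is not differentiable at 0; this regularisation is, and it exceeds the norm by at most
  -- η.
  set φ : ℝ → ℝ := fun t => √(‖e t‖ ^ 2 + η ^ 2) with hφ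
  have hpos : ∀ t, 0 < ‖e t‖ ^ 2 + η ^ 2 := fun t => by positivity
  have hd : ∀ t, HasDerivAt φ ((2 * inner ℝ (e t) (e' t)) / (2 * φ t)) t := fun t =>
    ((he t).norm_sq.add_const (η ^ 2)).sqrt (hpos t).ne'
  have hφe : ∀ t, ‖e t‖ ≤ φ t := fun t => Real.le_sqrt_of_sq_le (by nlinarith [sq_nonneg η])
  have hφpos : ∀ t, 0 < φ t := fun t => Real.sqrt_pos.2 (hpos t)
  have key : φ T - φ 0 ≤ c * (T - 0) := by
    refine (convex_Icc 0 T).image_sub_le_mul_sub_of_deriv_le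
      (fun t _ => (hd t).continuousAt.continuousWithinAt)
      (fun t _ => (hd t).differentiableAt.differentiableWithinAt) (fun t ht => ?_)
      0 (left_mem_Icc.2 hT) T (right_mem_Icc.2 hT) hT
    rw [(hd t).deriv, mul_div_mul_left _ _ two_ne_zero, div_le_iff₀ (hφpos t)]
    have := hle t (interior_subset ht).1
    rw [real_inner_comm] at this
    exact this.trans (mul_le_mul_of_nonneg_left (hφe t) hc)
  have h0 : φ 0 ≤ ‖e 0‖ + η := by
    rw [hφ]
    apply Real.sqrt_le_iff.2 ⟨by positivity, by nlinarith [norm_nonneg (e 0)]⟩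
  linarith [hφe T]

namespace DissipativeRelation

variable {E Z : Type*} [NormedAddCommGroup E] [InnerProductSpace ℝ E]
  [NormedAddCommGroup Z] [InnerProductSpace ℝ Z]

/-- A linear relation `x ↦ f` with output `k` is dissipative if `‖k‖² ≤ -⟪f, x⟫`. -/
def IsDissipative (G : Submodule ℝ (E × E × Z)) : Prop :=
  ∀ x f k, (x, f, k) ∈ G → ‖k‖ ^ 2 ≤ -inner ℝ f x

/-- `x` is a mild solution of `x' ∈ G x`, with integrated output `K`. -/
structure IsMild (G : Submodule ℝ (E × E × Z)) (x : ℝ → E) (K : ℝ → Z) : Prop where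
  cont : Continuous x
  mem : ∀ t, 0 ≤ t → (∫ s in (0 : ℝ)..t, x s, x t - x 0, K t) ∈ G

/-- `x` is a continuously differentiable solution of `x' ∈ G x` with output `k`. -/
structure IsStrong (G : Submodule ℝ (E × E × Z)) (x x' : ℝ → E) (k : ℝ → Z) : Prop where
  deriv : ∀ t, HasDerivAt x (x' t) t
  cont_deriv : Continuous x'
  cont_out : ContinuousOn k (Ici 0)
  mem : ∀ t, 0 ≤ t → (x t, x' t, k t) ∈ G

variable {G : Submodule ℝ (E × E × Z)}

theorem IsDissipative.topologicalClosure (hG : IsDissipative G) :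
    IsDissipative G.topologicalClosure := by
  intro x f k h
  have hcl : IsClosed {p : E × E × Z | ‖p.2.2‖ ^ 2 ≤ -inner ℝ p.2.1 p.1} :=
    isClosed_le (by fun_prop) (by fun_prop)
  have hsub : (G : Set (E × E × Z)) ⊆ {p : E × E × Z | ‖p.2.2‖ ^ 2 ≤ -inner ℝ p.2.1 p.1} :=
    fun p hp => hG p.1 p.2.1 p.2.2 hp
  exact closure_minimal hsub hcl h

theorem IsStrong.sub {x x' y y' : ℝ → E} {k l : ℝ → Z} (hx : IsStrong G x x' k)
    (hy : IsStrong G y y' l) :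
    IsStrong G (fun t => x t - y t) (fun t => x' t - y' t) (fun t => k t - l t) where
  deriv t := (hx.deriv t).sub (hy.deriv t)
  cont_deriv := hx.cont_deriv.sub hy.cont_deriv
  cont_out := hx.cont_out.sub hy.cont_out
  mem t ht := G.sub_mem (hx.mem t ht) (hy.mem t ht)

theorem IsStrong.const_smul {x x' : ℝ → E} {k : ℝ → Z} (hx : IsStrong G x x' k) (c : ℝ) :
    IsStrong G (fun t => c • x t) (fun t => c • x' t) (fun t => c • k t) where
  deriv t := (hx.deriv t).const_smul c
  cont_deriv := hx.cont_deriv.const_smul c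
  cont_out := hx.cont_out.const_smul c
  mem t ht := G.smul_mem c (hx.mem t ht)

theorem IsMild.sub {x y : ℝ → E} {K L : ℝ → Z} (hx : IsMild G x K) (hy : IsMild G y L) :
    IsMild G (fun t => x t - y t) (fun t => K t - L t) where
  cont := hx.cont.sub hy.cont
  mem t ht := by
    have h := G.sub_mem (hx.mem t ht) (hy.mem t ht)
    rw [intervalIntegral.integral_sub (hx.cont.intervalIntegrable _ _)
      (hy.cont.intervalIntegrable _ _)]
    convert h using 1
    simp only [Prod.mk_sub_mk]
    congr 2
    abel

/-- A mild solution need not lie in the domain, but its integral over any window does, with the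
increment as image. This is the source of all strong solutions below. -/
theorem IsMild.window {x : ℝ → E} {K : ℝ → Z} (hx : IsMild G x K) {s t : ℝ} (hs : 0 ≤ s)
    (ht : 0 ≤ t) : (∫ r in s..t, x r, x t - x s, K t - K s) ∈ G := by
  have h := G.sub_mem (hx.mem t ht) (hx.mem s hs)
  rw [← intervalIntegral.integral_interval_sub_left (hx.cont.intervalIntegrable _ _)
    (hx.cont.intervalIntegrable 0 _)]
  convert h using 1
  simp only [Prod.mk_sub_mk]
  congr 2
  abel

theorem IsMild.shift {x : ℝ → E} {K : ℝ → Z} (hx : IsMild G x K) {s : ℝ} (hs : 0 ≤ s) :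
    IsMild G (fun t => x (t + s)) (fun t => K (t + s) - K s) where
  cont := hx.cont.comp (by fun_prop)
  mem t ht := by
    have h := hx.window hs (add_nonneg ht hs)
    rw [intervalIntegral.integral_comp_add_right]
    simpa using h

/-- The bound forces k = 0 over x = 0 whatever f is, so by linearity the output is a function of x
alone, although f need not be one. -/
theorem IsDissipative.output_eq_zero (hG : IsDissipative G) {f : E} {k : Z}
    (h : ((0 : E), f, k) ∈ G) : k = 0 := by
  have := hG _ _ _ h
  rw [inner_zero_right, neg_zero] at this
  exact norm_eq_zero.1 (by nlinarith [norm_nonneg k])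

theorem IsMild.output_zero (hG : IsDissipative G) {x : ℝ → E} {K : ℝ → Z} (hx : IsMild G x K) :
    K 0 = 0 := by
  have := hx.mem 0 le_rfl
  rw [intervalIntegral.integral_same] at this
  exact hG.output_eq_zero this

/-- By Cauchy's inequality the output is dominated by a geometric mean, so outputs converge as soon
as x and f do. -/
theorem IsDissipative.norm_sq_le (hG : IsDissipative G) {x f : E} {k : Z}
    (h : (x, f, k) ∈ G) : ‖k‖ ^ 2 ≤ ‖f‖ * ‖x‖ :=
  (hG _ _ _ h).trans ((neg_le_abs _).trans (abs_real_inner_le_norm _ _))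

/-- The output is continuous along continuous curves in the relation. -/
theorem IsDissipative.continuousOn_output (hG : IsDissipative G) {x f : ℝ → E} {k : ℝ → Z}
    {s : Set ℝ} (hx : ContinuousOn x s) (hf : ContinuousOn f s)
    (h : ∀ t ∈ s, (x t, f t, k t) ∈ G) : ContinuousOn k s := by
  intro t ht
  rw [ContinuousWithinAt, tendsto_iff_norm_sub_tendsto_zero]
  have hb : Tendsto (fun r => √(‖f r - f t‖ * ‖x r - x t‖)) (𝓝[s] t) (𝓝 0) := by
    have h1 := (tendsto_iff_norm_sub_tendsto_zero.1 (hf t ht))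
    have h2 := (tendsto_iff_norm_sub_tendsto_zero.1 (hx t ht))
    have := (Real.continuous_sqrt.tendsto _).comp (h1.mul h2)
    rw [mul_zero, Real.sqrt_zero] at this
    exact this
  refine squeeze_zero' (Eventually.of_forall fun r => norm_nonneg _) ?_ hb
  filter_upwards [self_mem_nhdsWithin] with r hr
  exact Real.le_sqrt_of_sq_le (hG.norm_sq_le (G.sub_mem (h r hr) (h t ht)))

theorem IsMild.continuousOn_output (hG : IsDissipative G) {x : ℝ → E} {K : ℝ → Z}
    (hx : IsMild G x K) : ContinuousOn K (Ici 0) :=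
  hG.continuousOn_output
    (intervalIntegral.continuous_primitive (fun _ _ => hx.cont.intervalIntegrable _ _) 0).continuousOn
    (hx.cont.sub continuous_const).continuousOn fun t ht => hx.mem t ht

/-- Averages in time of a mild solution are strong solutions. -/
theorem IsMild.isStrong_window [CompleteSpace E] (hG : IsDissipative G) {x : ℝ → E} {K : ℝ → Z}
    (hx : IsMild G x K) {δ : ℝ} (hδ : 0 ≤ δ) :
    IsStrong G (fun t => ∫ r in t..t + δ, x r) (fun t => x (t + δ) - x t)
      (fun t => K (t + δ) - K t) where
  deriv t := by
    have h1 : HasDerivAt (fun t => ∫ r in (0 : ℝ)..t, x r) (x t) t :=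
      (hx.cont.integral_hasStrictDerivAt 0 t).hasDerivAt
    have h2 : HasDerivAt (fun t => ∫ r in (0 : ℝ)..t + δ, x r) (x (t + δ)) t :=
      (hx.cont.integral_hasStrictDerivAt 0 (t + δ)).hasDerivAt.comp_add_const t δ
    refine (h2.sub h1).congr_of_eventuallyEq (Eventually.of_forall fun s => ?_)
    exact (intervalIntegral.integral_interval_sub_left (hx.cont.intervalIntegrable _ _)
      (hx.cont.intervalIntegrable 0 _)).symm
  cont_deriv := (hx.cont.comp (by fun_prop)).sub hx.cont
  cont_out := by
    have hK := hx.continuousOn_output hG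
    refine ContinuousOn.sub (hK.comp (by fun_prop) fun t ht => ?_) hK
    exact add_nonneg (mem_Ici.1 ht) hδ
  mem t ht := hx.window ht (add_nonneg ht hδ)

end DissipativeRelation

/-! ### Square integrable outputs of mild solutions -/

namespace DissipativeRelation

variable {E Z : Type*} [NormedAddCommGroup E] [InnerProductSpace ℝ E] [CompleteSpace E]
  [NormedAddCommGroup Z] [InnerProductSpace ℝ Z] {G : Submodule ℝ (E × E × Z)}

/-- Energy balance: the derivative of ‖x‖² is 2⟨x', x⟩ ≤ -2‖k‖². Half of this decay is enough. -/
theorem IsStrong.integral_output_le (hG : IsDissipative G) {x x' : ℝ → E} {k : ℝ → Z}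
    (hx : IsStrong G x x' k) {T : ℝ} (hT : 0 ≤ T) :
    ∫ t in (0 : ℝ)..T, ‖k t‖ ^ 2 ≤ ‖x 0‖ ^ 2 := by
  have hxc : Continuous x := continuous_iff_continuousAt.2 fun t => (hx.deriv t).continuousAt
  have hc : Continuous fun t => 2 * inner ℝ (x t) (x' t) :=
    continuous_const.mul (hxc.inner hx.cont_deriv)
  have h1 : ∫ t in (0 : ℝ)..T, 2 * inner ℝ (x t) (x' t) = ‖x T‖ ^ 2 - ‖x 0‖ ^ 2 :=
    intervalIntegral.integral_eq_sub_of_hasDerivAt (fun t _ => (hx.deriv t).norm_sq)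
      (hc.intervalIntegrable _ _)
  have hk : ContinuousOn (fun t => ‖k t‖ ^ 2) (uIcc 0 T) := by
    rw [uIcc_of_le hT]
    exact ((hx.cont_out.mono Icc_subset_Ici_self).norm).pow 2
  have h2 : ∫ t in (0 : ℝ)..T, ‖k t‖ ^ 2 ≤ ∫ t in (0 : ℝ)..T, -(2 * inner ℝ (x t) (x' t)) := by
    refine intervalIntegral.integral_mono_on hT hk.intervalIntegrable
      (hc.neg.intervalIntegrable _ _) fun t ht => ?_
    have := hG _ _ _ (hx.mem t ht.1)
    rw [real_inner_comm] at this
    nlinarith [norm_nonneg (k t)]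
  rw [intervalIntegral.integral_neg, h1] at h2
  nlinarith [norm_nonneg (x T)]

theorem eLpNorm_two_sq {α F : Type*} [MeasurableSpace α] [NormedAddCommGroup F] {μ : Measure α}
    (f : α → F) : eLpNorm f 2 μ ^ 2 = ∫⁻ a, ‖f a‖ₑ ^ 2 ∂μ := by
  rw [eLpNorm_eq_lintegral_rpow_enorm_toReal two_ne_zero ENNReal.ofNat_ne_top,
    ← ENNReal.rpow_natCast, ← ENNReal.rpow_mul]
  simp

theorem eLpNorm_two_le_iff {α F : Type*} [MeasurableSpace α] [NormedAddCommGroup F]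
    {μ : Measure α} (f : α → F) (c : ℝ≥0∞) :
    eLpNorm f 2 μ ≤ c ↔ ∫⁻ a, ‖f a‖ₑ ^ 2 ∂μ ≤ c ^ 2 := by
  rw [← eLpNorm_two_sq, ENNReal.pow_le_pow_left_iff two_ne_zero]

theorem IsStrong.eLpNorm_output_le (hG : IsDissipative G) {x x' : ℝ → E} {k : ℝ → Z}
    (hx : IsStrong G x x' k) : eLpNorm k 2 (volume.restrict (Ioi 0)) ≤ ‖x 0‖ₑ := by
  rw [eLpNorm_two_le_iff]
  have hU : Ioi (0 : ℝ) = ⋃ n : ℕ, Ioc (0 : ℝ) n := by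
    ext t
    simp only [mem_Ioi, mem_iUnion, mem_Ioc]
    exact ⟨fun h => ⟨⌈t⌉₊, h, Nat.le_ceil t⟩, fun ⟨_, h, _⟩ => h⟩
  have hdir : Directed (· ⊆ ·) fun n : ℕ => Ioc (0 : ℝ) n :=
    Monotone.directed_le fun m n h => Ioc_subset_Ioc_right (by exact_mod_cast h)
  rw [hU, setLIntegral_iUnion_of_directed _ hdir]
  refine iSup_le fun n => ?_
  have hn : (0 : ℝ) ≤ n := n.cast_nonneg
  have hk : ContinuousOn (fun t => ‖k t‖ ^ 2) (uIcc 0 (n : ℝ)) := by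
    rw [uIcc_of_le hn]
    exact ((hx.cont_out.mono Icc_subset_Ici_self).norm).pow 2
  have h1 := hx.integral_output_le hG hn
  rw [intervalIntegral.integral_of_le hn] at h1
  have h2 := ofReal_integral_eq_lintegral_ofReal (μ := volume.restrict (Ioc 0 (n : ℝ)))
    (hk.intervalIntegrable (μ := volume)).1
    (Eventually.of_forall fun t => by positivity)
  have h3 : ∀ t, ENNReal.ofReal (‖k t‖ ^ 2) = ‖k t‖ₑ ^ 2 := fun t => by
    rw [ENNReal.ofReal_pow (norm_nonneg _), ofReal_norm]
  simp only [h3] at h2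
  rw [← h2, ← ofReal_norm, ← ENNReal.ofReal_pow (norm_nonneg _)]
  exact ENNReal.ofReal_le_ofReal h1

theorem tendsto_average_window {x : ℝ → E} (hx : Continuous x) (t : ℝ) :
    Tendsto (fun δ : ℝ => δ⁻¹ • ∫ r in t..t + δ, x r) (𝓝[>] 0) (𝓝 (x t)) := by
  have h := (hx.integral_hasStrictDerivAt t t).hasDerivAt.tendsto_slope_zero_right
  simpa using h

/-- Comparison of a mild solution with an element of the domain. -/
theorem IsMild.norm_sub_le (hG : IsDissipative G) {x : ℝ → E} {K : ℝ → Z} (hx : IsMild G x K)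
    {a f : E} {k : Z} (ha : (a, f, k) ∈ G) {t : ℝ} (ht : 0 ≤ t) :
    ‖x t - a‖ ≤ ‖x 0 - a‖ + t * ‖f‖ := by
  have hlim : ∀ s, Tendsto (fun δ : ℝ => ‖δ⁻¹ • (∫ r in s..s + δ, x r) - a‖) (𝓝[>] 0)
      (𝓝 ‖x s - a‖) := fun s => ((tendsto_average_window hx.cont s).sub_const a).norm
  refine le_of_tendsto_of_tendsto (hlim t) ((hlim 0).add_const (t * ‖f‖)) ?_
  filter_upwards [self_mem_nhdsWithin] with δ hδ
  have hδ : 0 < δ := hδ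
  have hs := hx.isStrong_window hG hδ.le
  -- For e the window integral minus δa, dissipativity of the difference gives ⟨e' - δf, e⟩ ≤ 0,
  -- hence ⟨e', e⟩ ≤ δ‖f‖‖e‖; dividing the resulting growth bound by δ and letting δ → 0 gives the
  -- claim.
  have key := norm_le_add_mul_of_inner_deriv_le (e := fun s => (∫ r in s..s + δ, x r) - δ • a)
    (fun s => (hs.deriv s).sub_const _) (c := δ * ‖f‖) (by positivity) (fun s hs0 => ?_) ht
  · have hre : ∀ s, δ⁻¹ • (∫ r in s..s + δ, x r) - a
        = δ⁻¹ • ((∫ r in s..s + δ, x r) - δ • a) := fun s => by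
      rw [smul_sub, smul_smul, inv_mul_cancel₀ hδ.ne', one_smul]
    rw [hre, hre, norm_smul, norm_smul, norm_inv, Real.norm_of_nonneg hδ.le]
    calc δ⁻¹ * _ ≤ δ⁻¹ * _ := mul_le_mul_of_nonneg_left key (by positivity)
      _ = _ := by field_simp
  · have h1 := hG _ _ _ (G.sub_mem (hs.mem s hs0) (G.smul_mem δ ha))
    have h2 : inner ℝ (x (s + δ) - x s - δ • f) ((∫ r in s..s + δ, x r) - δ • a) ≤ 0 := by
      have := sq_nonneg ‖(K (s + δ) - K s) - δ • k‖
      have h1' : ‖(K (s + δ) - K s) - δ • k‖ ^ 2 ≤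
        -inner ℝ (x (s + δ) - x s - δ • f) ((∫ r in s..s + δ, x r) - δ • a) := h1
      linarith
    rw [inner_sub_left, real_inner_smul_left] at h2
    have h3 := real_inner_le_norm f ((∫ r in s..s + δ, x r) - δ • a)
    nlinarith

theorem IsMild.norm_le (hG : IsDissipative G) {x : ℝ → E} {K : ℝ → Z} (hx : IsMild G x K)
    {t : ℝ} (ht : 0 ≤ t) : ‖x t‖ ≤ ‖x 0‖ := by
  simpa using hx.norm_sub_le hG (a := 0) (f := 0) (k := 0) G.zero_mem ht

/-- Difference quotients of `K`. -/
noncomputable def diffQuot (K : ℝ → Z) (δ t : ℝ) : Z := δ⁻¹ • (K (t + δ) - K t)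

/-- The step lengths `1 / (n + 1)`. -/
noncomputable def stepLength (n : ℕ) : ℝ := 1 / ((n : ℝ) + 1)

theorem stepLength_pos (n : ℕ) : 0 < stepLength n := Nat.one_div_pos_of_nat

theorem tendsto_stepLength : Tendsto stepLength atTop (𝓝[>] 0) :=
  tendsto_nhdsWithin_iff.2 ⟨tendsto_one_div_add_atTop_nhds_zero_nat,
    Eventually.of_forall stepLength_pos⟩

/-- `h` is the density of the integrated output `K`, the limit in `L²(0, ∞)` of its difference
quotients. -/
structure IsOutput (K h : ℝ → Z) : Prop where
  meas : StronglyMeasurable h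
  tendsto : Tendsto (fun n => eLpNorm (fun t => diffQuot K (stepLength n) t - h t) 2
    (volume.restrict (Ioi 0))) atTop (𝓝 0)

theorem IsMild.isStrong_average (hG : IsDissipative G) {x : ℝ → E} {K : ℝ → Z}
    (hx : IsMild G x K) {δ : ℝ} (hδ : 0 < δ) :
    IsStrong G (fun t => δ⁻¹ • ∫ r in t..t + δ, x r) (fun t => δ⁻¹ • (x (t + δ) - x t))
      (diffQuot K δ) :=
  (hx.isStrong_window hG hδ.le).const_smul δ⁻¹

theorem IsStrong.memLp_output (hG : IsDissipative G) {x x' : ℝ → E} {k : ℝ → Z}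
    (hx : IsStrong G x x' k) : MemLp k 2 (volume.restrict (Ioi 0)) :=
  ⟨(hx.cont_out.mono Ioi_subset_Ici_self).aestronglyMeasurable measurableSet_Ioi,
    (hx.eLpNorm_output_le hG).trans_lt enorm_lt_top⟩

theorem IsMild.memLp_diffQuot (hG : IsDissipative G) {x : ℝ → E} {K : ℝ → Z}
    (hx : IsMild G x K) (n : ℕ) :
    MemLp (diffQuot K (stepLength n)) 2 (volume.restrict (Ioi 0)) :=
  (hx.isStrong_average hG (stepLength_pos n)).memLp_output hG

/-- The difference quotients of K are outputs of time averages of x. Their mutual distances in L²(0,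
∞) are bounded by those of the initial averages, which converge to x 0. -/
theorem IsMild.exists_isOutput [CompleteSpace Z] (hG : IsDissipative G) {x : ℝ → E} {K : ℝ → Z}
    (hx : IsMild G x K) : ∃ h, IsOutput K h := by
  have hmem := hx.memLp_diffQuot hG
  have hcau : CauchySeq fun n => (hmem n).toLp := by
    have hav : CauchySeq fun n => (stepLength n)⁻¹ • ∫ r in (0 : ℝ)..0 + stepLength n, x r :=
      ((tendsto_average_window hx.cont 0).comp tendsto_stepLength).cauchySeq
    rw [Metric.cauchySeq_iff'] at hav ⊢
    intro ε hε
    obtain ⟨N, hN⟩ := hav ε hε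
    refine ⟨N, fun n hn => ?_⟩
    have h1 := ((hx.isStrong_average hG (stepLength_pos n)).sub
      (hx.isStrong_average hG (stepLength_pos N))).eLpNorm_output_le hG
    have h2 : edist ((hmem n).toLp) ((hmem N).toLp) < ENNReal.ofReal ε := by
      rw [Lp.edist_toLp_toLp]
      refine h1.trans_lt ?_
      rw [← edist_eq_enorm_sub, edist_dist]
      exact (ENNReal.ofReal_lt_ofReal_iff hε).2 (hN n hn)
    rw [edist_dist] at h2
    exact (ENNReal.ofReal_lt_ofReal_iff hε).1 h2
  obtain ⟨g, hg⟩ := cauchySeq_tendsto_of_complete hcau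
  refine ⟨g, Lp.stronglyMeasurable g, ?_⟩
  rw [Lp.tendsto_Lp_iff_tendsto_eLpNorm'] at hg
  refine hg.congr fun n => eLpNorm_congr_ae ?_
  filter_upwards [(hmem n).coeFn_toLp] with t ht
  simp [ht]

theorem IsOutput.memLp (hG : IsDissipative G) {x : ℝ → E} {K h : ℝ → Z}
    (hx : IsMild G x K) (hh : IsOutput K h) : MemLp h 2 (volume.restrict (Ioi 0)) := by
  obtain ⟨n, hn⟩ := ((tendsto_order.1 hh.tendsto).2 1 one_pos).exists
  have h1 : MemLp (fun t => diffQuot K (stepLength n) t - h t) 2 (volume.restrict (Ioi 0)) :=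
    ⟨(hx.memLp_diffQuot hG n).1.sub hh.meas.aestronglyMeasurable, hn.trans ENNReal.one_lt_top⟩
  have h2 := (hx.memLp_diffQuot hG n).sub h1
  refine h2.congr_norm hh.meas.aestronglyMeasurable (Eventually.of_forall fun t => ?_)
  simp

/-- The output of a mild solution is bounded in `L²(0, ∞)` by its initial value. -/
theorem IsOutput.eLpNorm_le (hG : IsDissipative G) {x : ℝ → E} {K h : ℝ → Z}
    (hx : IsMild G x K) (hh : IsOutput K h) :
    eLpNorm h 2 (volume.restrict (Ioi 0)) ≤ ‖x 0‖ₑ := by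
  have h1 : Tendsto (fun n => ‖(stepLength n)⁻¹ • ∫ r in (0 : ℝ)..0 + stepLength n, x r‖ₑ
      + eLpNorm (fun t => diffQuot K (stepLength n) t - h t) 2 (volume.restrict (Ioi 0)))
      atTop (𝓝 (‖x 0‖ₑ + 0)) :=
    ((tendsto_average_window hx.cont 0).comp tendsto_stepLength).enorm.add hh.tendsto
  rw [add_zero] at h1
  refine ge_of_tendsto' h1 fun n => ?_
  have hd := hx.isStrong_average hG (stepLength_pos n)
  have hq := (hx.memLp_diffQuot hG n).1
  calc eLpNorm h 2 (volume.restrict (Ioi 0))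
      = eLpNorm (fun t => diffQuot K (stepLength n) t - (diffQuot K (stepLength n) t - h t)) 2
        (volume.restrict (Ioi 0)) := by simp
    _ ≤ _ := eLpNorm_sub_le hq (hq.sub hh.meas.aestronglyMeasurable) one_le_two
    _ ≤ _ := by gcongr; exact hd.eLpNorm_output_le hG

theorem IsOutput.sub {K L h k : ℝ → Z} (hK : ContinuousOn K (Ici 0)) (hL : ContinuousOn L (Ici 0))
    (hh : IsOutput K h) (hk : IsOutput L k) :
    IsOutput (fun t => K t - L t) (fun t => h t - k t) where
  meas := hh.meas.sub hk.meas
  tendsto := by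
    have hm : ∀ {K : ℝ → Z}, ContinuousOn K (Ici 0) → ∀ n,
        AEStronglyMeasurable (diffQuot K (stepLength n)) (volume.restrict (Ioi 0)) := by
      intro K hK n
      refine (ContinuousOn.const_smul (ContinuousOn.sub (hK.comp (by fun_prop) fun t ht => ?_)
        (hK.mono Ioi_subset_Ici_self)) _).aestronglyMeasurable measurableSet_Ioi
      exact add_nonneg (mem_Ioi.1 ht).le (stepLength_pos n).le
    refine tendsto_of_tendsto_of_tendsto_of_le_of_le tendsto_const_nhds
      (by simpa using hh.tendsto.add hk.tendsto) (fun _ => zero_le) fun n => ?_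
    refine le_trans (le_of_eq ?_) (eLpNorm_sub_le ((hm hK n).sub hh.meas.aestronglyMeasurable)
      ((hm hL n).sub hk.meas.aestronglyMeasurable) one_le_two)
    congr 1
    funext t
    simp only [diffQuot, Pi.sub_apply, smul_sub]
    abel

/-- Translation to the right does not increase the `L²(0, ∞)` norm. -/
theorem eLpNorm_shift_le {f : ℝ → Z} (hf : AEStronglyMeasurable f (volume.restrict (Ioi 0)))
    {s : ℝ} (hs : 0 ≤ s) : eLpNorm (fun t => f (t + s)) 2 (volume.restrict (Ioi 0))
      ≤ eLpNorm f 2 (volume.restrict (Ioi 0)) := by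
  have hmp := (measurePreserving_add_right volume s).restrict_preimage
    (measurableSet_Ioi (a := s))
  have hset : (fun t : ℝ => t + s) ⁻¹' Ioi s = Ioi 0 := by ext; simp
  rw [hset] at hmp
  have hle : (volume : Measure ℝ).restrict (Ioi s) ≤ volume.restrict (Ioi 0) :=
    Measure.restrict_mono (Ioi_subset_Ioi hs) le_rfl
  have h1 := eLpNorm_comp_measurePreserving (p := 2) (hf.mono_measure hle) hmp
  exact h1.le.trans (eLpNorm_mono_measure _ hle)

theorem IsOutput.shift {K h : ℝ → Z} (hK : ContinuousOn K (Ici 0)) (hh : IsOutput K h) {s : ℝ}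
    (hs : 0 ≤ s) : IsOutput (fun t => K (t + s) - K s) (fun t => h (t + s)) where
  meas := hh.meas.comp_measurable (by fun_prop)
  tendsto := by
    refine tendsto_of_tendsto_of_tendsto_of_le_of_le tendsto_const_nhds hh.tendsto
      (fun _ => zero_le) fun n => ?_
    have hm : AEStronglyMeasurable (fun t => diffQuot K (stepLength n) t - h t)
        (volume.restrict (Ioi 0)) := by
      refine AEStronglyMeasurable.sub ?_ hh.meas.aestronglyMeasurable
      refine (ContinuousOn.const_smul (ContinuousOn.sub (hK.comp (by fun_prop) fun t ht => ?_)
        (hK.mono Ioi_subset_Ici_self)) _).aestronglyMeasurable measurableSet_Ioi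
      exact add_nonneg (mem_Ioi.1 ht).le (stepLength_pos n).le
    refine le_trans (le_of_eq ?_) (eLpNorm_shift_le hm hs)
    congr 1
    funext t
    simp only [diffQuot, sub_sub_sub_cancel_right, add_right_comm]

/-- The modulus of continuity in `L²(0, ∞)` of the output. -/
theorem IsOutput.eLpNorm_shift_sub_le (hG : IsDissipative G) {x : ℝ → E} {K h : ℝ → Z}
    (hx : IsMild G x K) (hh : IsOutput K h) {δ : ℝ} (hδ : 0 ≤ δ) :
    eLpNorm (fun t => h (t + δ) - h t) 2 (volume.restrict (Ioi 0)) ≤ ‖x δ - x 0‖ₑ := by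
  have hK := hx.continuousOn_output hG
  -- The shifted solution minus the original one is mild with initial value x δ - x 0.
  have := (IsOutput.sub ((hx.shift hδ).continuousOn_output hG) hK (hh.shift hK hδ) hh).eLpNorm_le
    hG ((hx.shift hδ).sub hx)
  simpa using this

theorem IsOutput.intervalIntegrable (hG : IsDissipative G) {x : ℝ → E} {K h : ℝ → Z}
    (hx : IsMild G x K) (hh : IsOutput K h) {s t : ℝ} (hs : 0 ≤ s) (ht : 0 ≤ t) :
    IntervalIntegrable h volume s t := by
  have h1 : ∀ t : ℝ, 0 ≤ t → IntervalIntegrable h volume 0 t := fun t ht => by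
    rw [intervalIntegrable_iff_integrableOn_Ioc_of_le ht]
    have : MemLp h 2 (volume.restrict (Ioc 0 t)) :=
      (hh.memLp hG hx).mono_measure (Measure.restrict_mono Ioc_subset_Ioi_self le_rfl)
    exact this.integrable one_le_two
  exact (h1 s hs).symm.trans (h1 t ht)

/-- The integrated output is the primitive of the output. -/
theorem IsOutput.integral_eq [CompleteSpace Z] (hG : IsDissipative G) {x : ℝ → E} {K h : ℝ → Z}
    (hx : IsMild G x K) (hh : IsOutput K h) {t : ℝ} (ht : 0 ≤ t) :
    ∫ s in (0 : ℝ)..t, h s = K t := by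
  have hK := hx.continuousOn_output hG
  -- a continuous extension of `K` to the line
  set L : ℝ → Z := fun s => K (max s 0) with hL
  have hLc : Continuous L := hK.comp_continuous (by fun_prop) fun s => mem_Ici.2 (le_max_right _ _)
  have hLK : ∀ s, 0 ≤ s → L s = K s := fun s hs => by rw [hL]; simp [hs]
  have hI : ∀ a b, IntervalIntegrable L volume a b := fun a b => hLc.intervalIntegrable a b
  have hmeasle : (volume : Measure ℝ).restrict (Ioc 0 t) ≤ volume.restrict (Ioi 0) :=
    Measure.restrict_mono Ioc_subset_Ioi_self le_rfl
  -- The integral of a difference quotient telescopes to the averages of K over short windows at t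
  -- and at 0.
  have hq : ∀ n, ∫ s in (0 : ℝ)..t, diffQuot K (stepLength n) s
      = (stepLength n)⁻¹ • (∫ r in t..t + stepLength n, L r)
        - (stepLength n)⁻¹ • ∫ r in (0 : ℝ)..0 + stepLength n, L r := by
    intro n
    have e1 : ∫ s in (0 : ℝ)..t, diffQuot K (stepLength n) s
        = ∫ s in (0 : ℝ)..t, (stepLength n)⁻¹ • (L (s + stepLength n) - L s) := by
      refine intervalIntegral.integral_congr fun s hs => ?_
      rw [uIcc_of_le ht] at hs
      simp only [diffQuot]
      rw [hLK _ hs.1, hLK _ (add_nonneg hs.1 (stepLength_pos n).le)]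
    have hLs : Continuous fun s => L (s + stepLength n) := hLc.comp (by fun_prop)
    rw [e1, intervalIntegral.integral_smul, intervalIntegral.integral_sub
      (hLs.intervalIntegrable _ _) (hI _ _),
      intervalIntegral.integral_comp_add_right, ← smul_sub]
    congr 1
    rw [intervalIntegral.integral_interval_sub_interval_comm (hI _ _) (hI _ _) (hI _ _),
      intervalIntegral.integral_symm 0, intervalIntegral.integral_symm t]
    abel
  have hlim1 : Tendsto (fun n => ∫ s in (0 : ℝ)..t, diffQuot K (stepLength n) s) atTop
      (𝓝 (K t)) := by
    simp only [hq]
    have a1 : ∀ s, Tendsto (fun δ : ℝ => δ⁻¹ • ∫ r in s..s + δ, L r) (𝓝[>] 0) (𝓝 (L s)) := by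
      intro s
      have h := (hLc.integral_hasStrictDerivAt s s).hasDerivAt.tendsto_slope_zero_right
      simpa using h
    have := ((a1 t).comp tendsto_stepLength).sub ((a1 0).comp tendsto_stepLength)
    rw [hLK t ht, hLK 0 le_rfl, hx.output_zero hG, sub_zero] at this
    exact this
  have hlim2 : Tendsto (fun n => ∫ s in (0 : ℝ)..t, diffQuot K (stepLength n) s) atTop
      (𝓝 (∫ s in (0 : ℝ)..t, h s)) := by
    simp only [intervalIntegral.integral_of_le ht]
    have hm : ∀ n, MemLp (diffQuot K (stepLength n)) 2 (volume.restrict (Ioc 0 t)) := fun n =>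
      (hx.memLp_diffQuot hG n).mono_measure hmeasle
    refine tendsto_integral_of_L1' h ?_ (Eventually.of_forall fun n =>
      (hm n).integrable one_le_two) ?_
    · exact hh.meas.aestronglyMeasurable
    -- On an interval of finite length Hölder's inequality turns the L² convergence into L¹
    -- convergence.
    · have h2 := ENNReal.Tendsto.mul_const (b := volume.restrict (Ioc 0 t) univ ^
        (1 / (1 : ℝ≥0∞).toReal - 1 / (2 : ℝ≥0∞).toReal)) hh.tendsto (Or.inr (by
          apply ENNReal.rpow_ne_top_of_nonneg
          · norm_num
          · simp))
      rw [zero_mul] at h2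
      refine tendsto_of_tendsto_of_tendsto_of_le_of_le tendsto_const_nhds h2
        (fun _ => zero_le) fun n => ?_
      refine (eLpNorm_le_eLpNorm_mul_rpow_measure_univ one_le_two
        ((hm n).1.sub hh.meas.aestronglyMeasurable)).trans ?_
      gcongr
      exact eLpNorm_mono_measure _ hmeasle
  exact tendsto_nhds_unique hlim2 hlim1

end DissipativeRelation

/-! ### Solutions that start in the domain -/

namespace DissipativeRelation

variable {E Z : Type*} [NormedAddCommGroup E] [InnerProductSpace ℝ E] [CompleteSpace E]
  [NormedAddCommGroup Z] [InnerProductSpace ℝ Z] {G : Submodule ℝ (E × E × Z)}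

/-- A mild solution that starts in the domain is differentiable from the right at time zero. -/
theorem IsMild.exists_tendsto_quotient (hG : IsDissipative G) {x : ℝ → E} {K : ℝ → Z}
    (hx : IsMild G x K) {f₀ : E} {k₀ : Z} (h0 : (x 0, f₀, k₀) ∈ G) :
    ∃ f, Tendsto (fun δ : ℝ => δ⁻¹ • (x δ - x 0)) (𝓝[>] 0) (𝓝 f) := by
  set z : ℝ → E := fun s => s⁻¹ • (x s - x 0) with hz
  set p : ℝ → E × E × Z := fun s => (s⁻¹ • ∫ r in (0 : ℝ)..s, x r, z s, s⁻¹ • K s) with hp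
  have hpG : ∀ s, 0 ≤ s → p s ∈ G := fun s hs => G.smul_mem s⁻¹ (hx.mem s hs)
  -- Convex combinations of the points p s stay in `G`. The infimum of the norms of their second
  -- components over C δ increases as δ decreases; its supremum L bounds all quotients, and strict
  -- convexity of the norm then gives convergence.
  set C : ℝ → Set (E × E × Z) := fun δ => convexHull ℝ (p '' Ioo 0 δ) with hC
  have hCG : ∀ δ, C δ ⊆ G := fun δ => convexHull_min
    (by rintro _ ⟨s, hs, rfl⟩; exact hpG s hs.1.le) G.convex
  have hpC : ∀ δ s, s ∈ Ioo 0 δ → p s ∈ C δ := fun δ s hs =>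
    subset_convexHull ℝ _ ⟨s, hs, rfl⟩
  set N : ℝ → Set ℝ := fun δ => (fun q : E × E × Z => ‖q.2.1‖) '' C δ with hN
  have hNbdd : ∀ δ, BddBelow (N δ) := fun δ =>
    ⟨0, by rintro _ ⟨q, -, rfl⟩; exact norm_nonneg _⟩
  have hNne : ∀ δ, 0 < δ → (N δ).Nonempty := fun δ hδ =>
    ⟨_, p (δ / 2), hpC δ _ ⟨by positivity, by linarith⟩, rfl⟩
  have hzle : ∀ s, 0 < s → ‖z s‖ ≤ ‖f₀‖ := fun s hs => by
    have h := hx.norm_sub_le hG h0 hs.le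
    rw [sub_self, norm_zero, zero_add] at h
    rw [hz, norm_smul, norm_inv, Real.norm_of_nonneg hs.le, inv_mul_le_iff₀ hs]
    exact h
  have hIle : ∀ δ, 0 < δ → sInf (N δ) ≤ ‖f₀‖ := fun δ hδ =>
    (csInf_le (hNbdd δ) ⟨p (δ / 2), hpC δ _ ⟨by positivity, by linarith⟩, rfl⟩).trans
      (hzle _ (by positivity))
  have hI0 : ∀ δ, 0 < δ → 0 ≤ sInf (N δ) := fun δ hδ =>
    le_csInf (hNne δ hδ) (by rintro _ ⟨q, -, rfl⟩; exact norm_nonneg _)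
  have hImono : ∀ δ δ', 0 < δ → δ ≤ δ' → sInf (N δ') ≤ sInf (N δ) := fun δ δ' hδ hle =>
    csInf_le_csInf (hNbdd δ') (hNne δ hδ)
      (image_mono (convexHull_mono (image_mono (Ioo_subset_Ioo_right hle))))
  set L : ℝ := sSup ((fun δ => sInf (N δ)) '' Ioi 0) with hLdef
  have hbdd : BddAbove ((fun δ => sInf (N δ)) '' Ioi 0) :=
    ⟨‖f₀‖, by rintro _ ⟨δ, hδ, rfl⟩; exact hIle δ hδ⟩
  have hIL : ∀ δ, 0 < δ → sInf (N δ) ≤ L := fun δ hδ => le_csSup hbdd ⟨δ, hδ, rfl⟩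
  have hL0 : 0 ≤ L := (hI0 1 one_pos).trans (hIL 1 one_pos)
  have havg : Tendsto (fun s : ℝ => s⁻¹ • ∫ r in (0 : ℝ)..s, x r) (𝓝[>] 0) (𝓝 (x 0)) := by
    simpa using tendsto_average_window hx.cont 0
  -- Compare x with a point q of the hull whose first component is close to x 0 and whose second
  -- component has norm at most about L.
  have hzL : ∀ s, 0 < s → ‖z s‖ ≤ L := by
    intro s hs
    have hmain : ‖x s - x 0‖ ≤ s * L := by
      refine le_of_forall_pos_le_add fun η hη => ?_
      -- The error η' enters twice through ‖x 0 - q.1‖ and s times through the norm of q.2.1.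
      set η' := η / (2 + s) with hη'
      have hη'0 : 0 < η' := by positivity
      have hev := havg.eventually (Metric.closedBall_mem_nhds (x 0) hη'0)
      obtain ⟨δ, hδ0, hδ⟩ := (mem_nhdsGT_iff_exists_Ioo_subset' (zero_lt_one (α := ℝ))).1 hev
      have hδ0 : 0 < δ := hδ0
      obtain ⟨_, ⟨q, hq, rfl⟩, hqlt⟩ :=
        exists_lt_of_csInf_lt (hNne δ hδ0) (lt_add_of_pos_right (sInf (N δ)) hη'0)
      have hq1 : q.1 ∈ Metric.closedBall (x 0) η' := by
        have hconv : Convex ℝ {q : E × E × Z | q.1 ∈ Metric.closedBall (x 0) η'} :=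
          (convex_closedBall (x 0) η').linear_preimage (LinearMap.fst ℝ E (E × Z))
        refine convexHull_min ?_ hconv hq
        rintro _ ⟨r, hr, rfl⟩
        exact hδ hr
      have hqG : (q.1, q.2.1, q.2.2) ∈ G := hCG δ hq
      have h1 := hx.norm_sub_le hG hqG hs.le
      have h2 : ‖x 0 - q.1‖ ≤ η' := by
        rw [← dist_eq_norm, dist_comm]; exact hq1
      have h3 : ‖x s - x 0‖ ≤ ‖x s - q.1‖ + ‖x 0 - q.1‖ := by
        rw [← norm_neg (x 0 - q.1), neg_sub]
        simpa using norm_add_le (x s - q.1) (q.1 - x 0)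
      have h4 : s * ‖q.2.1‖ ≤ s * (L + η') :=
        mul_le_mul_of_nonneg_left (hqlt.le.trans (by linarith [hIL δ hδ0])) hs.le
      have h5 : η' * (2 + s) = η := by rw [hη']; field_simp
      nlinarith
    rw [hz, norm_smul, norm_inv, Real.norm_of_nonneg hs.le, inv_mul_le_iff₀ hs]
    exact hmain
  have hcau : Cauchy (map z (𝓝[>] 0)) := by
    rw [Metric.cauchy_iff]
    refine ⟨inferInstance, fun ε hε => ?_⟩
    -- a scale at which the lower bound is close to `L`
    obtain ⟨δ, hδ0, hδ⟩ : ∃ δ, 0 < δ ∧ 4 * (L ^ 2 - sInf (N δ) ^ 2) < ε ^ 2 := by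
      -- With I the infimum, L - I < κ gives 4(L² - I²) ≤ 8L(L - I), which is less than ε².
      set κ := ε ^ 2 / (8 * (L + 1)) with hκ
      have hκ0 : 0 < κ := by positivity
      obtain ⟨_, ⟨δ, hδ0, rfl⟩, hlt⟩ := exists_lt_of_lt_csSup
        (⟨_, 1, mem_Ioi.2 one_pos, rfl⟩ : ((fun δ => sInf (N δ)) '' Ioi 0).Nonempty)
        (sub_lt_self L hκ0)
      refine ⟨δ, hδ0, ?_⟩
      have a1 := hIL δ hδ0
      have a2 := hI0 δ hδ0
      have a3 : κ * (8 * (L + 1)) = ε ^ 2 := by rw [hκ]; field_simp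
      have hlt' : L - κ < sInf (N δ) := hlt
      nlinarith
    refine ⟨z '' Ioo 0 δ, image_mem_map (Ioo_mem_nhdsGT hδ0), ?_⟩
    rintro _ ⟨s, hs, rfl⟩ _ ⟨r, hr, rfl⟩
    -- The midpoint is an admissible combination, hence not much shorter than L, while both
    -- quotients have norm at most L; the parallelogram law then makes their difference small.
    have hmid : sInf (N δ) ≤ ‖(1 / 2 : ℝ) • z s + (1 / 2 : ℝ) • z r‖ :=
      csInf_le (hNbdd δ) ⟨(1 / 2 : ℝ) • p s + (1 / 2 : ℝ) • p r,
        (convex_convexHull ℝ _) (hpC δ s hs) (hpC δ r hr) (by norm_num) (by norm_num)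
          (by norm_num), rfl⟩
    rw [← smul_add, norm_smul, Real.norm_of_nonneg (by norm_num)] at hmid
    have hpar := parallelogram_law_with_norm ℝ (z s) (z r)
    have b1 := hzL s hs.1
    have b2 := hzL r hr.1
    have b3 := hI0 δ hδ0
    rw [dist_eq_norm]
    refine lt_of_pow_lt_pow_left₀ 2 hε.le ?_
    nlinarith [norm_nonneg (z s), norm_nonneg (z r), norm_nonneg (z s + z r),
      mul_self_le_mul_self (norm_nonneg _) b1, mul_self_le_mul_self (norm_nonneg _) b2,
      mul_self_le_mul_self b3 hmid]
  exact CompleteSpace.complete hcau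

/-- Regularity of mild solutions that start in the domain. -/
theorem IsMild.exists_deriv [CompleteSpace Z] (hG : IsDissipative G)
    (hGc : IsClosed (G : Set (E × E × Z))) {x : ℝ → E} {K : ℝ → Z}
    (hx : IsMild G x K) {f₀ : E} {k₀ : Z} (h0 : (x 0, f₀, k₀) ∈ G) :
    ∃ (x' : ℝ → E) (h : ℝ → Z), Continuous x' ∧ ContinuousOn h (Ici 0) ∧
      (∀ t, 0 ≤ t → (x t, x' t, h t) ∈ G) ∧ (∀ t, 0 ≤ t → ∫ s in (0 : ℝ)..t, h s = K t) ∧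
      IsMild G x' (fun t => h t - h 0) := by
  set z : ℝ → ℝ → E := fun δ t => δ⁻¹ • (x (t + δ) - x t) with hz
  set a : ℝ → ℝ → E := fun δ t => δ⁻¹ • ∫ r in t..t + δ, x r with ha
  have hz0 : ∃ f, Tendsto (fun δ => z δ 0) (𝓝[>] 0) (𝓝 f) := by
    simpa [hz] using hx.exists_tendsto_quotient hG h0
  have hmem : ∀ δ, 0 < δ → ∀ t, 0 ≤ t → (a δ t, z δ t, diffQuot K δ t) ∈ G := fun δ hδ t ht =>
    (hx.isStrong_average hG hδ).mem t ht
  -- Each quotient z δ is itself mild, and mild solutions contract, so convergence at time 0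
  -- propagates uniformly to all later times.
  have hzcontr : ∀ t, 0 ≤ t → ∀ δ, 0 < δ → ∀ δ', 0 < δ' →
      ‖z δ t - z δ' t‖ ≤ ‖z δ 0 - z δ' 0‖ := by
    intro t ht δ hδ δ' hδ'
    have hm : ∀ δ : ℝ, 0 < δ → ∃ K', IsMild G (z δ) K' := fun δ hδ => by
      have h1 := (hx.shift hδ.le).sub hx
      refine ⟨fun t => δ⁻¹ • (K (t + δ) - K δ - K t), h1.cont.const_smul δ⁻¹, fun t ht => ?_⟩
      have h2 := G.smul_mem δ⁻¹ (h1.mem t ht)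
      rw [intervalIntegral.integral_smul]
      simpa [hz, smul_sub] using h2
    obtain ⟨_, h1⟩ := hm δ hδ
    obtain ⟨_, h2⟩ := hm δ' hδ'
    exact (h1.sub h2).norm_le hG ht
  have hpos : ∀ᶠ δ : ℝ in 𝓝[>] 0, 0 < δ := self_mem_nhdsWithin
  obtain ⟨f, hf⟩ := hz0
  have hzlim : ∀ t, 0 ≤ t → ∃ g, Tendsto (fun δ => z δ t) (𝓝[>] 0) (𝓝 g) := by
    intro t ht
    refine CompleteSpace.complete (f := map (fun δ => z δ t) (𝓝[>] 0)) ?_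
    have hc0 : Cauchy (map (fun δ => z δ 0) (𝓝[>] 0)) := hf.cauchy_map
    rw [cauchy_map_iff] at hc0 ⊢
    refine ⟨hc0.1, ?_⟩
    rw [tendsto_uniformity_iff_dist_tendsto_zero] at *
    refine squeeze_zero' (Eventually.of_forall fun _ => dist_nonneg) ?_ hc0.2
    filter_upwards [hpos.prod_mk hpos] with q hq
    rw [dist_eq_norm, dist_eq_norm]
    exact hzcontr t ht _ hq.1 _ hq.2
  choose! g hg using hzlim
  have hgf : ∀ t, 0 ≤ t → ∀ δ, 0 < δ → ‖z δ t - g t‖ ≤ ‖z δ 0 - f‖ := by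
    intro t ht δ hδ
    refine le_of_tendsto_of_tendsto ((tendsto_const_nhds.sub (hg t ht)).norm)
      ((tendsto_const_nhds.sub hf).norm) ?_
    filter_upwards [hpos] with δ' hδ'
    exact hzcontr t ht δ hδ δ' hδ'
  have hgc : ContinuousOn g (Ici 0) := by
    have hunif : TendstoUniformlyOn z g (𝓝[>] 0) (Ici 0) := by
      rw [Metric.tendstoUniformlyOn_iff]
      intro ε hε
      have := (tendsto_iff_norm_sub_tendsto_zero.1 hf).eventually (gt_mem_nhds hε)
      filter_upwards [this, hpos] with δ h1 h2 t ht
      rw [dist_comm, dist_eq_norm]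
      exact (hgf t ht δ h2).trans_lt h1
    refine hunif.continuousOn (Eventually.frequently (Eventually.of_forall fun δ => ?_))
    exact (((hx.cont.comp (by fun_prop)).sub hx.cont).const_smul _).continuousOn
  have hhlim : ∀ t, 0 ≤ t → ∃ l, Tendsto (fun δ => diffQuot K δ t) (𝓝[>] 0) (𝓝 l) := by
    intro t ht
    refine CompleteSpace.complete (f := map (fun δ => diffQuot K δ t) (𝓝[>] 0)) ?_
    have hc1 : Cauchy (map (fun δ => z δ t) (𝓝[>] 0)) := (hg t ht).cauchy_map
    have hc2 : Cauchy (map (fun δ => a δ t) (𝓝[>] 0)) :=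
      (tendsto_average_window hx.cont t).cauchy_map
    rw [cauchy_map_iff] at hc1 hc2 ⊢
    refine ⟨hc1.1, ?_⟩
    rw [tendsto_uniformity_iff_dist_tendsto_zero] at *
    have hb := (Real.continuous_sqrt.tendsto _).comp (hc1.2.mul hc2.2)
    rw [mul_zero, Real.sqrt_zero] at hb
    refine squeeze_zero' (Eventually.of_forall fun _ => dist_nonneg) ?_ hb
    filter_upwards [hpos.prod_mk hpos] with q hq
    simp only [Function.comp, dist_eq_norm]
    exact Real.le_sqrt_of_sq_le (hG.norm_sq_le (G.sub_mem (hmem _ hq.1 t ht) (hmem _ hq.2 t ht)))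
  choose! h hh using hhlim
  have hGmem : ∀ t, 0 ≤ t → (x t, g t, h t) ∈ G := by
    intro t ht
    refine hGc.mem_of_tendsto ((tendsto_average_window hx.cont t).prodMk_nhds
      ((hg t ht).prodMk_nhds (hh t ht))) ?_
    filter_upwards [hpos] with δ hδ
    exact hmem δ hδ t ht
  have hhc : ContinuousOn h (Ici 0) := hG.continuousOn_output hx.cont.continuousOn hgc hGmem
  -- Constant extension to negative times, since a mild solution is required to be continuous on the
  -- whole line.
  set x' : ℝ → E := fun t => g (max t 0) with hx'
  have hx'c : Continuous x' := hgc.comp_continuous (by fun_prop) fun s => mem_Ici.2 (le_max_right _ _)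
  have hx'g : ∀ t, 0 ≤ t → x' t = g t := fun t ht => by rw [hx']; simp [ht]
  have hInteg : ∀ t, 0 ≤ t → ∫ s in (0 : ℝ)..t, x' s = x t - x 0 := by
    intro t ht
    -- Only right derivatives are known; with a continuous right derivative the fundamental theorem
    -- still holds.
    refine intervalIntegral.integral_eq_sub_of_hasDeriv_right hx.cont.continuousOn
      (fun s hs => ?_) (hx'c.intervalIntegrable _ _)
    rw [min_eq_left ht, max_eq_right ht] at hs
    rw [hasDerivWithinAt_iff_tendsto_slope' self_notMem_Ioi, hx'g s hs.1.le]
    have hshift : Tendsto (fun r => r - s) (𝓝[>] s) (𝓝[>] 0) := by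
      refine tendsto_nhdsWithin_iff.2 ⟨?_, ?_⟩
      · have : Tendsto (fun r => r - s) (𝓝 s) (𝓝 (s - s)) := (continuous_sub_right s).tendsto s
        rw [sub_self] at this
        exact this.mono_left nhdsWithin_le_nhds
      · filter_upwards [self_mem_nhdsWithin] with r hr
        exact mem_Ioi.2 (sub_pos.2 (mem_Ioi.1 hr))
    refine ((hg s hs.1.le).comp hshift).congr fun r => ?_
    simp [hz, slope_def_module]
  refine ⟨x', h, hx'c, hhc, fun t ht => ?_, fun t ht => ?_, hx'c, fun t ht => ?_⟩
  · rw [hx'g t ht]; exact hGmem t ht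
  · have hih : IntervalIntegrable h volume 0 t := by
      apply ContinuousOn.intervalIntegrable
      rw [uIcc_of_le ht]
      exact hhc.mono Icc_subset_Ici_self
    have i1 : Integrable x (volume.restrict (Ioc 0 t)) := (hx.cont.intervalIntegrable 0 t).1
    have i2 : Integrable x' (volume.restrict (Ioc 0 t)) := (hx'c.intervalIntegrable 0 t).1
    have i3 : Integrable h (volume.restrict (Ioc 0 t)) := hih.1
    have key := Submodule.integral_mem_of_isClosed hGc (i1.prodMk (i2.prodMk i3))
      (by
        filter_upwards [ae_restrict_mem measurableSet_Ioc] with s hs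
        rw [hx'g s hs.1.le]
        exact hGmem s hs.1.le)
    rw [integral_pair i1 (i2.prodMk i3), integral_pair i2 i3] at key
    simp only [← intervalIntegral.integral_of_le ht] at key
    rw [hInteg t ht] at key
    -- The integral of h and K t are outputs over the same integral of x, so they coincide.
    have := G.sub_mem key (hx.mem t ht)
    simp only [Prod.mk_sub_mk, sub_self] at this
    exact sub_eq_zero.1 (hG.output_eq_zero this)
  -- As x' integrates to x t - x 0, its mild equation is the difference of the relations at times t
  -- and 0.
  · rw [hInteg t ht, hx'g t ht, hx'g 0 le_rfl]
    exact G.sub_mem (hGmem t ht) (hGmem 0 le_rfl)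

end DissipativeRelation

/-! ### Weighted Hardy inequalities -/

/-- Cauchy's inequality for lower Lebesgue integrals with a weight. -/
theorem lintegral_mul_sq_le {α : Type*} [MeasurableSpace α] {μ : Measure α} {w f : α → ℝ≥0∞}
    (hw : AEMeasurable w μ) (hf : AEMeasurable f μ) :
    (∫⁻ a, w a * f a ∂μ) ^ 2 ≤ (∫⁻ a, w a ∂μ) * ∫⁻ a, w a * f a ^ 2 ∂μ := by
  have hpq : Real.HolderConjugate 2 2 := Real.HolderConjugate.two_two
  have h := ENNReal.lintegral_mul_le_Lp_mul_Lq μ hpq (f := fun a => w a ^ (1 / 2 : ℝ))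
    (g := fun a => w a ^ (1 / 2 : ℝ) * f a) (hw.pow_const _) ((hw.pow_const _).mul hf)
  have hsq : ∀ c : ℝ≥0∞, c ^ (1 / 2 : ℝ) * c ^ (1 / 2 : ℝ) = c := fun c => by
    rw [← ENNReal.rpow_add_of_nonneg _ _ (by norm_num) (by norm_num)]; norm_num
  have e1 : ∀ a, ((fun a => w a ^ (1 / 2 : ℝ)) * fun a => w a ^ (1 / 2 : ℝ) * f a) a
      = w a * f a := fun a => by simp only [Pi.mul_apply, ← mul_assoc, hsq]
  have e2 : ∀ a, (w a ^ (1 / 2 : ℝ)) ^ (2 : ℝ) = w a := fun a => by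
    rw [← ENNReal.rpow_mul]; norm_num
  have e3 : ∀ a, (w a ^ (1 / 2 : ℝ) * f a) ^ (2 : ℝ) = w a * f a ^ 2 := fun a => by
    rw [ENNReal.mul_rpow_of_nonneg _ _ (by norm_num), e2]; norm_num
  simp only [e1, e2, e3] at h
  calc (∫⁻ a, w a * f a ∂μ) ^ 2
      ≤ ((∫⁻ a, w a ∂μ) ^ (1 / 2 : ℝ) * (∫⁻ a, w a * f a ^ 2 ∂μ) ^ (1 / 2 : ℝ)) ^ 2 := by gcongr
    _ = _ := by rw [mul_pow, pow_two, pow_two, hsq, hsq]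

theorem lintegral_sq_le {α : Type*} [MeasurableSpace α] {μ : Measure α} {f : α → ℝ≥0∞}
    (hf : AEMeasurable f μ) : (∫⁻ a, f a ∂μ) ^ 2 ≤ μ univ * ∫⁻ a, f a ^ 2 ∂μ := by
  simpa using lintegral_mul_sq_le (w := fun _ => 1) aemeasurable_const hf

/-- Tonelli's theorem on the triangle `0 < t ≤ δ`. -/
theorem lintegral_triangle {f g : ℝ → ℝ≥0∞} (hf : Measurable f) (hg : Measurable g) :
    ∫⁻ δ in Ioi (0 : ℝ), f δ * ∫⁻ t in Ioc 0 δ, g t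
      = ∫⁻ t in Ioi (0 : ℝ), g t * ∫⁻ δ in Ici t, f δ := by
  set F : ℝ → ℝ → ℝ≥0∞ := fun δ t => {p : ℝ × ℝ | p.2 ≤ p.1}.indicator
    (fun p => f p.1 * g p.2) (δ, t) with hF
  have hm : Measurable (Function.uncurry F) :=
    ((hf.comp measurable_fst).mul (hg.comp measurable_snd)).indicator
      (measurableSet_le measurable_snd measurable_fst)
  have h1 : ∀ δ, f δ * ∫⁻ t in Ioc 0 δ, g t = ∫⁻ t in Ioi (0 : ℝ), F δ t := by
    intro δ
    have e : (fun t => F δ t) = (Iic δ).indicator (fun t => f δ * g t) := by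
      ext t; simp [hF, indicator]
    rw [e, setLIntegral_indicator measurableSet_Iic, ← lintegral_const_mul _ hg, Iic_inter_Ioi]
  have h2 : ∀ t ∈ Ioi (0 : ℝ), g t * ∫⁻ δ in Ici t, f δ = ∫⁻ δ in Ioi (0 : ℝ), F δ t := by
    intro t ht
    have e : (fun δ => F δ t) = (Ici t).indicator (fun δ => g t * f δ) := by
      ext δ; simp [hF, indicator, mul_comm]
    have hsub : Ici t ∩ Ioi (0 : ℝ) = Ici t :=
      inter_eq_left.2 fun δ hδ => lt_of_lt_of_le (mem_Ioi.1 ht) (mem_Ici.1 hδ)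
    rw [e, setLIntegral_indicator measurableSet_Ici, ← lintegral_const_mul _ hf, hsub]
  simp only [h1]
  rw [lintegral_lintegral_swap hm.aemeasurable]
  exact (setLIntegral_congr_fun measurableSet_Ioi h2).symm

theorem lintegral_Ioc_rpow {θ δ : ℝ} (hθ : 0 < θ) (hδ : 0 < δ) :
    ∫⁻ t in Ioc 0 δ, ENNReal.ofReal (t ^ (θ - 1)) = ENNReal.ofReal (δ ^ θ / θ) := by
  have hi : IntegrableOn (fun t : ℝ => t ^ (θ - 1)) (Ioc 0 δ) :=
    (intervalIntegral.intervalIntegrable_rpow' (a := 0) (b := δ) (by linarith)).1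
  rw [← ofReal_integral_eq_lintegral_ofReal hi, ← intervalIntegral.integral_of_le hδ.le,
    integral_rpow (Or.inl (by linarith)), sub_add_cancel, Real.zero_rpow hθ.ne', sub_zero]
  filter_upwards [ae_restrict_mem measurableSet_Ioc] with t ht
  exact Real.rpow_nonneg ht.1.le _

theorem lintegral_Ici_rpow {θ t : ℝ} (hθ : 0 < θ) (ht : 0 < t) :
    ∫⁻ δ in Ici t, ENNReal.ofReal (δ ^ (-1 - θ)) = ENNReal.ofReal (t ^ (-θ) / θ) := by
  rw [setLIntegral_congr Ioi_ae_eq_Ici.symm, ← ofReal_integral_eq_lintegral_ofReal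
    (integrableOn_Ioi_rpow_of_lt (by linarith) ht), integral_Ioi_rpow_of_lt (by linarith) ht]
  · congr 1
    have : -1 - θ + 1 = -θ := by ring
    rw [this, neg_div_neg_eq]
  · filter_upwards [ae_restrict_mem measurableSet_Ioi] with δ hδ
    exact Real.rpow_nonneg (ht.trans hδ).le _

theorem ofReal_rpow_mul_ofReal {t a b c d : ℝ} (ht : 0 < t) (hc : 0 ≤ c) (h : a + b = d) :
    ENNReal.ofReal (t ^ a) * ENNReal.ofReal (t ^ b / c)
      = ENNReal.ofReal c⁻¹ * ENNReal.ofReal (t ^ d) := by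
  rw [← ENNReal.ofReal_mul (by positivity), ← ENNReal.ofReal_mul (by positivity), ← h,
    Real.rpow_add ht]
  congr 1
  ring

/-- Hardy's inequality for integrals from `0`. -/
theorem lintegral_hardy_Ioc {θ : ℝ} (hθ : 0 < θ) {α : ℝ → ℝ≥0∞} (hα : Measurable α) :
    ∫⁻ δ in Ioi (0 : ℝ), ENNReal.ofReal (δ ^ (-1 - 2 * θ)) *
        (∫⁻ t in Ioc 0 δ, ENNReal.ofReal (t ^ (θ - 1)) * α t) ^ 2
      ≤ ENNReal.ofReal θ⁻¹ ^ 2 * ∫⁻ t in Ioi (0 : ℝ), ENNReal.ofReal t⁻¹ * α t ^ 2 := by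
  have hr : ∀ a : ℝ, Measurable fun t : ℝ => ENNReal.ofReal (t ^ a) := fun a => by fun_prop
  have hp : ∀ a : ℝ, Measurable fun t : ℝ => ENNReal.ofReal (t ^ a) * α t ^ 2 := fun a =>
    (hr a).mul (hα.pow_const 2)
  -- Cauchy's inequality with weight t^(θ-1), of mass δ^θ/θ on (0, δ], moves the square inside;
  -- after Tonelli the inner integral is t^(-θ)/θ, which leaves the weight 1/t.
  calc _ ≤ ∫⁻ δ in Ioi (0 : ℝ), ENNReal.ofReal θ⁻¹ * (ENNReal.ofReal (δ ^ (-1 - θ)) *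
        ∫⁻ t in Ioc 0 δ, ENNReal.ofReal (t ^ (θ - 1)) * α t ^ 2) := by
        refine setLIntegral_mono' measurableSet_Ioi fun δ hδ => ?_
        have hδ : 0 < δ := hδ
        refine (mul_le_mul_right (lintegral_mul_sq_le (hr _).aemeasurable hα.aemeasurable)
          _).trans (le_of_eq ?_)
        rw [lintegral_Ioc_rpow hθ hδ, ← mul_assoc, ofReal_rpow_mul_ofReal (d := -1 - θ) hδ hθ.le
          (by ring), mul_assoc]
    _ = ENNReal.ofReal θ⁻¹ * ∫⁻ t in Ioi (0 : ℝ), (ENNReal.ofReal (t ^ (θ - 1)) * α t ^ 2) *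
        ∫⁻ δ in Ici t, ENNReal.ofReal (δ ^ (-1 - θ)) := by
        rw [lintegral_const_mul' _ _ ENNReal.ofReal_ne_top,
          lintegral_triangle (hr _) (hp _)]
    _ = ENNReal.ofReal θ⁻¹ * ∫⁻ t in Ioi (0 : ℝ), ENNReal.ofReal θ⁻¹ *
        (ENNReal.ofReal t⁻¹ * α t ^ 2) := by
        congr 1
        refine setLIntegral_congr_fun measurableSet_Ioi fun t ht => ?_
        have ht : 0 < t := ht
        rw [lintegral_Ici_rpow hθ ht, mul_right_comm,
          ofReal_rpow_mul_ofReal (d := -1) ht hθ.le (by ring), Real.rpow_neg_one, mul_assoc]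
    _ = _ := by
        rw [lintegral_const_mul' _ _ ENNReal.ofReal_ne_top, ← mul_assoc, pow_two]

/-- Hardy's inequality for integrals to `∞`. -/
theorem lintegral_hardy_Ici {θ : ℝ} (hθ : 0 < θ) {α : ℝ → ℝ≥0∞} (hα : Measurable α) :
    ∫⁻ δ in Ioi (0 : ℝ), ENNReal.ofReal (δ ^ (2 * θ - 1)) *
        (∫⁻ t in Ici δ, ENNReal.ofReal (t ^ (-1 - θ)) * α t) ^ 2
      ≤ ENNReal.ofReal θ⁻¹ ^ 2 * ∫⁻ t in Ioi (0 : ℝ), ENNReal.ofReal t⁻¹ * α t ^ 2 := by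
  have hr : ∀ a : ℝ, Measurable fun t : ℝ => ENNReal.ofReal (t ^ a) := fun a => by fun_prop
  have hp : ∀ a : ℝ, Measurable fun t : ℝ => ENNReal.ofReal (t ^ a) * α t ^ 2 := fun a =>
    (hr a).mul (hα.pow_const 2)
  calc _ ≤ ∫⁻ δ in Ioi (0 : ℝ), ENNReal.ofReal θ⁻¹ * (ENNReal.ofReal (δ ^ (θ - 1)) *
        ∫⁻ t in Ici δ, ENNReal.ofReal (t ^ (-1 - θ)) * α t ^ 2) := by
        refine setLIntegral_mono' measurableSet_Ioi fun δ hδ => ?_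
        have hδ : 0 < δ := hδ
        refine (mul_le_mul_right (lintegral_mul_sq_le (hr _).aemeasurable hα.aemeasurable)
          _).trans (le_of_eq ?_)
        rw [lintegral_Ici_rpow hθ hδ, ← mul_assoc, ofReal_rpow_mul_ofReal (d := θ - 1) hδ hθ.le
          (by ring), mul_assoc]
    _ = ENNReal.ofReal θ⁻¹ * ∫⁻ t in Ioi (0 : ℝ), (ENNReal.ofReal (t ^ (-1 - θ)) * α t ^ 2) *
        ∫⁻ δ in Ioc 0 t, ENNReal.ofReal (δ ^ (θ - 1)) := by
        rw [lintegral_const_mul' _ _ ENNReal.ofReal_ne_top,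
          ← lintegral_triangle (hp _) (hr _)]
    _ = ENNReal.ofReal θ⁻¹ * ∫⁻ t in Ioi (0 : ℝ), ENNReal.ofReal θ⁻¹ *
        (ENNReal.ofReal t⁻¹ * α t ^ 2) := by
        congr 1
        refine setLIntegral_congr_fun measurableSet_Ioi fun t ht => ?_
        have ht : 0 < t := ht
        rw [lintegral_Ioc_rpow hθ ht, mul_right_comm,
          ofReal_rpow_mul_ofReal (d := -1) ht hθ.le (by ring), Real.rpow_neg_one, mul_assoc]
    _ = _ := by
        rw [lintegral_const_mul' _ _ ENNReal.ofReal_ne_top, ← mul_assoc, pow_two]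

/-! ### Resolvents as Laplace transforms of mild solutions -/

namespace DissipativeRelation

section Resolvent

variable {E : Type*} [NormedAddCommGroup E] [InnerProductSpace ℝ E]

/-- The Laplace transform `∫₀^∞ e^{-s} y(ts) ds`, the resolvent `(1 - t𝓐)⁻¹` applied to `y(0)`
if `y` is a mild solution of `y' = 𝓐 y`. -/
noncomputable def resolvent (y : ℝ → E) (t : ℝ) : E :=
  ∫ s in Ioi (0 : ℝ), Real.exp (-s) • y (max (t * s) 0)

theorem integrableOn_exp_neg_Ioi : IntegrableOn (fun s : ℝ => Real.exp (-s)) (Ioi 0) := by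
  simpa using integrableOn_exp_mul_Ioi (a := -1) (by norm_num) 0

theorem integral_exp_neg_Ioi_zero : ∫ s in Ioi (0 : ℝ), Real.exp (-s) = 1 := by
  simpa using integral_exp_neg_Ioi 0

variable {y : ℝ → E} {B : ℝ}

theorem integrableOn_exp_smul (hy : Continuous y) (hB : ∀ s, 0 ≤ s → ‖y s‖ ≤ B) (t : ℝ) :
    IntegrableOn (fun s : ℝ => Real.exp (-s) • y (max (t * s) 0)) (Ioi 0) := by
  refine (integrableOn_exp_neg_Ioi.mul_const B).mono' ?_ (Eventually.of_forall fun s => ?_)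
  · exact (Continuous.smul (by fun_prop) (hy.comp (by fun_prop))).aestronglyMeasurable
  · rw [norm_smul, Real.norm_of_nonneg (Real.exp_pos _).le]
    exact mul_le_mul_of_nonneg_left (hB _ (le_max_right _ _)) (Real.exp_pos _).le

theorem norm_resolvent_le (hB : ∀ s, 0 ≤ s → ‖y s‖ ≤ B) (t : ℝ) : ‖resolvent y t‖ ≤ B := by
  have h := norm_integral_le_of_norm_le (integrableOn_exp_neg_Ioi.mul_const B)
    (f := fun s : ℝ => Real.exp (-s) • y (max (t * s) 0)) (Eventually.of_forall fun s => by
      rw [norm_smul, Real.norm_of_nonneg (Real.exp_pos _).le]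
      exact mul_le_mul_of_nonneg_left (hB _ (le_max_right _ _)) (Real.exp_pos _).le)
  rwa [integral_mul_const, integral_exp_neg_Ioi_zero, one_mul] at h

theorem continuous_resolvent (hy : Continuous y) (hB : ∀ s, 0 ≤ s → ‖y s‖ ≤ B) :
    Continuous (resolvent y) := by
  refine continuous_of_dominated (bound := fun s => Real.exp (-s) * B)
    (fun t => (integrableOn_exp_smul hy hB t).1) (fun t => Eventually.of_forall fun s => ?_)
    (integrableOn_exp_neg_Ioi.mul_const B) (Eventually.of_forall fun s => ?_)
  · rw [norm_smul, Real.norm_of_nonneg (Real.exp_pos _).le]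
    exact mul_le_mul_of_nonneg_left (hB _ (le_max_right _ _)) (Real.exp_pos _).le
  · exact (hy.comp (by fun_prop)).const_smul _

variable [CompleteSpace E] {Z : Type*} [NormedAddCommGroup Z] [InnerProductSpace ℝ Z]
  [CompleteSpace Z] {G : Submodule ℝ (E × E × Z)}

/-- Integration by parts: the primitive vanishes at 0 and grows at most linearly, so e^(-s) kills it
at infinity, and its derivative in s is t y(ts). -/
theorem integral_exp_smul_primitive (hy : Continuous y) (hB : ∀ s, 0 ≤ s → ‖y s‖ ≤ B) {t : ℝ}
    (ht : 0 < t) :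
    IntegrableOn (fun s => Real.exp (-s) • ∫ r in (0 : ℝ)..t * s, y r) (Ioi 0) ∧
      ∫ s in Ioi (0 : ℝ), Real.exp (-s) • ∫ r in (0 : ℝ)..t * s, y r = t • resolvent y t := by
  set Y : ℝ → E := fun s => ∫ r in (0 : ℝ)..t * s, y r with hY
  have hYd : ∀ s, HasDerivAt Y (t • y (t * s)) s := fun s => by
    have h1 := (hy.integral_hasStrictDerivAt 0 (t * s)).hasDerivAt
    have h2 : HasDerivAt (fun s => t * s) t s := by simpa using (hasDerivAt_id s).const_mul t
    exact h1.scomp s h2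
  have hYc : Continuous Y := continuous_iff_continuousAt.2 fun s => (hYd s).continuousAt
  have hYb : ∀ s, 0 ≤ s → ‖Y s‖ ≤ B * t * s := fun s hs => by
    have hts : 0 ≤ t * s := mul_nonneg ht.le hs
    have := intervalIntegral.norm_integral_le_of_norm_le_const (a := 0) (b := t * s) (f := y)
      (C := B) (fun r hr => hB r (by rw [uIoc_of_le hts] at hr; exact hr.1.le))
    rwa [sub_zero, abs_of_nonneg hts, ← mul_assoc] at this
  have hgam : IntegrableOn (fun s : ℝ => Real.exp (-s) * s) (Ioi 0) := by
    have := Real.GammaIntegral_convergent (s := 2) (by norm_num)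
    norm_num at this
    exact this
  have hI : IntegrableOn (fun s => Real.exp (-s) • Y s) (Ioi 0) := by
    refine (hgam.const_mul (B * t)).mono' ?_ ?_
    · exact (Continuous.smul (by fun_prop) hYc).aestronglyMeasurable
    · filter_upwards [ae_restrict_mem measurableSet_Ioi] with s hs
      rw [norm_smul, Real.norm_of_nonneg (Real.exp_pos _).le]
      nlinarith [mul_le_mul_of_nonneg_left (hYb s (mem_Ioi.1 hs).le) (Real.exp_pos (-s)).le]
  have hIt : IntegrableOn (fun s => t • (Real.exp (-s) • y (max (t * s) 0))) (Ioi 0) :=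
    (integrableOn_exp_smul hy hB t).smul t
  refine ⟨hI, ?_⟩
  have hpar := integral_Ioi_of_hasDerivAt_of_tendsto (a := (0 : ℝ)) (m := (0 : E))
    (f := fun s => Real.exp (-s) • Y s)
    (f' := fun s => t • (Real.exp (-s) • y (max (t * s) 0)) - Real.exp (-s) • Y s)
    (Continuous.smul (by fun_prop) hYc).continuousWithinAt (fun s hs => ?_)
    (hIt.sub hI) ?_
  · rw [integral_sub hIt hI, integral_smul] at hpar
    have h0 : Y 0 = 0 := by simp [hY]
    rw [h0, smul_zero, sub_zero, sub_eq_zero] at hpar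
    exact hpar.symm
  · have hs : 0 < s := hs
    have h1 : HasDerivAt (fun s : ℝ => Real.exp (-s)) (-Real.exp (-s)) s := by
      simpa using (hasDerivAt_neg s).exp
    refine (h1.smul (hYd s)).congr_deriv ?_
    rw [max_eq_left (by positivity), neg_smul, smul_smul, smul_smul, mul_comm (Real.exp _) t, ← sub_eq_add_neg]
  · have hlim : Tendsto (fun s : ℝ => B * t * (s ^ 1 * Real.exp (-s))) atTop (𝓝 0) := by
      simpa using (Real.tendsto_pow_mul_exp_neg_atTop_nhds_zero 1).const_mul (B * t)
    refine squeeze_zero_norm' ?_ hlim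
    filter_upwards [eventually_ge_atTop 0] with s hs
    rw [norm_smul, Real.norm_of_nonneg (Real.exp_pos _).le]
    nlinarith [mul_le_mul_of_nonneg_left (hYb s hs) (Real.exp_pos (-s)).le]

/-- The resolvent equation. -/
theorem IsMild.resolvent_mem (hG : IsDissipative G) (hGc : IsClosed (G : Set (E × E × Z)))
    (hy : IsMild G y fun _ => 0) {t : ℝ} (ht : 0 < t) :
    (resolvent y t, t⁻¹ • (resolvent y t - y 0), 0) ∈ G := by
  have hB : ∀ s, 0 ≤ s → ‖y s‖ ≤ ‖y 0‖ := fun s hs => hy.norm_le hG hs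
  obtain ⟨i1, e1⟩ := integral_exp_smul_primitive hy.cont hB ht
  have i2 := integrableOn_exp_smul hy.cont hB t
  have i3 : IntegrableOn (fun s : ℝ => Real.exp (-s) • y 0) (Ioi 0) :=
    integrableOn_exp_neg_Ioi.smul_const _
  have i4 : IntegrableOn (fun s : ℝ => Real.exp (-s) • y (max (t * s) 0) - Real.exp (-s) • y 0)
    (Ioi 0) := i2.sub i3
  have i5 : Integrable (fun _ : ℝ => (0 : Z)) (volume.restrict (Ioi 0)) := integrable_zero _ _ _
  -- Integrate the mild equation at time ts against e^(-s); the closed subspace `G` contains the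
  -- result.
  have key := Submodule.integral_mem_of_isClosed hGc (i1.integrable.prodMk (i4.prodMk i5)) (by
    filter_upwards [ae_restrict_mem measurableSet_Ioi] with s hs
    have hts : 0 ≤ t * s := mul_nonneg ht.le (mem_Ioi.1 hs).le
    have := G.smul_mem (Real.exp (-s)) (hy.mem (t * s) hts)
    rw [max_eq_left hts, ← smul_sub]
    simpa using this)
  rw [integral_pair i1 (i4.integrable.prodMk i5), integral_pair i4 i5, e1, integral_sub i2 i3,
    integral_smul_const, integral_exp_neg_Ioi_zero, one_smul, integral_zero] at key
  have := G.smul_mem t⁻¹ key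
  simpa [smul_smul, inv_mul_cancel₀ ht.ne', resolvent] using this

/-- Let a and b be v(2t) - y 0 and v(t) - y 0, where v is the resolvent. The two resolvent equations
and dissipativity of their difference give ⟨a - 2b, a - b⟩ ≤ 0, and twice this inner product is ‖b‖²
+ 3‖a - b‖² - ‖a‖². -/
theorem IsMild.resolvent_increment (hG : IsDissipative G) (hGc : IsClosed (G : Set (E × E × Z)))
    (hy : IsMild G y fun _ => 0) {t : ℝ} (ht : 0 < t) :
    ‖resolvent y t - y 0‖ ^ 2 + 3 * ‖resolvent y (2 * t) - resolvent y t‖ ^ 2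
      ≤ ‖resolvent y (2 * t) - y 0‖ ^ 2 := by
  have h1 := hy.resolvent_mem hG hGc ht
  have h2 := hy.resolvent_mem hG hGc (t := 2 * t) (by positivity)
  have h3 := hG _ _ _ (G.sub_mem h2 h1)
  set a := resolvent y (2 * t) - y 0 with ha
  set b := resolvent y t - y 0 with hb
  have hab : resolvent y (2 * t) - resolvent y t = a - b := by rw [ha, hb]; abel
  have h4 : inner ℝ ((2 * t)⁻¹ • a - t⁻¹ • b) (a - b) ≤ 0 := by
    have h3' : ‖(0 : Z) - 0‖ ^ 2 ≤ -inner ℝ ((2 * t)⁻¹ • a - t⁻¹ • b)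
      (resolvent y (2 * t) - resolvent y t) := h3
    rw [hab] at h3'
    simp only [sub_self, norm_zero] at h3'
    linarith
  have h5 : inner ℝ (a - (2 : ℝ) • b) (a - b) ≤ 0 := by
    clear_value a b
    have e : (2 * t)⁻¹ • a - t⁻¹ • b = (2 * t)⁻¹ • (a - (2 : ℝ) • b) := by
      rw [smul_sub, smul_smul]; congr 2; field_simp
    rw [e, real_inner_smul_left] at h4
    exact nonpos_of_mul_nonpos_right h4 (by positivity)
  rw [hab]
  have e1 : ‖a‖ ^ 2 = inner ℝ a a := (real_inner_self_eq_norm_sq a).symm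
  have e2 : ‖b‖ ^ 2 = inner ℝ b b := (real_inner_self_eq_norm_sq b).symm
  have e3 := norm_sub_sq_real a b
  simp only [inner_sub_left, inner_sub_right, real_inner_smul_left] at h5
  have e4 := real_inner_comm a b
  nlinarith

end Resolvent

end DissipativeRelation

theorem ENNReal.add_sq_le_two_mul (a b : ℝ≥0∞) : (a + b) ^ 2 ≤ 2 * a ^ 2 + 2 * b ^ 2 := by
  have h := ENNReal.rpow_add_le_mul_rpow_add_rpow a b (p := 2) (by norm_num)
  norm_num at h
  rwa [mul_add] at h

/-- Scaling of moments. -/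
theorem integral_rpow_smul_comp_mul {E : Type*} [NormedAddCommGroup E] [NormedSpace ℝ E]
    {v : ℝ → E} {θ c : ℝ} (hc : 0 < c)
    (hv : IntegrableOn (fun t : ℝ => t ^ (θ - 1) • v t) (Ioi 0)) :
    IntegrableOn (fun t : ℝ => t ^ (θ - 1) • v (c * t)) (Ioi 0) ∧
      ∫ t in Ioi (0 : ℝ), t ^ (θ - 1) • v (c * t)
        = c ^ (-θ) • ∫ t in Ioi (0 : ℝ), t ^ (θ - 1) • v t := by
  set F : ℝ → E := fun t => t ^ (θ - 1) • v t with hF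
  have e : EqOn (fun t : ℝ => c ^ (1 - θ) • F (c * t)) (fun t : ℝ => t ^ (θ - 1) • v (c * t))
      (Ioi 0) := fun t ht => by
    have ht : 0 < t := ht
    simp only [hF]
    rw [smul_smul, Real.mul_rpow hc.le ht.le, ← mul_assoc, ← Real.rpow_add hc]
    simp
  have hi : IntegrableOn (fun t => F (c * t)) (Ioi 0) := by
    rw [integrableOn_Ioi_comp_mul_left_iff F 0 hc, mul_zero]
    exact hv
  refine ⟨IntegrableOn.congr_fun (hi.smul (c ^ (1 - θ))) e measurableSet_Ioi, ?_⟩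
  rw [← setIntegral_congr_fun measurableSet_Ioi e, integral_smul,
    integral_comp_mul_left_Ioi F 0 hc, mul_zero, smul_smul]
  congr 1
  rw [← Real.rpow_neg_one c, ← Real.rpow_add hc]
  congr 1
  ring

theorem lintegral_Ioi_le_of_forall_Ioc {f : ℝ → ℝ≥0∞} {C : ℝ≥0∞}
    (h : ∀ a b : ℝ, 0 < a → a ≤ b → ∫⁻ t in Ioc a b, f t ≤ C) :
    ∫⁻ t in Ioi (0 : ℝ), f t ≤ C := by
  have hU : Ioi (0 : ℝ) = ⋃ n : ℕ, Ioc (1 / ((n : ℝ) + 1)) (n + 1) := by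
    ext t
    simp only [mem_Ioi, mem_iUnion, mem_Ioc]
    constructor
    · intro ht
      obtain ⟨n, hn⟩ := exists_nat_one_div_lt ht
      obtain ⟨m, hm⟩ := exists_nat_ge t
      refine ⟨max n m, lt_of_le_of_lt ?_ hn, ?_⟩
      · gcongr
        exact le_max_left _ _
      · push_cast
        linarith [le_max_right (n : ℝ) m]
    · rintro ⟨n, hn, -⟩
      exact lt_trans (by positivity) hn
  have hdir : Directed (· ⊆ ·) fun n : ℕ => Ioc (1 / ((n : ℝ) + 1)) ((n : ℝ) + 1) :=
    Monotone.directed_le fun m n hmn => by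
      have : (m : ℝ) ≤ n := by exact_mod_cast hmn
      exact Ioc_subset_Ioc (by gcongr) (by linarith)
  rw [hU, setLIntegral_iUnion_of_directed _ hdir]
  refine iSup_le fun n => h _ _ (by positivity) ?_
  rw [div_le_iff₀ (by positivity)]
  nlinarith [n.cast_nonneg (α := ℝ)]

/-! ### Moments and square functions of the resolvent -/

namespace DissipativeRelation

variable {E : Type*} [NormedAddCommGroup E] [InnerProductSpace ℝ E] {y : ℝ → E}

/-- By scaling, the moment of t ↦ y(ts) is s^(-θ) times that of y, and integrating e^(-s) s^(-θ)
gives Γ(1 - θ). Resolvents can therefore replace y in the formula for the fractional power. -/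
theorem integral_rpow_smul_resolvent [CompleteSpace E] (hy : Continuous y) {θ : ℝ} (h1 : θ < 1)
    (hInteg : IntegrableOn (fun t : ℝ => t ^ (θ - 1) • y t) (Ioi 0)) :
    IntegrableOn (fun t : ℝ => t ^ (θ - 1) • resolvent y t) (Ioi 0) ∧
      ∫ t in Ioi (0 : ℝ), t ^ (θ - 1) • resolvent y t
        = Real.Gamma (1 - θ) • ∫ t in Ioi (0 : ℝ), t ^ (θ - 1) • y t := by
  set w : ℝ → E := fun t => y (max t 0) with hw
  have hwc : Continuous w := hy.comp (by fun_prop)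
  have hwy : EqOn (fun t : ℝ => t ^ (θ - 1) • y t) (fun t : ℝ => t ^ (θ - 1) • w t) (Ioi 0) :=
    fun t ht => by simp only [hw]; rw [max_eq_left (mem_Ioi.1 ht).le]
  have hwi : IntegrableOn (fun t : ℝ => t ^ (θ - 1) • w t) (Ioi 0) :=
    hInteg.congr_fun hwy measurableSet_Ioi
  have hwn : IntegrableOn (fun t : ℝ => t ^ (θ - 1) • ‖w t‖) (Ioi 0) := by
    refine IntegrableOn.congr_fun hwi.norm (fun t ht => ?_) measurableSet_Ioi
    simp only [norm_smul, smul_eq_mul]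
    rw [Real.norm_of_nonneg (Real.rpow_nonneg (mem_Ioi.1 ht).le _)]
  set μ : Measure ℝ := volume.restrict (Ioi 0) with hμ
  set F : ℝ → ℝ → E := fun t s => t ^ (θ - 1) • Real.exp (-s) • w (t * s) with hF
  have hgam : IntegrableOn (fun s : ℝ => Real.exp (-s) * s ^ (-θ)) (Ioi 0) := by
    have := Real.GammaIntegral_convergent (s := 1 - θ) (by linarith)
    simpa [sub_sub_cancel_left] using this
  have hmeas : AEStronglyMeasurable (Function.uncurry F) (μ.prod μ) := by
    have h1 : Measurable fun p : ℝ × ℝ => p.1 ^ (θ - 1) := by fun_prop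
    have h2 : Continuous fun p : ℝ × ℝ => Real.exp (-p.2) • w (p.1 * p.2) :=
      Continuous.smul (by fun_prop) (hwc.comp (by fun_prop))
    exact h1.aestronglyMeasurable.smul h2.aestronglyMeasurable
  have hsc : ∀ s, 0 < s → IntegrableOn (fun t => F t s) (Ioi 0) ∧
      ∫ t in Ioi (0 : ℝ), F t s
        = (Real.exp (-s) * s ^ (-θ)) • ∫ t in Ioi (0 : ℝ), t ^ (θ - 1) • w t := fun s hs => by
    obtain ⟨i, e⟩ := integral_rpow_smul_comp_mul hs hwi
    have eF : (fun t => F t s) = fun t => Real.exp (-s) • (t ^ (θ - 1) • w (s * t)) := by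
      funext t; simp only [hF]; rw [smul_comm, mul_comm t s]
    rw [eF]
    refine ⟨i.smul _, ?_⟩
    rw [integral_smul, e, smul_smul]
  have hscn : ∀ s, 0 < s → ∫ t in Ioi (0 : ℝ), ‖F t s‖
        = (Real.exp (-s) * s ^ (-θ)) * ∫ t in Ioi (0 : ℝ), t ^ (θ - 1) • ‖w t‖ := fun s hs => by
    obtain ⟨i, e⟩ := integral_rpow_smul_comp_mul hs hwn
    have eF : EqOn (fun t => ‖F t s‖) (fun t => Real.exp (-s) * (t ^ (θ - 1) • ‖w (s * t)‖))
        (Ioi 0) := fun t ht => by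
      simp only [hF, norm_smul, smul_eq_mul]
      rw [Real.norm_of_nonneg (Real.rpow_nonneg (mem_Ioi.1 ht).le _),
        Real.norm_of_nonneg (Real.exp_pos _).le, mul_comm t s]
      ring
    rw [setIntegral_congr_fun measurableSet_Ioi eF, integral_const_mul, e, smul_eq_mul, mul_assoc]
  have hFi : Integrable (Function.uncurry F) (μ.prod μ) := by
    rw [integrable_prod_iff' hmeas]
    constructor
    · filter_upwards [ae_restrict_mem measurableSet_Ioi] with s hs
      exact (hsc s hs).1
    · have := hgam.mul_const (∫ t in Ioi (0 : ℝ), t ^ (θ - 1) • ‖w t‖)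
      refine IntegrableOn.congr_fun this (fun s hs => ?_) measurableSet_Ioi
      exact (hscn s hs).symm
  have hinner : ∀ t, ∫ s, F t s ∂μ = t ^ (θ - 1) • resolvent y t := fun t => by
    simp only [hF]
    rw [integral_smul]
    rfl
  refine ⟨?_, ?_⟩
  · have := hFi.integral_prod_left
    simp only [Function.uncurry_apply_pair, hinner] at this
    exact this
  · have := integral_integral_swap hFi
    simp only [hinner] at this
    rw [this, setIntegral_congr_fun measurableSet_Ioi (fun s hs => (hsc s hs).2),
      integral_smul_const, setIntegral_congr_fun measurableSet_Ioi hwy]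
    congr 1
    rw [Real.Gamma_eq_integral (by linarith)]
    simp [sub_sub_cancel_left]

variable [CompleteSpace E] {Z : Type*} [NormedAddCommGroup Z] [InnerProductSpace ℝ Z]
  [CompleteSpace Z] {G : Submodule ℝ (E × E × Z)}

/-- The square function estimate for the resolvent of a dissipative operator. -/
theorem IsMild.lintegral_resolvent_increment_lt_top (hG : IsDissipative G)
    (hGc : IsClosed (G : Set (E × E × Z))) (hy : IsMild G y fun _ => 0) {c : ℝ} (hc : 0 < c) :
    ∫⁻ t in Ioi (0 : ℝ), ENNReal.ofReal t⁻¹ *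
      ‖resolvent y (2 * (c * t)) - resolvent y (c * t)‖ₑ ^ 2 < ⊤ := by
  have hB : ∀ s, 0 ≤ s → ‖y s‖ ≤ ‖y 0‖ := fun s hs => hy.norm_le hG hs
  set v := resolvent y with hv
  have hvc : Continuous v := continuous_resolvent hy.cont hB
  set ψ : ℝ → ℝ := fun r => r⁻¹ * ‖v r - y 0‖ ^ 2 with hψ
  have hψc : ∀ a b : ℝ, 0 < a → a ≤ b → IntervalIntegrable ψ volume a b := fun a b ha hab => by
    refine ContinuousOn.intervalIntegrable ?_
    rw [uIcc_of_le hab]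
    refine ContinuousOn.mul (continuousOn_id.inv₀ fun r hr => (ha.trans_le hr.1).ne') ?_
    fun_prop
  have hψ0 : ∀ r, 0 < r → 0 ≤ ψ r := fun r hr => by simp only [hψ]; positivity
  set D : ℝ → ℝ := fun t => t⁻¹ * ‖v (2 * t) - v t‖ ^ 2 with hD
  have hDc : ∀ a b : ℝ, 0 < a → a ≤ b → IntervalIntegrable D volume a b := fun a b ha hab => by
    refine ContinuousOn.intervalIntegrable ?_
    rw [uIcc_of_le hab]
    refine ContinuousOn.mul (continuousOn_id.inv₀ fun r hr => (ha.trans_le hr.1).ne') ?_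
    fun_prop
  have hscale : ∀ (f : ℝ → ℝ) (c a b : ℝ), 0 < c →
      ∫ t in a..b, t⁻¹ * f (c * t) = ∫ r in c * a..c * b, r⁻¹ * f r := by
    intro f c a b hc
    have h := intervalIntegral.integral_comp_mul_left (a := a) (b := b)
      (fun r => r⁻¹ * f r) hc.ne'
    have e : ∀ t, t⁻¹ * f (c * t) = c * ((c * t)⁻¹ * f (c * t)) := fun t => by
      rw [mul_inv, ← mul_assoc, ← mul_assoc, mul_inv_cancel₀ hc.ne', one_mul]
    simp only [e]
    rw [intervalIntegral.integral_const_mul, h, smul_eq_mul, ← mul_assoc, mul_inv_cancel₀ hc.ne',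
      one_mul]
  -- With ψ(r) = ‖v r - y 0‖²/r the increment inequality bounds the integral of ψ + 3D over [a, b]
  -- by that of ψ over [2a, 2b]. The overlap cancels, and what remains of ψ on [b, 2b] is at most
  -- (2‖y 0‖)².
  have hmain : ∀ a b : ℝ, 0 < a → a ≤ b → ∫ t in a..b, D t ≤ (2 * ‖y 0‖) ^ 2 := by
    intro a b ha hab
    have hb : 0 < b := ha.trans_le hab
    have hψ2 : IntervalIntegrable (fun t => t⁻¹ * ‖v (2 * t) - y 0‖ ^ 2) volume a b := by
      refine ContinuousOn.intervalIntegrable ?_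
      rw [uIcc_of_le hab]
      refine ContinuousOn.mul (continuousOn_id.inv₀ fun r hr => (ha.trans_le hr.1).ne') ?_
      fun_prop
    have s1 : ∫ t in a..b, (ψ t + 3 * D t) ≤ ∫ t in a..b, t⁻¹ * ‖v (2 * t) - y 0‖ ^ 2 := by
      refine intervalIntegral.integral_mono_on hab
        ((hψc a b ha hab).add ((hDc a b ha hab).const_mul 3)) hψ2 fun t ht => ?_
      have ht0 : 0 < t := ha.trans_le ht.1
      have := mul_le_mul_of_nonneg_left (hy.resolvent_increment hG hGc ht0) (inv_pos.2 ht0).le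
      simp only [hψ, hD]
      linarith
    rw [intervalIntegral.integral_add (hψc a b ha hab) ((hDc a b ha hab).const_mul 3),
      intervalIntegral.integral_const_mul, hscale (fun r => ‖v r - y 0‖ ^ 2) 2 a b two_pos] at s1
    have s2 : (∫ r in 2 * a..2 * b, ψ r) ≤ (∫ r in a..b, ψ r) + ∫ r in b..2 * b, ψ r := by
      rw [intervalIntegral.integral_add_adjacent_intervals (hψc a b ha hab)
        (hψc b (2 * b) hb (by linarith))]
      rw [← intervalIntegral.integral_add_adjacent_intervals
        (hψc a (2 * a) ha (by linarith)) (hψc (2 * a) (2 * b) (by linarith) (by linarith))]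
      have := intervalIntegral.integral_nonneg (μ := volume) (a := a) (b := 2 * a) (f := ψ)
        (by linarith) fun r hr => hψ0 r (ha.trans_le hr.1)
      linarith
    have s3 : ∫ r in b..2 * b, ψ r ≤ ∫ r in b..2 * b, b⁻¹ * (2 * ‖y 0‖) ^ 2 := by
      refine intervalIntegral.integral_mono_on (by linarith) (hψc b (2 * b) hb (by linarith))
        (by simp) fun r hr => ?_
      have h2 : ‖v r - y 0‖ ≤ 2 * ‖y 0‖ :=
        (_root_.norm_sub_le _ _).trans (by linarith [norm_resolvent_le hB r])
      simp only [hψ]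
      have := inv_anti₀ hb hr.1
      gcongr
    have s4 : ∫ r in b..2 * b, b⁻¹ * (2 * ‖y 0‖) ^ 2 = (2 * ‖y 0‖) ^ 2 := by
      rw [intervalIntegral.integral_const, smul_eq_mul]
      field_simp
      ring
    have s5 := intervalIntegral.integral_nonneg (μ := volume) (a := a) (b := b) (f := D) hab
      fun r hr => by
        have : 0 < r := ha.trans_le hr.1
        simp only [hD]; positivity
    have s1' : (∫ t in a..b, ψ t) + 3 * ∫ t in a..b, D t ≤ ∫ r in 2 * a..2 * b, ψ r := s1
    linarith
  refine lt_of_le_of_lt (lintegral_Ioi_le_of_forall_Ioc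
    (C := ENNReal.ofReal ((2 * ‖y 0‖) ^ 2)) fun a b ha hab => ?_) ENNReal.ofReal_lt_top
  have hcD : ContinuousOn (fun t : ℝ => t⁻¹ * ‖v (2 * (c * t)) - v (c * t)‖ ^ 2) (Icc a b) :=
    ContinuousOn.mul (continuousOn_id.inv₀ fun r hr => (ha.trans_le hr.1).ne') (by fun_prop)
  have hi : IntegrableOn (fun t : ℝ => t⁻¹ * ‖v (2 * (c * t)) - v (c * t)‖ ^ 2) (Ioc a b) :=
    hcD.integrableOn_Icc.mono_set Ioc_subset_Icc_self
  have e1 : ∫⁻ t in Ioc a b, ENNReal.ofReal t⁻¹ * ‖v (2 * (c * t)) - v (c * t)‖ₑ ^ 2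
      = ENNReal.ofReal (∫ t in Ioc a b, t⁻¹ * ‖v (2 * (c * t)) - v (c * t)‖ ^ 2) := by
    rw [ofReal_integral_eq_lintegral_ofReal hi]
    · refine setLIntegral_congr_fun measurableSet_Ioc fun t ht => ?_
      have : 0 < t := ha.trans ht.1
      rw [ENNReal.ofReal_mul (by positivity), ENNReal.ofReal_pow (norm_nonneg _), ofReal_norm]
    · filter_upwards [ae_restrict_mem measurableSet_Ioc] with t ht
      have : 0 < t := ha.trans ht.1
      positivity
  rw [e1, ← intervalIntegral.integral_of_le hab,
    hscale (fun t => ‖v (2 * t) - v t‖ ^ 2) c a b hc]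
  exact ENNReal.ofReal_le_ofReal (hmain _ _ (by positivity) (by gcongr))

end DissipativeRelation

/-! ### Modulus of continuity for initial values in a fractional domain -/

namespace DissipativeRelation

variable {E : Type*} [NormedAddCommGroup E] [InnerProductSpace ℝ E]
  [CompleteSpace E] {Z : Type*} [NormedAddCommGroup Z] [InnerProductSpace ℝ Z]
  [CompleteSpace Z] {G : Submodule ℝ (E × E × Z)}

/-- A K-functional argument. Write x 0 as a multiple of ∫ t^(θ-1) D(t) dt, where D(t) lies in the
domain with image A(t)/t, and cut at t = δ: the tail is a domain element g with image f, whence ‖x δ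
- x 0‖ ≤ 2‖x 0 - g‖ + δ‖f‖. Both D and A are combinations of dyadic resolvent increments, so the
square function estimate and the two Hardy inequalities bound the two terms. -/
theorem lintegral_modulus_lt_top_of_isClosed (hG : IsDissipative G)
    (hGc : IsClosed (G : Set (E × E × Z))) {x y : ℝ → E} (hx : IsMild G x fun _ => 0)
    (hy : IsMild G y fun _ => 0) {θ c : ℝ} (h0 : 0 < θ) (h1 : θ < 1)
    (hInteg : IntegrableOn (fun t : ℝ => t ^ (θ - 1) • y t) (Ioi 0))
    (hx0 : x 0 = c • ∫ t in Ioi (0 : ℝ), t ^ (θ - 1) • y t) :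
    ∫⁻ δ in Ioi (0 : ℝ), ENNReal.ofReal (δ ^ (-1 - 2 * θ)) * ‖x δ - x 0‖ₑ ^ 2 < ⊤ := by
  have hB : ∀ s, 0 ≤ s → ‖y s‖ ≤ ‖y 0‖ := fun s hs => hy.norm_le hG hs
  set v := resolvent y with hv
  have hvc : Continuous v := continuous_resolvent hy.cont hB
  -- The coefficients 2, -3, 1 sum to zero, and so do 2/4, -3/2, 1, the coefficients of the image.
  -- The first makes D a combination of increments; the second does the same for A and also cancels
  -- y 0 in the resolvent equations.
  set D : ℝ → E := fun t => (2 : ℝ) • v (4 * t) - (3 : ℝ) • v (2 * t) + v t with hD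
  set A : ℝ → E := fun t => (1 / 2 : ℝ) • v (4 * t) - (3 / 2 : ℝ) • v (2 * t) + v t with hA
  have hDc : Continuous D := by simp only [hD]; fun_prop
  have hAc : Continuous A := by simp only [hA]; fun_prop
  -- the representation of the initial value
  obtain ⟨iv, ev⟩ := integral_rpow_smul_resolvent hy.cont h1 hInteg
  obtain ⟨iv2, ev2⟩ := integral_rpow_smul_comp_mul (c := 2) two_pos iv
  obtain ⟨iv4, ev4⟩ := integral_rpow_smul_comp_mul (c := 4) four_pos iv
  have eD : (fun t : ℝ => t ^ (θ - 1) • D t) = fun t : ℝ => (2 : ℝ) • (t ^ (θ - 1) • v (4 * t))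
      - (3 : ℝ) • (t ^ (θ - 1) • v (2 * t)) + t ^ (θ - 1) • v t := by
    funext t
    simp only [hD, smul_add, smul_sub, smul_comm (t ^ (θ - 1))]
  have j2 : IntegrableOn (fun t : ℝ => (3 : ℝ) • (t ^ (θ - 1) • v (2 * t))) (Ioi 0) := iv2.smul 3
  have j4 : IntegrableOn (fun t : ℝ => (2 : ℝ) • (t ^ (θ - 1) • v (4 * t))) (Ioi 0) := iv4.smul 2
  have j24 : IntegrableOn (fun t : ℝ => (2 : ℝ) • (t ^ (θ - 1) • v (4 * t))
    - (3 : ℝ) • (t ^ (θ - 1) • v (2 * t))) (Ioi 0) := j4.sub j2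
  have iD : IntegrableOn (fun t : ℝ => t ^ (θ - 1) • D t) (Ioi 0) := by
    rw [eD]; exact j24.add iv
  -- The factor by which the moment of D differs from that of v. With u = 2^(-θ) it equals (2u -
  -- 1)(u - 1), and 1/2 < u < 1.
  set κ : ℝ := 2 * 4 ^ (-θ) - 3 * 2 ^ (-θ) + 1 with hκ
  have hκ0 : κ ≠ 0 := by
    set u : ℝ := 2 ^ (-θ) with hu
    have hu4 : (4 : ℝ) ^ (-θ) = u ^ 2 := by
      rw [hu, show (4 : ℝ) = 2 * 2 by norm_num, Real.mul_rpow two_pos.le two_pos.le, pow_two]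
    have hu1 : u < 1 := Real.rpow_lt_one_of_one_lt_of_neg one_lt_two (by linarith)
    have hu2 : 1 / 2 < u := by
      have := Real.rpow_lt_rpow_of_exponent_lt (x := 2) one_lt_two (show (-1 : ℝ) < -θ by linarith)
      rwa [Real.rpow_neg_one, ← one_div] at this
    have : κ = (2 * u - 1) * (u - 1) := by rw [hκ, hu4]; ring
    rw [this]
    exact mul_ne_zero (by linarith) (by linarith)
  have hΓ : Real.Gamma (1 - θ) ≠ 0 := (Real.Gamma_pos_of_pos (by linarith)).ne'
  set C : ℝ := c / (κ * Real.Gamma (1 - θ)) with hC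
  have hrep : x 0 = C • ∫ t in Ioi (0 : ℝ), t ^ (θ - 1) • D t := by
    rw [eD, integral_add j24 iv, integral_sub j4 j2, integral_smul, integral_smul, ev2, ev4,
      hx0, ev]
    simp only [smul_smul, ← sub_smul, ← add_smul]
    congr 1
    have : 2 * (4 ^ (-θ) * Real.Gamma (1 - θ)) - 3 * (2 ^ (-θ) * Real.Gamma (1 - θ))
        + Real.Gamma (1 - θ) = κ * Real.Gamma (1 - θ) := by rw [hκ]; ring
    rw [this, hC, div_mul_cancel₀ _ (mul_ne_zero hκ0 hΓ)]
  -- membership in the relation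
  have hmem : ∀ t, 0 < t → (D t, t⁻¹ • A t, (0 : Z)) ∈ G := by
    intro t ht
    have m1 := hy.resolvent_mem hG hGc ht
    have m2 := G.smul_mem 3 (hy.resolvent_mem hG hGc (t := 2 * t) (by positivity))
    have m4 := G.smul_mem 2 (hy.resolvent_mem hG hGc (t := 4 * t) (by positivity))
    have m := G.add_mem (G.sub_mem m4 m2) m1
    simp only [Prod.smul_mk, Prod.mk_sub_mk, Prod.mk_add_mk, smul_zero, sub_zero, add_zero] at m
    convert m using 3
    simp only [hA, smul_add, smul_sub, smul_smul]
    have e4 : t⁻¹ * (1 / 2) = 2 * (4 * t)⁻¹ := by field_simp; norm_num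
    have e2 : t⁻¹ * (3 / 2) = 3 * (2 * t)⁻¹ := by field_simp
    have e0 : (2 * (4 * t)⁻¹) • y 0 - (3 * (2 * t)⁻¹) • y 0 + t⁻¹ • y 0 = 0 := by
      rw [← sub_smul, ← add_smul]
      have : 2 * (4 * t)⁻¹ - 3 * (2 * t)⁻¹ + t⁻¹ = 0 := by field_simp; norm_num
      rw [this, zero_smul]
    rw [e4, e2]
    rw [← sub_eq_zero]
    calc _ = (2 * (4 * t)⁻¹) • y 0 - (3 * (2 * t)⁻¹) • y 0 + t⁻¹ • y 0 := by abel
      _ = 0 := e0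
  have hAb : ∀ t, ‖A t‖ ≤ 3 * ‖y 0‖ := fun t => by
    have b : ∀ s, ‖v s‖ ≤ ‖y 0‖ := norm_resolvent_le hB
    calc ‖A t‖ ≤ ‖(1 / 2 : ℝ) • v (4 * t)‖ + ‖(3 / 2 : ℝ) • v (2 * t)‖ + ‖v t‖ :=
          (norm_add_le _ _).trans (by gcongr; exact _root_.norm_sub_le _ _)
      _ ≤ 3 * ‖y 0‖ := by
          rw [norm_smul, norm_smul]
          norm_num
          linarith [b t, b (2 * t), b (4 * t)]
  -- the pointwise estimate
  have hpt : ∀ δ, 0 < δ → ‖x δ - x 0‖ₑ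
      ≤ 2 * (‖C‖ₑ * ∫⁻ t in Ioc 0 δ, ENNReal.ofReal (t ^ (θ - 1)) * ‖D t‖ₑ)
        + ENNReal.ofReal δ * (‖C‖ₑ * ∫⁻ t in Ici δ, ENNReal.ofReal (t ^ (-1 - (1 - θ))) *
          ‖A t‖ₑ) := by
    intro δ hδ
    have k1 : IntegrableOn (fun t : ℝ => t ^ (θ - 1) • D t) (Ioi δ) :=
      iD.mono_set (Ioi_subset_Ioi hδ.le)
    have k1' : IntegrableOn (fun t : ℝ => t ^ (θ - 1) • D t) (Ioc 0 δ) :=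
      iD.mono_set Ioc_subset_Ioi_self
    have k2 : IntegrableOn (fun t : ℝ => t ^ (-1 - (1 - θ)) • A t) (Ioi δ) := by
      refine ((integrableOn_Ioi_rpow_of_lt (show -1 - (1 - θ) < -1 by linarith) hδ).mul_const
        (3 * ‖y 0‖)).mono' ?_ ?_
      · exact (Measurable.aestronglyMeasurable (by fun_prop)).smul hAc.aestronglyMeasurable
      · filter_upwards [ae_restrict_mem measurableSet_Ioi] with t ht
        have hp : 0 ≤ t ^ (-1 - (1 - θ)) := Real.rpow_nonneg (hδ.trans ht).le _
        rw [norm_smul, Real.norm_of_nonneg hp]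
        exact mul_le_mul_of_nonneg_left (hAb t) hp
    have k3 : Integrable (fun _ : ℝ => (0 : Z)) (volume.restrict (Ioi δ)) := integrable_zero _ _ _
    have key := Submodule.integral_mem_of_isClosed hGc (k1.integrable.prodMk (k2.prodMk k3)) (by
      filter_upwards [ae_restrict_mem measurableSet_Ioi] with t ht
      have ht0 : 0 < t := hδ.trans ht
      have := G.smul_mem (t ^ (θ - 1)) (hmem t ht0)
      simp only [Prod.smul_mk, smul_smul, smul_zero] at this
      have e : t ^ (θ - 1) * t⁻¹ = t ^ (-1 - (1 - θ)) := by
        rw [← Real.rpow_neg_one t, ← Real.rpow_add ht0]; congr 1; ring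
      rwa [e] at this)
    rw [integral_pair k1 (k2.integrable.prodMk k3), integral_pair k2 k3, integral_zero] at key
    have key2 := G.smul_mem C key
    simp only [Prod.smul_mk, smul_zero] at key2
    set g := C • ∫ t in Ioi δ, t ^ (θ - 1) • D t with hg
    set f := C • ∫ t in Ioi δ, t ^ (-1 - (1 - θ)) • A t with hf
    have hcmp := hx.norm_sub_le hG key2 hδ.le
    have hxg : x 0 - g = C • ∫ t in Ioc 0 δ, t ^ (θ - 1) • D t := by
      rw [hrep, hg, ← smul_sub, ← Ioc_union_Ioi_eq_Ioi hδ.le, setIntegral_union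
        (Ioc_disjoint_Ioi le_rfl) measurableSet_Ioi k1' k1, add_sub_cancel_right]
    have hnorm : ‖x δ - x 0‖ ≤ 2 * ‖x 0 - g‖ + δ * ‖f‖ := by
      have : x δ - x 0 = (x δ - g) - (x 0 - g) := by abel
      rw [this]
      linarith [_root_.norm_sub_le (x δ - g) (x 0 - g)]
    have hen : ‖x δ - x 0‖ₑ ≤ 2 * ‖x 0 - g‖ₑ + ENNReal.ofReal δ * ‖f‖ₑ := by
      rw [← ofReal_norm, ← ofReal_norm, ← ofReal_norm, ← ENNReal.ofReal_mul hδ.le,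
        ← ENNReal.ofReal_ofNat 2, ← ENNReal.ofReal_mul two_pos.le,
        ← ENNReal.ofReal_add (by positivity) (by positivity)]
      exact ENNReal.ofReal_le_ofReal hnorm
    refine hen.trans (add_le_add (mul_le_mul_right ?_ _) (mul_le_mul_right ?_ _))
    · rw [hxg, enorm_smul]
      refine mul_le_mul_right ((enorm_integral_le_lintegral_enorm _).trans_eq ?_) _
      refine setLIntegral_congr_fun measurableSet_Ioc fun t ht => ?_
      rw [enorm_smul, Real.enorm_of_nonneg (Real.rpow_nonneg ht.1.le _)]
    · rw [hf, enorm_smul, setLIntegral_congr Ioi_ae_eq_Ici.symm]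
      refine mul_le_mul_right ((enorm_integral_le_lintegral_enorm _).trans_eq ?_) _
      refine setLIntegral_congr_fun measurableSet_Ioi fun t ht => ?_
      rw [enorm_smul, Real.enorm_of_nonneg (Real.rpow_nonneg (hδ.trans ht).le _)]
  -- the square functions
  have hsq : ∀ (a b : ℝ) (F : ℝ → E), (∀ t, F t = a • (v (2 * (2 * t)) - v (2 * t))
      - b • (v (2 * (1 * t)) - v (1 * t))) →
      ∫⁻ t in Ioi (0 : ℝ), ENNReal.ofReal t⁻¹ * ‖F t‖ₑ ^ 2 < ⊤ := by
    intro a b F hF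
    have q2 := hy.lintegral_resolvent_increment_lt_top hG hGc two_pos
    have q1 := hy.lintegral_resolvent_increment_lt_top hG hGc one_pos
    rw [← hv] at q1 q2
    have hm : ∀ c : ℝ, Measurable fun t : ℝ =>
        ENNReal.ofReal t⁻¹ * ‖v (2 * (c * t)) - v (c * t)‖ₑ ^ 2 := fun c => by
      have : Continuous fun t : ℝ => v (2 * (c * t)) - v (c * t) := by fun_prop
      have h2 := this.enorm.measurable
      fun_prop
    have ha : 2 * ‖a‖ₑ ^ 2 ≠ ⊤ := ENNReal.mul_ne_top (by simp) (by simp)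
    have hb : 2 * ‖b‖ₑ ^ 2 ≠ ⊤ := ENNReal.mul_ne_top (by simp) (by simp)
    refine lt_of_le_of_lt (lintegral_mono (g := fun t : ℝ =>
      2 * ‖a‖ₑ ^ 2 * (ENNReal.ofReal t⁻¹ * ‖v (2 * (2 * t)) - v (2 * t)‖ₑ ^ 2)
      + 2 * ‖b‖ₑ ^ 2 * (ENNReal.ofReal t⁻¹ * ‖v (2 * (1 * t)) - v (1 * t)‖ₑ ^ 2)) fun t => ?_) ?_
    · rw [hF]
      calc _ ≤ ENNReal.ofReal t⁻¹ * (2 * ‖a • (v (2 * (2 * t)) - v (2 * t))‖ₑ ^ 2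
            + 2 * ‖b • (v (2 * (1 * t)) - v (1 * t))‖ₑ ^ 2) := by
            gcongr
            exact (pow_le_pow_left₀ zero_le (enorm_sub_le) 2).trans
              (ENNReal.add_sq_le_two_mul _ _)
        _ = _ := by simp only [enorm_smul]; ring
    · rw [lintegral_add_left ((hm 2).const_mul _), lintegral_const_mul _ (hm 2),
        lintegral_const_mul _ (hm 1)]
      exact ENNReal.add_lt_top.2 ⟨ENNReal.mul_lt_top ha.lt_top q2,
        ENNReal.mul_lt_top hb.lt_top q1⟩
  have hqD : ∫⁻ t in Ioi (0 : ℝ), ENNReal.ofReal t⁻¹ * ‖D t‖ₑ ^ 2 < ⊤ :=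
    hsq 2 1 D fun t => by
      simp only [hD, ← mul_assoc, one_mul]
      norm_num
      module
  have hqA : ∫⁻ t in Ioi (0 : ℝ), ENNReal.ofReal t⁻¹ * ‖A t‖ₑ ^ 2 < ⊤ :=
    hsq (1 / 2) 1 A fun t => by
      simp only [hA, ← mul_assoc, one_mul]
      norm_num
      module
  -- conclusion by Hardy's inequalities
  have hH1 := lintegral_hardy_Ioc h0 (α := fun t => ‖D t‖ₑ) hDc.enorm.measurable
  have hH2 := lintegral_hardy_Ici (sub_pos.2 h1) (α := fun t => ‖A t‖ₑ) hAc.enorm.measurable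
  set P : ℝ → ℝ≥0∞ := fun δ => ENNReal.ofReal (δ ^ (-1 - 2 * θ)) *
        (∫⁻ t in Ioc 0 δ, ENNReal.ofReal (t ^ (θ - 1)) * ‖D t‖ₑ) ^ 2 with hP
  set Q : ℝ → ℝ≥0∞ := fun δ => ENNReal.ofReal (δ ^ (2 * (1 - θ) - 1)) *
        (∫⁻ t in Ici δ, ENNReal.ofReal (t ^ (-1 - (1 - θ))) * ‖A t‖ₑ) ^ 2 with hQ
  have hPm : Measurable P := by
    have hmon : Monotone fun δ => ∫⁻ t in Ioc 0 δ, ENNReal.ofReal (t ^ (θ - 1)) * ‖D t‖ₑ :=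
      fun a b hab => lintegral_mono_set (Ioc_subset_Ioc_right hab)
    exact (Measurable.ennreal_ofReal (by fun_prop)).mul (hmon.measurable.pow_const 2)
  have hfin : ∫⁻ δ in Ioi (0 : ℝ), (8 * ‖C‖ₑ ^ 2 * P δ + 2 * ‖C‖ₑ ^ 2 * Q δ) < ⊤ := by
    have c8 : 8 * ‖C‖ₑ ^ 2 ≠ ⊤ := ENNReal.mul_ne_top (by simp) (by simp)
    have c2 : 2 * ‖C‖ₑ ^ 2 ≠ ⊤ := ENNReal.mul_ne_top (by simp) (by simp)
    rw [lintegral_add_left (hPm.const_mul _), lintegral_const_mul' _ _ c8,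
      lintegral_const_mul' _ _ c2]
    refine ENNReal.add_lt_top.2 ⟨ENNReal.mul_lt_top c8.lt_top (hH1.trans_lt ?_),
        ENNReal.mul_lt_top c2.lt_top (hH2.trans_lt ?_)⟩
    · exact ENNReal.mul_lt_top (by simp) hqD
    · exact ENNReal.mul_lt_top (by simp) hqA
  refine lt_of_le_of_lt (setLIntegral_mono' measurableSet_Ioi fun δ hδ => ?_) hfin
  have hδ : 0 < δ := hδ
  have e : ENNReal.ofReal (δ ^ (-1 - 2 * θ)) * ENNReal.ofReal δ ^ 2
      = ENNReal.ofReal (δ ^ (2 * (1 - θ) - 1)) := by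
    rw [← ENNReal.ofReal_pow hδ.le, ← ENNReal.ofReal_mul (by positivity), ← Real.rpow_natCast,
      ← Real.rpow_add hδ]
    congr 2
    push_cast
    ring
  calc _ ≤ ENNReal.ofReal (δ ^ (-1 - 2 * θ)) * (2 * (2 * (‖C‖ₑ * ∫⁻ t in Ioc 0 δ,
        ENNReal.ofReal (t ^ (θ - 1)) * ‖D t‖ₑ)) ^ 2 + 2 * (ENNReal.ofReal δ * (‖C‖ₑ *
          ∫⁻ t in Ici δ, ENNReal.ofReal (t ^ (-1 - (1 - θ))) * ‖A t‖ₑ)) ^ 2) := by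
        gcongr
        exact (pow_le_pow_left₀ zero_le (hpt δ hδ) 2).trans (ENNReal.add_sq_le_two_mul _ _)
    _ = _ := by
        simp only [hP, hQ, ← e]
        ring

/-- The relation with the output discarded. -/
noncomputable def forgetOutput (G : Submodule ℝ (E × E × Z)) : Submodule ℝ (E × E × Z) :=
  (G.map (LinearMap.prodMap LinearMap.id (LinearMap.prodMap LinearMap.id 0))).topologicalClosure

theorem IsDissipative.forgetOutput (hG : IsDissipative G) : IsDissipative (forgetOutput G) := by
  refine IsDissipative.topologicalClosure ?_
  rintro x f k ⟨⟨x', f', k'⟩, hmem, heq⟩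
  simp only [LinearMap.prodMap_apply, LinearMap.id_apply, LinearMap.zero_apply,
    Prod.mk.injEq] at heq
  obtain ⟨rfl, rfl, rfl⟩ := heq
  simpa using (sq_nonneg _).trans (hG _ _ _ hmem)

theorem IsMild.forgetOutput {x : ℝ → E} {K : ℝ → Z} (hx : IsMild G x K) :
    IsMild (forgetOutput G) x fun _ => 0 where
  cont := hx.cont
  mem t ht := Submodule.le_topologicalClosure _ ⟨_, hx.mem t ht, by simp⟩

/-- A mild solution that starts in the domain of a fractional power of the generator is continuous
at time zero with a square integrable modulus of continuity. -/
theorem IsMild.lintegral_modulus_lt_top (hG : IsDissipative G) {x y : ℝ → E} {K L : ℝ → Z}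
    (hx : IsMild G x K) (hy : IsMild G y L) {θ c : ℝ} (h0 : 0 < θ) (h1 : θ < 1)
    (hInteg : IntegrableOn (fun t : ℝ => t ^ (θ - 1) • y t) (Ioi 0))
    (hx0 : x 0 = c • ∫ t in Ioi (0 : ℝ), t ^ (θ - 1) • y t) :
    ∫⁻ δ in Ioi (0 : ℝ), ENNReal.ofReal (δ ^ (-1 - 2 * θ)) * ‖x δ - x 0‖ₑ ^ 2 < ⊤ :=
  lintegral_modulus_lt_top_of_isClosed hG.forgetOutput (Submodule.isClosed_topologicalClosure _)
    hx.forgetOutput hy.forgetOutput h0 h1 hInteg hx0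

end DissipativeRelation

/-! ### Double integrals and dyadic sums in time -/

theorem lintegral_Ioi_comp_add_left (f : ℝ → ℝ≥0∞) (t : ℝ) :
    ∫⁻ δ in Ioi (0 : ℝ), f (t + δ) = ∫⁻ τ in Ioi t, f τ := by
  have hmp := (measurePreserving_add_left volume t).restrict_preimage_emb
    (measurableEmbedding_addLeft t) (Ioi t)
  have hset : (fun δ : ℝ => t + δ) ⁻¹' Ioi t = Ioi 0 := by ext; simp
  rw [hset] at hmp
  exact hmp.lintegral_comp_emb (measurableEmbedding_addLeft t) f

/-- A symmetric function on a square is integrated over the two triangles. -/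
theorem lintegral_square_le_of_symm {F : ℝ → ℝ → ℝ≥0∞} (hF : Measurable (Function.uncurry F))
    (hsymm : ∀ s t, F s t = F t s) (hdiag : ∀ t, F t t = 0) (T : ℝ) :
    ∫⁻ t in Ioo 0 T, ∫⁻ τ in Ioo 0 T, F t τ
      ≤ 2 * ∫⁻ δ in Ioi (0 : ℝ), ∫⁻ t in Ioi (0 : ℝ), F t (t + δ) := by
  set g : ℝ → ℝ → ℝ≥0∞ := fun t τ =>
    {p : ℝ × ℝ | 0 < p.1 ∧ p.1 < p.2}.indicator (Function.uncurry F) (t, τ) with hg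
  have hset : MeasurableSet {p : ℝ × ℝ | 0 < p.1 ∧ p.1 < p.2} :=
    (measurableSet_lt measurable_const measurable_fst).inter
      (measurableSet_lt measurable_fst measurable_snd)
  have hgm : Measurable (Function.uncurry g) := hF.indicator hset
  have hle : ∀ t ∈ Ioo 0 T, ∀ τ ∈ Ioo 0 T, F t τ ≤ g t τ + g τ t := by
    intro t ht τ hτ
    rcases lt_trichotomy t τ with h | h | h
    · exact le_add_right (by simp [hg, indicator, ht.1, h])
    · rw [h, hdiag]; exact zero_le
    · exact le_add_left (by simp [hg, indicator, hτ.1, h, hsymm t τ])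
  have h1 : ∫⁻ t, ∫⁻ τ, g t τ = ∫⁻ δ in Ioi (0 : ℝ), ∫⁻ t in Ioi (0 : ℝ), F t (t + δ) := by
    have e : ∀ t, ∫⁻ τ, g t τ = (Ioi (0 : ℝ)).indicator (fun t => ∫⁻ τ in Ioi t, F t τ) t := by
      intro t
      by_cases ht : 0 < t
      · rw [indicator_of_mem (mem_Ioi.2 ht), ← lintegral_indicator measurableSet_Ioi]
        congr 1
        funext τ
        simp [hg, indicator, ht]
      · rw [indicator_of_notMem (by simpa using ht)]
        simp [hg, indicator, ht]
    simp only [e]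
    rw [lintegral_indicator measurableSet_Ioi]
    rw [lintegral_congr fun t => (lintegral_Ioi_comp_add_left (F t) t).symm]
    refine lintegral_lintegral_swap (f := fun t δ => F t (t + δ)) (Measurable.aemeasurable ?_)
    have : Measurable fun p : ℝ × ℝ => (p.1, p.1 + p.2) := by fun_prop
    exact hF.comp this
  calc ∫⁻ t in Ioo 0 T, ∫⁻ τ in Ioo 0 T, F t τ
      ≤ ∫⁻ t in Ioo 0 T, ∫⁻ τ in Ioo 0 T, (g t τ + g τ t) :=
        setLIntegral_mono' measurableSet_Ioo fun t ht =>
          setLIntegral_mono' measurableSet_Ioo fun τ hτ => hle t ht τ hτ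
    _ ≤ ∫⁻ t, ∫⁻ τ, (g t τ + g τ t) :=
        (setLIntegral_le_lintegral _ _).trans
          (lintegral_mono fun t => setLIntegral_le_lintegral _ _)
    _ = (∫⁻ t, ∫⁻ τ, g t τ) + ∫⁻ t, ∫⁻ τ, g τ t := by
        have e : ∀ t, ∫⁻ τ, (g t τ + g τ t) = (∫⁻ τ, g t τ) + ∫⁻ τ, g τ t := fun t =>
          lintegral_add_left (hgm.of_uncurry_left) _
        simp only [e]
        exact lintegral_add_left hgm.lintegral_prod_right' _
    _ = 2 * ∫⁻ t, ∫⁻ τ, g t τ := by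
        rw [two_mul]
        congr 1
        exact lintegral_lintegral_swap (hgm.comp measurable_swap).aemeasurable
    _ = _ := by rw [h1]

/-- Summation over dyadic scales of the averages of a function integrable with a weight. -/
theorem tsum_dyadic_average_lt_top {θ : ℝ} (hθ : 0 < θ) {α : ℝ → ℝ≥0∞} (hα : Measurable α)
    (hfin : ∫⁻ t in Ioi (0 : ℝ), ENNReal.ofReal (t ^ (-1 - 2 * θ)) * α t < ⊤) :
    ∑' j : ℕ, ENNReal.ofReal (((1 / 2 : ℝ) ^ j) ^ (-2 * θ)) *
      (ENNReal.ofReal ((1 / 2 : ℝ) ^ j)⁻¹ * ∫⁻ s in Ioc 0 ((1 / 2 : ℝ) ^ j), α s) < ⊤ := by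
  set W : ℝ → ℝ≥0∞ := fun r => ENNReal.ofReal (r ^ (-1 - (1 + 2 * θ))) * ∫⁻ s in Ioc 0 r, α s
    with hW
  -- The loss in replacing r^(-2-2θ) by its value at the right end of (δ, 2δ].
  set c : ℝ≥0∞ := ENNReal.ofReal (2 ^ (2 + 2 * θ)) with hc
  have hr : ∀ a : ℝ, Measurable fun t : ℝ => ENNReal.ofReal (t ^ a) := fun a => by fun_prop
  -- Each dyadic term is compared with the integral of W over (δ, 2δ]; these intervals are disjoint,
  -- so the sum becomes one integral, to which Tonelli applies.
  have hterm : ∀ j : ℕ, ENNReal.ofReal (((1 / 2 : ℝ) ^ j) ^ (-2 * θ)) *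
      (ENNReal.ofReal ((1 / 2 : ℝ) ^ j)⁻¹ * ∫⁻ s in Ioc 0 ((1 / 2 : ℝ) ^ j), α s)
      ≤ c * ∫⁻ r in Ioc ((1 / 2 : ℝ) ^ j) (2 * (1 / 2 : ℝ) ^ j), W r := by
    intro j
    set δ : ℝ := (1 / 2 : ℝ) ^ j with hδ
    have hδ0 : 0 < δ := by positivity
    have hlow : ∀ r ∈ Ioc δ (2 * δ), ENNReal.ofReal ((2 * δ) ^ (-1 - (1 + 2 * θ))) *
        ∫⁻ s in Ioc 0 δ, α s ≤ W r := by
      intro r hr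
      have hr0 : 0 < r := hδ0.trans hr.1
      refine mul_le_mul' (ENNReal.ofReal_le_ofReal ?_)
        (lintegral_mono_set (Ioc_subset_Ioc_right hr.1.le))
      exact Real.rpow_le_rpow_of_nonpos hr0 hr.2 (by linarith)
    have h1 := setLIntegral_mono' (μ := volume) measurableSet_Ioc hlow
    rw [setLIntegral_const, Real.volume_Ioc] at h1
    refine le_trans (le_of_eq ?_) (mul_le_mul_right h1 c)
    have e : 2 * δ - δ = δ := by ring
    rw [e, mul_right_comm, ← mul_assoc, ← mul_assoc, ← mul_assoc]
    congr 1
    rw [hc, ← ENNReal.ofReal_mul (by positivity), ← ENNReal.ofReal_mul (by positivity),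
      ← ENNReal.ofReal_mul (by positivity)]
    congr 1
    rw [Real.mul_rpow two_pos.le hδ0.le, ← mul_assoc, ← Real.rpow_add two_pos]
    have e2 : 2 + 2 * θ + (-1 - (1 + 2 * θ)) = 0 := by ring
    rw [e2, Real.rpow_zero, one_mul, ← Real.rpow_neg_one, ← Real.rpow_add hδ0]
    have e3 := Real.rpow_add hδ0 (-1 - (1 + 2 * θ)) 1
    rw [Real.rpow_one] at e3
    rw [← e3]
    congr 1
    ring
  have hdisj : Pairwise (Function.onFun Disjoint fun j : ℕ =>
      Ioc ((1 / 2 : ℝ) ^ j) (2 * (1 / 2 : ℝ) ^ j)) := by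
    have key : ∀ i j : ℕ, i < j → Disjoint (Ioc ((1 / 2 : ℝ) ^ i) (2 * (1 / 2 : ℝ) ^ i))
        (Ioc ((1 / 2 : ℝ) ^ j) (2 * (1 / 2 : ℝ) ^ j)) := by
      intro i j hij
      refine (Ioc_disjoint_Ioc_of_le ?_).symm
      have : (1 / 2 : ℝ) ^ j ≤ (1 / 2) ^ (i + 1) :=
        pow_le_pow_of_le_one (by norm_num) (by norm_num) hij
      rw [pow_succ] at this
      linarith
    intro i j hij
    rcases lt_or_gt_of_ne hij with h | h
    · exact key i j h
    · exact (key j i h).symm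
  calc _ ≤ ∑' j : ℕ, c * ∫⁻ r in Ioc ((1 / 2 : ℝ) ^ j) (2 * (1 / 2 : ℝ) ^ j), W r :=
        ENNReal.tsum_le_tsum hterm
    _ = c * ∫⁻ r in ⋃ j : ℕ, Ioc ((1 / 2 : ℝ) ^ j) (2 * (1 / 2 : ℝ) ^ j), W r := by
        rw [ENNReal.tsum_mul_left, lintegral_iUnion (fun j => measurableSet_Ioc) hdisj]
    _ ≤ c * ∫⁻ r in Ioi (0 : ℝ), W r := by
        gcongr
        exact iUnion_subset fun j r hr => lt_trans (by positivity) hr.1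
    _ = c * ∫⁻ t in Ioi (0 : ℝ), α t * ∫⁻ r in Ici t, ENNReal.ofReal (r ^ (-1 - (1 + 2 * θ))) := by
        rw [lintegral_triangle (hr _) hα]
    _ = c * ∫⁻ t in Ioi (0 : ℝ), ENNReal.ofReal (1 + 2 * θ)⁻¹ *
          (ENNReal.ofReal (t ^ (-1 - 2 * θ)) * α t) := by
        congr 1
        refine setLIntegral_congr_fun measurableSet_Ioi fun t ht => ?_
        have ht : 0 < t := ht
        have e : ENNReal.ofReal (t ^ (-(1 + 2 * θ)) / (1 + 2 * θ))
            = ENNReal.ofReal (1 + 2 * θ)⁻¹ * ENNReal.ofReal (t ^ (-1 - 2 * θ)) := by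
          rw [← ENNReal.ofReal_mul (by positivity), div_eq_inv_mul, neg_add']
        rw [lintegral_Ici_rpow (by positivity) ht, e]
        ring
    _ < ⊤ := by
        rw [lintegral_const_mul' _ _ ENNReal.ofReal_ne_top]
        exact ENNReal.mul_lt_top ENNReal.ofReal_lt_top
          (ENNReal.mul_lt_top ENNReal.ofReal_lt_top hfin)

/-! ### Fractional regularity in time and approximation by difference quotients -/

namespace DissipativeRelation

variable {E : Type*} [NormedAddCommGroup E] [InnerProductSpace ℝ E]
  [CompleteSpace E] {Z : Type*} [NormedAddCommGroup Z] [InnerProductSpace ℝ Z]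
  [CompleteSpace Z] {G : Submodule ℝ (E × E × Z)} {x : ℝ → E} {K h : ℝ → Z}

/-- Fractional regularity in time of the output. -/
theorem IsOutput.lintegral_slobodeckij_lt_top (hG : IsDissipative G) (hx : IsMild G x K)
    (hh : IsOutput K h) {θ : ℝ}
    (hfin : ∫⁻ δ in Ioi (0 : ℝ), ENNReal.ofReal (δ ^ (-1 - 2 * θ)) * ‖x δ - x 0‖ₑ ^ 2 < ⊤)
    (T : ℝ) :
    ∫⁻ t in Ioo 0 T, ∫⁻ τ in Ioo 0 T, ‖h t - h τ‖ₑ ^ 2 / ‖t - τ‖ₑ ^ (1 + 2 * θ) < ⊤ := by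
  have hm : Measurable (Function.uncurry fun t τ : ℝ =>
      ‖h t - h τ‖ₑ ^ 2 / ‖t - τ‖ₑ ^ (1 + 2 * θ)) := by
    have h1 : Measurable fun p : ℝ × ℝ => ‖h p.1 - h p.2‖ₑ :=
      ((hh.meas.comp_measurable measurable_fst).sub
        (hh.meas.comp_measurable measurable_snd)).enorm
    have h2 : Measurable fun p : ℝ × ℝ => ‖p.1 - p.2‖ₑ := by fun_prop
    exact (h1.pow_const 2).div (h2.pow_const _)
  -- By symmetry take τ = t + δ; for fixed δ the integral in t is the squared L² modulus of h, at
  -- most ‖x δ - x 0‖².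
  refine lt_of_le_of_lt (lintegral_square_le_of_symm hm (fun s t => ?_) (fun t => by simp) T) ?_
  · rw [← enorm_neg, neg_sub, ← enorm_neg (s - t), neg_sub]
  · refine ENNReal.mul_lt_top (by simp) (lt_of_le_of_lt
      (setLIntegral_mono' measurableSet_Ioi fun δ hδ => ?_) hfin)
    have hδ : 0 < δ := hδ
    have e : ∀ t, ‖h t - h (t + δ)‖ₑ ^ 2 / ‖t - (t + δ)‖ₑ ^ (1 + 2 * θ)
        = ENNReal.ofReal (δ ^ (-1 - 2 * θ)) * ‖h (t + δ) - h t‖ₑ ^ 2 := fun t => by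
      rw [sub_add_cancel_left, enorm_neg, Real.enorm_of_nonneg hδ.le,
        ENNReal.ofReal_rpow_of_pos hδ, ← enorm_neg, neg_sub, div_eq_mul_inv,
        ← ENNReal.ofReal_inv_of_pos (by positivity), ← Real.rpow_neg hδ.le, mul_comm]
      congr 3
      ring
    simp only [e]
    rw [lintegral_const_mul' _ _ ENNReal.ofReal_ne_top]
    gcongr
    exact (eLpNorm_two_le_iff _ _).1 (hh.eLpNorm_shift_sub_le hG hx hδ.le)

/-- Distance in `L²(0, ∞)` of the output to its difference quotients. -/
theorem IsOutput.lintegral_sub_diffQuot_le (hG : IsDissipative G) (hx : IsMild G x K)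
    (hh : IsOutput K h) {δ : ℝ} (hδ : 0 < δ) :
    ∫⁻ t in Ioi (0 : ℝ), ‖h t - diffQuot K δ t‖ₑ ^ 2
      ≤ ENNReal.ofReal δ⁻¹ * ∫⁻ s in Ioc 0 δ, ‖x s - x 0‖ₑ ^ 2 := by
  have hm : Measurable (Function.uncurry fun s t : ℝ => ‖h (t + s) - h t‖ₑ ^ 2) := by
    have h1 : Measurable fun p : ℝ × ℝ => ‖h (p.2 + p.1) - h p.2‖ₑ :=
      ((hh.meas.comp_measurable (by fun_prop)).sub
        (hh.meas.comp_measurable measurable_snd)).enorm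
    exact h1.pow_const 2
  have hpt : ∀ t ∈ Ioi (0 : ℝ), ‖h t - diffQuot K δ t‖ₑ ^ 2
      ≤ ENNReal.ofReal δ⁻¹ * ∫⁻ s in Ioc 0 δ, ‖h (t + s) - h t‖ₑ ^ 2 := by
    intro t ht
    have ht : 0 < t := ht
    have hi : IntervalIntegrable h volume t (t + δ) :=
      hh.intervalIntegrable hG hx ht.le (by linarith)
    have hi' : IntervalIntegrable (fun s => h (t + s)) volume 0 δ := by
      have := hi.comp_add_left t
      simpa using this
    -- As K is the primitive of h, the error is the mean of h(t + s) - h(t) over 0 < s ≤ δ.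
    have e1 : diffQuot K δ t - h t = δ⁻¹ • ∫ s in (0 : ℝ)..δ, (h (t + s) - h t) := by
      rw [intervalIntegral.integral_sub hi' (by simp), intervalIntegral.integral_const, sub_zero,
        smul_sub, smul_smul, inv_mul_cancel₀ hδ.ne', one_smul,
        intervalIntegral.integral_comp_add_left, add_zero, diffQuot,
        ← hh.integral_eq hG hx ht.le, ← hh.integral_eq hG hx (t := t + δ) (by linarith),
        intervalIntegral.integral_interval_sub_left
          (hh.intervalIntegrable hG hx le_rfl (by linarith))
          (hh.intervalIntegrable hG hx le_rfl ht.le)]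
    have hms : Measurable fun s : ℝ => ‖h (t + s) - h t‖ₑ :=
      ((hh.meas.comp_measurable (by fun_prop)).sub stronglyMeasurable_const).enorm
    have e2 : ‖h t - diffQuot K δ t‖ₑ
        ≤ ENNReal.ofReal δ⁻¹ * ∫⁻ s in Ioc 0 δ, ‖h (t + s) - h t‖ₑ := by
      rw [← enorm_neg, neg_sub, e1, enorm_smul, Real.enorm_of_nonneg (by positivity),
        intervalIntegral.integral_of_le hδ.le]
      gcongr
      exact enorm_integral_le_lintegral_enorm _
    calc ‖h t - diffQuot K δ t‖ₑ ^ 2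
        ≤ (ENNReal.ofReal δ⁻¹ * ∫⁻ s in Ioc 0 δ, ‖h (t + s) - h t‖ₑ) ^ 2 := by gcongr
      _ ≤ ENNReal.ofReal δ⁻¹ ^ 2 * (volume.restrict (Ioc 0 δ) univ *
          ∫⁻ s in Ioc 0 δ, ‖h (t + s) - h t‖ₑ ^ 2) := by
          rw [mul_pow]
          gcongr
          exact lintegral_sq_le hms.aemeasurable
      _ = _ := by
          rw [Measure.restrict_apply_univ, Real.volume_Ioc, sub_zero, ← mul_assoc, pow_two,
            mul_assoc (ENNReal.ofReal δ⁻¹), ← ENNReal.ofReal_mul (by positivity),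
            inv_mul_cancel₀ hδ.ne', ENNReal.ofReal_one, mul_one]
  refine (setLIntegral_mono' measurableSet_Ioi hpt).trans ?_
  rw [lintegral_const_mul' _ _ ENNReal.ofReal_ne_top]
  refine mul_le_mul_right ?_ _
  rw [lintegral_lintegral_swap (f := fun t s => ‖h (t + s) - h t‖ₑ ^ 2)
    (hm.comp measurable_swap).aemeasurable]
  refine setLIntegral_mono' measurableSet_Ioc fun s hs => ?_
  exact (eLpNorm_two_le_iff _ _).1 (hh.eLpNorm_shift_sub_le hG hx hs.1.le)

/-- The modulus of continuity at time zero is controlled by its averages. -/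
theorem IsMild.enorm_sub_sq_le (hG : IsDissipative G) (hx : IsMild G x K) {δ : ℝ} (hδ : 0 < δ) :
    ‖x δ - x 0‖ₑ ^ 2
      ≤ 4 * (ENNReal.ofReal δ⁻¹ * ∫⁻ s in Ioc 0 δ, ‖x s - x 0‖ₑ ^ 2) := by
  have hm : Measurable fun s => ‖x s - x 0‖ₑ := (hx.cont.sub continuous_const).enorm.measurable
  -- By contraction ‖x δ - x s‖ ≤ ‖x(δ - s) - x 0‖. Averaging over s, and reflecting s to δ - s in
  -- the second term, bounds the endpoint by the mean.
  have hpt : ∀ s ∈ Ioc 0 δ, ‖x δ - x 0‖ₑ ≤ ‖x s - x 0‖ₑ + ‖x (δ - s) - x 0‖ₑ := by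
    intro s hs
    have h1 := ((hx.shift (sub_nonneg.2 hs.2)).sub hx).norm_le hG hs.1.le
    simp only [zero_add, add_sub_cancel] at h1
    have h2 : ‖x δ - x s‖ₑ ≤ ‖x (δ - s) - x 0‖ₑ := by
      rw [← ofReal_norm, ← ofReal_norm]; exact ENNReal.ofReal_le_ofReal h1
    calc ‖x δ - x 0‖ₑ = ‖(x s - x 0) + (x δ - x s)‖ₑ := by congr 1; abel
      _ ≤ _ := (enorm_add_le _ _).trans (by gcongr)
  have hpt2 : ∀ s ∈ Ioc 0 δ, ‖x δ - x 0‖ₑ ^ 2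
      ≤ 2 * ‖x s - x 0‖ₑ ^ 2 + 2 * ‖x (δ - s) - x 0‖ₑ ^ 2 := fun s hs =>
    (pow_le_pow_left₀ zero_le (hpt s hs) 2).trans (ENNReal.add_sq_le_two_mul _ _)
  have h1 := setLIntegral_mono' (μ := volume) measurableSet_Ioc hpt2
  have hrefl : ∫⁻ s in Ioc 0 δ, ‖x (δ - s) - x 0‖ₑ ^ 2 = ∫⁻ s in Ioc 0 δ, ‖x s - x 0‖ₑ ^ 2 := by
    have hmp := (Measure.measurePreserving_sub_left volume δ).restrict_preimage_emb
      (MeasurableEquiv.subLeft δ).measurableEmbedding (Ico 0 δ)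
    have hset : (fun s : ℝ => δ - s) ⁻¹' Ico 0 δ = Ioc 0 δ := by
      ext s; simp only [mem_preimage, mem_Ico, mem_Ioc]; constructor <;> rintro ⟨a, b⟩ <;>
        constructor <;> linarith
    rw [hset] at hmp
    have := hmp.lintegral_comp_emb (MeasurableEquiv.subLeft δ).measurableEmbedding
      fun s => ‖x s - x 0‖ₑ ^ 2
    rw [this]
    exact setLIntegral_congr Ico_ae_eq_Ioc
  rw [setLIntegral_const, Real.volume_Ioc, sub_zero, lintegral_add_left (by fun_prop),
    lintegral_const_mul _ (by fun_prop), lintegral_const_mul' _ _ (by simp), hrefl, ← add_mul] at h1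
  have h2 := mul_le_mul_right h1 (ENNReal.ofReal δ⁻¹)
  calc ‖x δ - x 0‖ₑ ^ 2 = ENNReal.ofReal δ⁻¹ * (‖x δ - x 0‖ₑ ^ 2 * ENNReal.ofReal δ) := by
        rw [mul_comm (‖x δ - x 0‖ₑ ^ 2), ← mul_assoc, ← ENNReal.ofReal_mul (by positivity),
          inv_mul_cancel₀ hδ.ne', ENNReal.ofReal_one, one_mul]
    _ ≤ _ := h2
    _ = _ := by
        rw [← mul_assoc, ← mul_assoc]
        congr 1
        rw [mul_comm]
        congr 1
        norm_num

/-- Bounds for the difference quotients of the output by the graph norm. -/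
theorem IsMild.diffQuot_bound (hG : IsDissipative G) (hx : IsMild G x K) {N : Z → ℝ≥0∞}
    {C : ℝ≥0∞} (hN : ∀ a f k, (a, f, k) ∈ G → N k ≤ C * (‖a‖ₑ ^ 2 + ‖f‖ₑ ^ 2)) {δ : ℝ}
    (hδ : 0 < δ) {t : ℝ} (ht : 0 ≤ t) :
    N (diffQuot K δ t)
      ≤ C * (‖x 0‖ₑ ^ 2 + ENNReal.ofReal δ⁻¹ ^ 2 * ‖x δ - x 0‖ₑ ^ 2) := by
  refine (hN _ _ _ ((hx.isStrong_average hG hδ).mem t ht)).trans ?_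
  have enorm_mono : ∀ {a b : E}, ‖a‖ ≤ ‖b‖ → ‖a‖ₑ ≤ ‖b‖ₑ := fun {a b} hab => by
    rw [← ofReal_norm, ← ofReal_norm]; exact ENNReal.ofReal_le_ofReal hab
  gcongr
  · have : ‖∫ r in t..t + δ, x r‖ ≤ ‖x 0‖ * |t + δ - t| :=
      intervalIntegral.norm_integral_le_of_norm_le_const fun r hr =>
        hx.norm_le hG (by rw [uIoc_of_le (by linarith)] at hr; linarith [hr.1])
    refine enorm_mono ?_
    rw [add_sub_cancel_left, abs_of_pos hδ] at this
    rw [norm_smul, norm_inv, Real.norm_of_nonneg hδ.le, inv_mul_le_iff₀ hδ, mul_comm]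
    exact this
  · have h1 := ((hx.shift hδ.le).sub hx).norm_le hG ht
    simp only [zero_add] at h1
    rw [enorm_smul, Real.enorm_of_nonneg (by positivity), mul_pow]
    gcongr
    exact enorm_mono h1

end DissipativeRelation

/-! ### Comparison of measures under Lipschitz and antilipschitz maps -/

section Hausdorff

variable {X Y : Type*} [EMetricSpace X] [EMetricSpace Y] [MeasurableSpace X] [MeasurableSpace Y]
  [BorelSpace X] [BorelSpace Y]

open Measure in
-- An antilipschitz map contracts distances by at most 1/K. Applied to shears, this takes the place
-- of a change of variables formula.
theorem AntilipschitzWith.map_euclideanHausdorffMeasure_le {K : ℝ≥0} {f : X → Y}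
    (hf : AntilipschitzWith K f) (hm : Measurable f) (n : ℕ) :
    (euclideanHausdorffMeasure n : Measure X).map f
      ≤ ((K : ℝ≥0∞) ^ n) • (euclideanHausdorffMeasure n : Measure Y) := by
  refine Measure.le_iff.2 fun s hs => ?_
  rw [Measure.map_apply hm hs, euclideanHausdorffMeasure_def, euclideanHausdorffMeasure_def]
  have h := hf.hausdorffMeasure_preimage_le (d := (n : ℝ)) (by positivity) s
  rw [ENNReal.rpow_natCast] at h
  simp only [Measure.smul_apply, smul_eq_mul, ENNReal.smul_def]
  rw [mul_left_comm]
  gcongr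

open Measure in
theorem LipschitzWith.restrict_range_euclideanHausdorffMeasure_le {K : ℝ≥0} {f : X → Y}
    (hf : LipschitzWith K f) {S : Set Y} (hS : S ⊆ range f) (n : ℕ) :
    (euclideanHausdorffMeasure n : Measure Y).restrict S
      ≤ ((K : ℝ≥0∞) ^ n) • (euclideanHausdorffMeasure n : Measure X).map f := by
  refine Measure.le_iff.2 fun s hs => ?_
  rw [Measure.smul_apply, Measure.map_apply hf.continuous.measurable hs, Measure.restrict_apply hs]
  have h1 : s ∩ S ⊆ f '' (f ⁻¹' s) := by
    rintro y ⟨hy, hy'⟩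
    obtain ⟨x, rfl⟩ := hS hy'
    exact ⟨x, hy, rfl⟩
  refine (measure_mono h1).trans ?_
  have h := hf.hausdorffMeasure_image_le (d := (n : ℝ)) (by positivity) (f ⁻¹' s)
  rw [ENNReal.rpow_natCast] at h
  rw [euclideanHausdorffMeasure_def, euclideanHausdorffMeasure_def]
  simp only [Measure.smul_apply, smul_eq_mul, ENNReal.smul_def]
  rw [mul_left_comm]
  gcongr

end Hausdorff

/-! ### Korn's inequality for Lipschitz fields with compact support -/

section Korn

variable {E : Type*} [NormedAddCommGroup E] [InnerProductSpace ℝ E] [FiniteDimensional ℝ E]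
  [MeasurableSpace E] [BorelSpace E]

/-- Twice the symmetric part of the derivative. -/
noncomputable def symDeriv (v : E → E) (x : E) : E →L[ℝ] E :=
  fderiv ℝ v x + (fderiv ℝ v x).adjoint

/-- The discrete form of ∫ ∂_a f ∂_b g = ∫ ∂_b f ∂_a g: expand the products and use translation
invariance. Forward differences become backward ones. -/
theorem integral_shift_mul_shift {f g : E → ℝ} (hf : Continuous f) (hg : Continuous g)
    (hf' : HasCompactSupport f) (a b : E) :
    ∫ x, (f (x + a) - f x) * (g (x + b) - g x)
      = ∫ x, (f (x - b) - f x) * (g (x - a) - g x) := by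
  have int : ∀ c e : E, Integrable fun x => f (x + c) * g (x + e) := fun c e => by
    have h1 : HasCompactSupport fun x => f (x + c) :=
      hf'.comp_homeomorph (Homeomorph.addRight c)
    exact (by fun_prop : Continuous fun x => f (x + c) * g (x + e)).integrable_of_hasCompactSupport
      h1.mul_right
  have tr : ∀ c e s : E, ∫ x, f (x + c) * g (x + e) = ∫ x, f (x + (c - s)) * g (x + (e - s)) := by
    intro c e s
    rw [← integral_add_right_eq_self (fun x => f (x + (c - s)) * g (x + (e - s))) s]
    congr 1
    ext x
    congr 2 <;> abel
  have ex : ∀ c e : E, ∫ x, (f (x + c) - f x) * (g (x + e) - g x)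
      = (∫ x, f (x + c) * g (x + e)) - (∫ x, f (x + c) * g (x + 0))
        - (∫ x, f (x + 0) * g (x + e)) + ∫ x, f (x + 0) * g (x + 0) := by
    intro c e
    have h1 := integral_sub (int c e) (int c 0)
    have h2 := integral_sub ((int c e).sub (int c 0)) (int 0 e)
    have h3 := integral_add (((int c e).sub (int c 0)).sub (int 0 e)) (int 0 0)
    simp only [Pi.sub_apply] at h2 h3
    rw [← h1, ← h2, ← h3]
    congr 1
    ext x
    simp only [add_zero]
    ring
  have e1 := ex (-b) (-a)
  simp only [← sub_eq_add_neg] at e1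
  rw [ex, e1]
  have t1 := tr a b (a + b)
  have t2 := tr a 0 a
  have t3 := tr 0 b b
  simp only [sub_self, zero_sub, sub_add_cancel_left, sub_add_cancel_right] at t1 t2 t3
  rw [t1, t2, t3]
  simp only [← sub_eq_add_neg]
  ring

variable {ι : Type*} [Fintype ι]

/-- Korn's inequality for finite differences. Expanding the square, the cross terms sum to the
integral of the square of a discrete divergence, by `integral_shift_mul_shift`, and are therefore
nonnegative. -/
theorem sum_integral_shift_sq_le (b : OrthonormalBasis ι ℝ E) {v : E → E} (hv : Continuous v)
    (hv' : HasCompactSupport v) (h : ℝ) :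
    ∑ i, ∑ j, ∫ x, (inner ℝ (v (x + h • b i) - v x) (b j)) ^ 2
      ≤ 1 / 2 * ∑ i, ∑ j, ∫ x, (inner ℝ (v (x + h • b i) - v x) (b j)
        + inner ℝ (v (x + h • b j) - v x) (b i)) ^ 2 := by
  set f : ι → E → ℝ := fun j x => inner ℝ (v x) (b j)
  have hf : ∀ j, Continuous (f j) := fun j => by fun_prop
  have hf' : ∀ j, HasCompactSupport (f j) := fun j =>
    hv'.comp_left (g := fun y => inner ℝ y (b j)) (inner_zero_left _)
  set D : ι → ι → E → ℝ := fun i j x => f j (x + h • b i) - f j x with hD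
  have eD : ∀ i j x, inner ℝ (v (x + h • b i) - v x) (b j) = D i j x := fun i j x =>
    inner_sub_left _ _ _
  simp only [eD]
  have cD : ∀ i j, Continuous (D i j) := fun i j => by
    have := hf j
    simp only [hD]
    fun_prop
  have sD : ∀ i j, HasCompactSupport (D i j) := fun i j =>
    ((hf' j).comp_homeomorph (Homeomorph.addRight (h • b i))).sub (hf' j)
  have iD : ∀ i j k l, Integrable fun x => D i j x * D k l x := fun i j k l =>
    ((cD i j).mul (cD k l)).integrable_of_hasCompactSupport (sD i j).mul_right
  have cross : 0 ≤ ∑ i, ∑ j, ∫ x, D i j x * D j i x := by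
    set B : ι → E → ℝ := fun j x => f j (x - h • b j) - f j x with hB
    have cB : ∀ j, Continuous (B j) := fun j => by
      have := hf j
      simp only [hB]
      fun_prop
    have sB : ∀ j, HasCompactSupport (B j) := fun j =>
      ((hf' j).comp_homeomorph (Homeomorph.subRight (h • b j))).sub (hf' j)
    have iB : ∀ i j, Integrable fun x => B i x * B j x := fun i j =>
      ((cB i).mul (cB j)).integrable_of_hasCompactSupport (sB i).mul_right
    have : ∀ i j, ∫ x, D i j x * D j i x = ∫ x, B j x * B i x := fun i j =>
      integral_shift_mul_shift (hf j) (hf i) (hf' j) _ _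
    simp only [this]
    have e : ∑ i, ∑ j, ∫ x, B j x * B i x = ∫ x, (∑ i, B i x) ^ 2 := by
      have : ∀ x, (∑ i, B i x) ^ 2 = ∑ i, ∑ j, B j x * B i x := fun x => by
        rw [sq, Finset.sum_mul_sum]
        exact Finset.sum_congr rfl fun i _ => Finset.sum_congr rfl fun j _ => mul_comm _ _
      simp only [this]
      rw [integral_finsetSum _ fun i _ => integrable_finsetSum _ fun j _ => iB j i]
      exact Finset.sum_congr rfl fun i _ => (integral_finsetSum _ fun j _ => iB j i).symm
    rw [e]
    exact integral_nonneg fun x => sq_nonneg _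
  have ex : ∀ i j, ∫ x, (D i j x + D j i x) ^ 2
      = (∫ x, D i j x ^ 2) + 2 * (∫ x, D i j x * D j i x) + ∫ x, D j i x ^ 2 := fun i j => by
    rw [← integral_const_mul, ← integral_add, ← integral_add]
    · congr 1; ext x; ring
    · exact (by simpa only [sq] using iD i j i j : Integrable fun x => D i j x ^ 2).add
        ((iD i j j i).const_mul 2)
    · simpa only [sq] using iD j i j i
    · simpa only [sq] using iD i j i j
    · exact (iD i j j i).const_mul 2
  simp only [ex, Finset.sum_add_distrib, ← Finset.mul_sum]
  rw [Finset.sum_comm (f := fun i j => ∫ x, D j i x ^ 2)]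
  linarith

/-- Let the step tend to 0: the quotients are bounded by K, vanish off a fixed ball, and converge
almost everywhere by Rademacher's theorem. Lipschitz fields are needed because reflection and
shearing destroy smoothness. -/
theorem LipschitzWith.sum_integral_fderiv_sq_le (b : OrthonormalBasis ι ℝ E) {K : ℝ≥0} {v : E → E}
    (hv : LipschitzWith K v) (hv' : HasCompactSupport v) :
    ∑ i, ∑ j, ∫ x, (inner ℝ (fderiv ℝ v x (b i)) (b j)) ^ 2
      ≤ 1 / 2 * ∑ i, ∑ j, ∫ x, (inner ℝ (fderiv ℝ v x (b i)) (b j)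
        + inner ℝ (fderiv ℝ v x (b j)) (b i)) ^ 2 := by
  obtain ⟨M, hM0, hM⟩ : ∃ M : ℝ, 0 ≤ M ∧ ∀ x, M < ‖x‖ → v x = 0 := by
    obtain ⟨M, hM⟩ := hv'.isCompact.isBounded.subset_closedBall 0
    refine ⟨max M 0, le_max_right _ _, fun x hx => ?_⟩
    by_contra h
    have := hM (subset_tsupport v h)
    rw [mem_closedBall_zero_iff] at this
    exact absurd ((le_max_left M 0).trans_lt hx) (not_lt.2 this)
  set s : ℕ → ℝ := fun n => 1 / ((n : ℝ) + 1) with hs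
  have hs0 : ∀ n, 0 < s n := fun n => by simp only [hs]; positivity
  have hs1 : ∀ n, s n ≤ 1 := fun n => by
    simp only [hs]
    rw [div_le_one (by positivity)]
    have := n.cast_nonneg (α := ℝ)
    linarith
  have hst : Tendsto s atTop (𝓝[≠] 0) := by
    refine tendsto_nhdsWithin_iff.2 ⟨tendsto_one_div_add_atTop_nhds_zero_nat, ?_⟩
    exact Eventually.of_forall fun n => (hs0 n).ne'
  set Q : ℕ → ι → ι → E → ℝ := fun n i j x =>
    inner ℝ ((s n)⁻¹ • (v (x + s n • b i) - v x)) (b j) with hQ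
  set L : ι → ι → E → ℝ := fun i j x => inner ℝ (fderiv ℝ v x (b i)) (b j) with hL
  have hcv := hv.continuous
  have hQb : ∀ n i j x, |Q n i j x| ≤ K := fun n i j x => by
    have h1 : ‖v (x + s n • b i) - v x‖ ≤ K * s n := by
      have := hv.norm_sub_le (x + s n • b i) x
      rwa [add_sub_cancel_left, norm_smul, b.norm_eq_one, mul_one, Real.norm_of_nonneg (hs0 n).le]
        at this
    calc |Q n i j x| ≤ ‖(s n)⁻¹ • (v (x + s n • b i) - v x)‖ * ‖b j‖ := abs_real_inner_le_norm _ _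
      _ ≤ (s n)⁻¹ * (K * s n) := by
          rw [b.norm_eq_one, mul_one, norm_smul, norm_inv, Real.norm_of_nonneg (hs0 n).le]
          exact mul_le_mul_of_nonneg_left h1 (inv_nonneg.2 (hs0 n).le)
      _ = K := by have := (hs0 n).ne'; field_simp
  have hQ0 : ∀ n i j x, M + 1 < ‖x‖ → Q n i j x = 0 := fun n i j x hx => by
    have h1 : v x = 0 := hM x (by linarith)
    have h2 : v (x + s n • b i) = 0 := hM _ (by
      have := norm_sub_norm_le x (-(s n • b i))
      rw [norm_neg, norm_smul, b.norm_eq_one, mul_one, Real.norm_of_nonneg (hs0 n).le,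
        sub_neg_eq_add] at this
      linarith [hs1 n])
    simp [hQ, h1, h2]
  have hQc : ∀ n i j, Continuous (Q n i j) := fun n i j => by simp only [hQ]; fun_prop
  have hlim : ∀ᵐ x, ∀ i j, Tendsto (fun n => Q n i j x) atTop (𝓝 (L i j x)) := by
    filter_upwards [hv.ae_differentiableAt (μ := volume)] with x hx i j
    have h1 := (hx.hasFDerivAt.hasLineDerivAt (b i)).tendsto_slope_zero
    exact ((h1.comp hst).inner tendsto_const_nhds)
  have key : ∀ (F : E → ℝ) (G : ℕ → E → ℝ) (C : ℝ), (∀ n, Continuous (G n)) →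
      (∀ n x, |G n x| ≤ C) → (∀ n x, M + 1 < ‖x‖ → G n x = 0) →
      (∀ᵐ x, Tendsto (fun n => G n x) atTop (𝓝 (F x))) →
      Tendsto (fun n => ∫ x, G n x) atTop (𝓝 (∫ x, F x)) := by
    intro F G C hG hC h0 hF
    refine tendsto_integral_of_dominated_convergence
      ((Metric.closedBall (0 : E) (M + 1)).indicator fun _ => C)
      (fun n => (hG n).aestronglyMeasurable) ?_ (fun n => Eventually.of_forall fun x => ?_) hF
    · exact (integrableOn_const (by exact measure_closedBall_lt_top.ne)).integrable_indicator
        measurableSet_closedBall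
    · by_cases hx : ‖x‖ ≤ M + 1
      · rw [indicator_of_mem (by simpa using hx)]
        exact hC n x
      · rw [h0 n x (not_le.1 hx), norm_zero, indicator_of_notMem (by simpa using hx)]
  have t1 : ∀ i j, Tendsto (fun n => ∫ x, Q n i j x ^ 2) atTop (𝓝 (∫ x, L i j x ^ 2)) := by
    intro i j
    refine key _ (fun n x => Q n i j x ^ 2) (K ^ 2) (fun n => (hQc n i j).pow 2) (fun n x => ?_)
      (fun n x hx => by simp only [hQ0 n i j x hx]; norm_num) ?_
    · rw [abs_pow]; exact pow_le_pow_left₀ (abs_nonneg _) (hQb n i j x) 2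
    · filter_upwards [hlim] with x hx using (hx i j).pow 2
  have t2 : ∀ i j, Tendsto (fun n => ∫ x, (Q n i j x + Q n j i x) ^ 2) atTop
      (𝓝 (∫ x, (L i j x + L j i x) ^ 2)) := by
    intro i j
    refine key _ (fun n x => (Q n i j x + Q n j i x) ^ 2) ((K + K) ^ 2)
      (fun n => ((hQc n i j).add (hQc n j i)).pow 2) (fun n x => ?_)
      (fun n x hx => by simp only [hQ0 n i j x hx, hQ0 n j i x hx]; norm_num) ?_
    · rw [abs_pow]
      exact pow_le_pow_left₀ (abs_nonneg _)
        ((abs_add_le _ _).trans (add_le_add (hQb n i j x) (hQb n j i x))) 2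
    · filter_upwards [hlim] with x hx using ((hx i j).add (hx j i)).pow 2
  have T1 := tendsto_finsetSum Finset.univ fun i (_ : i ∈ Finset.univ) =>
    tendsto_finsetSum Finset.univ fun j (_ : j ∈ Finset.univ) => t1 i j
  have T2 := (tendsto_finsetSum Finset.univ fun i (_ : i ∈ Finset.univ) =>
    tendsto_finsetSum Finset.univ fun j (_ : j ∈ Finset.univ) => t2 i j).const_mul (1 / 2 : ℝ)
  refine le_of_tendsto_of_tendsto' T1 T2 fun n => ?_
  have h := mul_le_mul_of_nonneg_left (sum_integral_shift_sq_le b hcv hv' (s n))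
    (sq_nonneg (s n)⁻¹)
  rw [mul_left_comm] at h
  simp only [Finset.mul_sum, ← integral_const_mul] at h
  simp only [Finset.mul_sum, hQ, inner_smul_left, ← mul_add, mul_pow, conj_trivial,
    ← integral_const_mul]
  exact h

/-- Korn's inequality in the whole space. -/
theorem exists_korn : ∃ C : ℝ≥0, ∀ (K : ℝ≥0) (v : E → E), LipschitzWith K v →
    HasCompactSupport v → ∫⁻ x, ‖fderiv ℝ v x‖ₑ ^ 2 ≤ C * ∫⁻ x, ‖symDeriv v x‖ₑ ^ 2 := by
  set b := stdOrthonormalBasis ℝ E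
  set N : ℕ := Module.finrank ℝ E
  refine ⟨N * N, fun K v hv hv' => ?_⟩
  have hfd : Measurable fun x => fderiv ℝ v x := measurable_fderiv ℝ v
  have hb : ∀ x, ‖fderiv ℝ v x‖ ≤ K := fun x => norm_fderiv_le_of_lipschitz ℝ hv
  have hz : ∀ x, x ∉ tsupport v → fderiv ℝ v x = 0 := fun x hx =>
    image_eq_zero_of_notMem_tsupport fun h => hx (tsupport_fderiv_subset ℝ h)
  have hLm : ∀ i j, Measurable fun x => (inner ℝ (fderiv ℝ v x (b i)) (b j) : ℝ) := fun i j =>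
    ((by fun_prop : Continuous fun A : E →L[ℝ] E => (inner ℝ (A (b i)) (b j) : ℝ))).measurable.comp
      hfd
  have hLb : ∀ i j x, |(inner ℝ (fderiv ℝ v x (b i)) (b j) : ℝ)| ≤ K := fun i j x => by
    refine (abs_real_inner_le_norm _ _).trans ?_
    rw [b.norm_eq_one, mul_one]
    refine ((fderiv ℝ v x).le_opNorm _).trans ?_
    rw [b.norm_eq_one, mul_one]
    exact hb x
  have int : ∀ (G : E → ℝ) (C : ℝ), Measurable G → (∀ x, |G x| ≤ C) →
      (∀ x, x ∉ tsupport v → G x = 0) → Integrable G := by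
    intro G C hG hC h0
    have : IntegrableOn G (tsupport v) :=
      Measure.integrableOn_of_bounded (M := C) hv'.isCompact.measure_lt_top.ne
        hG.aestronglyMeasurable (Eventually.of_forall fun x => hC x)
    rwa [integrableOn_iff_integrable_of_support_subset] at this
    intro x hx
    by_contra h
    exact hx (h0 x h)
  have i1 : ∀ i j, Integrable fun x => (inner ℝ (fderiv ℝ v x (b i)) (b j) : ℝ) ^ 2 := fun i j =>
    int _ (K ^ 2) ((hLm i j).pow_const 2)
      (fun x => by rw [abs_pow]; exact pow_le_pow_left₀ (abs_nonneg _) (hLb i j x) 2)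
      (fun x hx => by rw [hz x hx]; simp)
  have i2 : ∀ i j, Integrable fun x => ((inner ℝ (fderiv ℝ v x (b i)) (b j) : ℝ)
      + inner ℝ (fderiv ℝ v x (b j)) (b i)) ^ 2 := fun i j =>
    int _ ((K + K) ^ 2) (((hLm i j).add (hLm j i)).pow_const 2)
      (fun x => by
        rw [abs_pow]
        exact pow_le_pow_left₀ (abs_nonneg _)
          ((abs_add_le _ _).trans (add_le_add (hLb i j x) (hLb j i x))) 2)
      (fun x hx => by rw [hz x hx]; simp)
  have key := hv.sum_integral_fderiv_sq_le b hv'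
  have frob : ∀ A : E →L[ℝ] E, ‖A‖ ^ 2 ≤ ∑ i, ∑ j, (inner ℝ (A (b i)) (b j) : ℝ) ^ 2 := by
    intro A
    have hA : ∀ i, ‖A (b i)‖ ^ 2 = ∑ j, (inner ℝ (A (b i)) (b j) : ℝ) ^ 2 := fun i => by
      rw [← b.sum_sq_norm_inner_left]
      simp
    simp only [← hA]
    have h0 : 0 ≤ ∑ i, ‖A (b i)‖ ^ 2 := Finset.sum_nonneg fun i _ => sq_nonneg _
    have : ‖A‖ ≤ Real.sqrt (∑ i, ‖A (b i)‖ ^ 2) := by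
      refine A.opNorm_le_bound (Real.sqrt_nonneg _) fun x => ?_
      have e : A x = ∑ i, (inner ℝ (b i) x : ℝ) • A (b i) := by
        conv_lhs => rw [← b.sum_repr' x]
        simp
      have hx : ∑ i, (inner ℝ (b i) x : ℝ) ^ 2 = ‖x‖ ^ 2 := by
        rw [← b.sum_sq_norm_inner_right x]
        simp
      rw [e, ← Real.sqrt_sq (norm_nonneg x), ← hx, ← Real.sqrt_mul h0]
      refine Real.le_sqrt_of_sq_le ?_
      calc _ ≤ (∑ i, |(inner ℝ (b i) x : ℝ)| * ‖A (b i)‖) ^ 2 := by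
            refine pow_le_pow_left₀ (norm_nonneg _) ((norm_sum_le _ _).trans (le_of_eq ?_)) 2
            simp [norm_smul]
        _ ≤ (∑ i, |(inner ℝ (b i) x : ℝ)| ^ 2) * ∑ i, ‖A (b i)‖ ^ 2 :=
            Finset.sum_mul_sq_le_sq_mul_sq _ _ _
        _ = _ := by simp only [sq_abs]; ring
    exact (pow_le_pow_left₀ (norm_nonneg _) this 2).trans_eq (Real.sq_sqrt h0)
  have back : ∀ x, ∑ i, ∑ j, ((inner ℝ (fderiv ℝ v x (b i)) (b j) : ℝ)
      + inner ℝ (fderiv ℝ v x (b j)) (b i)) ^ 2 ≤ (N * N) * ‖symDeriv v x‖ ^ 2 := by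
    intro x
    have h1 : ∀ i j, ((inner ℝ (fderiv ℝ v x (b i)) (b j) : ℝ)
        + inner ℝ (fderiv ℝ v x (b j)) (b i)) ^ 2 ≤ ‖symDeriv v x‖ ^ 2 := by
      intro i j
      have e : (inner ℝ (fderiv ℝ v x (b i)) (b j) : ℝ) + inner ℝ (fderiv ℝ v x (b j)) (b i)
          = inner ℝ (symDeriv v x (b i)) (b j) := by
        rw [symDeriv, add_apply, inner_add_left,
          ContinuousLinearMap.adjoint_inner_left, real_inner_comm (b i)]
      rw [e, ← sq_abs]
      refine pow_le_pow_left₀ (abs_nonneg _) ((abs_real_inner_le_norm _ _).trans ?_) 2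
      rw [b.norm_eq_one, mul_one]
      refine ((symDeriv v x).le_opNorm _).trans ?_
      rw [b.norm_eq_one, mul_one]
    calc _ ≤ ∑ _i : Fin N, ∑ _j : Fin N, ‖symDeriv v x‖ ^ 2 :=
          Finset.sum_le_sum fun i _ => Finset.sum_le_sum fun j _ => h1 i j
      _ = _ := by simp; ring
  have e1 : ∀ A : E →L[ℝ] E, ‖A‖ₑ ^ 2 = ENNReal.ofReal (‖A‖ ^ 2) := fun A => by
    rw [ENNReal.ofReal_pow (norm_nonneg _), ofReal_norm]
  calc ∫⁻ x, ‖fderiv ℝ v x‖ₑ ^ 2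
      ≤ ∫⁻ x, ENNReal.ofReal (∑ i, ∑ j, (inner ℝ (fderiv ℝ v x (b i)) (b j) : ℝ) ^ 2) :=
        lintegral_mono fun x => by rw [e1]; exact ENNReal.ofReal_le_ofReal (frob _)
    _ = ENNReal.ofReal (∑ i, ∑ j, ∫ x, (inner ℝ (fderiv ℝ v x (b i)) (b j) : ℝ) ^ 2) := by
        rw [← ofReal_integral_eq_lintegral_ofReal
          (integrable_finsetSum _ fun i _ => integrable_finsetSum _ fun j _ => i1 i j)
          (Eventually.of_forall fun x => Finset.sum_nonneg fun i _ => Finset.sum_nonneg fun j _ =>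
            sq_nonneg _),
          integral_finsetSum _ fun i _ => integrable_finsetSum _ fun j _ => i1 i j]
        congr 1
        exact Finset.sum_congr rfl fun i _ => integral_finsetSum _ fun j _ => i1 i j
    _ ≤ ENNReal.ofReal (∑ i, ∑ j, ∫ x, ((inner ℝ (fderiv ℝ v x (b i)) (b j) : ℝ)
          + inner ℝ (fderiv ℝ v x (b j)) (b i)) ^ 2) := by
        refine ENNReal.ofReal_le_ofReal (key.trans ?_)
        have : 0 ≤ ∑ i, ∑ j, ∫ x, ((inner ℝ (fderiv ℝ v x (b i)) (b j) : ℝ)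
          + inner ℝ (fderiv ℝ v x (b j)) (b i)) ^ 2 :=
          Finset.sum_nonneg fun i _ => Finset.sum_nonneg fun j _ =>
            integral_nonneg fun x => sq_nonneg _
        linarith
    _ = ∫⁻ x, ENNReal.ofReal (∑ i, ∑ j, ((inner ℝ (fderiv ℝ v x (b i)) (b j) : ℝ)
          + inner ℝ (fderiv ℝ v x (b j)) (b i)) ^ 2) := by
        rw [← ofReal_integral_eq_lintegral_ofReal
          (integrable_finsetSum _ fun i _ => integrable_finsetSum _ fun j _ => i2 i j)
          (Eventually.of_forall fun x => Finset.sum_nonneg fun i _ => Finset.sum_nonneg fun j _ =>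
            sq_nonneg _),
          integral_finsetSum _ fun i _ => integrable_finsetSum _ fun j _ => i2 i j]
        congr 1
        exact Finset.sum_congr rfl fun i _ => (integral_finsetSum _ fun j _ => i2 i j).symm
    _ ≤ ∫⁻ x, ((N * N : ℝ≥0) : ℝ≥0∞) * ‖symDeriv v x‖ₑ ^ 2 := lintegral_mono fun x => by
        rw [e1, ← ENNReal.ofReal_coe_nnreal, ← ENNReal.ofReal_mul (by positivity)]
        exact ENNReal.ofReal_le_ofReal (by simpa using back x)
    _ = _ := lintegral_const_mul' _ _ ENNReal.coe_ne_top

end Korn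

/-! ### Korn's inequality in a half space -/

section HalfSpaceKorn

variable {E : Type*} [NormedAddCommGroup E] [InnerProductSpace ℝ E]

/-- Multiplication of the component along the unit vector `n` by `-l`. -/
noncomputable def stretch (n : E) (l : ℝ) : E →L[ℝ] E :=
  ContinuousLinearMap.id ℝ E - (1 + l) • (innerSL ℝ n).smulRight n

theorem stretch_apply (n : E) (l : ℝ) (x : E) :
    stretch n l x = x - ((1 + l) * inner ℝ n x) • n := by
  simp [stretch, smul_smul]

theorem inner_stretch {n : E} (hn : ‖n‖ = 1) (l : ℝ) (x : E) :
    inner ℝ n (stretch n l x) = -l * inner ℝ n x := by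
  rw [stretch_apply, inner_sub_right, inner_smul_right, real_inner_self_eq_norm_sq, hn]
  ring

theorem stretch_stretch {n : E} (hn : ‖n‖ = 1) {l : ℝ} (hl : l ≠ 0) (x : E) :
    stretch n l⁻¹ (stretch n l x) = x := by
  rw [stretch_apply n l⁻¹, inner_stretch hn, stretch_apply, sub_sub, ← add_smul]
  have : (1 + l) * inner ℝ n x + (1 + l⁻¹) * (-l * inner ℝ n x) = 0 := by field_simp; ring
  rw [this, zero_smul, sub_zero]

variable [FiniteDimensional ℝ E]

theorem adjoint_stretch (n : E) (l : ℝ) : (stretch n l).adjoint = stretch n l := by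
  refine ContinuousLinearMap.ext fun x => ext_inner_right ℝ fun y => ?_
  rw [ContinuousLinearMap.adjoint_inner_left, stretch_apply, stretch_apply, inner_sub_left,
    inner_sub_right, inner_smul_left, inner_smul_right, real_inner_comm n x]
  simp only [conj_trivial]
  ring

variable [MeasurableSpace E] [BorelSpace E]

theorem det_stretch_ne_zero {n : E} (hn : ‖n‖ = 1) {l : ℝ} (hl : l ≠ 0) :
    LinearMap.det (stretch n l : E →ₗ[ℝ] E) ≠ 0 := by
  have h : (stretch n l⁻¹ : E →ₗ[ℝ] E) ∘ₗ (stretch n l : E →ₗ[ℝ] E) = LinearMap.id :=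
    LinearMap.ext fun x => stretch_stretch hn hl x
  intro h0
  have := congrArg LinearMap.det h
  rw [LinearMap.det_comp, h0, mul_zero, LinearMap.det_id] at this
  exact zero_ne_one this

theorem quasiMeasurePreserving_stretch {n : E} (hn : ‖n‖ = 1) {l : ℝ} (hl : l ≠ 0) :
    Measure.QuasiMeasurePreserving (stretch n l) (volume : Measure E) volume := by
  refine ⟨(stretch n l).continuous.measurable, ?_⟩
  have := Measure.map_linearMap_addHaar_eq_smul_addHaar (volume : Measure E)
    (det_stretch_ne_zero hn hl)
  simp only [ContinuousLinearMap.coe_coe] at this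
  rw [this]
  exact Measure.smul_absolutelyContinuous

/-- For l > 0 the stretch exchanges the two half spaces and is linear and invertible, so only a
determinant is lost. -/
theorem exists_setLIntegral_comp_stretch_le {n : E} (hn : ‖n‖ = 1) {l : ℝ} (hl : 0 < l) :
    ∃ c : ℝ≥0, ∀ f : E → ℝ≥0∞, Measurable f →
      ∫⁻ x in {x | inner ℝ n x < 0}, f (stretch n l x)
        ≤ c * ∫⁻ x in {x | 0 < inner ℝ n x}, f x := by
  refine ⟨Real.toNNReal |(LinearMap.det (stretch n l : E →ₗ[ℝ] E))⁻¹|, fun f hf => ?_⟩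
  have hmap := Measure.map_linearMap_addHaar_eq_smul_addHaar (volume : Measure E)
    (det_stretch_ne_zero hn hl.ne')
  simp only [ContinuousLinearMap.coe_coe] at hmap
  have hs : MeasurableSet {x : E | 0 < inner ℝ n x} :=
    measurableSet_lt measurable_const (by fun_prop)
  have hpre : {x : E | inner ℝ n x < 0} = stretch n l ⁻¹' {x : E | 0 < inner ℝ n x} := by
    ext x
    simp only [mem_ofPred_eq, mem_preimage, inner_stretch hn]
    constructor
    · intro h; nlinarith
    · intro h; by_contra h'; nlinarith
  have hm := (stretch n l).continuous.measurable
  rw [hpre, ← setLIntegral_map hs hf hm, hmap, Measure.restrict_smul, lintegral_smul_measure]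
  exact le_rfl

theorem addHaar_hyperplane {n : E} (hn : n ≠ 0) : volume {x : E | inner ℝ n x = 0} = 0 := by
  have h := Measure.addHaar_submodule (volume : Measure E) (ℝ ∙ n)ᗮ (by
    intro h
    have h1 : n ∈ (ℝ ∙ n)ᗮ := h ▸ Submodule.mem_top
    rw [Submodule.mem_orthogonal_singleton_iff_inner_right, inner_self_eq_zero] at h1
    exact hn h1)
  convert h using 2
  ext x
  exact Submodule.mem_orthogonal_singleton_iff_inner_right.symm

/-- Extension of a vector field across the hyperplane orthogonal to `n` which keeps the size of the
symmetrized derivative under control. -/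
noncomputable def reflectExtend (n : E) (u : E → E) (x : E) : E :=
  (3 : ℝ) • stretch n 1 (u (x - (2 * min (inner ℝ n x) 0) • n))
    - (2 : ℝ) • stretch n 2 (u (x - (3 * min (inner ℝ n x) 0) • n))

/-- Nitsche's coefficients: 3 - 2 = 1 on tangential components and 3·(-1) - 2·(-2) = 1 on the normal
one, so nothing changes on the side where the minimum is 0. -/
theorem reflectExtend_of_nonneg {n : E} (u : E → E) {x : E} (hx : 0 ≤ (inner ℝ n x : ℝ)) :
    reflectExtend n u x = u x := by
  simp only [reflectExtend, min_eq_right hx, mul_zero, zero_smul, sub_zero, stretch_apply]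
  module

theorem reflectExtend_of_neg {n : E} (u : E → E) {x : E} (hx : (inner ℝ n x : ℝ) < 0) :
    reflectExtend n u x = (3 : ℝ) • stretch n 1 (u (stretch n 1 x))
      - (2 : ℝ) • stretch n 2 (u (stretch n 2 x)) := by
  simp only [reflectExtend, min_eq_left hx.le]
  rw [stretch_apply n 1 x, stretch_apply n 2 x]
  norm_num

/-- Written with min(⟨n, x⟩, 0), the extension is a combination of Lipschitz maps, with no gluing
across the hyperplane. -/
theorem LipschitzWith.reflectExtend {n : E} {K : ℝ≥0} {u : E → E} (hu : LipschitzWith K u) :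
    ∃ K', LipschitzWith K' (reflectExtend n u) := by
  have hin : LipschitzWith ‖n‖₊ fun x : E => (inner ℝ n x : ℝ) := by
    have := (innerSL ℝ n).lipschitz
    rw [show ‖innerSL ℝ n‖₊ = ‖n‖₊ from Subtype.ext (innerSL_apply_norm ℝ n)] at this
    exact this
  have hmin : LipschitzWith ‖n‖₊ fun x : E => min (inner ℝ n x : ℝ) 0 := hin.min_const 0
  have hsm : ∀ c : ℝ, ∃ K', LipschitzWith K' fun x : E => x - (c * min (inner ℝ n x : ℝ) 0) • n := by
    intro c
    have h1 := ((ContinuousLinearMap.toSpanSingleton ℝ n).lipschitz.comp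
      ((lipschitzWith_smul c).comp hmin))
    exact ⟨_, LipschitzWith.id.sub h1⟩
  obtain ⟨K1, h1⟩ := hsm 2
  obtain ⟨K2, h2⟩ := hsm 3
  exact ⟨_, ((lipschitzWith_smul (3 : ℝ)).comp ((stretch n 1).lipschitz.comp (hu.comp h1))).sub
    ((lipschitzWith_smul (2 : ℝ)).comp ((stretch n 2).lipschitz.comp (hu.comp h2)))⟩

theorem HasCompactSupport.reflectExtend {n : E} (hn : ‖n‖ = 1) {u : E → E}
    (hu : HasCompactSupport u) : HasCompactSupport (reflectExtend n u) := by
  have hK : IsCompact (tsupport u ∪ stretch n 1⁻¹ '' tsupport u ∪ stretch n 2⁻¹ '' tsupport u) :=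
    ((hu.isCompact.union (hu.isCompact.image (stretch n 1⁻¹).continuous)).union
      (hu.isCompact.image (stretch n 2⁻¹).continuous))
  refine HasCompactSupport.intro hK fun x hx => ?_
  simp only [mem_union, not_or] at hx
  rcases le_or_gt 0 (inner ℝ n x : ℝ) with h | h
  · rw [reflectExtend_of_nonneg u h, image_eq_zero_of_notMem_tsupport hx.1.1]
  · have h1 : u (stretch n 1 x) = 0 := image_eq_zero_of_notMem_tsupport fun h' =>
      hx.1.2 ⟨_, h', stretch_stretch hn one_ne_zero x⟩
    have h2 : u (stretch n 2 x) = 0 := image_eq_zero_of_notMem_tsupport fun h' =>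
      hx.2 ⟨_, h', stretch_stretch hn two_ne_zero x⟩
    rw [reflectExtend_of_neg u h, h1, h2]
    simp

/-- The derivative of S ∘ u ∘ S is S Du S; since S is self-adjoint, symmetrising gives S (Du + Duᵀ)
S. Stretching the values as well as the argument is what keeps the strain controlled by the strain.
-/
theorem symDeriv_reflectExtend_of_neg {n : E} {u : E → E} {x : E}
    (hx : (inner ℝ n x : ℝ) < 0) (h1 : DifferentiableAt ℝ u (stretch n 1 x))
    (h2 : DifferentiableAt ℝ u (stretch n 2 x)) :
    symDeriv (reflectExtend n u) x
      = (3 : ℝ) • (stretch n 1 ∘L symDeriv u (stretch n 1 x) ∘L stretch n 1)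
        - (2 : ℝ) • (stretch n 2 ∘L symDeriv u (stretch n 2 x) ∘L stretch n 2) := by
  have hd : ∀ l : ℝ, DifferentiableAt ℝ u (stretch n l x) →
      HasFDerivAt (fun y => stretch n l (u (stretch n l y)))
        (stretch n l ∘L fderiv ℝ u (stretch n l x) ∘L stretch n l) x := fun l hl =>
    (stretch n l).hasFDerivAt.comp x (hl.hasFDerivAt.comp x (stretch n l).hasFDerivAt)
  have hev : (fun y => (3 : ℝ) • stretch n 1 (u (stretch n 1 y))
      - (2 : ℝ) • stretch n 2 (u (stretch n 2 y))) =ᶠ[𝓝 x] reflectExtend n u := by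
    filter_upwards [(isOpen_lt (by fun_prop : Continuous fun y : E => (inner ℝ n y : ℝ))
      continuous_const).mem_nhds hx] with y hy
    exact (reflectExtend_of_neg u hy).symm
  have hD := ((((hd 1 h1).const_smul (3 : ℝ)).sub ((hd 2 h2).const_smul (2 : ℝ))).congr_of_eventuallyEq
    hev.symm).fderiv
  rw [symDeriv, hD]
  have e : ∀ c : ℝ, ∀ A : E →L[ℝ] E, (c • A).adjoint = c • A.adjoint := fun c A => by
    rw [LinearIsometryEquiv.map_smulₛₗ]; simp
  rw [map_sub, e, e]
  simp only [ContinuousLinearMap.adjoint_comp, adjoint_stretch, ContinuousLinearMap.comp_assoc,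
    symDeriv, ContinuousLinearMap.comp_add, ContinuousLinearMap.add_comp, smul_add]
  abel

theorem measurable_symDeriv (u : E → E) : Measurable (symDeriv u) := by
  have h := measurable_fderiv ℝ u
  exact h.add ((ContinuousLinearMap.adjoint (𝕜 := ℝ) (E := E) (F := E)).continuous.measurable.comp h)

/-- Korn's inequality in a half space. -/
theorem exists_korn_halfSpace {n : E} (hn : ‖n‖ = 1) :
    ∃ C : ℝ≥0, ∀ (K : ℝ≥0) (u : E → E), LipschitzWith K u → HasCompactSupport u →
      ∫⁻ x in {x | 0 < inner ℝ n x}, ‖fderiv ℝ u x‖ₑ ^ 2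
        ≤ C * ∫⁻ x in {x | 0 < inner ℝ n x}, ‖symDeriv u x‖ₑ ^ 2 := by
  obtain ⟨C, hC⟩ := exists_korn (E := E)
  obtain ⟨c1, hc1⟩ := exists_setLIntegral_comp_stretch_le hn one_pos
  obtain ⟨c2, hc2⟩ := exists_setLIntegral_comp_stretch_le hn two_pos
  set a1 : ℝ≥0 := 3 * ‖stretch n 1‖₊ ^ 2
  set a2 : ℝ≥0 := 2 * ‖stretch n 2‖₊ ^ 2
  refine ⟨C * (1 + (2 * a1 ^ 2 * c1 + 2 * a2 ^ 2 * c2)), fun K u hu hu' => ?_⟩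
  set H : Set E := {x | 0 < inner ℝ n x} with hH
  set V := reflectExtend n u with hV
  obtain ⟨K', hV'⟩ := hu.reflectExtend (n := n)
  have hHo : IsOpen H := isOpen_lt continuous_const (by fun_prop)
  have hN : MeasurableSet {x : E | (inner ℝ n x : ℝ) < 0} :=
    measurableSet_lt (by fun_prop) measurable_const
  have hVu : ∀ x ∈ H, fderiv ℝ V x = fderiv ℝ u x := fun x hx => by
    refine Filter.EventuallyEq.fderiv_eq ?_
    filter_upwards [hHo.mem_nhds hx] with y hy
    exact reflectExtend_of_nonneg u (le_of_lt hy)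
  have hVs : ∀ x ∈ H, symDeriv V x = symDeriv u x := fun x hx => by
    rw [symDeriv, symDeriv, hVu x hx]
  have hm := measurable_symDeriv u
  have hsplit : ∫⁻ x, ‖symDeriv V x‖ₑ ^ 2 = (∫⁻ x in H, ‖symDeriv V x‖ₑ ^ 2)
      + ∫⁻ x in {x : E | (inner ℝ n x : ℝ) < 0}, ‖symDeriv V x‖ₑ ^ 2 := by
    rw [← lintegral_add_compl _ hHo.measurableSet]
    congr 1
    refine setLIntegral_congr ?_
    have h0 := measure_eq_zero_iff_ae_notMem.1 (addHaar_hyperplane (E := E) (n := n)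
      (by rintro rfl; simp at hn))
    filter_upwards [h0] with x hx
    refine propext (show x ∈ Hᶜ ↔ _ from ?_)
    simp only [hH, mem_compl_iff, mem_ofPred_eq, not_lt] at hx ⊢
    exact ⟨fun h => lt_of_le_of_ne h hx, fun h => le_of_lt h⟩
  have hneg : ∫⁻ x in {x : E | (inner ℝ n x : ℝ) < 0}, ‖symDeriv V x‖ₑ ^ 2
      ≤ (2 * a1 ^ 2 * c1 + 2 * a2 ^ 2 * c2 : ℝ≥0) * ∫⁻ x in H, ‖symDeriv u x‖ₑ ^ 2 := by
    have hae := hu.ae_differentiableAt (μ := (volume : Measure E))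
    have d1 := (quasiMeasurePreserving_stretch hn (one_ne_zero (α := ℝ))).ae hae
    have d2 := (quasiMeasurePreserving_stretch hn (two_ne_zero (α := ℝ))).ae hae
    have hb : ∀ l : ℝ, ∀ A : E →L[ℝ] E,
        ‖stretch n l ∘L A ∘L stretch n l‖ₑ ≤ (‖stretch n l‖₊ ^ 2 : ℝ≥0) * ‖A‖ₑ := by
      intro l A
      have : ‖stretch n l ∘L A ∘L stretch n l‖₊ ≤ ‖stretch n l‖₊ ^ 2 * ‖A‖₊ := by
        refine (ContinuousLinearMap.opNNNorm_comp_le _ _).trans ?_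
        refine (mul_le_mul_right (ContinuousLinearMap.opNNNorm_comp_le _ _) _).trans (le_of_eq ?_)
        ring
      simp only [enorm_eq_nnnorm]
      exact_mod_cast this
    calc _ ≤ ∫⁻ x in {x : E | (inner ℝ n x : ℝ) < 0},
          (((2 * a1 ^ 2 : ℝ≥0) : ℝ≥0∞) * ‖symDeriv u (stretch n 1 x)‖ₑ ^ 2
            + ((2 * a2 ^ 2 : ℝ≥0) : ℝ≥0∞) * ‖symDeriv u (stretch n 2 x)‖ₑ ^ 2) := by
          refine setLIntegral_mono_ae' hN ?_
          filter_upwards [d1, d2] with x hx1 hx2 hx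
          rw [symDeriv_reflectExtend_of_neg hx hx1 hx2]
          refine (pow_le_pow_left₀ (zero_le) (enorm_sub_le.trans (add_le_add ?_ ?_)) 2).trans
            (ENNReal.add_sq_le_two_mul
              ((a1 : ℝ≥0∞) * ‖symDeriv u (stretch n 1 x)‖ₑ)
              ((a2 : ℝ≥0∞) * ‖symDeriv u (stretch n 2 x)‖ₑ) |>.trans (le_of_eq ?_))
          · rw [enorm_smul]
            refine (mul_le_mul_right (hb 1 _) _).trans (le_of_eq ?_)
            rw [← mul_assoc, enorm_eq_nnnorm, ← ENNReal.coe_mul]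
            congr 3
            ext; simp
          · rw [enorm_smul]
            refine (mul_le_mul_right (hb 2 _) _).trans (le_of_eq ?_)
            rw [← mul_assoc, enorm_eq_nnnorm, ← ENNReal.coe_mul]
            congr 3
            ext; simp
          · push_cast; ring
      _ = ((2 * a1 ^ 2 : ℝ≥0) : ℝ≥0∞) * (∫⁻ x in {x : E | (inner ℝ n x : ℝ) < 0},
            ‖symDeriv u (stretch n 1 x)‖ₑ ^ 2)
          + ((2 * a2 ^ 2 : ℝ≥0) : ℝ≥0∞) * ∫⁻ x in {x : E | (inner ℝ n x : ℝ) < 0},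
            ‖symDeriv u (stretch n 2 x)‖ₑ ^ 2 := by
          rw [lintegral_add_left, lintegral_const_mul' _ _ ENNReal.coe_ne_top,
            lintegral_const_mul' _ _ ENNReal.coe_ne_top]
          exact ((hm.comp (stretch n 1).continuous.measurable).enorm.pow_const 2).const_mul _
      _ ≤ ((2 * a1 ^ 2 : ℝ≥0) : ℝ≥0∞) * (c1 * ∫⁻ x in H, ‖symDeriv u x‖ₑ ^ 2)
          + ((2 * a2 ^ 2 : ℝ≥0) : ℝ≥0∞) * (c2 * ∫⁻ x in H, ‖symDeriv u x‖ₑ ^ 2) := by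
          gcongr
          · exact hc1 _ (hm.enorm.pow_const 2)
          · exact hc2 _ (hm.enorm.pow_const 2)
      _ = _ := by push_cast; ring
  calc ∫⁻ x in H, ‖fderiv ℝ u x‖ₑ ^ 2 = ∫⁻ x in H, ‖fderiv ℝ V x‖ₑ ^ 2 :=
        setLIntegral_congr_fun hHo.measurableSet fun x hx => by simp only [hVu x hx]
    _ ≤ ∫⁻ x, ‖fderiv ℝ V x‖ₑ ^ 2 := setLIntegral_le_lintegral _ _
    _ ≤ C * ∫⁻ x, ‖symDeriv V x‖ₑ ^ 2 := hC K' V hV' (hu'.reflectExtend hn)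
    _ ≤ C * ((∫⁻ x in H, ‖symDeriv u x‖ₑ ^ 2) + (2 * a1 ^ 2 * c1 + 2 * a2 ^ 2 * c2 : ℝ≥0)
          * ∫⁻ x in H, ‖symDeriv u x‖ₑ ^ 2) := by
        rw [hsplit]
        refine mul_le_mul_right (add_le_add (le_of_eq ?_) hneg) _
        exact setLIntegral_congr_fun hHo.measurableSet fun x hx => by simp only [hVs x hx]
    _ = _ := by push_cast; ring

end HalfSpaceKorn

/-! ### Traces of Lipschitz functions on a hyperplane -/

/-- Polar coordinates; the constant is the mass of the unit sphere. -/
theorem exists_lintegral_fun_norm_le {F : Type*} [NormedAddCommGroup F] [NormedSpace ℝ F]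
    [FiniteDimensional ℝ F] [Nontrivial F] [MeasurableSpace F] [BorelSpace F] (μ : Measure F)
    [μ.IsAddHaarMeasure] :
    ∃ C : ℝ≥0, ∀ f : ℝ → ℝ≥0∞, Measurable f → ∫⁻ x, f ‖x‖ ∂μ
      ≤ C * ∫⁻ r in Ioi (0 : ℝ), ENNReal.ofReal (r ^ (Module.finrank ℝ F - 1)) * f r := by
  refine ⟨(μ.toSphere univ).toNNReal, fun f hf => ?_⟩
  rw [ENNReal.coe_toNNReal (measure_ne_top _ _)]
  have h0 : ∫⁻ x, f ‖x‖ ∂μ = ∫⁻ x : ({(0)}ᶜ : Set F), f ‖x.1‖ ∂(μ.comap (↑)) := by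
    rw [lintegral_subtype_comap (measurableSet_singleton _).compl fun x => f ‖x‖,
      restrict_compl_singleton]
  have h1 := μ.measurePreserving_homeomorphUnitSphereProd.lintegral_comp
    (f := fun p => f p.2) (hf.comp (measurable_subtype_coe.comp measurable_snd))
  simp only [homeomorphUnitSphereProd_apply_snd_coe] at h1
  have hm : Measurable fun p : Metric.sphere (0 : F) 1 × Ioi (0 : ℝ) => f p.2 :=
    hf.comp (measurable_subtype_coe.comp measurable_snd)
  rw [h0, h1, lintegral_prod _ hm.aemeasurable]
  simp only [lintegral_const]
  have hm' : Measurable fun r : Ioi (0 : ℝ) => f r := hf.comp measurable_subtype_coe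
  rw [mul_comm, Measure.volumeIoiPow,
    lintegral_withDensity_eq_lintegral_mul _ (by fun_prop) hm']
  refine le_of_eq ?_
  congr 1
  exact lintegral_subtype_comap measurableSet_Ioi
    (fun r : ℝ => ENNReal.ofReal (r ^ (Module.finrank ℝ F - 1)) * f r)

section LipschitzFTC

variable {E G : Type*} [NormedAddCommGroup E] [NormedSpace ℝ E] [NormedAddCommGroup G]
  [InnerProductSpace ℝ G]

/-- Pair the curve with the unit vector along its increment; the scalar function so obtained is
Lipschitz, hence absolutely continuous. -/
theorem LipschitzWith.norm_sub_le_integral_norm_deriv {K : ℝ≥0} {c : ℝ → G}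
    (hc : LipschitzWith K c) {r : ℝ} (hr : 0 ≤ r) {q : ℝ → ℝ≥0∞}
    (hq : ∀ᵐ s ∂(volume.restrict (Ioc 0 r)), DifferentiableAt ℝ c s ∧ ‖deriv c s‖ₑ ≤ q s) :
    ‖c r - c 0‖ₑ ≤ ∫⁻ s in Ioc 0 r, q s := by
  by_cases h0 : c r - c 0 = 0
  · rw [h0]; simp
  set e : G := (‖c r - c 0‖)⁻¹ • (c r - c 0) with he
  have hne : ‖c r - c 0‖ ≠ 0 := norm_ne_zero_iff.2 h0
  have hen : ‖e‖ = 1 := by rw [he, norm_smul, norm_inv, norm_norm, inv_mul_cancel₀ hne]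
  have hel : LipschitzWith (‖innerSL ℝ e‖₊ * K) fun s => (inner ℝ e (c s) : ℝ) :=
    (innerSL ℝ e).lipschitz.comp hc
  have hftc := (hel.lipschitzOnWith (s := uIcc 0 r)).absolutelyContinuousOnInterval.integral_deriv_eq_sub
  have hval : (inner ℝ e (c r) : ℝ) - inner ℝ e (c 0) = ‖c r - c 0‖ := by
    rw [← inner_sub_right, he, inner_smul_left, real_inner_self_eq_norm_sq]
    simp only [conj_trivial]
    field_simp
  rw [hval, intervalIntegral.integral_of_le hr] at hftc
  rw [← ofReal_norm, ← hftc]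
  refine ((ENNReal.ofReal_le_ofReal (le_abs_self _)).trans ?_)
  rw [← Real.norm_eq_abs, ofReal_norm]
  refine (enorm_integral_le_lintegral_enorm _).trans ?_
  refine lintegral_mono_ae ?_
  filter_upwards [hq] with s hs
  refine le_trans ?_ hs.2
  have hd : deriv (fun s => (inner ℝ e (c s) : ℝ)) s = inner ℝ e (deriv c s) :=
    ((innerSL ℝ e).hasFDerivAt.comp_hasDerivAt s hs.1.hasDerivAt).deriv
  rw [hd, ← ofReal_norm, ← ofReal_norm]
  refine ENNReal.ofReal_le_ofReal ((abs_real_inner_le_norm _ _).trans ?_)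
  rw [hen, one_mul]

end LipschitzFTC

section HyperplaneTrace

variable {E F : Type*} [NormedAddCommGroup E] [InnerProductSpace ℝ E] [FiniteDimensional ℝ E]
  [MeasurableSpace E] [BorelSpace E] [NormedAddCommGroup F] [InnerProductSpace ℝ F]
  [FiniteDimensional ℝ F] [MeasurableSpace F] [BorelSpace F]

theorem bijective_add_smul {n : E} (hn : ‖n‖ = 1) (L : F →ₗᵢ[ℝ] E)
    (hL : ∀ ξ, inner ℝ n (L ξ) = 0) (hdim : Module.finrank ℝ E = Module.finrank ℝ F + 1) :
    Function.Bijective fun p : F × ℝ => L p.1 + p.2 • n := by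
  set Θ : F × ℝ →L[ℝ] E := L.toContinuousLinearMap.coprod
    (ContinuousLinearMap.toSpanSingleton ℝ n) with hΘ
  have hΘa : ∀ p, Θ p = L p.1 + p.2 • n := fun p => rfl
  have hinj : Function.Injective Θ := by
    refine (injective_iff_map_eq_zero Θ).2 fun p hp => ?_
    have h2 : p.2 = 0 := by
      have h := congrArg (inner ℝ n) hp
      rwa [hΘa, inner_add_right, hL, inner_smul_right, real_inner_self_eq_norm_sq, hn, one_pow,
        mul_one, zero_add, inner_zero_right] at h
    have h1 : p.1 = 0 := by
      rw [hΘa, h2, zero_smul, add_zero] at hp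
      exact L.injective (hp.trans (map_zero L).symm)
    exact Prod.ext h1 h2
  have hr : Module.finrank ℝ (F × ℝ) = Module.finrank ℝ E := by
    rw [Module.finrank_prod, Module.finrank_self, hdim]
  exact ⟨hinj, (LinearMap.injective_iff_surjective_of_finrank_eq_finrank
    (f := (Θ : F × ℝ →ₗ[ℝ] E)) hr).1 hinj⟩

/-- The image of product Lebesgue measure under the linear bijection (ξ, s) ↦ Lξ + sn is a Haar
measure, hence a multiple of volume. -/
theorem exists_lintegral_slices_le {n : E} (hn : ‖n‖ = 1) (L : F →ₗᵢ[ℝ] E)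
    (hL : ∀ ξ, inner ℝ n (L ξ) = 0) (hdim : Module.finrank ℝ E = Module.finrank ℝ F + 1) :
    ∃ c : ℝ≥0, ∀ f : E → ℝ≥0∞, Measurable f →
      ∫⁻ s in Ioi (0 : ℝ), ∫⁻ ξ, f (L ξ + s • n) ≤ c * ∫⁻ x in {x | 0 < inner ℝ n x}, f x := by
  set Θ : F × ℝ →L[ℝ] E := L.toContinuousLinearMap.coprod
    (ContinuousLinearMap.toSpanSingleton ℝ n) with hΘ
  have hin : ∀ p, inner ℝ n (Θ p) = p.2 := fun p => by
    have : Θ p = L p.1 + p.2 • n := rfl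
    rw [this, inner_add_right, hL, inner_smul_right, real_inner_self_eq_norm_sq, hn]; simp
  obtain ⟨hinj, hsurj⟩ : Function.Bijective Θ := bijective_add_smul hn L hL hdim
  set e : (F × ℝ) ≃L[ℝ] E := ContinuousLinearEquiv.ofBijective Θ
    (LinearMap.ker_eq_bot.2 hinj) (LinearMap.range_eq_top.2 hsurj) with he
  set μ : Measure E := ((volume : Measure F).prod (volume : Measure ℝ)).map e with hμ
  have : μ.IsAddHaarMeasure := e.isAddHaarMeasure_map _
  have hμ' : μ = μ.addHaarScalarFactor (volume : Measure E) • (volume : Measure E) :=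
    Measure.isAddLeftInvariant_eq_smul _ _
  refine ⟨μ.addHaarScalarFactor (volume : Measure E), fun f hf => ?_⟩
  have hH : MeasurableSet {x : E | 0 < (inner ℝ n x : ℝ)} :=
    measurableSet_lt measurable_const (by fun_prop)
  have h1 : ∫⁻ x in {x : E | 0 < (inner ℝ n x : ℝ)}, f x ∂μ
      = μ.addHaarScalarFactor (volume : Measure E) *
        ∫⁻ x in {x : E | 0 < (inner ℝ n x : ℝ)}, f x := by
    conv_lhs => rw [hμ']
    rw [Measure.restrict_smul, lintegral_smul_measure]
    rfl
  rw [← h1, hμ, setLIntegral_map hH hf e.continuous.measurable]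
  have hpre : e ⁻¹' {x : E | 0 < (inner ℝ n x : ℝ)} = univ ×ˢ Ioi (0 : ℝ) := by
    ext p
    have : e p = Θ p := rfl
    simp only [mem_preimage, mem_ofPred_eq, this, hin, mem_prod, mem_univ, true_and, mem_Ioi]
  have hfe : Measurable fun p => f (e p) := hf.comp e.continuous.measurable
  rw [hpre, ← Measure.prod_restrict, Measure.restrict_univ,
    lintegral_prod_symm _ hfe.aemeasurable]
  exact le_rfl

/-- At height s the oblique line is displaced horizontally by sθ, which a translation of ξ undoes.
Oblique directions therefore cost nothing after integration over the hyperplane. -/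
theorem lintegral_lintegral_slices {n : E} (L : F →ₗᵢ[ℝ] E) (θ : F) {f : E → ℝ≥0∞}
    (hf : Measurable f) {w : ℝ → ℝ≥0∞} (hw : Measurable w) (S : Set ℝ) :
    ∫⁻ ξ, ∫⁻ s in S, w s * f (L ξ + s • (L θ + n))
      = ∫⁻ s in S, w s * ∫⁻ ξ, f (L ξ + s • n) := by
  have hLc := L.continuous
  have hg : Measurable fun p : F × ℝ => L p.1 + p.2 • (L θ + n) :=
    (by fun_prop : Continuous fun p : F × ℝ => L p.1 + p.2 • (L θ + n)).measurable
  rw [lintegral_lintegral_swap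
    ((hw.comp measurable_snd).mul (hf.comp hg)).aemeasurable]
  refine lintegral_congr fun s => ?_
  have hg' : Measurable fun ξ : F => f (L ξ + s • (L θ + n)) :=
    hf.comp (by fun_prop : Continuous fun ξ : F => L ξ + s • (L θ + n)).measurable
  rw [lintegral_const_mul _ hg',
    ← lintegral_add_right_eq_self (fun ξ => f (L ξ + s • n)) (s • θ)]
  congr 1
  refine lintegral_congr fun ξ => ?_
  rw [map_add, map_smul, smul_add, add_assoc]

/-- The increment of a Lipschitz function along a transversal direction, in mean square over the
hyperplane. -/
theorem LipschitzWith.lintegral_increment_le {n : E} (hn : ‖n‖ = 1) (L : F →ₗᵢ[ℝ] E)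
    (hL : ∀ ξ, inner ℝ n (L ξ) = 0) (hdim : Module.finrank ℝ E = Module.finrank ℝ F + 1)
    {K : ℝ≥0} {u : E → E} (hu : LipschitzWith K u) (θ : F) {r : ℝ} (hr : 0 < r) :
    ∫⁻ ξ, ‖u (L ξ + r • (L θ + n)) - u (L ξ)‖ₑ ^ 2
      ≤ ‖L θ + n‖ₑ ^ 2 * ENNReal.ofReal (2 * r ^ (1 / 2 : ℝ)) *
        ∫⁻ s in Ioc 0 r, ENNReal.ofReal (s ^ (1 / 2 : ℝ)) *
          ∫⁻ ξ, ‖fderiv ℝ u (L ξ + s • n)‖ₑ ^ 2 := by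
  set a := L θ + n with ha
  have hLc := L.continuous
  have hfd : Measurable fun x => ‖fderiv ℝ u x‖ₑ ^ 2 := (measurable_fderiv ℝ u).enorm.pow_const 2
  have hpc : ∀ ξ : F, Measurable fun s : ℝ => L ξ + s • a := fun ξ =>
    (by fun_prop : Continuous fun s : ℝ => L ξ + s • a).measurable
  -- By Rademacher and Fubini, almost every oblique line meets the set of nondifferentiability in a
  -- null set.
  have hdiff : ∀ᵐ ξ : F, ∀ᵐ s ∂(volume.restrict (Ioi (0 : ℝ))),
      DifferentiableAt ℝ u (L ξ + s • a) := by
    set N : Set E := {x | ¬ DifferentiableAt ℝ u x} with hN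
    have hNm : MeasurableSet N := (measurableSet_of_differentiableAt ℝ u).compl
    have hN0 : volume N = 0 := hu.ae_differentiableAt
    obtain ⟨c, hc⟩ := exists_lintegral_slices_le hn L hL hdim
    have hi : Measurable (N.indicator (1 : E → ℝ≥0∞)) := measurable_one.indicator hNm
    have h1 := lintegral_lintegral_slices (n := n) L θ hi (measurable_const (a := (1 : ℝ≥0∞)))
      (Ioi (0 : ℝ))
    simp only [one_mul] at h1
    have h2 := hc _ hi
    rw [← h1, lintegral_indicator_one hNm] at h2
    have h3 : ∫⁻ ξ, ∫⁻ s in Ioi (0 : ℝ), N.indicator (1 : E → ℝ≥0∞) (L ξ + s • a) = 0 := by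
      refine le_antisymm (h2.trans ?_) zero_le
      rw [le_antisymm ((Measure.restrict_apply_le _ _).trans hN0.le) zero_le, mul_zero]
    rw [lintegral_eq_zero_iff] at h3
    · filter_upwards [h3] with ξ hξ
      simp only [Pi.zero_apply] at hξ
      have hm : Measurable fun s : ℝ => N.indicator (1 : E → ℝ≥0∞) (L ξ + s • a) :=
        hi.comp (hpc ξ)
      rw [lintegral_eq_zero_iff hm] at hξ
      filter_upwards [hξ] with s hs
      by_contra hns
      have : N.indicator (1 : E → ℝ≥0∞) (L ξ + s • a) = 1 := indicator_of_mem hns _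
      rw [Pi.zero_apply, this] at hs
      exact one_ne_zero hs
    · refine Measurable.lintegral_prod_right' (f := fun p : F × ℝ =>
        N.indicator (1 : E → ℝ≥0∞) (L p.1 + p.2 • a)) (hi.comp ?_)
      exact (by fun_prop : Continuous fun p : F × ℝ => L p.1 + p.2 • a).measurable
  have hroot : Measurable fun s : ℝ => ENNReal.ofReal (s ^ (1 / 2 : ℝ)) := by fun_prop
  rw [← lintegral_lintegral_slices (n := n) L θ hfd hroot (Ioc 0 r),
    ← lintegral_const_mul' _ _ (by finiteness)]
  refine lintegral_mono_ae ?_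
  filter_upwards [hdiff] with ξ hξ
  have hcl : LipschitzWith (K * ‖ContinuousLinearMap.toSpanSingleton ℝ a‖₊)
      fun s : ℝ => u (L ξ + s • a) :=
    hu.comp (by
      have h := (ContinuousLinearMap.toSpanSingleton ℝ a).lipschitz
      have h' : LipschitzWith (0 + ‖ContinuousLinearMap.toSpanSingleton ℝ a‖₊)
        fun s : ℝ => L ξ + s • a := (LipschitzWith.const (L ξ)).add h
      rwa [zero_add] at h')
  have h1 := hcl.norm_sub_le_integral_norm_deriv (r := r) hr.le
    (q := fun s => ‖a‖ₑ * ‖fderiv ℝ u (L ξ + s • a)‖ₑ) (by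
      filter_upwards [ae_mono (Measure.restrict_mono Ioc_subset_Ioi_self le_rfl) hξ] with s hs
      have hd : HasDerivAt (fun s : ℝ => L ξ + s • a) a s := by
        simpa using ((hasDerivAt_id s).smul_const a).const_add (L ξ)
      have hd' := hs.hasFDerivAt.comp_hasDerivAt s hd
      refine ⟨hd'.differentiableAt, ?_⟩
      have e1 : deriv (fun s : ℝ => u (L ξ + s • a)) s = fderiv ℝ u (L ξ + s • a) a := hd'.deriv
      rw [e1, mul_comm]
      exact ContinuousLinearMap.le_opENorm _ _)
  simp only [zero_smul, add_zero] at h1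
  have hfm : Measurable fun s : ℝ => ‖fderiv ℝ u (L ξ + s • a)‖ₑ :=
    ((measurable_fderiv ℝ u).enorm.comp (hpc ξ))
  rw [lintegral_const_mul _ hfm] at h1
  refine (pow_le_pow_left₀ zero_le h1 2).trans ?_
  rw [mul_pow, mul_assoc]
  refine mul_le_mul_right ?_ _
  -- Cauchy's inequality with weight s^(-1/2), whose integral over (0, r] is 2r^(1/2); the
  -- compensating factor s^(1/2) makes the later integral over r converge.
  have hw : Measurable fun s : ℝ => ENNReal.ofReal (s ^ ((1 / 2 : ℝ) - 1)) := by fun_prop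
  have h2 := lintegral_mul_sq_le (μ := volume.restrict (Ioc 0 r)) hw.aemeasurable
    (hroot.mul hfm).aemeasurable
  have e2 : ∫⁻ s in Ioc 0 r, ENNReal.ofReal (s ^ ((1 / 2 : ℝ) - 1)) *
      (ENNReal.ofReal (s ^ (1 / 2 : ℝ)) * ‖fderiv ℝ u (L ξ + s • a)‖ₑ)
      = ∫⁻ s in Ioc 0 r, ‖fderiv ℝ u (L ξ + s • a)‖ₑ := by
    refine setLIntegral_congr_fun measurableSet_Ioc fun s hs => ?_
    rw [← mul_assoc, ← ENNReal.ofReal_mul (Real.rpow_nonneg hs.1.le _), ← Real.rpow_add hs.1]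
    norm_num
  have e3 : ∫⁻ s in Ioc 0 r, ENNReal.ofReal (s ^ ((1 / 2 : ℝ) - 1)) *
      (ENNReal.ofReal (s ^ (1 / 2 : ℝ)) * ‖fderiv ℝ u (L ξ + s • a)‖ₑ) ^ 2
      = ∫⁻ s in Ioc 0 r, ENNReal.ofReal (s ^ (1 / 2 : ℝ)) *
        ‖fderiv ℝ u (L ξ + s • a)‖ₑ ^ 2 := by
    refine setLIntegral_congr_fun measurableSet_Ioc fun s hs => ?_
    rw [mul_pow, ← mul_assoc, ← ENNReal.ofReal_pow (Real.rpow_nonneg hs.1.le _),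
      ← ENNReal.ofReal_mul (Real.rpow_nonneg hs.1.le _), ← Real.rpow_mul_natCast hs.1.le,
      ← Real.rpow_add hs.1]
    norm_num
  simp only [Pi.mul_apply] at h2
  rw [e2, e3, lintegral_Ioc_rpow (by norm_num) hr] at h2
  refine h2.trans (le_of_eq ?_)
  congr 2
  ring

/-- The Slobodeckij seminorm of the trace on a hyperplane. -/
theorem exists_lintegral_trace_slobodeckij_le [Nontrivial F] {n : E} (hn : ‖n‖ = 1)
    (L : F →ₗᵢ[ℝ] E) (hL : ∀ ξ, inner ℝ n (L ξ) = 0)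
    (hdim : Module.finrank ℝ E = Module.finrank ℝ F + 1) :
    ∃ C : ℝ≥0, ∀ (K : ℝ≥0) (u : E → E), LipschitzWith K u →
      ∫⁻ ζ, ∫⁻ ξ, ‖u (L (ξ + ζ)) - u (L ξ)‖ₑ ^ 2 / ‖ζ‖ₑ ^ (Module.finrank ℝ E : ℝ)
        ≤ C * ∫⁻ x in {x | 0 < inner ℝ n x}, ‖fderiv ℝ u x‖ₑ ^ 2 := by
  obtain ⟨c, hc⟩ := exists_lintegral_slices_le hn L hL hdim
  obtain ⟨P, hP⟩ := exists_lintegral_fun_norm_le (volume : Measure F)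
  refine ⟨P * (40 * c), fun K u hu => ?_⟩
  set A : ℝ → ℝ≥0∞ := fun s => ∫⁻ ξ, ‖fderiv ℝ u (L ξ + s • n)‖ₑ ^ 2 with hA
  have hLc := L.continuous
  have hfd : Measurable fun x => ‖fderiv ℝ u x‖ₑ ^ 2 := (measurable_fderiv ℝ u).enorm.pow_const 2
  have hAm : Measurable A := by
    refine Measurable.lintegral_prod_right' (f := fun p : ℝ × F =>
      ‖fderiv ℝ u (L p.2 + p.1 • n)‖ₑ ^ 2) (hfd.comp ?_)
    exact (by fun_prop : Continuous fun p : ℝ × F => L p.2 + p.1 • n).measurable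
  have hroot : Measurable fun s : ℝ => ENNReal.ofReal (s ^ (1 / 2 : ℝ)) := by fun_prop
  set g : ℝ → ℝ≥0∞ := fun s => ENNReal.ofReal (s ^ (1 / 2 : ℝ)) * A s with hg
  have hgm : Measurable g := hroot.mul hAm
  set B : ℝ → ℝ≥0∞ := fun r => ∫⁻ s in Ioc 0 r, g s with hB
  have hBm : Measurable B := by
    have : Monotone B := fun a b hab => lintegral_mono_set (Ioc_subset_Ioc_right hab)
    exact this.measurable
  -- Both ξ and ξ + ζ are joined to the same point at height r = ‖ζ‖, the first obliquely and the
  -- second vertically. The squared lengths of the directions are at most 4 and 1, whence 20 = 2·(4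
  -- + 1)·2.
  have hinc : ∀ ζ : F, ζ ≠ 0 → ∫⁻ ξ, ‖u (L (ξ + ζ)) - u (L ξ)‖ₑ ^ 2
      ≤ ENNReal.ofReal (20 * ‖ζ‖ ^ (1 / 2 : ℝ)) * B ‖ζ‖ := by
    intro ζ hζ
    set r := ‖ζ‖ with hr
    have hr0 : 0 < r := norm_pos_iff.2 hζ
    set θ : F := r⁻¹ • ζ with hθ
    have hrθ : r • θ = ζ := by rw [hθ, smul_smul, mul_inv_cancel₀ hr0.ne', one_smul]
    have hθn : ‖θ‖ = 1 := by rw [hθ, norm_smul, norm_inv, norm_norm, inv_mul_cancel₀ hr0.ne']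
    have h1 := hu.lintegral_increment_le hn L hL hdim θ hr0
    have h2 := hu.lintegral_increment_le hn L hL hdim 0 hr0
    have ha : ‖L θ + n‖ₑ ≤ 2 := by
      refine (enorm_add_le _ _).trans (le_of_eq ?_)
      rw [← ofReal_norm, ← ofReal_norm, L.norm_map, hθn, hn, ← ENNReal.ofReal_add] <;> norm_num
    have hb : ‖L 0 + n‖ₑ = 1 := by rw [map_zero, zero_add, ← ofReal_norm, hn]; simp
    rw [hb, one_pow, one_mul] at h2
    rw [← lintegral_add_right_eq_self _ ζ] at h2
    have hp : ∀ ξ, ‖u (L (ξ + ζ)) - u (L ξ)‖ₑ ^ 2 ≤ 2 * ‖u (L ξ + r • (L θ + n)) - u (L ξ)‖ₑ ^ 2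
        + 2 * ‖u (L (ξ + ζ) + r • (L 0 + n)) - u (L (ξ + ζ))‖ₑ ^ 2 := by
      intro ξ
      have e : L ξ + r • (L θ + n) = L (ξ + ζ) + r • (L 0 + n) := by
        rw [map_zero, zero_add, smul_add, ← map_smul, hrθ, map_add, add_assoc]
      rw [← mul_add]
      have h3 := ENNReal.add_sq_le_two_mul ‖u (L ξ + r • (L θ + n)) - u (L ξ)‖ₑ
        ‖u (L (ξ + ζ) + r • (L 0 + n)) - u (L (ξ + ζ))‖ₑ
      rw [← mul_add] at h3
      refine (pow_le_pow_left₀ zero_le ?_ 2).trans h3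
      rw [← e]
      have : u (L (ξ + ζ)) - u (L ξ) = (u (L ξ + r • (L θ + n)) - u (L ξ))
        - (u (L ξ + r • (L θ + n)) - u (L (ξ + ζ))) := by abel
      rw [this]
      exact enorm_sub_le
    have hcu := hu.continuous
    calc _ ≤ _ := lintegral_mono hp
      _ = 2 * (∫⁻ ξ, ‖u (L ξ + r • (L θ + n)) - u (L ξ)‖ₑ ^ 2)
          + 2 * ∫⁻ ξ, ‖u (L (ξ + ζ) + r • (L 0 + n)) - u (L (ξ + ζ))‖ₑ ^ 2 := by
          have hm : Measurable fun ξ => ‖u (L ξ + r • (L θ + n)) - u (L ξ)‖ₑ ^ 2 :=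
            (by fun_prop : Continuous fun ξ =>
              u (L ξ + r • (L θ + n)) - u (L ξ)).measurable.enorm.pow_const 2
          rw [lintegral_add_left (hm.const_mul 2), lintegral_const_mul' _ _ ENNReal.ofNat_ne_top,
            lintegral_const_mul' _ _ ENNReal.ofNat_ne_top]
      _ ≤ 2 * (2 ^ 2 * ENNReal.ofReal (2 * r ^ (1 / 2 : ℝ)) * B r)
          + 2 * (ENNReal.ofReal (2 * r ^ (1 / 2 : ℝ)) * B r) := by
          refine add_le_add (mul_le_mul_right (h1.trans ?_) _) (mul_le_mul_right h2 _)
          gcongr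
      _ = 10 * ENNReal.ofReal (2 * r ^ (1 / 2 : ℝ)) * B r := by ring
      _ = _ := by
          rw [← ENNReal.ofReal_ofNat, ← ENNReal.ofReal_mul (by norm_num)]
          congr 2
          ring
  set m := Module.finrank ℝ F with hm
  have hm0 : 0 < m := Module.finrank_pos
  calc _ ≤ ∫⁻ ζ : F, (fun r : ℝ => ENNReal.ofReal (r ^ (-((m : ℝ) + 1))) *
        (ENNReal.ofReal (20 * r ^ (1 / 2 : ℝ)) * B r)) ‖ζ‖ := by
        refine lintegral_mono fun ζ => ?_
        by_cases hζ : ζ = 0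
        · simp [hζ]
        · have hr0 : 0 < ‖ζ‖ := norm_pos_iff.2 hζ
          simp only [div_eq_mul_inv]
          rw [lintegral_mul_const', mul_comm]
          · refine mul_le_mul' (le_of_eq ?_) (hinc ζ hζ)
            rw [← ofReal_norm, ENNReal.ofReal_rpow_of_pos hr0,
              ← ENNReal.ofReal_inv_of_pos (by positivity), ← Real.rpow_neg hr0.le, hdim]
            push_cast
            rfl
          · refine ENNReal.inv_ne_top.2 ?_
            rw [ne_eq, ENNReal.rpow_eq_zero_iff]
            simp [hζ, hdim]
    _ ≤ P * ∫⁻ r in Ioi (0 : ℝ), ENNReal.ofReal (r ^ (m - 1)) *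
          (ENNReal.ofReal (r ^ (-((m : ℝ) + 1))) *
            (ENNReal.ofReal (20 * r ^ (1 / 2 : ℝ)) * B r)) := hP _ (by fun_prop)
    _ = P * ∫⁻ r in Ioi (0 : ℝ), 20 * (ENNReal.ofReal (r ^ (-1 - (1 / 2 : ℝ))) * B r) := by
        congr 1
        refine setLIntegral_congr_fun measurableSet_Ioi fun r hr => ?_
        have hr0 : 0 < r := hr
        rw [← mul_assoc, ← mul_assoc, ← mul_assoc, ← ENNReal.ofReal_mul (by positivity),
          ← ENNReal.ofReal_mul (by positivity), ← ENNReal.ofReal_ofNat,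
          ← ENNReal.ofReal_mul (by positivity)]
        congr 2
        rw [← Real.rpow_natCast, Nat.cast_sub hm0, mul_left_comm, ← Real.rpow_add hr0,
          ← Real.rpow_add hr0]
        congr 2
        push_cast
        ring
    -- After Tonelli the integral of r^(-3/2) over [s, ∞) is 2s^(-1/2), which cancels the factor
    -- s^(1/2) in g.
    _ = P * (20 * ∫⁻ s in Ioi (0 : ℝ), g s * ∫⁻ r in Ici s, ENNReal.ofReal (r ^ (-1 - (1 / 2 : ℝ)))) := by
        rw [lintegral_const_mul' _ _ ENNReal.ofNat_ne_top,
          lintegral_triangle (by fun_prop) hgm]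
    _ = P * (20 * ∫⁻ s in Ioi (0 : ℝ), 2 * A s) := by
        congr 2
        refine setLIntegral_congr_fun measurableSet_Ioi fun s hs => ?_
        have hs0 : 0 < s := hs
        simp only [hg]
        rw [lintegral_Ici_rpow (by norm_num) hs0, mul_right_comm,
          ofReal_rpow_mul_ofReal hs0 (by norm_num) (d := 0) (by norm_num)]
        norm_num
    _ ≤ P * (20 * (2 * (c * ∫⁻ x in {x | 0 < inner ℝ n x}, ‖fderiv ℝ u x‖ₑ ^ 2))) := by
        rw [lintegral_const_mul' _ _ ENNReal.ofNat_ne_top]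
        gcongr
        exact hc _ hfd
    _ = _ := by push_cast; ring

/-- The mean square of the trace on a hyperplane. -/
theorem exists_lintegral_trace_sq_le {n : E} (hn : ‖n‖ = 1)
    (L : F →ₗᵢ[ℝ] E) (hL : ∀ ξ, inner ℝ n (L ξ) = 0)
    (hdim : Module.finrank ℝ E = Module.finrank ℝ F + 1) (M : ℝ) :
    ∃ C : ℝ≥0, ∀ (K : ℝ≥0) (u : E → E), LipschitzWith K u → (∀ x, M ≤ ‖x‖ → u x = 0) →
      ∫⁻ ξ, ‖u (L ξ)‖ₑ ^ 2 ≤ C * ∫⁻ x in {x | 0 < inner ℝ n x}, ‖fderiv ℝ u x‖ₑ ^ 2 := by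
  obtain ⟨c, hc⟩ := exists_lintegral_slices_le hn L hL hdim
  -- At height r the function vanishes, so its boundary value is an increment; the 1 keeps r
  -- positive.
  set r := max M 1 with hr
  have hr0 : 0 < r := lt_max_of_lt_right one_pos
  refine ⟨Real.toNNReal (2 * r ^ (1 / 2 : ℝ)) * (Real.toNNReal (r ^ (1 / 2 : ℝ)) * c),
    fun K u hu hu0 => ?_⟩
  have hfd : Measurable fun x => ‖fderiv ℝ u x‖ₑ ^ 2 := (measurable_fderiv ℝ u).enorm.pow_const 2
  have h := hu.lintegral_increment_le hn L hL hdim 0 hr0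
  have hz : ∀ ξ, u (L ξ + r • (L 0 + n)) = 0 := fun ξ => by
    refine hu0 _ ((le_max_left M 1).trans ?_)
    have h1 : (inner ℝ n (L ξ + r • (L 0 + n)) : ℝ) = r := by
      rw [map_zero, zero_add, inner_add_right, hL, inner_smul_right, real_inner_self_eq_norm_sq, hn]
      simp
    have h2 := real_inner_le_norm n (L ξ + r • (L 0 + n))
    rw [h1, hn, one_mul] at h2
    exact h2
  have hb : ‖L 0 + n‖ₑ = 1 := by rw [map_zero, zero_add, ← ofReal_norm, hn]; simp
  simp only [hz, zero_sub, enorm_neg, hb, one_pow, one_mul] at h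
  refine h.trans ?_
  push_cast
  rw [mul_assoc, mul_assoc]
  refine mul_le_mul_right ?_ _
  calc _ ≤ ∫⁻ s in Ioc 0 r, ENNReal.ofReal (r ^ (1 / 2 : ℝ)) *
          ∫⁻ ξ, ‖fderiv ℝ u (L ξ + s • n)‖ₑ ^ 2 := by
        refine setLIntegral_mono' measurableSet_Ioc fun s hs => ?_
        gcongr
        exacts [hs.1.le, hs.2]
    _ ≤ ENNReal.ofReal (r ^ (1 / 2 : ℝ)) * ∫⁻ s in Ioi (0 : ℝ),
          ∫⁻ ξ, ‖fderiv ℝ u (L ξ + s • n)‖ₑ ^ 2 := by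
        rw [lintegral_const_mul' _ _ ENNReal.ofReal_ne_top]
        gcongr
        exact Ioc_subset_Ioi_self
    _ ≤ _ := mul_le_mul_right (hc _ hfd) _

end HyperplaneTrace

/-! ### Graph domains -/

/-- Absorption of half of the left side, legitimate only because that side is finite. -/
theorem ENNReal.le_two_mul_of_le_add_half {I a : ℝ≥0∞} (hI : I ≠ ⊤) (h : I ≤ a + 2⁻¹ * I) :
    I ≤ 2 * a := by
  by_cases ha : a = ⊤
  · simp [ha]
  lift I to ℝ≥0 using hI
  lift a to ℝ≥0 using ha
  have e : (2⁻¹ : ℝ≥0∞) = ((2⁻¹ : ℝ≥0) : ℝ≥0∞) := by simp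
  rw [e] at h
  have h' : I ≤ a + 2⁻¹ * I := by exact_mod_cast h
  have : I ≤ 2 * a := by
    rw [← NNReal.coe_le_coe] at h' ⊢
    push_cast at h' ⊢
    linarith
  exact_mod_cast this

section Shear

variable {E : Type*} [NormedAddCommGroup E] [InnerProductSpace ℝ E]

/-- Translation in the direction `n` by the amount `g`. -/
def shear (n : E) (g : E → ℝ) (x : E) : E := x + g x • n

variable {n : E} {g : E → ℝ} {η : ℝ≥0}

theorem lipschitzWith_shear (hn : ‖n‖ = 1) (hg : LipschitzWith η g) :
    LipschitzWith (1 + η) (shear n g) := by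
  refine LipschitzWith.id.add (LipschitzWith.of_dist_le_mul fun x y => ?_)
  rw [dist_eq_norm, ← sub_smul, norm_smul, hn, mul_one, ← dist_eq_norm]
  exact hg.dist_le_mul x y

theorem shear_neg_shear (hgn : ∀ x (s : ℝ), g (x + s • n) = g x) (x : E) :
    shear n (-g) (shear n g x) = x := by
  simp [shear, hgn]

theorem antilipschitzWith_shear (hn : ‖n‖ = 1) (hg : LipschitzWith η g)
    (hgn : ∀ x (s : ℝ), g (x + s • n) = g x) : AntilipschitzWith (1 + η) (shear n g) :=
  (lipschitzWith_shear hn hg.neg).to_rightInverse (shear_neg_shear hgn)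

theorem inner_shear (hn : ‖n‖ = 1) (x : E) :
    (inner ℝ n (shear n g x) : ℝ) = inner ℝ n x + g x := by
  rw [shear, inner_add_right, inner_smul_right, real_inner_self_eq_norm_sq, hn]
  ring

variable [FiniteDimensional ℝ E] [MeasurableSpace E] [BorelSpace E]

/-- By the chain rule the derivative D of the sheared field is B + W, with B the derivative of v at
the sheared point and ‖W‖ ≤ η‖B‖ ≤ 2η‖D‖. Symmetrising W doubles the error. -/
theorem enorm_symDeriv_comp_shear_le (hn : ‖n‖ = 1) (hg : LipschitzWith η g) (hη : η ≤ 1 / 2)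
    {v : E → E} (hv : Differentiable ℝ v) {x : E} (hx : DifferentiableAt ℝ g x) :
    ‖symDeriv (v ∘ shear n g) x‖ₑ
      ≤ ‖symDeriv v (shear n g x)‖ₑ + (4 * η : ℝ≥0) * ‖fderiv ℝ (v ∘ shear n g) x‖ₑ := by
  set B := fderiv ℝ v (shear n g x) with hB
  set D := fderiv ℝ (v ∘ shear n g) x with hD
  set G := fderiv ℝ g x with hG
  have hGn : ‖G‖ ≤ η := norm_fderiv_le_of_lipschitz ℝ hg
  have hsh : HasFDerivAt (shear n g) (ContinuousLinearMap.id ℝ E + G.smulRight n) x :=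
    (hasFDerivAt_id x).add (hx.hasFDerivAt.smul_const n)
  have hDB : D = B + B ∘L G.smulRight n := by
    have := ((hv _).hasFDerivAt.comp x hsh).fderiv
    rw [hD, this, ContinuousLinearMap.comp_add, ContinuousLinearMap.comp_id]
  set W := B ∘L G.smulRight n with hW
  have hWn : ‖W‖ ≤ η * ‖B‖ := by
    refine (ContinuousLinearMap.opNorm_comp_le _ _).trans ?_
    rw [ContinuousLinearMap.norm_smulRight_apply, hn, mul_one, mul_comm]
    gcongr
  have hη' : (η : ℝ) ≤ 1 / 2 := by exact_mod_cast hη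
  have hBn : ‖B‖ ≤ 2 * ‖D‖ := by
    have h1 : ‖B‖ ≤ ‖D‖ + ‖W‖ := by
      have : B = D - W := by rw [hDB]; abel
      calc ‖B‖ = ‖D - W‖ := by rw [← this]
        _ ≤ _ := norm_sub_le _ _
    nlinarith [norm_nonneg B]
  have key : ‖symDeriv (v ∘ shear n g) x‖ ≤ ‖symDeriv v (shear n g x)‖ + (4 * η) * ‖D‖ := by
    have e : symDeriv (v ∘ shear n g) x = symDeriv v (shear n g x) + (W + W.adjoint) := by
      rw [symDeriv, symDeriv, ← hD, ← hB, hDB, map_add]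
      abel
    rw [e]
    refine (norm_add_le _ _).trans (add_le_add_right ((norm_add_le _ _).trans ?_) _)
    rw [LinearIsometryEquiv.norm_map]
    nlinarith [η.coe_nonneg]
  simp only [← ofReal_norm]
  rw [← ENNReal.ofReal_coe_nnreal, ← ENNReal.ofReal_mul (by positivity),
    ← ENNReal.ofReal_add (norm_nonneg _) (by positivity)]
  exact ENNReal.ofReal_le_ofReal (by exact_mod_cast key)

/-- The finiteness that permits the absorption in Korn's inequality above a graph. -/
theorem LipschitzWith.lintegral_enorm_fderiv_sq_ne_top {K : ℝ≥0} {u : E → E}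
    (hu : LipschitzWith K u) (hu' : HasCompactSupport u) (S : Set E) :
    ∫⁻ x in S, ‖fderiv ℝ u x‖ₑ ^ 2 ≠ ⊤ := by
  have h : ∫⁻ x in S, ‖fderiv ℝ u x‖ₑ ^ 2
      ≤ ∫⁻ x, (tsupport u).indicator (fun _ => (K : ℝ≥0∞) ^ 2) x := by
    refine (setLIntegral_le_lintegral _ _).trans (lintegral_mono fun x => ?_)
    by_cases hx : x ∈ tsupport u
    · rw [indicator_of_mem hx]
      gcongr
      have := norm_fderiv_le_of_lipschitz (x₀ := x) ℝ hu
      rw [enorm_eq_nnnorm]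
      exact_mod_cast this
    · have : fderiv ℝ u x = 0 :=
        image_eq_zero_of_notMem_tsupport fun h => hx (tsupport_fderiv_subset ℝ h)
      simp [this]
  refine ne_top_of_le_ne_top ?_ h
  rw [lintegral_indicator_const (isClosed_tsupport u).measurableSet]
  exact ENNReal.mul_ne_top (by finiteness) hu'.isCompact.measure_lt_top.ne

theorem map_volume_le_of_antilipschitzWith {K : ℝ≥0} {f : E → E} (hf : AntilipschitzWith K f)
    (hm : Measurable f) :
    (volume : Measure E).map f ≤ ((K : ℝ≥0∞) ^ Module.finrank ℝ E) • volume := by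
  have h := hf.map_euclideanHausdorffMeasure_le hm (Module.finrank ℝ E)
  rwa [InnerProductSpace.euclideanHausdorffMeasure_eq_volume] at h

/-- Korn's inequality above a graph of small slope, in the coordinates which flatten the graph. -/
theorem exists_korn_graph (hn : ‖n‖ = 1) :
    ∃ η : ℝ≥0, 0 < η ∧ η ≤ 1 ∧ ∃ C : ℝ≥0, ∀ g : E → ℝ, LipschitzWith η g →
      (∀ x (s : ℝ), g (x + s • n) = g x) → ∀ v : E → E, ContDiff ℝ 1 v → HasCompactSupport v →
      (∃ K, LipschitzWith K (v ∘ shear n g)) ∧ HasCompactSupport (v ∘ shear n g) ∧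
      ∫⁻ x in {x | 0 < inner ℝ n x}, ‖fderiv ℝ (v ∘ shear n g) x‖ₑ ^ 2
        ≤ C * ∫⁻ x in {x | g x < inner ℝ n x}, ‖symDeriv v x‖ₑ ^ 2 := by
  obtain ⟨C, hC⟩ := exists_korn_halfSpace hn
  -- Chosen so that Cη and η are both at most 1/8, whence C·2(4η)² ≤ 1/2 and the gradient term can
  -- be absorbed.
  set η : ℝ≥0 := 1 / (8 * (C + 1)) with hη
  have hη8 : η ≤ 1 / 8 := by
    rw [hη]
    refine one_div_le_one_div_of_le (by norm_num) ?_
    exact le_mul_of_one_le_right zero_le (by simp)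
  have hη0 : 0 < η := by rw [hη]; positivity
  have hηC : C * (2 * (4 * η) ^ 2) ≤ 2⁻¹ := by
    have h1 : η * (8 * (C + 1)) = 1 := by rw [hη]; field_simp
    have h2 : (η : ℝ) * (8 * (C + 1)) = 1 := by exact_mod_cast h1
    rw [← NNReal.coe_le_coe]
    push_cast
    have h3 : (η : ℝ) * C ≤ 1 / 8 := by nlinarith [η.coe_nonneg]
    have h4 : (η : ℝ) ≤ 1 / 8 := by exact_mod_cast hη8
    nlinarith [η.coe_nonneg, C.coe_nonneg, mul_le_mul h3 h4 η.coe_nonneg (by norm_num)]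
  refine ⟨η, hη0, hη8.trans (by rw [← NNReal.coe_le_coe]; push_cast; norm_num),
    2 * (C * (2 * 2 ^ Module.finrank ℝ E)),
    fun g hg hgn v hv hv' => ?_⟩
  obtain ⟨Kv, hKv⟩ := hv.lipschitzWith_of_hasCompactSupport hv' one_ne_zero
  have hsl := lipschitzWith_shear hn hg
  have hu := hKv.comp hsl
  have hu' : HasCompactSupport (v ∘ shear n g) := by
    refine HasCompactSupport.intro (hv'.isCompact.image
      (lipschitzWith_shear hn hg.neg).continuous) fun x hx => ?_
    exact image_eq_zero_of_notMem_tsupport (f := v) fun h => hx ⟨_, h, shear_neg_shear hgn x⟩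
  refine ⟨⟨_, hu⟩, hu', ?_⟩
  set I := ∫⁻ x in {x | 0 < inner ℝ n x}, ‖fderiv ℝ (v ∘ shear n g) x‖ₑ ^ 2 with hI
  set J := ∫⁻ x in {x | 0 < inner ℝ n x}, ‖symDeriv v (shear n g x)‖ₑ ^ 2 with hJ
  have hsm := hsl.continuous.measurable
  have hJm : Measurable fun x => ‖symDeriv v x‖ₑ ^ 2 := (measurable_symDeriv v).enorm.pow_const 2
  have hT : MeasurableSet {x : E | g x < (inner ℝ n x : ℝ)} :=
    measurableSet_lt hg.continuous.measurable (by fun_prop)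
  -- The shear carries the half space onto the region above the graph and is antilipschitz with
  -- constant 1 + η ≤ 2.
  have hJle : J ≤ 2 ^ Module.finrank ℝ E * ∫⁻ x in {x | g x < inner ℝ n x}, ‖symDeriv v x‖ₑ ^ 2 := by
    have hpre : {x : E | 0 < (inner ℝ n x : ℝ)} = shear n g ⁻¹' {x | g x < inner ℝ n x} := by
      ext x
      simp only [mem_ofPred_eq, mem_preimage, inner_shear hn]
      have : g (shear n g x) = g x := hgn _ _
      rw [this]
      constructor <;> intro h <;> linarith
    rw [hJ, hpre, ← setLIntegral_map hT hJm hsm]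
    have hle := map_volume_le_of_antilipschitzWith (antilipschitzWith_shear hn hg hgn) hsm
    calc _ ≤ ∫⁻ x in {x | g x < inner ℝ n x}, ‖symDeriv v x‖ₑ ^ 2
          ∂((((1 + η : ℝ≥0) : ℝ≥0∞) ^ Module.finrank ℝ E) • (volume : Measure E)) :=
          lintegral_mono' (Measure.restrict_mono le_rfl hle) le_rfl
      _ = ((1 + η : ℝ≥0) : ℝ≥0∞) ^ Module.finrank ℝ E *
          ∫⁻ x in {x | g x < inner ℝ n x}, ‖symDeriv v x‖ₑ ^ 2 := by
          rw [Measure.restrict_smul, lintegral_smul_measure, smul_eq_mul]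
      _ ≤ _ := by
          gcongr
          have : 1 + η ≤ 2 := by
            calc 1 + η ≤ 1 + 1 / 8 := by gcongr
              _ ≤ 2 := by rw [← NNReal.coe_le_coe]; push_cast; norm_num
          exact_mod_cast this
  have hineq : I ≤ C * (2 * J) + 2⁻¹ * I := by
    calc I ≤ C * ∫⁻ x in {x | 0 < inner ℝ n x}, ‖symDeriv (v ∘ shear n g) x‖ₑ ^ 2 :=
          hC _ _ hu hu'
      _ ≤ C * ∫⁻ x in {x | 0 < inner ℝ n x}, (2 * ‖symDeriv v (shear n g x)‖ₑ ^ 2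
            + ((2 * (4 * η) ^ 2 : ℝ≥0) : ℝ≥0∞) * ‖fderiv ℝ (v ∘ shear n g) x‖ₑ ^ 2) := by
          refine mul_le_mul_right (lintegral_mono_ae (ae_restrict_of_ae ?_)) _
          filter_upwards [hg.ae_differentiableAt (μ := (volume : Measure E))] with x hx
          refine (pow_le_pow_left₀ zero_le (enorm_symDeriv_comp_shear_le hn hg
            (hη8.trans (by
              rw [← NNReal.coe_le_coe]; push_cast; norm_num))
              (hv.differentiable one_ne_zero) hx) 2).trans
              ((ENNReal.add_sq_le_two_mul _ _).trans (le_of_eq ?_))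
          push_cast
          ring
      _ = C * (2 * J) + (C * (2 * (4 * η) ^ 2) : ℝ≥0) * I := by
          have hm : Measurable fun x => ‖symDeriv v (shear n g x)‖ₑ ^ 2 := hJm.comp hsm
          rw [lintegral_add_left (hm.const_mul 2),
            lintegral_const_mul' _ _ ENNReal.ofNat_ne_top,
            lintegral_const_mul' _ _ ENNReal.coe_ne_top]
          push_cast
          ring
      _ ≤ _ := by
          gcongr
          have : ((2⁻¹ : ℝ≥0) : ℝ≥0∞) = 2⁻¹ := by simp
          rw [← this]
          exact_mod_cast hηC
  have hfin := ENNReal.le_two_mul_of_le_add_half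
    (hu.lintegral_enorm_fderiv_sq_ne_top hu' _) hineq
  refine hfin.trans ?_
  calc _ ≤ 2 * (C * (2 * (2 ^ Module.finrank ℝ E *
        ∫⁻ x in {x | g x < inner ℝ n x}, ‖symDeriv v x‖ₑ ^ 2))) := by gcongr
    _ = _ := by push_cast; ring

end Shear

/-! ### Traces on graphs -/

section GraphTrace

variable {E F : Type*} [NormedAddCommGroup E] [InnerProductSpace ℝ E] [FiniteDimensional ℝ E]
  [MeasurableSpace E] [BorelSpace E] [NormedAddCommGroup F] [InnerProductSpace ℝ F]
  [FiniteDimensional ℝ F] [MeasurableSpace F] [BorelSpace F]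
  {n : E} {g : E → ℝ} {η : ℝ≥0} {L : F →ₗᵢ[ℝ] E} {S : Set E}

theorem norm_le_norm_add_smul (hL : ∀ ξ, inner ℝ n (L ξ) = 0) (ξ : F) (t : ℝ) :
    ‖ξ‖ ≤ ‖L ξ + t • n‖ := by
  have h : ‖L ξ + t • n‖ * ‖L ξ + t • n‖ = ‖L ξ‖ * ‖L ξ‖ + ‖t • n‖ * ‖t • n‖ :=
    norm_add_sq_eq_norm_sq_add_norm_sq_of_inner_eq_zero _ _ (by
      rw [inner_smul_right, real_inner_comm, hL, mul_zero])
  rw [L.norm_map] at h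
  nlinarith [norm_nonneg ξ, norm_nonneg (L ξ + t • n), norm_nonneg (t • n)]

theorem enorm_sub_le_enorm_shear_sub (hL : ∀ ξ, inner ℝ n (L ξ) = 0) (ξ ξ' : F) :
    ‖ξ - ξ'‖ₑ ≤ ‖shear n g (L ξ) - shear n g (L ξ')‖ₑ := by
  have h := norm_le_norm_add_smul hL (ξ - ξ') (g (L ξ) - g (L ξ'))
  have e : L (ξ - ξ') + (g (L ξ) - g (L ξ')) • n = shear n g (L ξ) - shear n g (L ξ') := by
    rw [shear, shear, map_sub, sub_smul]; abel
  rw [e] at h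
  rw [← ofReal_norm, ← ofReal_norm]
  exact ENNReal.ofReal_le_ofReal h

open Measure in
-- The graph is the image of the hyperplane under a map with Lipschitz constant 1 + η ≤ 2.
theorem hausdorffMeasure_restrict_graph_le (hn : ‖n‖ = 1) (hL : ∀ ξ, inner ℝ n (L ξ) = 0)
    (hdim : Module.finrank ℝ E = Module.finrank ℝ F + 1) (hη : η ≤ 1) (hg : LipschitzWith η g)
    (hgn : ∀ x (s : ℝ), g (x + s • n) = g x) (hS : ∀ x ∈ S, inner ℝ n x = g x) :
    (euclideanHausdorffMeasure (Module.finrank ℝ F)).restrict S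
      ≤ ((2 : ℝ≥0∞) ^ Module.finrank ℝ F) •
        (volume : Measure F).map (fun ξ => shear n g (L ξ)) := by
  have hl : LipschitzWith (1 + η) fun ξ : F => shear n g (L ξ) := by
    have := (lipschitzWith_shear hn hg).comp L.lipschitz
    rwa [mul_one] at this
  have hr : S ⊆ range fun ξ : F => shear n g (L ξ) := by
    intro x hx
    obtain ⟨p, hp⟩ := (bijective_add_smul hn L hL hdim).2 x
    refine ⟨p.1, ?_⟩
    have h1 : (inner ℝ n x : ℝ) = p.2 := by
      rw [← hp, inner_add_right, hL, inner_smul_right, real_inner_self_eq_norm_sq, hn]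
      simp
    have h2 : g (L p.1) = p.2 := by rw [← h1, hS x hx, ← hp, hgn]
    simp only [shear, h2]
    exact hp
  refine (hl.restrict_range_euclideanHausdorffMeasure_le hr _).trans ?_
  rw [InnerProductSpace.euclideanHausdorffMeasure_eq_volume]
  refine Measure.le_iff.2 fun s _ => ?_
  simp only [Measure.smul_apply, smul_eq_mul]
  gcongr
  have h : 1 + η ≤ 2 := by
    calc 1 + η ≤ 1 + 1 := by gcongr
      _ = 2 := by norm_num
  exact_mod_cast h

theorem lintegral_lintegral_le_of_le_smul_map {X Y : Type*} [MeasurableSpace X] [MeasurableSpace Y]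
    {μ : Measure Y} {ν : Measure X} [SFinite ν] {c : ℝ≥0∞} {ψ : X → Y} (hψ : Measurable ψ)
    (h : μ ≤ c • ν.map ψ) {k : Y → Y → ℝ≥0∞} (hk : Measurable fun q : Y × Y => k q.1 q.2) :
    ∫⁻ x, ∫⁻ y, k x y ∂μ ∂μ ≤ c * (c * ∫⁻ ξ, ∫⁻ ξ', k (ψ ξ) (ψ ξ') ∂ν ∂ν) := by
  have one : ∀ f : Y → ℝ≥0∞, Measurable f → ∫⁻ x, f x ∂μ ≤ c * ∫⁻ ξ, f (ψ ξ) ∂ν := fun f hf => by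
    refine (lintegral_mono' h le_rfl).trans (le_of_eq ?_)
    rw [lintegral_smul_measure, smul_eq_mul, lintegral_map hf hψ]
  have hm : Measurable fun x => ∫⁻ ξ', k x (ψ ξ') ∂ν :=
    Measurable.lintegral_prod_right' (f := fun q : Y × X => k q.1 (ψ q.2))
      (hk.comp (measurable_fst.prodMk (hψ.comp measurable_snd)))
  have hm' : Measurable fun ξ => ∫⁻ ξ', k (ψ ξ) (ψ ξ') ∂ν := hm.comp hψ
  have h1 : ∀ x, ∫⁻ y, k x y ∂μ ≤ c * ∫⁻ ξ', k x (ψ ξ') ∂ν := fun x =>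
    one _ (hk.comp (measurable_const.prodMk measurable_id))
  refine (lintegral_mono h1).trans ?_
  rw [lintegral_const_mul _ hm]
  exact mul_le_mul_right (one _ hm) _

open Measure in
-- Projection of the graph to the hyperplane does not increase distances, so flattening can only
-- enlarge the kernel; the substitution ξ' = ξ + ζ gives the translation form.
theorem lintegral_slobodeckij_graph_le [Nontrivial F] (hn : ‖n‖ = 1)
    (hL : ∀ ξ, inner ℝ n (L ξ) = 0)
    (hdim : Module.finrank ℝ E = Module.finrank ℝ F + 1) (hη : η ≤ 1) (hg : LipschitzWith η g)
    (hgn : ∀ x (s : ℝ), g (x + s • n) = g x) (hS : ∀ x ∈ S, inner ℝ n x = g x)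
    {v : E → E} (hv : Continuous v) {p : ℝ} (hp : 0 ≤ p) :
    ∫⁻ x in S, ∫⁻ y in S, ‖v x - v y‖ₑ ^ 2 / ‖x - y‖ₑ ^ p
        ∂(euclideanHausdorffMeasure (Module.finrank ℝ F))
        ∂(euclideanHausdorffMeasure (Module.finrank ℝ F))
      ≤ 2 ^ Module.finrank ℝ F * (2 ^ Module.finrank ℝ F * ∫⁻ ζ : F, ∫⁻ ξ : F,
        ‖(v ∘ shear n g) (L (ξ + ζ)) - (v ∘ shear n g) (L ξ)‖ₑ ^ 2 / ‖ζ‖ₑ ^ p) := by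
  have hψc : Continuous fun ξ : F => shear n g (L ξ) :=
    (lipschitzWith_shear hn hg).continuous.comp L.continuous
  have hkm : Measurable fun q : E × E => ‖v q.1 - v q.2‖ₑ ^ 2 / ‖q.1 - q.2‖ₑ ^ p := by
    have h1 : Measurable fun q : E × E => v q.1 - v q.2 :=
      (by fun_prop : Continuous fun q : E × E => v q.1 - v q.2).measurable
    have h2 : Measurable fun q : E × E => q.1 - q.2 :=
      (by fun_prop : Continuous fun q : E × E => q.1 - q.2).measurable
    exact (h1.enorm.pow_const 2).div (h2.enorm.pow_const p)
  refine (lintegral_lintegral_le_of_le_smul_map hψc.measurable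
    (hausdorffMeasure_restrict_graph_le hn hL hdim hη hg hgn hS)
    (k := fun x y => ‖v x - v y‖ₑ ^ 2 / ‖x - y‖ₑ ^ p) hkm).trans ?_
  refine mul_le_mul_right (mul_le_mul_right ?_ _) _
  set u : F → E := fun ξ => (v ∘ shear n g) (L ξ) with hu
  have huc : Continuous u := hv.comp hψc
  have hm : Measurable fun q : F × F => ‖u (q.1 + q.2) - u q.1‖ₑ ^ 2 / ‖q.2‖ₑ ^ p := by
    have h1 : Measurable fun q : F × F => u (q.1 + q.2) - u q.1 :=
      (by fun_prop : Continuous fun q : F × F => u (q.1 + q.2) - u q.1).measurable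
    exact (h1.enorm.pow_const 2).div (measurable_snd.enorm.pow_const p)
  have hsw : ∫⁻ ξ, ∫⁻ ζ, ‖u (ξ + ζ) - u ξ‖ₑ ^ 2 / ‖ζ‖ₑ ^ p
      = ∫⁻ ζ, ∫⁻ ξ, ‖u (ξ + ζ) - u ξ‖ₑ ^ 2 / ‖ζ‖ₑ ^ p :=
    lintegral_lintegral_swap hm.aemeasurable
  rw [← hsw]
  refine lintegral_mono fun ξ => ?_
  have htr := lintegral_add_left_eq_self (μ := (volume : Measure F))
    (fun ξ' => ‖u ξ' - u ξ‖ₑ ^ 2 / ‖ξ' - ξ‖ₑ ^ p) ξ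
  simp only [add_sub_cancel_left] at htr
  rw [htr]
  refine lintegral_mono fun ξ' => ?_
  have e1 : ‖v (shear n g (L ξ)) - v (shear n g (L ξ'))‖ₑ = ‖u ξ' - u ξ‖ₑ := by
    rw [← enorm_neg, neg_sub]; rfl
  have e2 : ‖ξ' - ξ‖ₑ ≤ ‖shear n g (L ξ) - shear n g (L ξ')‖ₑ := by
    rw [← enorm_neg, neg_sub]; exact enorm_sub_le_enorm_shear_sub hL ξ ξ'
  simp only [e1]
  exact ENNReal.div_le_div_left (ENNReal.rpow_le_rpow e2 hp) _

open Measure in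
/-- Trace estimate above a graph of small slope, in terms of the symmetrized derivative. -/
theorem exists_trace_graph [Nontrivial F] (hn : ‖n‖ = 1) (hL : ∀ ξ, inner ℝ n (L ξ) = 0)
    (hdim : Module.finrank ℝ E = Module.finrank ℝ F + 1) :
    ∃ η : ℝ≥0, 0 < η ∧ η ≤ 1 ∧ ∀ g : E → ℝ, LipschitzWith η g →
      (∀ x (s : ℝ), g (x + s • n) = g x) → ∀ M : ℝ, ∃ C : ℝ≥0, ∀ S : Set E,
      (∀ x ∈ S, inner ℝ n x = g x) → ∀ v : E → E, ContDiff ℝ 1 v → HasCompactSupport v →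
      (∀ x, M ≤ ‖x‖ → v x = 0) →
      (∫⁻ x in S, ∫⁻ y in S, ‖v x - v y‖ₑ ^ 2 / ‖x - y‖ₑ ^ (Module.finrank ℝ E : ℝ)
          ∂(euclideanHausdorffMeasure (Module.finrank ℝ F))
          ∂(euclideanHausdorffMeasure (Module.finrank ℝ F))
        ≤ C * ∫⁻ x in {x | g x < inner ℝ n x}, ‖symDeriv v x‖ₑ ^ 2) ∧
      (∫⁻ x in S, ‖v x‖ₑ ^ 2 ∂(euclideanHausdorffMeasure (Module.finrank ℝ F))
        ≤ C * ∫⁻ x in {x | g x < inner ℝ n x}, ‖symDeriv v x‖ₑ ^ 2) := by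
  obtain ⟨η, hη0, hη1, C, hC⟩ := exists_korn_graph hn
  obtain ⟨C₁, hC₁⟩ := exists_lintegral_trace_slobodeckij_le hn L hL hdim
  refine ⟨η, hη0, hη1, fun g hg hgn M => ?_⟩
  -- If the sheared point lies in the ball of radius M, then |g x| ≤ |g 0| + M because the slope is
  -- at most 1, so x itself lies in the ball of radius M + (|g 0| + M).
  obtain ⟨C₂, hC₂⟩ := exists_lintegral_trace_sq_le hn L hL hdim (M + (|g 0| + M))
  set m := Module.finrank ℝ F
  refine ⟨2 ^ m * (2 ^ m * (C₁ * C)) + 2 ^ m * (C₂ * C), fun S hS v hv hv' hM => ?_⟩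
  obtain ⟨⟨K, hK⟩, hu', hI⟩ := hC g hg hgn v hv hv'
  set J := ∫⁻ x in {x | g x < inner ℝ n x}, ‖symDeriv v x‖ₑ ^ 2
  constructor
  · refine (lintegral_slobodeckij_graph_le hn hL hdim hη1 hg hgn hS hv.continuous
      (Nat.cast_nonneg _)).trans ?_
    calc _ ≤ (2 : ℝ≥0∞) ^ m * (2 ^ m * (C₁ * (C * J))) := by
          gcongr
          exact (hC₁ K _ hK).trans (mul_le_mul_right hI _)
      _ = ((2 ^ m * (2 ^ m * (C₁ * C)) : ℝ≥0) : ℝ≥0∞) * J := by push_cast; ring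
      _ ≤ _ := by gcongr; exact le_self_add
  · have hz : ∀ x, M + (|g 0| + M) ≤ ‖x‖ → (v ∘ shear n g) x = 0 := fun x hx => by
      refine hM _ ?_
      by_contra h
      push Not at h
      have h1 : |g x| ≤ |g 0| + M := by
        have h2 : g x = g (shear n g x) := (hgn _ _).symm
        have h3 := hg.dist_le_mul (shear n g x) 0
        rw [Real.dist_eq, dist_zero_right, ← h2] at h3
        have h4 : (η : ℝ) ≤ 1 := by exact_mod_cast hη1
        have h5 := abs_sub_abs_le_abs_sub (g x) (g 0)
        nlinarith [norm_nonneg (shear n g x)]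
      have h6 : ‖x‖ ≤ ‖shear n g x‖ + |g x| := by
        have : x = shear n g x - g x • n := by simp [shear]
        calc ‖x‖ = ‖shear n g x - g x • n‖ := by rw [← this]
          _ ≤ ‖shear n g x‖ + ‖g x • n‖ := norm_sub_le _ _
          _ = _ := by rw [norm_smul, hn, mul_one, Real.norm_eq_abs]
      linarith
    have hμ := hausdorffMeasure_restrict_graph_le hn hL hdim hη1 hg hgn hS
    have hψc : Continuous fun ξ : F => shear n g (L ξ) :=
      (lipschitzWith_shear hn hg).continuous.comp L.continuous
    calc _ ≤ 2 ^ m * ∫⁻ ξ, ‖(v ∘ shear n g) (L ξ)‖ₑ ^ 2 := by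
          refine (lintegral_mono' hμ le_rfl).trans (le_of_eq ?_)
          rw [lintegral_smul_measure, smul_eq_mul,
            lintegral_map (hv.continuous.measurable.enorm.pow_const 2) hψc.measurable]
          rfl
      _ ≤ (2 : ℝ≥0∞) ^ m * (C₂ * (C * J)) := by
          gcongr
          exact (hC₂ K _ hK hz).trans (mul_le_mul_right hI _)
      _ = ((2 ^ m * (C₂ * C) : ℝ≥0) : ℝ≥0∞) * J := by push_cast; ring
      _ ≤ _ := by gcongr; exact le_add_self

open Measure in
/-- Upper Ahlfors regularity of a Lipschitz graph. -/
theorem exists_hausdorffMeasure_graph_ball_le (hn : ‖n‖ = 1) (hL : ∀ ξ, inner ℝ n (L ξ) = 0)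
    (hdim : Module.finrank ℝ E = Module.finrank ℝ F + 1) :
    ∃ C : ℝ≥0, ∀ (η : ℝ≥0) (g : E → ℝ), η ≤ 1 → LipschitzWith η g →
      (∀ x (s : ℝ), g (x + s • n) = g x) → ∀ S : Set E, (∀ x ∈ S, inner ℝ n x = g x) →
      ∀ (x : E) (r : ℝ), 0 < r →
        (euclideanHausdorffMeasure (Module.finrank ℝ F)).restrict S (Metric.closedBall x r)
          ≤ C * ENNReal.ofReal (r ^ Module.finrank ℝ F) := by
  set m := Module.finrank ℝ F
  have hfin : (volume : Measure F) (Metric.closedBall 0 1) ≠ ⊤ := measure_closedBall_lt_top.ne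
  refine ⟨2 ^ m * (2 ^ m * (volume (Metric.closedBall (0 : F) 1)).toNNReal),
    fun η g hη hg hgn S hS x r hr => ?_⟩
  have hψc : Continuous fun ξ : F => shear n g (L ξ) :=
    (lipschitzWith_shear hn hg).continuous.comp L.continuous
  have h1 := hausdorffMeasure_restrict_graph_le hn hL hdim hη hg hgn hS (Metric.closedBall x r)
  rw [Measure.smul_apply, Measure.map_apply hψc.measurable measurableSet_closedBall,
    smul_eq_mul] at h1
  refine h1.trans ?_
  set Q := (fun ξ : F => shear n g (L ξ)) ⁻¹' Metric.closedBall x r with hQ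
  have h2 : volume Q ≤ 2 ^ m * (ENNReal.ofReal (r ^ m) * volume (Metric.closedBall (0 : F) 1)) := by
    rcases Q.eq_empty_or_nonempty with h | ⟨ξ₀, hξ₀⟩
    · simp [h]
    have hsub : Q ⊆ Metric.closedBall ξ₀ (2 * r) := fun ξ hξ => by
      have h3 := norm_le_norm_add_smul hL (ξ - ξ₀) (g (L ξ) - g (L ξ₀))
      have e : L (ξ - ξ₀) + (g (L ξ) - g (L ξ₀)) • n = shear n g (L ξ) - shear n g (L ξ₀) := by
        rw [shear, shear, map_sub, sub_smul]; abel
      rw [e, ← dist_eq_norm, ← dist_eq_norm] at h3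
      have h4 := dist_triangle_right (shear n g (L ξ)) (shear n g (L ξ₀)) x
      have h5 : dist (shear n g (L ξ)) x ≤ r := hξ
      have h6 : dist (shear n g (L ξ₀)) x ≤ r := hξ₀
      rw [Metric.mem_closedBall]
      linarith
    refine (measure_mono hsub).trans (le_of_eq ?_)
    rw [Measure.addHaar_closedBall' _ _ (by positivity), mul_pow,
      ENNReal.ofReal_mul (by positivity), mul_assoc]
    congr 1
    rw [ENNReal.ofReal_pow (by norm_num), ENNReal.ofReal_ofNat]
  calc _ ≤ 2 ^ m * (2 ^ m * (ENNReal.ofReal (r ^ m) * volume (Metric.closedBall (0 : F) 1))) :=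
        mul_le_mul_right h2 _
    _ = _ := by
        push_cast
        rw [ENNReal.coe_toNNReal hfin]
        ring

end GraphTrace

/-! ### Level sets as graphs -/

section LevelSet

variable {E : Type*} [NormedAddCommGroup E] [InnerProductSpace ℝ E] [FiniteDimensional ℝ E]

theorem lipschitzWith_sub_inner_smul {n : E} (hn : ‖n‖ = 1) :
    LipschitzWith 1 fun x : E => x - (inner ℝ n x : ℝ) • n := by
  refine LipschitzWith.of_dist_le_mul fun x y => ?_
  rw [dist_eq_norm, dist_eq_norm, NNReal.coe_one, one_mul]
  have e : x - (inner ℝ n x : ℝ) • n - (y - (inner ℝ n y : ℝ) • n)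
      = (x - y) - (inner ℝ n (x - y) : ℝ) • n := by rw [inner_sub_right, sub_smul]; abel
  rw [e]
  have h := norm_sub_sq_real (x - y) ((inner ℝ n (x - y) : ℝ) • n)
  rw [inner_smul_right, real_inner_comm n (x - y), norm_smul, hn, mul_one, Real.norm_eq_abs, sq_abs] at h
  refine le_of_sq_le_sq ?_ (norm_nonneg _)
  nlinarith [sq_nonneg (inner ℝ n (x - y) : ℝ)]

/-- Near a regular point, the zero set of a function is a graph of small slope, and the function is
positive above it. -/
theorem exists_graph_of_hasStrictFDerivAt {ρ : E → ℝ} {ρ' : E →L[ℝ] ℝ} {x₀ : E}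
    (h : HasStrictFDerivAt ρ ρ' x₀) (hρ : Continuous ρ) (h0 : ρ x₀ = 0) (hρ' : ρ' ≠ 0) :
    ∃ n : E, ‖n‖ = 1 ∧ ∀ η : ℝ≥0, 0 < η → ∃ g : E → ℝ, LipschitzWith η g ∧
      (∀ x (s : ℝ), g (x + s • n) = g x) ∧ ∃ R > 0, ∀ y ∈ Metric.ball x₀ R,
        (ρ y = 0 → inner ℝ n y = g y) ∧ (g y < inner ℝ n y → 0 < ρ y) := by
  set v := (InnerProductSpace.toDual ℝ E).symm ρ' with hv
  have hv0 : v ≠ 0 := fun h => hρ' ((LinearIsometryEquiv.map_eq_zero_iff _).1 h)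
  set k := ‖v‖ with hk
  have hk0 : 0 < k := norm_pos_iff.2 hv0
  set n : E := k⁻¹ • v with hn
  have hn1 : ‖n‖ = 1 := by rw [hn, norm_smul, norm_inv, norm_norm, inv_mul_cancel₀ hk0.ne']
  have hρn : ∀ x, ρ' x = k * inner ℝ n x := fun x => by
    rw [hn, inner_smul_left, hv]
    simp only [conj_trivial]
    rw [mul_inv_cancel_left₀ hk0.ne', InnerProductSpace.toDual_symm_apply]
  refine ⟨n, hn1, fun η hη => ?_⟩
  -- The error allowed in the linear approximation: c ≤ k/2 keeps ρ increasing along n, and c ≤ ηk/2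
  -- gives the slope η.
  set c : ℝ≥0 := ⟨k, hk0.le⟩ * min (1 / 2) (η / 2) with hc
  have hc0 : 0 < c := mul_pos hk0 (lt_min (by norm_num) (by positivity))
  have hck : (c : ℝ) ≤ k / 2 := by
    have : (min (1 / 2) (η / 2) : ℝ≥0) ≤ 1 / 2 := min_le_left _ _
    have h' : ((min (1 / 2) (η / 2) : ℝ≥0) : ℝ) ≤ 1 / 2 := by exact_mod_cast this
    have e : (c : ℝ) = k * ((min (1 / 2) (η / 2) : ℝ≥0) : ℝ) := rfl
    rw [e]; nlinarith
  have hcη : (c : ℝ) ≤ η * (k / 2) := by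
    have : (min (1 / 2) (η / 2) : ℝ≥0) ≤ η / 2 := min_le_right _ _
    have h' : ((min (1 / 2) (η / 2) : ℝ≥0) : ℝ) ≤ η / 2 := by exact_mod_cast this
    have e : (c : ℝ) = k * ((min (1 / 2) (η / 2) : ℝ≥0) : ℝ) := rfl
    rw [e]; nlinarith
  obtain ⟨s, hs, happ⟩ := h.approximates_deriv_on_nhds (Or.inr hc0)
  obtain ⟨R', hR'0, hR's⟩ := Metric.mem_nhds_iff.1 hs
  have happ' : ∀ y ∈ Metric.ball x₀ R', ∀ y' ∈ Metric.ball x₀ R',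
      |ρ y - ρ y' - k * inner ℝ n (y - y')| ≤ c * ‖y - y'‖ := fun y hy y' hy' => by
    have := happ y (hR's hy) y' (hR's hy')
    rwa [hρn, Real.norm_eq_abs] at this
  set Q : E → E := fun x => x - (inner ℝ n x : ℝ) • n with hQ
  set Z : Set E := {y | ρ y = 0} ∩ Metric.ball x₀ R' with hZ
  -- Two zeros satisfy k|⟨n, y - y'⟩| ≤ c‖y - y'‖. Splitting y - y' into tangential and normal parts
  -- and absorbing the normal part gives a cone condition.
  have hZlip : ∀ y ∈ Z, ∀ y' ∈ Z, |(inner ℝ n y : ℝ) - inner ℝ n y'| ≤ η * ‖Q y - Q y'‖ := by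
    intro y hy y' hy'
    have h1 := happ' y hy.2 y' hy'.2
    have hy0 : ρ y = 0 := hy.1
    have hy0' : ρ y' = 0 := hy'.1
    rw [hy0, hy0', sub_zero, zero_sub, abs_neg, abs_mul, abs_of_pos hk0] at h1
    have h2 : ‖y - y'‖ ≤ ‖Q y - Q y'‖ + |(inner ℝ n (y - y') : ℝ)| := by
      have e : y - y' = (Q y - Q y') + (inner ℝ n (y - y') : ℝ) • n := by
        simp only [hQ]; rw [inner_sub_right, sub_smul]; abel
      calc ‖y - y'‖ = ‖(Q y - Q y') + (inner ℝ n (y - y') : ℝ) • n‖ := by rw [← e]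
        _ ≤ _ := norm_add_le _ _
        _ = _ := by rw [norm_smul, hn1, mul_one, Real.norm_eq_abs]
    rw [← inner_sub_right]
    set q := ‖Q y - Q y'‖
    set a := |(inner ℝ n (y - y') : ℝ)|
    have h3 : k * a ≤ c * q + c * a := by
      calc k * a ≤ c * ‖y - y'‖ := h1
        _ ≤ c * (q + a) := mul_le_mul_of_nonneg_left h2 c.coe_nonneg
        _ = _ := by ring
    have ha0 : 0 ≤ a := abs_nonneg _
    have hq0 : 0 ≤ q := norm_nonneg _
    have h4 : (k / 2) * a ≤ (k / 2) * (η * q) := by nlinarith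
    exact le_of_mul_le_mul_left h4 (by positivity)
  -- By the cone condition the height is a Lipschitz function of the projection; selected on the
  -- projected zero set, it is then extended to the whole space.
  choose! sel hsel using fun x (hx : x ∈ Q '' Z) => hx
  have hlipon : LipschitzOnWith η (fun x => (inner ℝ n (sel x) : ℝ)) (Q '' Z) := by
    refine LipschitzOnWith.of_dist_le_mul fun x hx x' hx' => ?_
    have := hZlip _ (hsel x hx).1 _ (hsel x' hx').1
    rwa [(hsel x hx).2, (hsel x' hx').2, ← Real.dist_eq, ← dist_eq_norm] at this
  obtain ⟨g₀, hg₀, hg₀'⟩ := hlipon.extend_real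
  have hgZ : ∀ y ∈ Z, inner ℝ n y = g₀ (Q y) := fun y hy => by
    have hy' : Q y ∈ Q '' Z := ⟨y, hy, rfl⟩
    rw [← hg₀' hy']
    have := hZlip _ hy _ (hsel _ hy').1
    rw [(hsel _ hy').2, sub_self, norm_zero, mul_zero] at this
    exact sub_eq_zero.1 (abs_nonpos_iff.1 this)
  have hQn : ∀ x (s : ℝ), Q (x + s • n) = Q x := fun x s => by
    simp only [hQ]
    rw [inner_add_right, inner_smul_right, real_inner_self_eq_norm_sq, hn1, add_smul]
    simp only [one_pow, mul_one]
    abel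
  refine ⟨g₀ ∘ Q, ?_, fun x s => by simp only [Function.comp, hQn], R' / 8, by positivity,
    fun y hy => ⟨fun hy0 => ?_, fun hgy => ?_⟩⟩
  · have := hg₀.comp (lipschitzWith_sub_inner_smul hn1)
    rwa [mul_one] at this
  · exact hgZ y ⟨hy0, Metric.ball_subset_ball (by linarith) hy⟩
  -- Along the line y + tn, |t| ≤ 4R, the growth of ρ is at least (k/2)·4R, more than |ρ y| ≤
  -- (3/2)kR, so ρ has a zero there, which lies on the graph. If y is above the graph, this zero has
  -- t < 0, and monotonicity gives ρ y > 0. The factor 8 keeps the segment in the ball of radius R'.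
  · set R := R' / 8 with hR
    have hR0 : 0 < R := by positivity
    have hyR : ‖y - x₀‖ < R := by rwa [← dist_eq_norm]
    have hmem : ∀ t : ℝ, |t| ≤ 4 * R → y + t • n ∈ Metric.ball x₀ R' := fun t ht => by
      rw [Metric.mem_ball, dist_eq_norm, add_sub_right_comm]
      refine (norm_add_le _ _).trans_lt ?_
      rw [norm_smul, hn1, mul_one, Real.norm_eq_abs]
      linarith
    have hy' : y ∈ Metric.ball x₀ R' := Metric.ball_subset_ball (by linarith) hy
    have hline : ∀ t : ℝ, |t| ≤ 4 * R → |ρ (y + t • n) - ρ y - k * t| ≤ c * |t| := fun t ht => by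
      have := happ' _ (hmem t ht) _ hy'
      rwa [add_sub_cancel_left, inner_smul_right, real_inner_self_eq_norm_sq, hn1, one_pow, mul_one,
        norm_smul, hn1, mul_one, Real.norm_eq_abs] at this
    have hρy : |ρ y| ≤ (3 / 2) * k * R := by
      have h1 := happ' y hy' x₀ (Metric.mem_ball_self hR'0)
      rw [h0, sub_zero] at h1
      have h2 := abs_real_inner_le_norm n (y - x₀)
      rw [hn1, one_mul] at h2
      have h3 := abs_sub_abs_le_abs_sub (ρ y) (k * inner ℝ n (y - x₀))
      rw [abs_mul, abs_of_pos hk0] at h3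
      have h4 : (c : ℝ) * ‖y - x₀‖ ≤ (k / 2) * R := mul_le_mul hck hyR.le (norm_nonneg _) (by positivity)
      nlinarith
    have hpos : 0 ≤ ρ (y + (4 * R) • n) := by
      have h1 := hline (4 * R) (by rw [abs_of_pos (by positivity)])
      rw [abs_of_pos (by positivity : 0 < 4 * R)] at h1
      have := (abs_le.1 h1).1
      have := (abs_le.1 hρy).1
      nlinarith
    have hneg : ρ (y + (-(4 * R)) • n) ≤ 0 := by
      have h1 := hline (-(4 * R)) (by rw [abs_neg, abs_of_pos (by positivity)])
      rw [abs_neg, abs_of_pos (by positivity : 0 < 4 * R)] at h1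
      have := (abs_le.1 h1).2
      have := (abs_le.1 hρy).2
      nlinarith
    have hcont : ContinuousOn (fun t : ℝ => ρ (y + t • n)) (Icc (-(4 * R)) (4 * R)) :=
      (by fun_prop : Continuous fun t : ℝ => ρ (y + t • n)).continuousOn
    obtain ⟨t, ht, htz⟩ := intermediate_value_Icc (by linarith) hcont ⟨hneg, hpos⟩
    have htR : |t| ≤ 4 * R := abs_le.2 ht
    have hz := hgZ _ ⟨htz, hmem t htR⟩
    rw [hQn, inner_add_right, inner_smul_right, real_inner_self_eq_norm_sq, hn1, one_pow,
      mul_one] at hz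
    have ht0 : t < 0 := by
      simp only [Function.comp] at hgy
      linarith
    have h1 := (abs_le.1 (hline t htR)).2
    have htz' : ρ (y + t • n) = 0 := htz
    rw [htz', abs_of_neg ht0] at h1
    nlinarith

end LevelSet

/-! ### Trace estimate on a compact hypersurface -/

namespace StokesLame

variable {d : ℕ}

theorem exists_linearIsometry_orthogonal (hd : 2 ≤ d) {n : Vec d} (hn : ‖n‖ = 1) :
    ∃ L : Vec (d - 1) →ₗᵢ[ℝ] Vec d, ∀ ξ, inner ℝ n (L ξ) = 0 := by
  have hfr : Module.finrank ℝ (ℝ ∙ n)ᗮ = d - 1 := by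
    have h := Submodule.finrank_add_finrank_orthogonal (ℝ ∙ n)
    rw [finrank_span_singleton (by rintro rfl; simp at hn), finrank_euclideanSpace_fin] at h
    omega
  set b := (stdOrthonormalBasis ℝ (ℝ ∙ n)ᗮ).reindex (finCongr hfr)
  refine ⟨(ℝ ∙ n)ᗮ.subtypeₗᵢ.comp b.repr.symm.toLinearIsometry, fun ξ => ?_⟩
  exact Submodule.mem_orthogonal_singleton_iff_inner_right.1 (b.repr.symm ξ).2

/-- Near `x₀`, the set `Γ` lies in the zero set of a function whose positivity set lies in `D`. -/
def HasChart (D Γ : Set (Vec d)) (x₀ : Vec d) : Prop :=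
  ∃ ρ : Vec d → ℝ, ContDiff ℝ 1 ρ ∧ ρ x₀ = 0 ∧ fderiv ℝ ρ x₀ ≠ 0 ∧ ∃ R > 0,
    ∀ y ∈ Metric.ball x₀ R, (y ∈ Γ → ρ y = 0) ∧ (0 < ρ y → y ∈ D)

theorem measure_surface (S T : Set (Vec d)) (hT : MeasurableSet T) :
    (surface S).restrict T = surface (T ∩ S) := by
  rw [surface, surface, Measure.restrict_restrict hT]

/-- The admissible slope depends only on the normal, so the graph can be chosen afterwards on a
small ball. There the region above the graph lies in D, and outside the ball v vanishes. -/
theorem HasChart.exists_local_trace (hd : 2 ≤ d) {D Γ : Set (Vec d)} {x₀ : Vec d}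
    (h : HasChart D Γ x₀) :
    ∃ R > 0, ∃ C : ℝ≥0,
      (∀ x (r : ℝ), 0 < r → surface (Γ ∩ Metric.ball x₀ R) (Metric.closedBall x r)
        ≤ C * ENNReal.ofReal (r ^ (d - 1))) ∧
      ∀ v : Vec d → Vec d, ContDiff ℝ 1 v → tsupport v ⊆ Metric.ball x₀ R →
        (∫⁻ x, ∫⁻ y, ‖v x - v y‖ₑ ^ 2 / ‖x - y‖ₑ ^ (d : ℝ) ∂(surface (Γ ∩ Metric.ball x₀ R))
            ∂(surface (Γ ∩ Metric.ball x₀ R))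
          ≤ C * ∫⁻ x in D, ‖symDeriv v x‖ₑ ^ 2) ∧
        ∫⁻ x, ‖v x‖ₑ ^ 2 ∂(surface (Γ ∩ Metric.ball x₀ R))
          ≤ C * ∫⁻ x in D, ‖symDeriv v x‖ₑ ^ 2 := by
  obtain ⟨ρ, hρ, h0, hρ', R₁, hR₁, hchart⟩ := h
  obtain ⟨n, hn, hgr⟩ := exists_graph_of_hasStrictFDerivAt
    (hρ.contDiffAt.hasStrictFDerivAt one_ne_zero) hρ.continuous h0 hρ'
  obtain ⟨L, hL⟩ := exists_linearIsometry_orthogonal hd hn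
  have hdim : Module.finrank ℝ (Vec d) = Module.finrank ℝ (Vec (d - 1)) + 1 := by
    rw [finrank_euclideanSpace_fin, finrank_euclideanSpace_fin]; omega
  have : Nontrivial (Vec (d - 1)) := by
    refine Module.nontrivial_of_finrank_pos (R := ℝ) ?_
    rw [finrank_euclideanSpace_fin]; omega
  obtain ⟨η, hη0, hη1, hη⟩ := exists_trace_graph hn hL hdim
  obtain ⟨g, hg, hgn, R₂, hR₂, hgraph⟩ := hgr η hη0
  obtain ⟨C₁, hC₁⟩ := exists_hausdorffMeasure_graph_ball_le hn hL hdim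
  set R := min R₁ R₂ with hR
  have hR0 : 0 < R := lt_min hR₁ hR₂
  obtain ⟨C₂, hC₂⟩ := hη g hg hgn (‖x₀‖ + R)
  simp only [finrank_euclideanSpace_fin] at hC₁ hC₂
  have hS : ∀ x ∈ Γ ∩ Metric.ball x₀ R, inner ℝ n x = g x := fun x hx =>
    (hgraph x (Metric.ball_subset_ball (min_le_right _ _) hx.2)).1
      ((hchart x (Metric.ball_subset_ball (min_le_left _ _) hx.2)).1 hx.1)
  refine ⟨R, hR0, C₁ + C₂, fun x r hr => ?_, fun v hv hvs => ?_⟩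
  · refine (hC₁ η g hη1 hg hgn _ hS x r hr).trans ?_
    gcongr
    exact le_self_add
  have hv' : HasCompactSupport v :=
    (isCompact_closedBall x₀ R).of_isClosed_subset (isClosed_tsupport v)
      (hvs.trans Metric.ball_subset_closedBall)
  have hzero : ∀ x, ‖x₀‖ + R ≤ ‖x‖ → v x = 0 := fun x hx => by
    refine image_eq_zero_of_notMem_tsupport fun hxs => ?_
    have h1 := hvs hxs
    rw [Metric.mem_ball, dist_eq_norm] at h1
    have := norm_sub_norm_le x x₀
    linarith
  have hJ : ∫⁻ x in {x | g x < inner ℝ n x}, ‖symDeriv v x‖ₑ ^ 2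
      ≤ ∫⁻ x in D, ‖symDeriv v x‖ₑ ^ 2 := by
    have hz : ∀ x, x ∉ Metric.ball x₀ R → ‖symDeriv v x‖ₑ ^ 2 = 0 := fun x hx => by
      have : fderiv ℝ v x = 0 :=
        image_eq_zero_of_notMem_tsupport fun h => hx (hvs (tsupport_fderiv_subset ℝ h))
      rw [symDeriv, this, map_zero, add_zero, ← ofReal_norm, norm_zero]
      simp
    have hT : MeasurableSet {x : Vec d | g x < (inner ℝ n x : ℝ)} :=
      measurableSet_lt hg.continuous.measurable (by fun_prop)
    calc _ = ∫⁻ x in {x | g x < inner ℝ n x} ∩ Metric.ball x₀ R, ‖symDeriv v x‖ₑ ^ 2 := by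
          rw [inter_comm, ← setLIntegral_indicator measurableSet_ball]
          refine lintegral_congr fun x => ?_
          by_cases hx : x ∈ Metric.ball x₀ R
          · rw [indicator_of_mem hx]
          · rw [indicator_of_notMem hx, hz x hx]
      _ ≤ _ := by
          refine lintegral_mono_set fun x hx => ?_
          exact (hchart x (Metric.ball_subset_ball (min_le_left _ _) hx.2)).2
            ((hgraph x (Metric.ball_subset_ball (min_le_right _ _) hx.2)).2 hx.1)
  obtain ⟨h1, h2⟩ := hC₂ _ hS v hv hv' hzero
  have hcoe : (C₂ : ℝ≥0∞) ≤ ((C₁ + C₂ : ℝ≥0) : ℝ≥0∞) := by exact_mod_cast le_add_self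
  exact ⟨h1.trans (mul_le_mul' hcoe hJ), h2.trans (mul_le_mul' hcoe hJ)⟩

end StokesLame

/-! ### Cutoff and patching over a compact hypersurface -/

namespace StokesLame

variable {d : ℕ}

/-- Product rule: the commutator with the cutoff is the symmetrised tensor product of φ and the
gradient of χ, of order zero in φ. -/
theorem enorm_symDeriv_smul_le {χ : Vec d → ℝ} {φ : Vec d → Vec d} {x : Vec d}
    (hχ : DifferentiableAt ℝ χ x) (hφ : DifferentiableAt ℝ φ x) (h1 : ‖χ x‖ ≤ 1) {A : ℝ≥0}
    (hA : ‖fderiv ℝ χ x‖ ≤ A) :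
    ‖symDeriv (fun y => χ y • φ y) x‖ₑ ≤ ‖symDeriv φ x‖ₑ + (2 * A : ℝ≥0) * ‖φ x‖ₑ := by
  set W := (fderiv ℝ χ x).smulRight (φ x) with hW
  have e : symDeriv (fun y => χ y • φ y) x = χ x • symDeriv φ x + (W + W.adjoint) := by
    have hD : fderiv ℝ (fun y => χ y • φ y) x = χ x • fderiv ℝ φ x + W :=
      (hχ.hasFDerivAt.smul hφ.hasFDerivAt).fderiv
    have ha : (χ x • fderiv ℝ φ x).adjoint = χ x • (fderiv ℝ φ x).adjoint := by
      rw [LinearIsometryEquiv.map_smulₛₗ]; simp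
    rw [symDeriv, hD, map_add, ha, symDeriv, smul_add]
    abel
  have hWn : ‖W‖ ≤ A * ‖φ x‖ := by
    rw [hW, ContinuousLinearMap.norm_smulRight_apply]
    gcongr
  have key : ‖symDeriv (fun y => χ y • φ y) x‖ ≤ ‖symDeriv φ x‖ + 2 * A * ‖φ x‖ := by
    rw [e]
    refine (norm_add_le _ _).trans (add_le_add ?_ ((norm_add_le _ _).trans ?_))
    · rw [norm_smul]
      exact mul_le_of_le_one_left (norm_nonneg _) h1
    · rw [LinearIsometryEquiv.norm_map]
      linarith
  simp only [← ofReal_norm]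
  rw [← ENNReal.ofReal_coe_nnreal, ← ENNReal.ofReal_mul (by positivity),
    ← ENNReal.ofReal_add (norm_nonneg _) (by positivity)]
  exact ENNReal.ofReal_le_ofReal (by exact_mod_cast key)

theorem surface_mono {S T : Set (Vec d)} (h : S ⊆ T) : surface S ≤ surface T :=
  Measure.restrict_mono h le_rfl

/-- Multiply by a bump equal to 1 on the smaller ball. This removes the support condition at the
price of the L² norm of φ. -/
theorem HasChart.exists_local_trace_cutoff (hd : 2 ≤ d) {D Γ : Set (Vec d)} (hΓ : MeasurableSet Γ)
    {x₀ : Vec d} (h : HasChart D Γ x₀) :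
    ∃ r > 0, ∃ C : ℝ≥0,
      (∀ x (ρ : ℝ), 0 < ρ → surface (Γ ∩ Metric.ball x₀ r) (Metric.closedBall x ρ)
        ≤ C * ENNReal.ofReal (ρ ^ (d - 1))) ∧
      ∀ φ : Vec d → Vec d, ContDiff ℝ ∞ φ →
        (∫⁻ x, ∫⁻ y, ‖φ x - φ y‖ₑ ^ 2 / ‖x - y‖ₑ ^ (d : ℝ) ∂(surface (Γ ∩ Metric.ball x₀ r))
            ∂(surface (Γ ∩ Metric.ball x₀ r))
          ≤ C * ((∫⁻ x in D, ‖symDeriv φ x‖ₑ ^ 2) + ∫⁻ x in D, ‖φ x‖ₑ ^ 2)) ∧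
        ∫⁻ x, ‖φ x‖ₑ ^ 2 ∂(surface (Γ ∩ Metric.ball x₀ r))
          ≤ C * ((∫⁻ x in D, ‖symDeriv φ x‖ₑ ^ 2) + ∫⁻ x in D, ‖φ x‖ₑ ^ 2) := by
  obtain ⟨R, hR, C, hball, hC⟩ := h.exists_local_trace hd
  set χ : ContDiffBump x₀ := ⟨R / 2, 3 * R / 4, by positivity, by linarith⟩ with hχ
  obtain ⟨A, hA⟩ : ∃ A : ℝ≥0, ∀ x, ‖fderiv ℝ χ x‖ ≤ A := by
    obtain ⟨K, hK⟩ := (χ.contDiff (n := 1)).lipschitzWith_of_hasCompactSupport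
      χ.hasCompactSupport one_ne_zero
    exact ⟨K, fun x => norm_fderiv_le_of_lipschitz ℝ hK⟩
  refine ⟨R / 2, by positivity, C * (2 + 2 * (2 * A) ^ 2) + C, fun x ρ hρ => ?_, fun φ hφ => ?_⟩
  · refine (surface_mono (inter_subset_inter_right Γ
      (Metric.ball_subset_ball (by linarith))) _).trans ((hball x ρ hρ).trans ?_)
    gcongr
    exact le_add_self
  set v : Vec d → Vec d := fun y => χ y • φ y with hv
  have hvc : ContDiff ℝ 1 v := (χ.contDiff (n := 1)).smul (hφ.of_le (by exact_mod_cast le_top))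
  have hvs : tsupport v ⊆ Metric.ball x₀ R := by
    refine (closure_mono (Function.support_smul_subset_left (fun y => χ y) φ)).trans ?_
    have h1 : closure (Function.support fun y => χ y) = Metric.closedBall x₀ (3 * R / 4) :=
      χ.tsupport_eq
    rw [h1]
    exact Metric.closedBall_subset_ball (by linarith)
  have hsub : Γ ∩ Metric.ball x₀ (R / 2) ⊆ Γ ∩ Metric.ball x₀ R :=
    inter_subset_inter_right Γ (Metric.ball_subset_ball (by linarith))
  have hvφ : ∀ y ∈ Γ ∩ Metric.ball x₀ (R / 2), v y = φ y := fun y hy => by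
    have : χ y = 1 := χ.one_of_mem_closedBall (Metric.ball_subset_closedBall hy.2)
    simp only [hv, this, one_smul]
  have hae : ∀ᵐ y ∂(surface (Γ ∩ Metric.ball x₀ (R / 2))), v y = φ y := by
    filter_upwards [ae_restrict_mem (hΓ.inter measurableSet_ball)] with y hy using hvφ y hy
  obtain ⟨h1, h2⟩ := hC v hvc hvs
  have hJ : ∫⁻ x in D, ‖symDeriv v x‖ₑ ^ 2 ≤ (2 + 2 * (2 * A) ^ 2 : ℝ≥0) *
      ((∫⁻ x in D, ‖symDeriv φ x‖ₑ ^ 2) + ∫⁻ x in D, ‖φ x‖ₑ ^ 2) := by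
    calc _ ≤ ∫⁻ x in D, (2 * ‖symDeriv φ x‖ₑ ^ 2
          + ((2 * (2 * A) ^ 2 : ℝ≥0) : ℝ≥0∞) * ‖φ x‖ₑ ^ 2) := by
          refine lintegral_mono fun x => ?_
          have hχd : DifferentiableAt ℝ χ x := (χ.contDiff (n := 1)).differentiable one_ne_zero x
          refine (pow_le_pow_left₀ zero_le (enorm_symDeriv_smul_le hχd
            (hφ.differentiable (by simp) x) ?_ (hA x)) 2).trans
            ((ENNReal.add_sq_le_two_mul _ _).trans (le_of_eq ?_))
          · rw [Real.norm_of_nonneg χ.nonneg]; exact χ.le_one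
          · push_cast; ring
      _ = 2 * (∫⁻ x in D, ‖symDeriv φ x‖ₑ ^ 2)
          + ((2 * (2 * A) ^ 2 : ℝ≥0) : ℝ≥0∞) * ∫⁻ x in D, ‖φ x‖ₑ ^ 2 := by
          rw [lintegral_add_left (((measurable_symDeriv φ).enorm.pow_const 2).const_mul 2),
            lintegral_const_mul' _ _ ENNReal.ofNat_ne_top,
            lintegral_const_mul' _ _ ENNReal.coe_ne_top]
      _ ≤ _ := by
          rw [mul_add]
          gcongr
          · exact_mod_cast le_self_add
          · exact_mod_cast le_add_self
  have hfin : (C : ℝ≥0∞) * ∫⁻ x in D, ‖symDeriv v x‖ₑ ^ 2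
      ≤ ((C * (2 + 2 * (2 * A) ^ 2) + C : ℝ≥0) : ℝ≥0∞) *
        ((∫⁻ x in D, ‖symDeriv φ x‖ₑ ^ 2) + ∫⁻ x in D, ‖φ x‖ₑ ^ 2) := by
    refine (mul_le_mul_right hJ _).trans ?_
    rw [← mul_assoc, ← ENNReal.coe_mul]
    gcongr
    exact le_self_add
  constructor
  · refine le_trans (le_of_eq ?_) ((lintegral_mono' (surface_mono hsub) fun x =>
      lintegral_mono' (surface_mono hsub) le_rfl).trans (h1.trans hfin))
    refine lintegral_congr_ae ?_
    filter_upwards [hae] with x hx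
    refine lintegral_congr_ae ?_
    filter_upwards [hae] with y hy
    rw [hx, hy]
  · refine le_trans (le_of_eq ?_) ((lintegral_mono' (surface_mono hsub) le_rfl).trans
      (h2.trans hfin))
    refine lintegral_congr_ae ?_
    filter_upwards [hae] with x hx
    rw [hx]

/-- Upper Ahlfors regularity of a compact hypersurface. -/
theorem exists_surface_closedBall_le (hd : 2 ≤ d) {D Γ : Set (Vec d)} (hΓ : IsCompact Γ)
    (hchart : ∀ x ∈ Γ, HasChart D Γ x) :
    ∃ C : ℝ≥0, ∀ x (ρ : ℝ), 0 < ρ → surface Γ (Metric.closedBall x ρ)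
      ≤ C * ENNReal.ofReal (ρ ^ (d - 1)) := by
  choose! r hr C hC using fun x hx =>
    (hchart x hx).exists_local_trace_cutoff hd hΓ.isClosed.measurableSet
  obtain ⟨t, htΓ, ht⟩ := hΓ.elim_nhds_subcover (fun x => Metric.ball x (r x))
    fun x hx => Metric.ball_mem_nhds x (hr x hx)
  refine ⟨∑ i ∈ t, C i, fun x ρ hρ => ?_⟩
  have hcov : Γ ⊆ ⋃ i ∈ t, Γ ∩ Metric.ball i (r i) := by
    intro y hy
    obtain ⟨i, hi, hyi⟩ := mem_iUnion₂.1 (ht hy)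
    exact mem_iUnion₂.2 ⟨i, hi, hy, hyi⟩
  calc surface Γ (Metric.closedBall x ρ) ≤ ∑ i ∈ t,
        surface (Γ ∩ Metric.ball i (r i)) (Metric.closedBall x ρ) := by
        simp only [surface]
        rw [Measure.restrict_apply measurableSet_closedBall]
        refine (measure_mono (inter_subset_inter_right _ hcov)).trans ?_
        rw [inter_iUnion₂]
        refine (measure_biUnion_finset_le _ _).trans (Finset.sum_le_sum fun i _ => ?_)
        rw [Measure.restrict_apply measurableSet_closedBall]
    _ ≤ ∑ i ∈ t, (C i : ℝ≥0∞) * ENNReal.ofReal (ρ ^ (d - 1)) :=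
        Finset.sum_le_sum fun i hi => (hC i (htΓ i hi)).1 x ρ hρ
    _ = _ := by rw [← Finset.sum_mul, ENNReal.ofNNReal_finsetSum]

theorem isFiniteMeasure_surface (hd : 2 ≤ d) {D Γ : Set (Vec d)} (hΓ : IsCompact Γ)
    (hchart : ∀ x ∈ Γ, HasChart D Γ x) : IsFiniteMeasure (surface Γ) := by
  obtain ⟨C, hC⟩ := exists_surface_closedBall_le hd hΓ hchart
  obtain ⟨R, hR⟩ := hΓ.isBounded.subset_closedBall (0 : Vec d)
  refine ⟨?_⟩
  have h1 : surface Γ univ ≤ surface Γ (Metric.closedBall 0 (max R 1)) := by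
    rw [surface, Measure.restrict_apply_univ, Measure.restrict_apply measurableSet_closedBall]
    exact measure_mono (subset_inter
      (hR.trans (Metric.closedBall_subset_closedBall (le_max_left _ _))) subset_rfl)
  exact (h1.trans (hC 0 _ (lt_max_of_lt_right one_pos))).trans_lt
    (ENNReal.mul_lt_top ENNReal.coe_lt_top ENNReal.ofReal_lt_top)

theorem lintegral_lintegral_sum_add {X ι : Type*} [MeasurableSpace X] {σ : Measure X}
    [IsFiniteMeasure σ] (t : Finset ι) {k : ι → X → X → ℝ≥0∞}
    (hk : ∀ i, Measurable fun q : X × X => k i q.1 q.2) {f : X → ℝ≥0∞} (hf : Measurable f)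
    (c : ℝ≥0) :
    ∫⁻ x, ∫⁻ y, ((∑ i ∈ t, k i x y) + c * (f x + f y)) ∂σ ∂σ
      = (∑ i ∈ t, ∫⁻ x, ∫⁻ y, k i x y ∂σ ∂σ) + c * (2 * σ univ * ∫⁻ x, f x ∂σ) := by
  have h1 : ∀ x, ∫⁻ y, ((∑ i ∈ t, k i x y) + c * (f x + f y)) ∂σ
      = (∑ i ∈ t, ∫⁻ y, k i x y ∂σ) + c * (f x * σ univ + ∫⁻ y, f y ∂σ) := fun x => by
    have hmi : ∀ i, Measurable fun y => k i x y := fun i =>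
      (hk i).comp (measurable_const.prodMk measurable_id)
    rw [lintegral_add_left (Finset.measurable_sum _ fun i _ => hmi i),
      lintegral_finsetSum _ fun i _ => hmi i, lintegral_const_mul' _ _ ENNReal.coe_ne_top,
      lintegral_add_left measurable_const, lintegral_const]
  simp only [h1]
  have hmi : ∀ i, Measurable fun x => ∫⁻ y, k i x y ∂σ := fun i => (hk i).lintegral_prod_right'
  rw [lintegral_add_left (Finset.measurable_sum _ fun i _ => hmi i),
    lintegral_finsetSum _ fun i _ => hmi i, lintegral_const_mul' _ _ ENNReal.coe_ne_top,
    lintegral_add_left (hf.mul_const _), lintegral_mul_const _ hf, lintegral_const]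
  ring

/-- Korn's inequality combined with the trace theorem. -/
theorem exists_trace_estimate (hd : 2 ≤ d) {D Γ : Set (Vec d)} (hΓ : IsCompact Γ)
    (hchart : ∀ x ∈ Γ, HasChart D Γ x) :
    ∃ C : ℝ≥0, ∀ φ : Vec d → Vec d, ContDiff ℝ ∞ φ →
      ∫⁻ x, ∫⁻ y, ‖φ x - φ y‖ₑ ^ 2 / ‖x - y‖ₑ ^ (d : ℝ) ∂(surface Γ) ∂(surface Γ)
        ≤ C * ((∫⁻ x in D, ‖symDeriv φ x‖ₑ ^ 2) + ∫⁻ x in D, ‖φ x‖ₑ ^ 2) := by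
  have hfinite := isFiniteMeasure_surface hd hΓ hchart
  have hΓm := hΓ.isClosed.measurableSet
  choose! r hr C hC using fun x hx => (hchart x hx).exists_local_trace_cutoff hd hΓm
  obtain ⟨t, htΓ, ht⟩ := hΓ.elim_nhds_subcover (fun x => Metric.ball x (r x))
    fun x hx => Metric.ball_mem_nhds x (hr x hx)
  -- Pairs closer than the Lebesgue number lie in a common ball, where the local estimate applies;
  -- for the others the kernel is bounded and the L² norm on the surface suffices.
  obtain ⟨δ, hδ, hleb⟩ := lebesgue_number_lemma_of_metric (ι := t) hΓ
    (c := fun i => Metric.ball (i : Vec d) (r i)) (fun i => Metric.isOpen_ball) (by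
      intro y hy
      obtain ⟨i, hi, hyi⟩ := mem_iUnion₂.1 (ht hy)
      exact mem_iUnion.2 ⟨⟨i, hi⟩, hyi⟩)
  set σ := surface Γ with hσ
  set Λ : ℝ≥0 := Real.toNNReal (2 * (δ ^ (d : ℝ))⁻¹) with hΛ
  set m : ℝ≥0 := (σ univ).toNNReal with hm
  have hmσ : (m : ℝ≥0∞) = σ univ := ENNReal.coe_toNNReal (measure_ne_top _ _)
  refine ⟨(∑ i ∈ t, C i) + Λ * (2 * m * ∑ i ∈ t, C i), fun φ hφ => ?_⟩
  set J := (∫⁻ x in D, ‖symDeriv φ x‖ₑ ^ 2) + ∫⁻ x in D, ‖φ x‖ₑ ^ 2 with hJ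
  set k : Vec d → Vec d → ℝ≥0∞ := fun x y => ‖φ x - φ y‖ₑ ^ 2 / ‖x - y‖ₑ ^ (d : ℝ) with hk
  have hφc := hφ.continuous
  have hkm : Measurable fun q : Vec d × Vec d => k q.1 q.2 := by
    have h1 : Measurable fun q : Vec d × Vec d => φ q.1 - φ q.2 :=
      (by fun_prop : Continuous fun q : Vec d × Vec d => φ q.1 - φ q.2).measurable
    have h2 : Measurable fun q : Vec d × Vec d => q.1 - q.2 :=
      (by fun_prop : Continuous fun q : Vec d × Vec d => q.1 - q.2).measurable
    exact (h1.enorm.pow_const 2).div (h2.enorm.pow_const _)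
  have hφm : Measurable fun x => ‖φ x‖ₑ ^ 2 := hφc.measurable.enorm.pow_const 2
  have hbd : ∀ i : Vec d, (surface (Γ ∩ Metric.ball i (r i)))
      = σ.restrict (Metric.ball i (r i)) := fun i => by
    rw [hσ, measure_surface _ _ measurableSet_ball, inter_comm]
  have hL2 : ∫⁻ x, ‖φ x‖ₑ ^ 2 ∂σ ≤ (∑ i ∈ t, C i : ℝ≥0) * J := by
    have hcov : Γ ⊆ ⋃ i ∈ t, Metric.ball i (r i) := ht
    calc ∫⁻ x, ‖φ x‖ₑ ^ 2 ∂σ ≤ ∑ i ∈ t, ∫⁻ x in Metric.ball i (r i), ‖φ x‖ₑ ^ 2 ∂σ := by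
          have h1 : σ ≤ ∑ i ∈ t, σ.restrict (Metric.ball i (r i)) := by
            refine Measure.le_iff.2 fun s hs => ?_
            rw [Measure.finsetSum_apply]
            have h2 : σ s = σ (s ∩ Γ) := by
              rw [hσ, surface, Measure.restrict_apply hs, Measure.restrict_apply (hs.inter hΓm),
                inter_assoc, inter_self]
            rw [h2]
            refine (measure_mono (inter_subset_inter_right s hcov)).trans ?_
            rw [inter_iUnion₂]
            refine (measure_biUnion_finset_le _ _).trans (Finset.sum_le_sum fun i _ => ?_)
            rw [Measure.restrict_apply hs]
          refine (lintegral_mono' h1 le_rfl).trans (le_of_eq ?_)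
          rw [lintegral_finsetSum_measure]
      _ ≤ ∑ i ∈ t, (C i : ℝ≥0∞) * J := Finset.sum_le_sum fun i hi => by
          have := ((hC i (htΓ i hi)).2 φ hφ).2
          rwa [hbd] at this
      _ = _ := by rw [← Finset.sum_mul, ENNReal.ofNNReal_finsetSum]
  have hpt : ∀ x ∈ Γ, ∀ y ∈ Γ, k x y ≤ (∑ i ∈ t, (Metric.ball i (r i)).indicator
      (fun x => (Metric.ball i (r i)).indicator (k x) y) x)
        + Λ * (‖φ x‖ₑ ^ 2 + ‖φ y‖ₑ ^ 2) := by
    intro x hx y hy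
    rcases lt_or_ge (dist y x) δ with h | h
    · obtain ⟨i, hi⟩ := hleb x hx
      refine le_trans ?_ (le_self_add.trans (add_le_add_left (Finset.single_le_sum
        (f := fun i => (Metric.ball i (r i)).indicator
          (fun x => (Metric.ball i (r i)).indicator (k x) y) x) (fun _ _ => zero_le) i.2) _))
      rw [indicator_of_mem (hi (Metric.mem_ball_self hδ)), indicator_of_mem (hi h)]
    · refine le_trans ?_ le_add_self
      have hxy : ENNReal.ofReal δ ≤ ‖x - y‖ₑ := by
        rw [← ofReal_norm, ← dist_eq_norm, dist_comm]
        exact ENNReal.ofReal_le_ofReal h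
      calc k x y ≤ (2 * ‖φ x‖ₑ ^ 2 + 2 * ‖φ y‖ₑ ^ 2) / ENNReal.ofReal δ ^ (d : ℝ) := by
            refine ENNReal.div_le_div ?_ (ENNReal.rpow_le_rpow hxy (Nat.cast_nonneg _))
            exact (pow_le_pow_left₀ zero_le enorm_sub_le 2).trans (ENNReal.add_sq_le_two_mul _ _)
        _ = _ := by
            rw [ENNReal.ofReal_rpow_of_pos hδ, div_eq_mul_inv,
              ← ENNReal.ofReal_inv_of_pos (by positivity), hΛ, ENNReal.ofNNReal_toNNReal,
              ENNReal.ofReal_mul (by norm_num), ENNReal.ofReal_ofNat]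
            ring
  have hind : ∀ i : Vec d, Measurable fun q : Vec d × Vec d => (Metric.ball i (r i)).indicator
      (fun x => (Metric.ball i (r i)).indicator (k x) q.2) q.1 := fun i => by
    have h1 : Measurable ((Metric.ball i (r i) ×ˢ Metric.ball i (r i)).indicator
        fun q : Vec d × Vec d => k q.1 q.2) :=
      hkm.indicator (measurableSet_ball.prod measurableSet_ball)
    convert h1 using 1
    ext q
    by_cases h1 : q.1 ∈ Metric.ball i (r i)
    · by_cases h2 : q.2 ∈ Metric.ball i (r i)
      · rw [indicator_of_mem h1, indicator_of_mem h2, indicator_of_mem (mk_mem_prod h1 h2)]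
      · rw [indicator_of_mem h1, indicator_of_notMem h2,
          indicator_of_notMem fun h => h2 (mem_prod.1 h).2]
    · rw [indicator_of_notMem h1, indicator_of_notMem fun h => h1 (mem_prod.1 h).1]
  have hterm : ∀ i ∈ t, ∫⁻ x, ∫⁻ y, (Metric.ball i (r i)).indicator
      (fun x => (Metric.ball i (r i)).indicator (k x) y) x ∂σ ∂σ ≤ C i * J := fun i hi => by
    have h1 := ((hC i (htΓ i hi)).2 φ hφ).1
    rw [hbd] at h1
    refine le_trans (le_of_eq ?_) h1
    rw [← lintegral_indicator measurableSet_ball]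
    refine lintegral_congr fun x => ?_
    by_cases hx : x ∈ Metric.ball i (r i)
    · simp only [indicator_of_mem hx]
      rw [lintegral_indicator measurableSet_ball]
    · simp only [indicator_of_notMem hx, lintegral_zero]
  calc ∫⁻ x, ∫⁻ y, k x y ∂σ ∂σ
      ≤ ∫⁻ x, ∫⁻ y, ((∑ i ∈ t, (Metric.ball i (r i)).indicator
        (fun x => (Metric.ball i (r i)).indicator (k x) y) x)
          + Λ * (‖φ x‖ₑ ^ 2 + ‖φ y‖ₑ ^ 2)) ∂σ ∂σ := by
        refine lintegral_mono_ae ?_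
        filter_upwards [ae_restrict_mem hΓm] with x hx
        refine lintegral_mono_ae ?_
        filter_upwards [ae_restrict_mem hΓm] with y hy
        exact hpt x hx y hy
    _ = (∑ i ∈ t, ∫⁻ x, ∫⁻ y, (Metric.ball i (r i)).indicator
        (fun x => (Metric.ball i (r i)).indicator (k x) y) x ∂σ ∂σ)
          + Λ * (2 * σ univ * ∫⁻ x, ‖φ x‖ₑ ^ 2 ∂σ) :=
        lintegral_lintegral_sum_add t (k := fun i x y => (Metric.ball i (r i)).indicator
          (fun x => (Metric.ball i (r i)).indicator (k x) y) x) hind hφm Λ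
    _ ≤ (∑ i ∈ t, C i * J) + Λ * (2 * m * ((∑ i ∈ t, C i : ℝ≥0) * J)) := by
        rw [hmσ]
        exact add_le_add (Finset.sum_le_sum hterm)
          (mul_le_mul_right (mul_le_mul_right hL2 _) _)
    _ = _ := by
        rw [← Finset.sum_mul]
        push_cast
        ring

end StokesLame

namespace StokesLame

variable {d : ℕ}

/-! ### The interface -/

theorem Geometry.isCompact_interface (P : Geometry d) : IsCompact P.interface :=
  Metric.isCompact_of_isClosed_isBounded isClosed_frontier
    (P.solid_smooth.isBounded.closure.subset frontier_subset_closure)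

/-- Near the boundary point the solid is {ρ < 0}, so the open set {ρ > 0} misses the solid and hence
its closure; it is fluid because the closed solid lies inside the total region. The interface avoids
both open sets. -/
theorem Geometry.exists_chart (P : Geometry d) {x₀ : Vec d} (hx₀ : x₀ ∈ P.interface) :
    ∃ ρ : Vec d → ℝ, ContDiff ℝ 1 ρ ∧ ρ x₀ = 0 ∧ fderiv ℝ ρ x₀ ≠ 0 ∧ ∃ R > 0,
      ∀ y ∈ Metric.ball x₀ R, (y ∈ P.interface → ρ y = 0) ∧ (ρ y < 0 → y ∈ P.solid) ∧
        (0 < ρ y → y ∈ P.fluid) := by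
  obtain ⟨U, hU, ρ, hρ, hρ', hDU⟩ := P.solid_smooth.smooth_boundary x₀ hx₀
  obtain ⟨R₁, hR₁, hRU⟩ := Metric.mem_nhds_iff.1 hU
  have htot : P.total ∈ 𝓝 x₀ :=
    P.total_smooth.isOpen.mem_nhds (P.immersed (frontier_subset_closure hx₀))
  obtain ⟨R₂, hR₂, hRt⟩ := Metric.mem_nhds_iff.1 htot
  have hmem : ∀ y ∈ Metric.ball x₀ R₁, (y ∈ P.solid ↔ ρ y < 0) := fun y hy => by
    have h := Set.ext_iff.1 hDU y
    simp only [mem_inter_iff, hRU hy, and_true] at h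
    exact h
  have hpos : ∀ y ∈ Metric.ball x₀ R₁, 0 < ρ y → y ∉ closure P.solid := fun y hy hy0 hcl => by
    have hn : Metric.ball x₀ R₁ ∩ {z | 0 < ρ z} ∈ 𝓝 y :=
      inter_mem (Metric.isOpen_ball.mem_nhds hy)
        ((isOpen_lt continuous_const hρ.continuous).mem_nhds hy0)
    obtain ⟨z, hz, hzs⟩ := mem_closure_iff_nhds.1 hcl _ hn
    have h1 : ρ z < 0 := (hmem z hz.1).1 hzs
    have h2 : 0 < ρ z := hz.2
    linarith
  have hzero : ∀ y ∈ Metric.ball x₀ R₁, y ∈ P.interface → ρ y = 0 := fun y hy hyi => by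
    refine le_antisymm (not_lt.1 fun h => hpos y hy h (frontier_subset_closure hyi)) ?_
    refine not_lt.1 fun h => ?_
    have h1 : y ∈ interior P.solid := by
      rw [P.solid_smooth.isOpen.interior_eq]
      exact (hmem y hy).2 h
    exact hyi.2 h1
  refine ⟨ρ, hρ.of_le (by exact_mod_cast le_top), hzero x₀ (Metric.mem_ball_self hR₁) hx₀, hρ',
    min R₁ R₂, lt_min hR₁ hR₂, fun y hy => ?_⟩
  have hy1 := Metric.ball_subset_ball (min_le_left R₁ R₂) hy
  have hy2 := Metric.ball_subset_ball (min_le_right R₁ R₂) hy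
  exact ⟨hzero y hy1, fun h => (hmem y hy1).2 h, fun h => ⟨hRt hy2, hpos y hy1 h⟩⟩

theorem Geometry.hasChart_solid (P : Geometry d) {x₀ : Vec d} (hx₀ : x₀ ∈ P.interface) :
    HasChart P.solid P.interface x₀ := by
  obtain ⟨ρ, hρ, h0, hρ', R, hR, h⟩ := P.exists_chart hx₀
  refine ⟨-ρ, hρ.neg, by simp [h0], ?_, R, hR, fun y hy => ⟨fun hyi => ?_, fun hy0 => ?_⟩⟩
  · rw [fderiv_neg]
    exact neg_ne_zero.2 hρ'
  · simp [(h y hy).1 hyi]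
  · exact (h y hy).2.1 (by simpa using hy0)

theorem Geometry.hasChart_fluid (P : Geometry d) {x₀ : Vec d} (hx₀ : x₀ ∈ P.interface) :
    HasChart P.fluid P.interface x₀ := by
  obtain ⟨ρ, hρ, h0, hρ', R, hR, h⟩ := P.exists_chart hx₀
  exact ⟨ρ, hρ, h0, hρ', R, hR, fun y hy => ⟨(h y hy).1, (h y hy).2.2⟩⟩

/-! ### Strain and symmetrized derivative -/

/-- The strain tensor as a continuous linear map. -/
noncomputable def strainL (d : ℕ) : Mat d →L[ℝ] Mat d :=
  LinearMap.toContinuousLinearMap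
    { toFun := strain
      map_add' := fun G H => by ext ij; simp [strain]; ring
      map_smul' := fun c G => by ext ij; simp [strain]; ring }

@[simp]
theorem strainL_apply (G : Mat d) : strainL d G = strain G := rfl

theorem norm_symDeriv_le (φ : Vec d → Vec d) (x : Vec d) :
    ‖symDeriv φ x‖ ≤ 2 * ‖strain (jacobian φ x)‖ := by
  set A := fderiv ℝ φ x with hA
  set S := strain (jacobian φ x) with hS
  refine ContinuousLinearMap.opNorm_le_bound _ (by positivity) fun y => ?_
  have hcoord : ∀ i, symDeriv φ x y i = ∑ j, 2 * S (i, j) * y j := fun i => by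
    have h1 : A y i = ∑ j, y j * A (EuclideanSpace.single j 1) i := by
      conv_lhs => rw [← (EuclideanSpace.basisFun (Fin d) ℝ).sum_repr y]
      simp
    have h2 : A.adjoint y i = ∑ j, y j * A (EuclideanSpace.single i 1) j := by
      have h3 : A.adjoint y i = inner ℝ (EuclideanSpace.single i (1 : ℝ)) (A.adjoint y) := by
        rw [EuclideanSpace.inner_single_left]; simp
      rw [h3, ContinuousLinearMap.adjoint_inner_right, PiLp.inner_apply]
      simp
    have h4 : symDeriv φ x y i = A y i + A.adjoint y i := rfl
    rw [h4, h1, h2, ← Finset.sum_add_distrib]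
    refine Finset.sum_congr rfl fun j _ => ?_
    simp only [hS, strain, jacobian]
    ring
  have hsq : ‖symDeriv φ x y‖ ^ 2 ≤ (2 * ‖S‖ * ‖y‖) ^ 2 := by
    rw [EuclideanSpace.norm_sq_eq, mul_pow, mul_pow, EuclideanSpace.norm_sq_eq S,
      Fintype.sum_prod_type, Finset.mul_sum, Finset.sum_mul]
    refine Finset.sum_le_sum fun i _ => ?_
    rw [hcoord, Real.norm_eq_abs, sq_abs]
    refine (Finset.sum_mul_sq_le_sq_mul_sq _ _ _).trans (le_of_eq ?_)
    rw [EuclideanSpace.norm_sq_eq y, Finset.mul_sum]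
    simp only [mul_pow, Real.norm_eq_abs, sq_abs, ← Finset.mul_sum]
  exact le_of_sq_le_sq hsq (by positivity)

theorem enorm_symDeriv_le (φ : Vec d → Vec d) (x : Vec d) :
    ‖symDeriv φ x‖ₑ ≤ 2 * ‖strain (jacobian φ x)‖ₑ := by
  have h := ENNReal.ofReal_le_ofReal (norm_symDeriv_le φ x)
  rwa [ENNReal.ofReal_mul (by norm_num), ofReal_norm, ofReal_norm, ENNReal.ofReal_ofNat] at h

theorem continuous_jacobian {φ : Vec d → Vec d} (hφ : ContDiff ℝ ∞ φ) :
    Continuous (jacobian φ) := by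
  have h := hφ.continuous_fderiv (by simp)
  refine (PiLp.continuous_toLp 2 _).comp (continuous_pi fun ij => ?_)
  have h1 : Continuous fun x => fderiv ℝ φ x (EuclideanSpace.single ij.2 1) :=
    h.clm_apply continuous_const
  fun_prop

/-! ### Lower semicontinuity of the Slobodeckij seminorm -/

theorem lintegral_lintegral_le_liminf {X : Type*} [MeasurableSpace X] {σ : Measure X} [SFinite σ]
    {k : ℕ → X → X → ℝ≥0∞} {l : X → X → ℝ≥0∞}
    (hk : ∀ n, Measurable fun q : X × X => k n q.1 q.2)
    (h : ∀ᵐ x ∂σ, ∀ᵐ y ∂σ, l x y ≤ liminf (fun n => k n x y) atTop) :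
    ∫⁻ x, ∫⁻ y, l x y ∂σ ∂σ ≤ liminf (fun n => ∫⁻ x, ∫⁻ y, k n x y ∂σ ∂σ) atTop := by
  have h1 : ∀ᵐ x ∂σ, ∫⁻ y, l x y ∂σ ≤ liminf (fun n => ∫⁻ y, k n x y ∂σ) atTop := by
    filter_upwards [h] with x hx
    exact (lintegral_mono_ae hx).trans
      (lintegral_liminf_le fun n => (hk n).comp (measurable_const.prodMk measurable_id))
  exact (lintegral_mono_ae h1).trans (lintegral_liminf_le fun n => (hk n).lintegral_prod_right')

theorem measurable_slobodeckij_kernel {f : Vec d → Vec d} (hf : Measurable f) (p : ℝ) :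
    Measurable fun q : Vec d × Vec d => ‖f q.1 - f q.2‖ₑ ^ 2 / ‖q.1 - q.2‖ₑ ^ p := by
  have h1 : Measurable fun q : Vec d × Vec d => f q.1 - f q.2 :=
    (hf.comp measurable_fst).sub (hf.comp measurable_snd)
  have h2 : Measurable fun q : Vec d × Vec d => q.1 - q.2 := measurable_fst.sub measurable_snd
  exact (h1.enorm.pow_const 2).div (h2.enorm.pow_const _)

theorem slobodeckij_kernel_le_liminf {f : ℕ → Vec d → Vec d} {g : Vec d → Vec d} {x y : Vec d}
    (hx : Tendsto (fun n => f n x) atTop (𝓝 (g x)))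
    (hy : Tendsto (fun n => f n y) atTop (𝓝 (g y))) (p : ℝ) :
    ‖g x - g y‖ₑ ^ 2 / ‖x - y‖ₑ ^ p
      ≤ liminf (fun n => ‖f n x - f n y‖ₑ ^ 2 / ‖x - y‖ₑ ^ p) atTop := by
  by_cases hxy : x = y
  · subst hxy; simp
  have h1 : ‖x - y‖ₑ ≠ 0 := by simpa [sub_eq_zero] using hxy
  have h2 : ‖x - y‖ₑ ^ p ≠ 0 := by
    rw [ne_eq, ENNReal.rpow_eq_zero_iff]
    simp [h1]
  have h3 : Tendsto (fun n => ‖f n x - f n y‖ₑ ^ 2) atTop (𝓝 (‖g x - g y‖ₑ ^ 2)) :=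
    ((ENNReal.continuous_pow 2).tendsto _).comp ((hx.sub hy).enorm)
  exact le_of_eq (ENNReal.Tendsto.div_const h3 (Or.inr h2)).liminf_eq.symm

theorem lintegral_slobodeckij_le_liminf {σ : Measure (Vec d)} [SFinite σ]
    {f : ℕ → Vec d → Vec d} {g : Vec d → Vec d} (hf : ∀ n, Measurable (f n))
    (hlim : ∀ᵐ x ∂σ, Tendsto (fun n => f n x) atTop (𝓝 (g x))) (p : ℝ) :
    ∫⁻ x, ∫⁻ y, ‖g x - g y‖ₑ ^ 2 / ‖x - y‖ₑ ^ p ∂σ ∂σ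
      ≤ liminf (fun n => ∫⁻ x, ∫⁻ y, ‖f n x - f n y‖ₑ ^ 2 / ‖x - y‖ₑ ^ p ∂σ ∂σ) atTop := by
  refine lintegral_lintegral_le_liminf
    (k := fun n x y => ‖f n x - f n y‖ₑ ^ 2 / ‖x - y‖ₑ ^ p)
    (fun n => measurable_slobodeckij_kernel (hf n) p) ?_
  filter_upwards [hlim] with x hx
  filter_upwards [hlim] with y hy
  exact slobodeckij_kernel_le_liminf hx hy p

/-- Along a subsequence the L² convergence is pointwise almost everywhere, and Fatou's lemma in both
variables does the rest. -/
theorem lintegral_slobodeckij_le_of_tendsto {σ : Measure (Vec d)} [SFinite σ]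
    {f : ℕ → Vec d → Vec d} {g : Vec d → Vec d} (hf : ∀ n, Measurable (f n))
    (hg : AEStronglyMeasurable g σ)
    (hlim : Tendsto (fun n => eLpNorm (fun x => f n x - g x) 2 σ) atTop (𝓝 0)) {p : ℝ}
    {c : ℕ → ℝ≥0∞} {C : ℝ≥0∞} (hc : Tendsto c atTop (𝓝 C))
    (h : ∀ n, ∫⁻ x, ∫⁻ y, ‖f n x - f n y‖ₑ ^ 2 / ‖x - y‖ₑ ^ p ∂σ ∂σ ≤ c n) :
    ∫⁻ x, ∫⁻ y, ‖g x - g y‖ₑ ^ 2 / ‖x - y‖ₑ ^ p ∂σ ∂σ ≤ C := by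
  obtain ⟨ns, hns, hae⟩ := (tendstoInMeasure_of_tendsto_eLpNorm two_ne_zero
    (fun n => (hf n).aestronglyMeasurable) hg hlim).exists_seq_tendsto_ae
  refine (lintegral_slobodeckij_le_liminf (fun n => hf (ns n)) hae p).trans ?_
  rw [← (hc.comp hns.tendsto_atTop).liminf_eq]
  exact liminf_le_liminf (Eventually.of_forall fun n => h (ns n))

theorem slobodeckij_le_of_tendsto {S : Set (Vec d)} [SFinite (surface S)] {s : ℝ}
    {f : ℕ → L2Surf S} {g : L2Surf S} (hlim : Tendsto f atTop (𝓝 g)) {c : ℕ → ℝ≥0∞} {C : ℝ≥0∞}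
    (hc : Tendsto c atTop (𝓝 C)) (h : ∀ n, slobodeckij S s (f n) ≤ c n) :
    slobodeckij S s g ≤ C := by
  refine lintegral_slobodeckij_le_of_tendsto (f := fun n => f n)
    (fun n => (Lp.stronglyMeasurable (f n)).measurable) (Lp.aestronglyMeasurable g) ?_ hc h
  have := (Lp.tendsto_Lp_iff_tendsto_eLpNorm' f g).1 hlim
  exact this

/-! ### The trace estimate for Sobolev fields -/

/-- The smooth fields approximating the trace converge in L² together with their Jacobians, hence
their strains; the estimate passes to the limit by lower semicontinuity. The factor 4 comes from the
symmetrised derivative being twice the strain. -/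
theorem exists_slobodeckij_trace_le (hd : 2 ≤ d) {D Γ : Set (Vec d)} (hΓ : IsCompact Γ)
    (hchart : ∀ x ∈ Γ, HasChart D Γ x) :
    ∃ C : ℝ≥0, ∀ (p : Jet D) (g : L2Surf Γ), HasTrace D Γ p g →
      slobodeckij Γ (1 / 2) g
        ≤ C * (eLpNorm (fun x => strain (p.2 x)) 2 (volume.restrict D) ^ 2 + ‖p.1‖ₑ ^ 2) := by
  obtain ⟨C, hC⟩ := exists_trace_estimate hd hΓ hchart
  have hfinite := isFiniteMeasure_surface hd hΓ hchart
  refine ⟨C * 4, fun p g ⟨φ, hφ, h1, h2, h3⟩ => ?_⟩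
  set μ := (volume : Measure (Vec d)).restrict D
  set a : ℕ → ℝ≥0∞ := fun n => eLpNorm (fun x => strain (jacobian (φ n) x)) 2 μ
  set b : ℕ → ℝ≥0∞ := fun n => eLpNorm (φ n) 2 μ
  set a₀ := eLpNorm (fun x => strain (p.2 x)) 2 μ with ha₀
  have hp2 : AEStronglyMeasurable (fun x => p.2 x) μ := Lp.aestronglyMeasurable _
  have hp1 : AEStronglyMeasurable (fun x => p.1 x) μ := Lp.aestronglyMeasurable _
  have hjm : ∀ n, AEStronglyMeasurable (jacobian (φ n)) μ := fun n =>
    (continuous_jacobian (hφ n).1).aestronglyMeasurable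
  have hsm : AEStronglyMeasurable (fun x => strain (p.2 x)) μ :=
    (strainL d).continuous.comp_aestronglyMeasurable hp2
  set ε₁ : ℕ → ℝ≥0∞ := fun n => ENNReal.ofReal ‖strainL d‖ *
    eLpNorm (fun x => jacobian (φ n) x - p.2 x) 2 μ
  set ε₂ : ℕ → ℝ≥0∞ := fun n => eLpNorm (fun x => φ n x - p.1 x) 2 μ
  have ha : ∀ n, a n ≤ ε₁ n + a₀ := fun n => by
    have h4 : (fun x => strain (jacobian (φ n) x))
        = (fun x => strainL d (jacobian (φ n) x - p.2 x)) + fun x => strain (p.2 x) := by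
      ext1 x
      simp only [Pi.add_apply, map_sub, strainL_apply, sub_add_cancel]
    simp only [a]
    rw [h4]
    refine (eLpNorm_add_le ((strainL d).continuous.comp_aestronglyMeasurable ((hjm n).sub hp2)) hsm
      (by norm_num)).trans (add_le_add_left ?_ _)
    refine eLpNorm_le_mul_eLpNorm_of_ae_le_mul (Eventually.of_forall fun x => ?_) 2
    exact (strainL d).le_opNorm _
  have hb : ∀ n, b n ≤ ε₂ n + ‖p.1‖ₑ := fun n => by
    have h4 : φ n = (fun x => φ n x - p.1 x) + fun x => p.1 x := by ext1 x; simp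
    simp only [b]
    conv_lhs => rw [h4]
    refine (eLpNorm_add_le ((hφ n).1.continuous.aestronglyMeasurable.sub hp1) hp1
      (by norm_num)).trans (add_le_add_right (le_of_eq ?_) _)
    exact (Lp.enorm_def p.1).symm
  have hε₁ : Tendsto ε₁ atTop (𝓝 0) := by
    have := ENNReal.Tendsto.const_mul h2 (Or.inr (ENNReal.ofReal_ne_top (r := ‖strainL d‖)))
    rwa [mul_zero] at this
  have hc : Tendsto (fun n => (C : ℝ≥0∞) * (4 * (ε₁ n + a₀) ^ 2 + (ε₂ n + ‖p.1‖ₑ) ^ 2)) atTop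
      (𝓝 (C * (4 * (0 + a₀) ^ 2 + (0 + ‖p.1‖ₑ) ^ 2))) := by
    refine ENNReal.Tendsto.const_mul ?_ (Or.inr ENNReal.coe_ne_top)
    refine Tendsto.add (ENNReal.Tendsto.const_mul ?_ (Or.inr ENNReal.ofNat_ne_top)) ?_
    · exact ((ENNReal.continuous_pow 2).tendsto _).comp (hε₁.add tendsto_const_nhds)
    · exact ((ENNReal.continuous_pow 2).tendsto _).comp (h1.add tendsto_const_nhds)
  have hkey := lintegral_slobodeckij_le_of_tendsto (p := (d : ℝ) - 1 + 2 * (1 / 2))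
    (fun n => (hφ n).1.continuous.measurable) (Lp.aestronglyMeasurable g) h3 hc fun n => by
      have e : (d : ℝ) - 1 + 2 * (1 / 2) = d := by ring
      rw [e]
      refine (hC (φ n) (hφ n).1).trans (mul_le_mul_right (add_le_add ?_ ?_) _)
      · calc _ ≤ ∫⁻ x in D, 4 * ‖strain (jacobian (φ n) x)‖ₑ ^ 2 := by
              refine lintegral_mono fun x => ?_
              refine (pow_le_pow_left₀ zero_le (enorm_symDeriv_le (φ n) x) 2).trans (le_of_eq ?_)
              rw [mul_pow]
              norm_num
          _ = 4 * a n ^ 2 := by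
              rw [lintegral_const_mul' _ _ ENNReal.ofNat_ne_top, DissipativeRelation.eLpNorm_two_sq]
          _ ≤ _ := by gcongr; exact ha n
      · rw [← DissipativeRelation.eLpNorm_two_sq]
        gcongr
        exact hb n
  refine hkey.trans ?_
  simp only [zero_add]
  push_cast
  rw [mul_assoc]
  gcongr
  rw [mul_add]
  gcongr
  exact le_mul_of_one_le_left zero_le (by norm_num)

end StokesLame

/-! ### Double integrals over a diagonal strip -/

theorem lintegral_lintegral_le_add_tsum {X : Type*} [MeasurableSpace X] {σ : Measure X} [SFinite σ]
    {a l : X → X → ℝ≥0∞} {b : ℕ → X → X → ℝ≥0∞} (ha : Measurable fun q : X × X => a q.1 q.2)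
    (hb : ∀ j, Measurable fun q : X × X => b j q.1 q.2)
    (h : ∀ x y, l x y ≤ a x y + ∑' j, b j x y) :
    ∫⁻ x, ∫⁻ y, l x y ∂σ ∂σ
      ≤ ∫⁻ x, ∫⁻ y, a x y ∂σ ∂σ + ∑' j, ∫⁻ x, ∫⁻ y, b j x y ∂σ ∂σ := by
  have hm : ∀ {k : X → X → ℝ≥0∞}, (Measurable fun q : X × X => k q.1 q.2) →
      Measurable fun x => ∫⁻ y, k x y ∂σ := fun hk => hk.lintegral_prod_right'
  have hs : ∀ {k : X → X → ℝ≥0∞} (x : X), (Measurable fun q : X × X => k q.1 q.2) →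
      Measurable fun y => k x y := fun x hk => hk.comp (measurable_const.prodMk measurable_id)
  have h1 : ∀ x, ∫⁻ y, (a x y + ∑' j, b j x y) ∂σ
      = ∫⁻ y, a x y ∂σ + ∑' j, ∫⁻ y, b j x y ∂σ := fun x => by
    rw [lintegral_add_left (hs x ha), lintegral_tsum fun j => (hs x (hb j)).aemeasurable]
  refine (lintegral_mono fun x => lintegral_mono fun y => h x y).trans (le_of_eq ?_)
  simp only [h1]
  rw [lintegral_add_left (hm ha), lintegral_tsum fun j => (hm (hb j)).aemeasurable]

theorem lintegral_lintegral_mul_add_mul {X : Type*} [MeasurableSpace X] {σ : Measure X} [SFinite σ]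
    {a b : X → X → ℝ≥0∞} {p q : ℝ≥0∞} (ha : Measurable fun q : X × X => a q.1 q.2)
    (hb : Measurable fun q : X × X => b q.1 q.2) :
    ∫⁻ x, ∫⁻ y, (p * a x y + q * b x y) ∂σ ∂σ
      = p * ∫⁻ x, ∫⁻ y, a x y ∂σ ∂σ + q * ∫⁻ x, ∫⁻ y, b x y ∂σ ∂σ := by
  have hm : ∀ {k : X → X → ℝ≥0∞}, (Measurable fun q : X × X => k q.1 q.2) →
      Measurable fun x => ∫⁻ y, k x y ∂σ := fun hk => hk.lintegral_prod_right'
  have hs : ∀ {k : X → X → ℝ≥0∞} (x : X), (Measurable fun q : X × X => k q.1 q.2) →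
      Measurable fun y => k x y := fun x hk => hk.comp (measurable_const.prodMk measurable_id)
  have h1 : ∀ x, ∫⁻ y, (p * a x y + q * b x y) ∂σ
      = p * ∫⁻ y, a x y ∂σ + q * ∫⁻ y, b x y ∂σ := fun x => by
    rw [lintegral_add_left ((hs x ha).const_mul p), lintegral_const_mul _ (hs x ha),
      lintegral_const_mul _ (hs x hb)]
  simp only [h1]
  rw [lintegral_add_left ((hm ha).const_mul p), lintegral_const_mul _ (hm ha),
    lintegral_const_mul _ (hm hb)]

/-- The strip is symmetric and its slices are balls of mass at most M, so each of the two summands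
contributes M times the integral of u. -/
theorem lintegral_lintegral_strip_le {X : Type*} [PseudoMetricSpace X] [MeasurableSpace X]
    [OpensMeasurableSpace X] [SecondCountableTopology X] {σ : Measure X} [SFinite σ] {u : X → ℝ≥0∞}
    (hu : Measurable u) {ρ : ℝ} {M : ℝ≥0∞} (hM : ∀ x, σ (Metric.closedBall x ρ) ≤ M) :
    ∫⁻ x, ∫⁻ y, {q : X × X | dist q.1 q.2 ≤ ρ}.indicator (fun q => u q.1 + u q.2) (x, y) ∂σ ∂σ
      ≤ 2 * M * ∫⁻ x, u x ∂σ := by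
  set S : Set (X × X) := {q : X × X | dist q.1 q.2 ≤ ρ} with hSdef
  have hS : MeasurableSet S := measurableSet_le measurable_dist measurable_const
  have hball : ∀ x, ∫⁻ y, S.indicator (fun _ => (1 : ℝ≥0∞)) (x, y) ∂σ ≤ M := fun x => by
    have h1 : (fun y => S.indicator (fun _ => (1 : ℝ≥0∞)) (x, y))
        = (Metric.closedBall x ρ).indicator fun _ => 1 := by
      ext1 y
      simp only [indicator, hSdef, mem_ofPred_eq, Metric.mem_closedBall, dist_comm]
    refine (le_of_eq ?_).trans (hM x)
    rw [h1]
    exact lintegral_indicator_one Metric.isClosed_closedBall.measurableSet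
  have hI : Measurable (S.indicator fun _ => (1 : ℝ≥0∞)) := measurable_const.indicator hS
  have hIs : ∀ x, Measurable fun y => S.indicator (fun _ => (1 : ℝ≥0∞)) (x, y) := fun x =>
    hI.comp (measurable_const.prodMk measurable_id)
  have hsymm : ∀ x y, S.indicator (fun _ => (1 : ℝ≥0∞)) (x, y)
      = S.indicator (fun _ => (1 : ℝ≥0∞)) (y, x) := fun x y => by
    simp only [indicator, hSdef, mem_ofPred_eq, dist_comm]
  have h1 : ∫⁻ x, ∫⁻ y, u x * S.indicator (fun _ => (1 : ℝ≥0∞)) (x, y) ∂σ ∂σ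
      ≤ M * ∫⁻ x, u x ∂σ := by
    rw [← lintegral_const_mul _ hu]
    refine lintegral_mono fun x => ?_
    rw [lintegral_const_mul _ (hIs x), mul_comm M]
    exact mul_le_mul_right (hball x) _
  have hm1 : Measurable fun q : X × X => u q.1 * S.indicator (fun _ => (1 : ℝ≥0∞)) (q.1, q.2) :=
    (hu.comp measurable_fst).mul hI
  have hm2 : Measurable fun q : X × X => u q.2 * S.indicator (fun _ => (1 : ℝ≥0∞)) (q.1, q.2) :=
    (hu.comp measurable_snd).mul hI
  have h2 : ∫⁻ x, ∫⁻ y, u y * S.indicator (fun _ => (1 : ℝ≥0∞)) (x, y) ∂σ ∂σ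
      ≤ M * ∫⁻ x, u x ∂σ := by
    rw [lintegral_lintegral_swap hm2.aemeasurable]
    refine le_trans (le_of_eq ?_) h1
    refine lintegral_congr fun x => lintegral_congr fun y => ?_
    rw [hsymm]
  have h3 : ∀ x y, S.indicator (fun q => u q.1 + u q.2) (x, y)
      = 1 * (u x * S.indicator (fun _ => (1 : ℝ≥0∞)) (x, y))
        + 1 * (u y * S.indicator (fun _ => (1 : ℝ≥0∞)) (x, y)) := fun x y => by
    by_cases h : (x, y) ∈ S <;> simp [h]
  simp only [h3]
  rw [lintegral_lintegral_mul_add_mul hm1 hm2, one_mul, one_mul, mul_assoc, two_mul]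
  exact add_le_add h1 h2

/-! ### Interpolation between `L²` and `H^{1/2}` -/

theorem enorm_sub_sq_le_of_approx {E : Type*} [NormedAddCommGroup E] (a b a' b' : E) :
    ‖a - b‖ₑ ^ 2 ≤ 2 * ‖a' - b'‖ₑ ^ 2 + 4 * (‖a - a'‖ₑ ^ 2 + ‖b - b'‖ₑ ^ 2) := by
  have h1 : ‖a - b‖ₑ ≤ ‖a' - b'‖ₑ + (‖a - a'‖ₑ + ‖b - b'‖ₑ) := by
    have e : a - b = (a' - b') + ((a - a') - (b - b')) := by abel
    rw [e]
    refine (enorm_add_le _ _).trans (add_le_add_right ?_ _)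
    exact enorm_sub_le
  calc ‖a - b‖ₑ ^ 2 ≤ (‖a' - b'‖ₑ + (‖a - a'‖ₑ + ‖b - b'‖ₑ)) ^ 2 := by gcongr
    _ ≤ 2 * ‖a' - b'‖ₑ ^ 2 + 2 * (‖a - a'‖ₑ + ‖b - b'‖ₑ) ^ 2 := ENNReal.add_sq_le_two_mul _ _
    _ ≤ 2 * ‖a' - b'‖ₑ ^ 2 + 2 * (2 * ‖a - a'‖ₑ ^ 2 + 2 * ‖b - b'‖ₑ ^ 2) := by
        gcongr; exact ENNReal.add_sq_le_two_mul _ _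
    _ = _ := by ring

/-- At distance between 4^(-j-1) and 4^(-j) replace f by g j plus an error. Passing from exponent D
+ ε to D + 1 gains |x - y|^(1-ε) ≤ (2^(-j))^(2-2ε); the error is kept on the whole strip of width
4^(-j). Distances above 1 use f alone. -/
theorem slobodeckij_kernel_interpolation {E F : Type*} [NormedAddCommGroup E]
    [NormedAddCommGroup F] {D ε : ℝ} (hD : 0 ≤ D) (h0 : 0 < ε) (h1 : ε < 1)
    (f : E → F) (g : ℕ → E → F) (x y : E) :
    ‖f x - f y‖ₑ ^ 2 / ‖x - y‖ₑ ^ (D + ε) ≤ 2 * (‖f x‖ₑ ^ 2 + ‖f y‖ₑ ^ 2) +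
      ∑' j, (2 * ENNReal.ofReal (((1 / 2 : ℝ) ^ j) ^ (2 - 2 * ε))
          * (‖g j x - g j y‖ₑ ^ 2 / ‖x - y‖ₑ ^ (D + 1))
        + 4 * ENNReal.ofReal (((1 / 2 : ℝ) ^ (j + 1)) ^ (-2 * (D + ε)))
          * {q : E × E | dist q.1 q.2 ≤ ((1 / 2 : ℝ) ^ j) ^ 2}.indicator
            (fun q => ‖f q.1 - g j q.1‖ₑ ^ 2 + ‖f q.2 - g j q.2‖ₑ ^ 2) (x, y)) := by
  by_cases hxy : x = y
  · subst hxy; simp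
  have hr : 0 < ‖x - y‖ := norm_pos_iff.2 (sub_ne_zero.2 hxy)
  set r := ‖x - y‖ with hrdef
  have her : ‖x - y‖ₑ = ENNReal.ofReal r := (ofReal_norm _).symm
  have hpow : ∀ p : ℝ, ‖x - y‖ₑ ^ p = ENNReal.ofReal (r ^ p) := fun p => by
    rw [her, ENNReal.ofReal_rpow_of_pos hr]
  have hdiv : ∀ (a : ℝ≥0∞) (p : ℝ), a / ‖x - y‖ₑ ^ p = ENNReal.ofReal (r ^ (-p)) * a :=
    fun a p => by
      rw [hpow, div_eq_mul_inv, mul_comm, ← ENNReal.ofReal_inv_of_pos (Real.rpow_pos_of_pos hr p),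
        Real.rpow_neg hr.le]
  by_cases hr1 : 1 < r
  · refine le_trans ?_ le_self_add
    rw [hdiv]
    have h2 : ENNReal.ofReal (r ^ (-(D + ε))) ≤ 1 := by
      rw [ENNReal.ofReal_le_one]
      exact Real.rpow_le_one_of_one_le_of_nonpos hr1.le (by linarith)
    refine (mul_le_of_le_one_left zero_le h2).trans ?_
    calc ‖f x - f y‖ₑ ^ 2 ≤ (‖f x‖ₑ + ‖f y‖ₑ) ^ 2 := by gcongr; exact enorm_sub_le
      _ ≤ _ := (ENNReal.add_sq_le_two_mul _ _).trans (le_of_eq (by ring))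
  push Not at hr1
  -- Base 1/4, the square of the time step: a step 2^(-j) in time corresponds to distance 4^(-j) in
  -- space.
  obtain ⟨j, hj1, hj2⟩ := exists_nat_pow_near_of_lt_one hr hr1
    (by norm_num : (0 : ℝ) < 1 / 4) (by norm_num)
  have hq : ∀ k : ℕ, (1 / 4 : ℝ) ^ k = ((1 / 2 : ℝ) ^ k) ^ 2 := fun k => by
    rw [← pow_mul, mul_comm k 2, pow_mul]; norm_num
  rw [hq] at hj1 hj2
  refine le_trans ?_ (le_add_left (ENNReal.le_tsum j))
  set δ : ℝ := (1 / 2 : ℝ) ^ j with hδ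
  set η : ℝ := (1 / 2 : ℝ) ^ (j + 1) with hη
  have hδ0 : 0 < δ := by positivity
  have hη0 : 0 < η := by positivity
  have hsq : ∀ {a : ℝ}, 0 < a → ∀ p : ℝ, (a ^ 2) ^ p = a ^ (2 * p) := fun ha p => by
    rw [← Real.rpow_natCast, ← Real.rpow_mul ha.le]; norm_num
  have hmem : (x, y) ∈ {q : E × E | dist q.1 q.2 ≤ δ ^ 2} := by
    simpa [dist_eq_norm] using hj2
  rw [indicator_of_mem hmem, hdiv, hdiv]
  have hb1 : ENNReal.ofReal (r ^ (-(D + ε)))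
      ≤ ENNReal.ofReal (δ ^ (2 - 2 * ε)) * ENNReal.ofReal (r ^ (-(D + 1))) := by
    rw [← ENNReal.ofReal_mul (by positivity)]
    refine ENNReal.ofReal_le_ofReal ?_
    have e : r ^ (-(D + ε)) = r ^ (1 - ε) * r ^ (-(D + 1)) := by
      rw [← Real.rpow_add hr]; congr 1; ring
    rw [e]
    refine mul_le_mul_of_nonneg_right ?_ (by positivity)
    refine (Real.rpow_le_rpow hr.le hj2 (by linarith)).trans (le_of_eq ?_)
    rw [hsq hδ0]; congr 1; ring
  have hb2 : ENNReal.ofReal (r ^ (-(D + ε))) ≤ ENNReal.ofReal (η ^ (-2 * (D + ε))) := by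
    refine ENNReal.ofReal_le_ofReal ?_
    have e : η ^ (-2 * (D + ε)) = (η ^ 2) ^ (-(D + ε)) := by rw [hsq hη0]; congr 1; ring
    rw [e]
    exact Real.rpow_le_rpow_of_nonpos (by positivity) hj1.le (by linarith)
  calc ENNReal.ofReal (r ^ (-(D + ε))) * ‖f x - f y‖ₑ ^ 2
      ≤ ENNReal.ofReal (r ^ (-(D + ε))) * (2 * ‖g j x - g j y‖ₑ ^ 2
        + 4 * (‖f x - g j x‖ₑ ^ 2 + ‖f y - g j y‖ₑ ^ 2)) := by
        gcongr; exact enorm_sub_sq_le_of_approx _ _ _ _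
    _ = 2 * (ENNReal.ofReal (r ^ (-(D + ε))) * ‖g j x - g j y‖ₑ ^ 2)
        + 4 * (ENNReal.ofReal (r ^ (-(D + ε))) * (‖f x - g j x‖ₑ ^ 2 + ‖f y - g j y‖ₑ ^ 2)) := by
        ring
    _ ≤ 2 * (ENNReal.ofReal (δ ^ (2 - 2 * ε)) * ENNReal.ofReal (r ^ (-(D + 1)))
          * ‖g j x - g j y‖ₑ ^ 2)
        + 4 * (ENNReal.ofReal (η ^ (-2 * (D + ε)))
          * (‖f x - g j x‖ₑ ^ 2 + ‖f y - g j y‖ₑ ^ 2)) := by gcongr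
    _ = _ := by simp only [mul_assoc]

namespace StokesLame

variable {d : ℕ}

/-- Integration of the pointwise interpolation. By upper Ahlfors regularity a slice of the j-th
strip has mass O(4^(-j(d-1))), which cancels the dimensional part of the singular factor and leaves
the weight (2^(-j))^(-2ε) for the L² errors. -/
theorem exists_slobodeckij_interpolation (hd : 2 ≤ d) {D Γ : Set (Vec d)} (hΓ : IsCompact Γ)
    (hchart : ∀ x ∈ Γ, HasChart D Γ x) {ε : ℝ} (h0 : 0 < ε) (h1 : ε < 1) :
    ∃ C : ℝ≥0∞, C ≠ ⊤ ∧ ∀ (f : L2Surf Γ) (g : ℕ → L2Surf Γ),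
      slobodeckij Γ (ε / 2) f ≤ C * (‖f‖ₑ ^ 2 +
        ∑' j, (ENNReal.ofReal (((1 / 2 : ℝ) ^ j) ^ (2 - 2 * ε)) * slobodeckij Γ (1 / 2) (g j)
          + ENNReal.ofReal (((1 / 2 : ℝ) ^ j) ^ (-2 * ε)) * ‖f - g j‖ₑ ^ 2)) := by
  obtain ⟨A, hA⟩ := exists_surface_closedBall_le hd hΓ hchart
  have hfinite := isFiniteMeasure_surface hd hΓ hchart
  set σ := surface Γ with hσ
  set c : ℝ := 2 ^ (2 * ((d : ℝ) - 1 + ε)) with hc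
  set B : ℝ≥0∞ := 8 * A * ENNReal.ofReal c with hB
  have hD : (0 : ℝ) ≤ (d : ℝ) - 1 := by
    have : (2 : ℝ) ≤ d := by exact_mod_cast hd
    linarith
  refine ⟨4 * σ univ + 2 + B, ?_, fun f g => ?_⟩
  · refine ENNReal.add_ne_top.2 ⟨ENNReal.add_ne_top.2 ⟨ENNReal.mul_ne_top (by simp)
      (measure_ne_top _ _), by simp⟩, ?_⟩
    exact ENNReal.mul_ne_top (ENNReal.mul_ne_top (by simp) ENNReal.coe_ne_top)
      ENNReal.ofReal_ne_top
  have hmf : Measurable (f : Vec d → Vec d) := (Lp.stronglyMeasurable f).measurable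
  have hmg : ∀ j, Measurable (g j : Vec d → Vec d) := fun j =>
    (Lp.stronglyMeasurable (g j)).measurable
  have hnorm : ∀ k : L2Surf Γ, ∫⁻ x, ‖k x‖ₑ ^ 2 ∂σ = ‖k‖ₑ ^ 2 := fun k => by
    rw [← DissipativeRelation.eLpNorm_two_sq, Lp.enorm_def]
  have hnorm' : ∀ j, ∫⁻ x, ‖f x - g j x‖ₑ ^ 2 ∂σ = ‖f - g j‖ₑ ^ 2 := fun j => by
    rw [← hnorm]
    refine lintegral_congr_ae ?_
    filter_upwards [Lp.coeFn_sub f (g j)] with x hx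
    rw [hx, Pi.sub_apply]
  have hmu : ∀ j, Measurable fun x => ‖f x - g j x‖ₑ ^ 2 := fun j =>
    (hmf.sub (hmg j)).enorm.pow_const 2
  have e1 : (d : ℝ) - 1 + 2 * (ε / 2) = (d : ℝ) - 1 + ε := by ring
  have e2 : (d : ℝ) - 1 + 2 * (1 / 2) = (d : ℝ) - 1 + 1 := by ring
  have hmu1 : Measurable fun x => ‖f x‖ₑ ^ 2 := hmf.enorm.pow_const 2
  have hma : Measurable fun q : Vec d × Vec d => 2 * (‖f q.1‖ₑ ^ 2 + ‖f q.2‖ₑ ^ 2) :=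
    ((hmu1.comp measurable_fst).add (hmu1.comp measurable_snd)).const_mul 2
  have hmk : ∀ j, Measurable fun q : Vec d × Vec d =>
      ‖g j q.1 - g j q.2‖ₑ ^ 2 / ‖q.1 - q.2‖ₑ ^ ((d : ℝ) - 1 + 1) := fun j =>
    measurable_slobodeckij_kernel (hmg j) _
  have hmi : ∀ j : ℕ, Measurable fun q : Vec d × Vec d =>
      {q : Vec d × Vec d | dist q.1 q.2 ≤ ((1 / 2 : ℝ) ^ j) ^ 2}.indicator
        (fun q => ‖f q.1 - g j q.1‖ₑ ^ 2 + ‖f q.2 - g j q.2‖ₑ ^ 2) (q.1, q.2) := fun j =>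
    (((hmu j).comp measurable_fst).add ((hmu j).comp measurable_snd)).indicator
      (measurableSet_le measurable_dist measurable_const)
  have hA1 : ∫⁻ x, ∫⁻ y, 2 * (‖f x‖ₑ ^ 2 + ‖f y‖ₑ ^ 2) ∂σ ∂σ = 4 * σ univ * ‖f‖ₑ ^ 2 := by
    have h2 : ∀ x, ∫⁻ y, 2 * (‖f x‖ₑ ^ 2 + ‖f y‖ₑ ^ 2) ∂σ
        = 2 * σ univ * ‖f x‖ₑ ^ 2 + 2 * ‖f‖ₑ ^ 2 := fun x => by
      rw [lintegral_const_mul' _ _ (by simp), lintegral_add_left measurable_const, lintegral_const,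
        hnorm]
      ring
    simp only [h2]
    rw [lintegral_add_right _ measurable_const, lintegral_const, lintegral_const_mul _ hmu1, hnorm]
    ring
  have hterm : ∀ j : ℕ, ∫⁻ x, ∫⁻ y, (2 * ENNReal.ofReal (((1 / 2 : ℝ) ^ j) ^ (2 - 2 * ε))
          * (‖g j x - g j y‖ₑ ^ 2 / ‖x - y‖ₑ ^ ((d : ℝ) - 1 + 1))
        + 4 * ENNReal.ofReal (((1 / 2 : ℝ) ^ (j + 1)) ^ (-2 * ((d : ℝ) - 1 + ε)))
          * {q : Vec d × Vec d | dist q.1 q.2 ≤ ((1 / 2 : ℝ) ^ j) ^ 2}.indicator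
            (fun q => ‖f q.1 - g j q.1‖ₑ ^ 2 + ‖f q.2 - g j q.2‖ₑ ^ 2) (x, y)) ∂σ ∂σ
      ≤ (2 + B) * (ENNReal.ofReal (((1 / 2 : ℝ) ^ j) ^ (2 - 2 * ε)) * slobodeckij Γ (1 / 2) (g j)
          + ENNReal.ofReal (((1 / 2 : ℝ) ^ j) ^ (-2 * ε)) * ‖f - g j‖ₑ ^ 2) := fun j => by
    rw [lintegral_lintegral_mul_add_mul (hmk j) (hmi j)]
    have hslob : ∫⁻ x, ∫⁻ y, ‖g j x - g j y‖ₑ ^ 2 / ‖x - y‖ₑ ^ ((d : ℝ) - 1 + 1) ∂σ ∂σ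
        = slobodeckij Γ (1 / 2) (g j) := by
      rw [slobodeckij, e2]
    rw [hslob]
    set δ : ℝ := (1 / 2 : ℝ) ^ j with hδ
    have hδ0 : 0 < δ := by positivity
    have hstrip := lintegral_lintegral_strip_le (σ := σ) (hmu j)
      (fun x => hA x (δ ^ 2) (by positivity))
    rw [hnorm'] at hstrip
    -- The constant c comes from the scale j + 1 in the singular factor as against j in the mass of
    -- the strip.
    have hcoef : ENNReal.ofReal (((1 / 2 : ℝ) ^ (j + 1)) ^ (-2 * ((d : ℝ) - 1 + ε)))
        * ENNReal.ofReal ((δ ^ 2) ^ (d - 1))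
        = ENNReal.ofReal c * ENNReal.ofReal (δ ^ (-2 * ε)) := by
      rw [← ENNReal.ofReal_mul (by positivity), ← ENNReal.ofReal_mul (by positivity)]
      congr 1
      have hη : (1 / 2 : ℝ) ^ (j + 1) = δ * 2⁻¹ := by rw [pow_succ, hδ]; norm_num
      rw [hη, Real.mul_rpow hδ0.le (by norm_num), Real.inv_rpow (by norm_num),
        ← Real.rpow_neg (by norm_num), ← pow_mul, ← Real.rpow_natCast δ, hc]
      have e3 : -(-2 * ((d : ℝ) - 1 + ε)) = 2 * ((d : ℝ) - 1 + ε) := by ring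
      rw [e3, mul_right_comm, ← Real.rpow_add hδ0, mul_comm]
      congr 2
      push_cast [Nat.cast_sub (by omega : 1 ≤ d)]
      ring
    rw [mul_add (2 + B)]
    refine add_le_add ?_ ?_
    · rw [mul_assoc]
      exact mul_le_mul_left le_self_add _
    · refine (mul_le_mul_right hstrip _).trans ?_
      calc _ = 8 * A * (ENNReal.ofReal (((1 / 2 : ℝ) ^ (j + 1)) ^ (-2 * ((d : ℝ) - 1 + ε)))
            * ENNReal.ofReal ((δ ^ 2) ^ (d - 1))) * ‖f - g j‖ₑ ^ 2 := by ring
        _ = B * (ENNReal.ofReal (δ ^ (-2 * ε)) * ‖f - g j‖ₑ ^ 2) := by rw [hcoef, hB]; ring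
        _ ≤ _ := mul_le_mul_left le_add_self _
  have hstart := lintegral_lintegral_le_add_tsum (σ := σ) hma
    (fun j => ((hmk j).const_mul (2 * ENNReal.ofReal (((1 / 2 : ℝ) ^ j) ^ (2 - 2 * ε)))).add
      ((hmi j).const_mul
        (4 * ENNReal.ofReal (((1 / 2 : ℝ) ^ (j + 1)) ^ (-2 * ((d : ℝ) - 1 + ε))))))
    (slobodeckij_kernel_interpolation hD h0 h1 f (fun j => g j))
  rw [slobodeckij, e1]
  refine hstart.trans ?_
  rw [hA1]
  have htsum := ENNReal.tsum_le_tsum hterm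
  rw [ENNReal.tsum_mul_left] at htsum
  refine le_trans (add_le_add le_rfl htsum) ?_
  rw [mul_add]
  refine add_le_add (mul_le_mul_left ?_ _) (mul_le_mul_left ?_ _)
  · exact le_self_add.trans (le_of_eq (add_assoc _ _ _).symm)
  · exact le_add_self.trans (le_of_eq (add_assoc _ _ _).symm)

end StokesLame

/-! ### Spatial regularity of the output along dyadic time steps -/

theorem tsum_ofReal_dyadic_rpow_lt_top {a : ℝ} (ha : 0 < a) :
    ∑' j : ℕ, ENNReal.ofReal (((1 / 2 : ℝ) ^ j) ^ a) < ⊤ := by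
  have h : ∀ j : ℕ, ENNReal.ofReal (((1 / 2 : ℝ) ^ j) ^ a) = ENNReal.ofReal ((1 / 2 : ℝ) ^ a) ^ j :=
    fun j => by
      rw [← ENNReal.ofReal_pow (by positivity), ← Real.rpow_natCast, ← Real.rpow_natCast,
        ← Real.rpow_mul (by norm_num), ← Real.rpow_mul (by norm_num), mul_comm]
  simp only [h, ENNReal.tsum_geometric, ENNReal.inv_lt_top, tsub_pos_iff_lt]
  rw [ENNReal.ofReal_lt_one]
  exact Real.rpow_lt_one (by norm_num) (by norm_num) ha

namespace DissipativeRelation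

variable {E Z : Type*} [NormedAddCommGroup E] [InnerProductSpace ℝ E] [CompleteSpace E]
  [NormedAddCommGroup Z] [InnerProductSpace ℝ Z] [CompleteSpace Z]
  {G : Submodule ℝ (E × E × Z)} {x : ℝ → E} {K h : ℝ → Z}

/-- Spatial regularity of the output by interpolation along dyadic difference quotients. -/
theorem IsOutput.lintegral_interpolation_lt_top (hG : IsDissipative G) (hx : IsMild G x K)
    (hh : IsOutput K h) {ε : ℝ} (h0 : 0 < ε) (h1 : ε < 1)
    (hfin : ∫⁻ δ in Ioi (0 : ℝ), ENNReal.ofReal (δ ^ (-1 - 2 * ε)) * ‖x δ - x 0‖ₑ ^ 2 < ⊤)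
    {M N : Z → ℝ≥0∞} {B C : ℝ≥0∞} (hB : B ≠ ⊤) (hC : C ≠ ⊤)
    (hN : ∀ a f k, (a, f, k) ∈ G → N k ≤ B * (‖a‖ₑ ^ 2 + ‖f‖ₑ ^ 2))
    (hM : ∀ (f : Z) (g : ℕ → Z), M f ≤ C * (‖f‖ₑ ^ 2 +
        ∑' j, (ENNReal.ofReal (((1 / 2 : ℝ) ^ j) ^ (2 - 2 * ε)) * N (g j)
          + ENNReal.ofReal (((1 / 2 : ℝ) ^ j) ^ (-2 * ε)) * ‖f - g j‖ₑ ^ 2)))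
    (T : ℝ) : ∫⁻ t in Ioo 0 T, M (h t) < ⊤ := by
  set δ : ℕ → ℝ := fun j => (1 / 2 : ℝ) ^ j with hδ
  have hδ0 : ∀ j, 0 < δ j := fun j => by simp only [hδ]; positivity
  set p : ℕ → ℝ≥0∞ := fun j => ENNReal.ofReal (δ j ^ (2 - 2 * ε)) with hp
  set q : ℕ → ℝ≥0∞ := fun j => ENNReal.ofReal (δ j ^ (-2 * ε)) with hq
  set I : ℕ → ℝ≥0∞ := fun j => ENNReal.ofReal (δ j)⁻¹ * ∫⁻ s in Ioc 0 (δ j), ‖x s - x 0‖ₑ ^ 2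
    with hI
  -- The graph norm of a time average costs δ^(-2), which turns the H^{1/2} weight into the L²
  -- weight; one summable series controls both contributions.
  have hpq : ∀ j, p j * ENNReal.ofReal (δ j)⁻¹ ^ 2 = q j := fun j => by
    simp only [hp, hq]
    rw [← ENNReal.ofReal_pow (inv_nonneg.2 (hδ0 j).le),
      ← ENNReal.ofReal_mul (Real.rpow_nonneg (hδ0 j).le _)]
    congr 1
    rw [← Real.rpow_natCast, Real.inv_rpow (hδ0 j).le, ← Real.rpow_neg (hδ0 j).le,
      ← Real.rpow_add (hδ0 j)]
    congr 1
    push_cast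
    ring
  set b : ℕ → ℝ≥0∞ := fun j => B * ‖x 0‖ₑ ^ 2 * p j + 4 * B * (q j * I j) with hb
  set r : ℕ → ℝ → ℝ≥0∞ := fun j t => ‖h t - diffQuot K (δ j) t‖ₑ ^ 2 with hr
  have hpt : ∀ t ∈ Ioo 0 T, M (h t) ≤ C * (‖h t‖ₑ ^ 2 + ∑' j, (b j + q j * r j t)) :=
    fun t ht => by
      refine (hM (h t) fun j => diffQuot K (δ j) t).trans ?_
      gcongr with j
      calc p j * N (diffQuot K (δ j) t)
          ≤ p j * (B * (‖x 0‖ₑ ^ 2 + ENNReal.ofReal (δ j)⁻¹ ^ 2 * (4 * I j))) := by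
            gcongr
            refine (hx.diffQuot_bound hG hN (hδ0 j) ht.1.le).trans ?_
            gcongr
            exact hx.enorm_sub_sq_le hG (hδ0 j)
        _ = B * ‖x 0‖ₑ ^ 2 * p j + 4 * B * ((p j * ENNReal.ofReal (δ j)⁻¹ ^ 2) * I j) := by ring
        _ = b j := by rw [hpq]
  have hmr : ∀ j, AEMeasurable (r j) (volume.restrict (Ioo 0 T)) := fun j => by
    have hK := hx.continuousOn_output hG
    have hc : ContinuousOn (diffQuot K (δ j)) (Ioo 0 T) := by
      refine ContinuousOn.const_smul (ContinuousOn.sub ?_ ?_) _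
      · exact hK.comp (by fun_prop) fun t ht => (add_pos ht.1 (hδ0 j)).le
      · exact hK.mono fun t ht => ht.1.le
    exact ((hh.meas.aestronglyMeasurable.sub
      (hc.aestronglyMeasurable measurableSet_Ioo)).enorm).pow_const 2
  have hmh : AEMeasurable (fun t => ‖h t‖ₑ ^ 2) (volume.restrict (Ioo 0 T)) :=
    (hh.meas.aestronglyMeasurable.enorm).pow_const 2
  have hsum : ∑' j, q j * I j < ⊤ :=
    tsum_dyadic_average_lt_top h0
      (((hx.cont.sub continuous_const).enorm.measurable).pow_const 2) hfin
  have hsump : ∑' j, p j < ⊤ := tsum_ofReal_dyadic_rpow_lt_top (by linarith)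
  have hhfin : ∫⁻ t in Ioo 0 T, ‖h t‖ₑ ^ 2 < ⊤ := by
    refine (lintegral_mono_set fun t ht => ht.1).trans_lt ?_
    rw [← eLpNorm_two_sq]
    exact ENNReal.pow_lt_top (hh.memLp hG hx).2
  have hrj : ∀ j, ∫⁻ t in Ioo 0 T, (b j + q j * r j t)
      ≤ ENNReal.ofReal T * b j + q j * I j := fun j => by
    rw [lintegral_add_left measurable_const, lintegral_const, Measure.restrict_apply_univ,
      Real.volume_Ioo, sub_zero, mul_comm (b j), lintegral_const_mul' _ _ ENNReal.ofReal_ne_top]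
    gcongr
    exact (lintegral_mono_set fun t ht => ht.1).trans (hh.lintegral_sub_diffQuot_le hG hx (hδ0 j))
  calc ∫⁻ t in Ioo 0 T, M (h t)
      ≤ ∫⁻ t in Ioo 0 T, C * (‖h t‖ₑ ^ 2 + ∑' j, (b j + q j * r j t)) :=
        setLIntegral_mono' measurableSet_Ioo hpt
    _ = C * ((∫⁻ t in Ioo 0 T, ‖h t‖ₑ ^ 2) + ∑' j, ∫⁻ t in Ioo 0 T, (b j + q j * r j t)) := by
        rw [lintegral_const_mul' _ _ hC, lintegral_add_left' hmh,
          lintegral_tsum fun j => ((hmr j).const_mul _).const_add _]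
    _ ≤ C * ((∫⁻ t in Ioo 0 T, ‖h t‖ₑ ^ 2) + ∑' j, (ENNReal.ofReal T * b j + q j * I j)) := by
        gcongr with j
        exact hrj j
    _ < ⊤ := by
        refine ENNReal.mul_lt_top hC.lt_top (ENNReal.add_lt_top.2 ⟨hhfin, ?_⟩)
        rw [ENNReal.tsum_add, ENNReal.tsum_mul_left]
        refine ENNReal.add_lt_top.2 ⟨ENNReal.mul_lt_top ENNReal.ofReal_lt_top ?_, hsum⟩
        simp only [hb]
        rw [ENNReal.tsum_add, ENNReal.tsum_mul_left, ENNReal.tsum_mul_left]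
        exact ENNReal.add_lt_top.2 ⟨ENNReal.mul_lt_top (ENNReal.mul_lt_top hB.lt_top
          (ENNReal.pow_lt_top enorm_lt_top)) hsump,
          ENNReal.mul_lt_top (ENNReal.mul_lt_top (by simp) hB.lt_top) hsum⟩

end DissipativeRelation

/-! ### Linear predicates -/

/-- The predicate `Q` cuts out a linear subspace. -/
structure IsSubspace {E : Type*} [AddCommGroup E] [Module ℝ E] (Q : E → Prop) : Prop where
  zero : Q 0
  add : ∀ a b, Q a → Q b → Q (a + b)
  smul : ∀ (c : ℝ) a, Q a → Q (c • a)

namespace IsSubspace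

variable {E F : Type*} [AddCommGroup E] [Module ℝ E] [AddCommGroup F] [Module ℝ F]

theorem and {Q R : E → Prop} (hQ : IsSubspace Q) (hR : IsSubspace R) :
    IsSubspace fun p => Q p ∧ R p :=
  ⟨⟨hQ.zero, hR.zero⟩, fun a b ha hb => ⟨hQ.add a b ha.1 hb.1, hR.add a b ha.2 hb.2⟩,
    fun c a ha => ⟨hQ.smul c a ha.1, hR.smul c a ha.2⟩⟩

theorem all {ι : Sort*} {Q : ι → E → Prop} (hQ : ∀ i, IsSubspace (Q i)) :
    IsSubspace fun p => ∀ i, Q i p :=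
  ⟨fun i => (hQ i).zero, fun a b ha hb i => (hQ i).add a b (ha i) (hb i),
    fun c a ha i => (hQ i).smul c a (ha i)⟩

/-- Projecting preserves linearity; this removes the auxiliary Jacobian and trace from the graph of
the generator. -/
theorem exists_snd {Q : E × F → Prop} (hQ : IsSubspace Q) : IsSubspace fun p => ∃ a, Q (p, a) :=
  ⟨⟨0, hQ.zero⟩, fun _ _ ⟨x, hx⟩ ⟨y, hy⟩ => ⟨x + y, hQ.add _ _ hx hy⟩,
    fun c _ ⟨x, hx⟩ => ⟨c • x, hQ.smul c _ hx⟩⟩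

theorem comap {Q : E → Prop} (hQ : IsSubspace Q) (L : F →ₗ[ℝ] E) :
    IsSubspace fun p => Q (L p) :=
  ⟨by rw [map_zero]; exact hQ.zero, fun a b ha hb => by rw [map_add]; exact hQ.add _ _ ha hb,
    fun c a ha => by rw [map_smul]; exact hQ.smul c _ ha⟩

theorem of_eq (L M : E →ₗ[ℝ] F) : IsSubspace fun p => L p = M p :=
  ⟨by simp, fun a b ha hb => by simp [ha, hb], fun c a ha => by simp [ha]⟩

/-- The subspace cut out by a linear predicate. -/
def toSubmodule {Q : E → Prop} (hQ : IsSubspace Q) : Submodule ℝ E where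
  carrier := {p | Q p}
  zero_mem' := hQ.zero
  add_mem' := fun {a b} ha hb => hQ.add a b ha hb
  smul_mem' := fun c {a} ha => hQ.smul c a ha

end IsSubspace

/-! ### Approximation in `L²` by functions -/

section Approx

variable {α E : Type*} [MeasurableSpace α] {μ : Measure α} [NormedAddCommGroup E] [NormedSpace ℝ E]

theorem tendsto_eLpNorm_sub_add {a b : ℕ → α → E} {f g : Lp E 2 μ}
    (ham : ∀ n, AEStronglyMeasurable (a n) μ) (hbm : ∀ n, AEStronglyMeasurable (b n) μ)
    (ha : Tendsto (fun n => eLpNorm (fun x => a n x - f x) 2 μ) atTop (𝓝 0))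
    (hb : Tendsto (fun n => eLpNorm (fun x => b n x - g x) 2 μ) atTop (𝓝 0)) :
    Tendsto (fun n => eLpNorm (fun x => (a n x + b n x) - (f + g : Lp E 2 μ) x) 2 μ) atTop
      (𝓝 0) := by
  have hsum := ha.add hb
  rw [add_zero] at hsum
  refine tendsto_of_tendsto_of_tendsto_of_le_of_le tendsto_const_nhds hsum (fun _ => zero_le)
    fun n => ?_
  have h1 : eLpNorm (fun x => (a n x + b n x) - (f + g : Lp E 2 μ) x) 2 μ
      = eLpNorm ((fun x => a n x - f x) + fun x => b n x - g x) 2 μ := by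
    refine eLpNorm_congr_ae ?_
    filter_upwards [Lp.coeFn_add f g] with x hx
    simp only [hx, Pi.add_apply]
    abel
  rw [h1]
  exact eLpNorm_add_le ((ham n).sub (Lp.aestronglyMeasurable f))
    ((hbm n).sub (Lp.aestronglyMeasurable g)) (by norm_num)

theorem tendsto_eLpNorm_sub_smul {a : ℕ → α → E} {f : Lp E 2 μ} (c : ℝ)
    (ha : Tendsto (fun n => eLpNorm (fun x => a n x - f x) 2 μ) atTop (𝓝 0)) :
    Tendsto (fun n => eLpNorm (fun x => c • a n x - (c • f : Lp E 2 μ) x) 2 μ) atTop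
      (𝓝 0) := by
  have h := ENNReal.Tendsto.const_mul ha (Or.inr (enorm_ne_top (x := c)))
  rw [mul_zero] at h
  refine h.congr fun n => ?_
  rw [← eLpNorm_const_smul]
  refine eLpNorm_congr_ae ?_
  filter_upwards [Lp.coeFn_smul c f] with x hx
  rw [hx]
  simp only [Pi.smul_apply, smul_sub]

theorem tendsto_eLpNorm_zero_sub :
    Tendsto (fun _ : ℕ => eLpNorm (fun x => (0 : E) - (0 : Lp E 2 μ) x) 2 μ) atTop (𝓝 0) := by
  have h : eLpNorm (fun x => (0 : E) - (0 : Lp E 2 μ) x) 2 μ = 0 := by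
    rw [← eLpNorm_zero (ε := E) (p := 2) (μ := μ)]
    refine eLpNorm_congr_ae ?_
    filter_upwards [Lp.coeFn_zero E 2 μ] with x hx
    rw [hx]
    simp
  rw [h]
  exact tendsto_const_nhds

end Approx

namespace StokesLame

variable {d : ℕ}

/-! ### Integration against test functions as a functional on `L²` -/

/-- Turning an integral against a test function into an inner product with a fixed L² element makes
the defining conditions visibly linear, with no separate integrability checks. -/
theorem exists_toLp_test {E : Type*} [NormedAddCommGroup E] [InnerProductSpace ℝ E]
    (D : Set (Vec d)) {k : Vec d → E} (hk : Continuous k) (hc : HasCompactSupport k) :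
    ∃ t : Lp E 2 ((volume : Measure (Vec d)).restrict D), ∀ f : Lp E 2 (volume.restrict D),
      inner ℝ t f = ∫ x in D, inner ℝ (k x) (f x) := by
  have hmem : MemLp k 2 ((volume : Measure (Vec d)).restrict D) :=
    (hk.memLp_of_hasCompactSupport hc).restrict D
  refine ⟨hmem.toLp k, fun f => ?_⟩
  rw [MeasureTheory.L2.inner_def]
  refine integral_congr_ae ?_
  filter_upwards [hmem.coeFn_toLp] with x hx
  rw [hx]

theorem exists_toLp_coord {ι : Type*} [Fintype ι] [DecidableEq ι] (D : Set (Vec d))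
    {φ : Vec d → ℝ} (hφ : Continuous φ) (hc : HasCompactSupport φ) (i : ι) :
    ∃ t : Lp (EuclideanSpace ℝ ι) 2 ((volume : Measure (Vec d)).restrict D),
      ∀ f : Lp (EuclideanSpace ℝ ι) 2 (volume.restrict D),
        inner ℝ t f = ∫ x in D, f x i * φ x := by
  obtain ⟨t, ht⟩ := exists_toLp_test (E := EuclideanSpace ℝ ι) D
    (k := fun x => φ x • EuclideanSpace.single i 1) (by fun_prop)
    (HasCompactSupport.intro hc.isCompact fun x hx => by
      rw [image_eq_zero_of_notMem_tsupport hx, zero_smul])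
  refine ⟨t, fun f => ?_⟩
  rw [ht]
  refine integral_congr_ae (Eventually.of_forall fun x => ?_)
  simp only [inner_smul_left, EuclideanSpace.inner_single_left]
  simp [mul_comm]

theorem continuous_partialDeriv {φ : Vec d → ℝ} (hφ : ContDiff ℝ ∞ φ) (j : Fin d) :
    Continuous (partialDeriv j φ) :=
  (hφ.continuous_fderiv (by simp)).clm_apply continuous_const

theorem hasCompactSupport_partialDeriv {φ : Vec d → ℝ} (hφ : HasCompactSupport φ) (j : Fin d) :
    HasCompactSupport (partialDeriv j φ) :=
  hφ.fderiv_apply (𝕜 := ℝ) _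

theorem exists_toLp_grad (D : Set (Vec d)) {φ : Vec d → ℝ} (hφ : ContDiff ℝ ∞ φ)
    (hc : HasCompactSupport φ) :
    ∃ t : L2 D, ∀ u : L2 D, inner ℝ t u = ∫ x in D, ∑ j, u x j * partialDeriv j φ x := by
  obtain ⟨t, ht⟩ := exists_toLp_test (E := Vec d) D
    (k := fun x => WithLp.toLp 2 fun j => partialDeriv j φ x)
    ((PiLp.continuous_toLp 2 _).comp (continuous_pi fun j => continuous_partialDeriv hφ j))
    (HasCompactSupport.intro hc.isCompact fun x hx => by
      have h0 : ∀ j, partialDeriv j φ x = 0 := fun j => image_eq_zero_of_notMem_tsupport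
        fun h => hx (tsupport_fderiv_apply_subset ℝ _ h)
      ext j
      simp [h0])
  refine ⟨t, fun f => ?_⟩
  rw [ht]
  refine integral_congr_ae (Eventually.of_forall fun x => ?_)
  simp [PiLp.inner_apply]

theorem exists_toLp_row (D : Set (Vec d)) {φ : Vec d → ℝ} (hφ : ContDiff ℝ ∞ φ)
    (hc : HasCompactSupport φ) (i : Fin d) :
    ∃ t : L2Mat D, ∀ M : L2Mat D, inner ℝ t M = ∫ x in D, ∑ j, M x (i, j) * partialDeriv j φ x := by
  obtain ⟨t, ht⟩ := exists_toLp_test (E := Mat d) D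
    (k := fun x => WithLp.toLp 2 fun ij => if ij.1 = i then partialDeriv ij.2 φ x else 0)
    ((PiLp.continuous_toLp 2 _).comp (continuous_pi fun ij => by
      by_cases h : ij.1 = i
      · simpa [h] using continuous_partialDeriv hφ ij.2
      · simpa [h] using continuous_const))
    (HasCompactSupport.intro hc.isCompact fun x hx => by
      have h0 : ∀ j, partialDeriv j φ x = 0 := fun j => image_eq_zero_of_notMem_tsupport
        fun h => hx (tsupport_fderiv_apply_subset ℝ _ h)
      ext j
      simp [h0])
  refine ⟨t, fun f => ?_⟩
  rw [ht]
  refine integral_congr_ae (Eventually.of_forall fun x => ?_)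
  simp only [PiLp.inner_apply, Fintype.sum_prod_type]
  rw [Finset.sum_eq_single i (fun i' _ hi' => by simp [hi']) (by simp)]
  simp

/-! ### Linearity of the function spaces -/

theorem isSubspace_isH1 (D : Set (Vec d)) : IsSubspace (IsH1 D) := by
  refine IsSubspace.all fun φ => IsSubspace.all fun hφ => IsSubspace.all fun i =>
    IsSubspace.all fun j => ?_
  obtain ⟨s, hs⟩ := exists_toLp_coord (ι := Fin d) D (continuous_partialDeriv hφ.1 j)
    (hasCompactSupport_partialDeriv hφ.2.1 j) i
  obtain ⟨t, ht⟩ := exists_toLp_coord (ι := Fin d × Fin d) D hφ.1.continuous hφ.2.1 (i, j)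
  simp only [← hs, ← ht]
  exact IsSubspace.of_eq (E := Jet D) (F := ℝ) ((innerₛₗ ℝ s).comp (LinearMap.fst ℝ _ _))
    (-(innerₛₗ ℝ t).comp (LinearMap.snd ℝ _ _))

theorem isSubspace_isDivFree (D : Set (Vec d)) : IsSubspace (IsDivFree D) := by
  refine IsSubspace.all fun φ => IsSubspace.all fun hφ => ?_
  obtain ⟨t, ht⟩ := exists_toLp_grad D hφ.1 hφ.2.1
  simp only [← ht]
  exact IsSubspace.of_eq (innerₛₗ ℝ t) 0

/-- A trace is given by an approximating sequence, not by a formula, so linearity holds as that of a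
relation, by combining the sequences. -/
theorem isSubspace_hasTrace (D S : Set (Vec d)) :
    IsSubspace fun p : Jet D × L2Surf S => HasTrace D S p.1 p.2 := by
  refine ⟨⟨fun _ _ => 0, fun _ => ⟨contDiff_const, HasCompactSupport.zero⟩, ?_, ?_, ?_⟩, ?_, ?_⟩
  · exact tendsto_eLpNorm_zero_sub
  · have h : jacobian (fun _ : Vec d => (0 : Vec d)) = fun _ => 0 := by
      ext x ij; simp [jacobian]
    simp only [h]
    exact tendsto_eLpNorm_zero_sub
  · exact tendsto_eLpNorm_zero_sub
  · rintro ⟨p, g⟩ ⟨p', g'⟩ ⟨φ, hφ, h1, h2, h3⟩ ⟨φ', hφ', h1', h2', h3'⟩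
    refine ⟨fun n x => φ n x + φ' n x, fun n => ⟨(hφ n).1.add (hφ' n).1,
      (hφ n).2.add (hφ' n).2⟩, ?_, ?_, ?_⟩
    · exact tendsto_eLpNorm_sub_add (fun n => (hφ n).1.continuous.aestronglyMeasurable)
        (fun n => (hφ' n).1.continuous.aestronglyMeasurable) h1 h1'
    · have h : ∀ n, jacobian (fun x => φ n x + φ' n x)
          = fun x => jacobian (φ n) x + jacobian (φ' n) x := fun n => by
        ext x ij
        have e := fderiv_fun_add (((hφ n).1.differentiable (by simp)) x)
          (((hφ' n).1.differentiable (by simp)) x)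
        simp [jacobian, e]
      simp only [h]
      exact tendsto_eLpNorm_sub_add (fun n => (continuous_jacobian (hφ n).1).aestronglyMeasurable)
        (fun n => (continuous_jacobian (hφ' n).1).aestronglyMeasurable) h2 h2'
    · exact tendsto_eLpNorm_sub_add (fun n => (hφ n).1.continuous.aestronglyMeasurable)
        (fun n => (hφ' n).1.continuous.aestronglyMeasurable) h3 h3'
  · rintro c ⟨p, g⟩ ⟨φ, hφ, h1, h2, h3⟩
    refine ⟨fun n x => c • φ n x, fun n => ⟨(hφ n).1.const_smul c,
      (hφ n).2.smul_left (f := fun _ => c)⟩, ?_, ?_, ?_⟩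
    · exact tendsto_eLpNorm_sub_smul c h1
    · have h : ∀ n, jacobian (fun x => c • φ n x) = fun x => c • jacobian (φ n) x := fun n => by
        ext x ij
        have e := fderiv_fun_const_smul (((hφ n).1.differentiable (by simp)) x) c
        simp [jacobian, e]
      simp only [h]
      exact tendsto_eLpNorm_sub_smul c h2
    · exact tendsto_eLpNorm_sub_smul c h3

theorem isSubspace_inV (P : Geometry d) : IsSubspace (InV P) :=
  (isSubspace_isH1 P.fluid).and (((isSubspace_isDivFree P.fluid).comap (LinearMap.fst ℝ _ _)).and
    ((isSubspace_hasTrace P.fluid P.outer).comap (LinearMap.inl ℝ _ _)))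

end StokesLame

namespace StokesLame

variable {d : ℕ}

/-! ### The square root of the elasticity tensor -/

/-- The coefficient of the trace part of the square root of the elasticity tensor. -/
noncomputable def rootCoeff (d : ℕ) (lam mu : ℝ) : ℝ :=
  (√(2 * mu + d * lam) - √(2 * mu)) / d

/-- The square root of the elasticity tensor, applied to the strain of `G`. -/
noncomputable def root (lam mu : ℝ) (G : Mat d) : Mat d :=
  WithLp.toLp 2 fun ij =>
    rootCoeff d lam mu * (∑ k, strain G (k, k)) * (if ij.1 = ij.2 then 1 else 0)
      + √(2 * mu) * strain G ij

theorem inner_isotropic (a b a' b' s s' : ℝ) (X Y : Mat d) (hs : s = ∑ k, X (k, k))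
    (hs' : s' = ∑ k, Y (k, k)) :
    inner ℝ (WithLp.toLp 2 fun ij : Fin d × Fin d =>
        a * s * (if ij.1 = ij.2 then 1 else 0) + b * X ij : Mat d)
      (WithLp.toLp 2 fun ij : Fin d × Fin d =>
        a' * s' * (if ij.1 = ij.2 then 1 else 0) + b' * Y ij : Mat d)
      = (a * a' * d + a * b' + b * a') * (s * s') + b * b' * inner ℝ X Y := by
  have key : ∀ i j : Fin d,
      (a' * s' * (if i = j then 1 else 0) + b' * Y (i, j))
        * (a * s * (if i = j then 1 else 0) + b * X (i, j))
      = (if i = j then a * a' * (s * s') + a * b' * s * Y (i, j) + b * a' * s' * X (i, j) else 0)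
        + b * b' * (Y (i, j) * X (i, j)) := fun i j => by
    split_ifs <;> ring
  simp only [PiLp.inner_apply, Fintype.sum_prod_type, RCLike.inner_apply, conj_trivial]
  simp only [key, Finset.sum_add_distrib, Finset.sum_ite_eq, Finset.mem_univ, if_true,
    ← Finset.mul_sum, Finset.sum_const, Finset.card_univ, Fintype.card_fin, nsmul_eq_mul]
  rw [← hs, ← hs']
  ring

/-- The elasticity tensor has eigenvalue 2μ on trace-free matrices and 2μ + dλ on multiples of the
identity, and the coefficient of `root` produces their square roots. The elastic energy becomes a
squared L² norm, so the energy space is a plain product of L² spaces and its completeness needs no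
Korn inequality. -/
theorem inner_root_root {lam mu : ℝ} (hd : 0 < d) (hmu : 0 < mu) (hlam : 0 < d * lam + 2 * mu)
    (G H : Mat d) :
    inner ℝ (root lam mu G) (root lam mu H) = inner ℝ (stress lam mu G) (strain H) := by
  have hH : strain H = WithLp.toLp 2 fun ij : Fin d × Fin d =>
      0 * (∑ k, strain H (k, k)) * (if ij.1 = ij.2 then 1 else 0) + 1 * strain H ij := by
    ext ij; simp
  have hd' : (d : ℝ) ≠ 0 := by positivity
  have h1 : √(2 * mu) * √(2 * mu) = 2 * mu := Real.mul_self_sqrt (by linarith)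
  have h2 : √(2 * mu + d * lam) * √(2 * mu + d * lam) = 2 * mu + d * lam :=
    Real.mul_self_sqrt (by linarith)
  have hcoef : rootCoeff d lam mu * rootCoeff d lam mu * d + rootCoeff d lam mu * √(2 * mu)
      + √(2 * mu) * rootCoeff d lam mu = lam := by
    rw [rootCoeff]
    field_simp
    linear_combination h2 - h1
  conv_rhs => rw [hH]
  rw [root, root, stress, inner_isotropic _ _ _ _ _ _ _ _ rfl rfl,
    inner_isotropic _ _ _ _ _ _ _ _ rfl rfl, hcoef, h1]
  ring

theorem inner_stress_strain (lam mu : ℝ) (G H : Mat d) :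
    inner ℝ (stress lam mu G) (strain H)
      = lam * ((∑ k, strain G (k, k)) * ∑ k, strain H (k, k))
        + 2 * mu * inner ℝ (strain G) (strain H) := by
  have hH : strain H = WithLp.toLp 2 fun ij : Fin d × Fin d =>
      0 * (∑ k, strain H (k, k)) * (if ij.1 = ij.2 then 1 else 0) + 1 * strain H ij := by
    ext ij; simp
  conv_lhs => rw [hH]
  rw [stress, inner_isotropic _ _ _ _ _ _ _ _ rfl rfl]
  ring

/-- Coercivity with the smaller eigenvalue: for λ ≥ 0 the trace term is dropped, for λ < 0 it is
bounded by (tr ε)² ≤ d‖ε‖². -/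
theorem min_mul_norm_strain_sq_le {lam mu : ℝ} (hd : 0 < d) (hmu : 0 < mu)
    (hlam : 0 < d * lam + 2 * mu) (G : Mat d) :
    min (2 * mu) (d * lam + 2 * mu) * ‖strain G‖ ^ 2 ≤ ‖root lam mu G‖ ^ 2 := by
  rw [← real_inner_self_eq_norm_sq (root lam mu G), inner_root_root hd hmu hlam,
    inner_stress_strain, real_inner_self_eq_norm_sq]
  set t := ∑ k, strain G (k, k) with ht
  have htr : t * t ≤ d * ‖strain G‖ ^ 2 := by
    have h1 : t ^ 2 ≤ d * ∑ k, strain G (k, k) ^ 2 := by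
      have := sq_sum_le_card_mul_sum_sq (s := Finset.univ) (f := fun k : Fin d => strain G (k, k))
      simpa using this
    have h2 : ∑ k, strain G (k, k) ^ 2 ≤ ‖strain G‖ ^ 2 := by
      rw [EuclideanSpace.norm_sq_eq, Fintype.sum_prod_type]
      refine Finset.sum_le_sum fun i _ => ?_
      have := Finset.single_le_sum (f := fun j => ‖strain G (i, j)‖ ^ 2) (fun j _ => by positivity)
        (Finset.mem_univ i)
      simpa using this
    nlinarith [(Nat.cast_nonneg d : (0 : ℝ) ≤ d)]
  rcases le_total 0 lam with h | h
  · have := min_le_left (2 * mu) (d * lam + 2 * mu)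
    nlinarith [mul_self_nonneg t, sq_nonneg ‖strain G‖]
  · have := min_le_right (2 * mu) (d * lam + 2 * mu)
    nlinarith [sq_nonneg ‖strain G‖]

theorem inner_stress_symm (lam mu : ℝ) (G M : Mat d) :
    inner ℝ M (stress lam mu G) = inner ℝ (stress lam mu G) (strain M) := by
  have hsym : ∀ i j, stress lam mu G (j, i) = stress lam mu G (i, j) := fun i j => by
    simp only [stress, strain]
    rw [add_comm (G (j, i)), if_congr eq_comm rfl rfl]
  simp only [PiLp.inner_apply, Fintype.sum_prod_type, RCLike.inner_apply, conj_trivial]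
  have h1 : ∑ i, ∑ j, M (j, i) * stress lam mu G (i, j)
      = ∑ i, ∑ j, stress lam mu G (i, j) * M (i, j) := by
    rw [Finset.sum_comm]
    refine Finset.sum_congr rfl fun i _ => Finset.sum_congr rfl fun j _ => ?_
    rw [hsym i j, mul_comm]
  have h2 : ∀ i j, strain M (i, j) * stress lam mu G (i, j)
      = 2⁻¹ * (stress lam mu G (i, j) * M (i, j)) + 2⁻¹ * (M (j, i) * stress lam mu G (i, j)) :=
    fun i j => by simp only [strain]; ring
  simp only [h2, Finset.sum_add_distrib, ← Finset.mul_sum]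
  rw [h1]
  ring

/-- `root` as a continuous linear map. -/
noncomputable def rootL (d : ℕ) (lam mu : ℝ) : Mat d →L[ℝ] Mat d :=
  LinearMap.toContinuousLinearMap
    { toFun := root lam mu
      map_add' := fun G H => by
        ext ij
        have h : ∀ kl, strain (G + H) kl = strain G kl + strain H kl := fun kl => by
          rw [← strainL_apply, map_add]; rfl
        simp only [root, h, Finset.sum_add_distrib, PiLp.add_apply]
        ring
      map_smul' := fun c G => by
        ext ij
        have h : ∀ kl, strain (c • G) kl = c * strain G kl := fun kl => by
          rw [← strainL_apply, map_smul]; rfl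
        simp only [root, h, ← Finset.mul_sum, PiLp.smul_apply, smul_eq_mul, RingHom.id_apply]
        ring }

/-- `root` acting on square integrable matrix fields. -/
noncomputable def rootLp (D : Set (Vec d)) (lam mu : ℝ) : L2Mat D →L[ℝ] L2Mat D :=
  (rootL d lam mu).compLpL 2 (volume.restrict D)

/-- The strain acting on square integrable matrix fields. -/
noncomputable def strainLp (D : Set (Vec d)) : L2Mat D →L[ℝ] L2Mat D :=
  (strainL d).compLpL 2 (volume.restrict D)

theorem coeFn_rootLp (D : Set (Vec d)) (lam mu : ℝ) (M : L2Mat D) :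
    rootLp D lam mu M =ᵐ[volume.restrict D] fun x => root lam mu (M x) :=
  (rootL d lam mu).coeFn_compLpL M

theorem coeFn_strainLp (D : Set (Vec d)) (M : L2Mat D) :
    strainLp D M =ᵐ[volume.restrict D] fun x => strain (M x) :=
  (strainL d).coeFn_compLpL M

theorem inner_strainLp (D : Set (Vec d)) (M N : L2Mat D) :
    inner ℝ (strainLp D M) (strainLp D N) = ∫ x in D, inner ℝ (strain (M x)) (strain (N x)) := by
  rw [MeasureTheory.L2.inner_def]
  refine integral_congr_ae ?_
  filter_upwards [coeFn_strainLp D M, coeFn_strainLp D N] with x hx hy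
  rw [hx, hy]

theorem inner_rootLp {lam mu : ℝ} (hd : 0 < d) (hmu : 0 < mu) (hlam : 0 < d * lam + 2 * mu)
    (D : Set (Vec d)) (M N : L2Mat D) :
    inner ℝ (rootLp D lam mu M) (rootLp D lam mu N)
      = ∫ x in D, inner ℝ (stress lam mu (M x)) (strain (N x)) := by
  rw [MeasureTheory.L2.inner_def]
  refine integral_congr_ae ?_
  filter_upwards [coeFn_rootLp D lam mu M, coeFn_rootLp D lam mu N] with x hx hy
  rw [hx, hy, inner_root_root hd hmu hlam]

theorem inner_rootLp_eq_integral {lam mu : ℝ} (hd : 0 < d) (hmu : 0 < mu)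
    (hlam : 0 < d * lam + 2 * mu) (D : Set (Vec d)) (M N : L2Mat D) :
    inner ℝ (rootLp D lam mu M) (rootLp D lam mu N)
      = ∫ x in D, inner ℝ (N x) (stress lam mu (M x)) := by
  rw [inner_rootLp hd hmu hlam]
  refine integral_congr_ae (Eventually.of_forall fun x => ?_)
  exact (inner_stress_symm lam mu (M x) (N x)).symm

theorem min_mul_norm_strainLp_sq_le {lam mu : ℝ} (hd : 0 < d) (hmu : 0 < mu)
    (hlam : 0 < d * lam + 2 * mu) (D : Set (Vec d)) (M : L2Mat D) :
    min (2 * mu) (d * lam + 2 * mu) * ‖strainLp D M‖ ^ 2 ≤ ‖rootLp D lam mu M‖ ^ 2 := by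
  set c := min (2 * mu) (d * lam + 2 * mu) with hc
  have hc0 : 0 ≤ c := le_min (by linarith) hlam.le
  have h : ‖√c • strainLp D M‖ ≤ ‖rootLp D lam mu M‖ := by
    refine Lp.norm_le_norm_of_ae_le ?_
    filter_upwards [coeFn_rootLp D lam mu M, coeFn_strainLp D M,
      Lp.coeFn_smul (√c) (strainLp D M)] with x h1 h2 h3
    rw [h1, h3, Pi.smul_apply, h2]
    refine le_of_sq_le_sq ?_ (norm_nonneg _)
    rw [norm_smul, mul_pow, Real.norm_eq_abs, sq_abs, Real.sq_sqrt hc0]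
    exact min_mul_norm_strain_sq_le hd hmu hlam (M x)
  have h2 := pow_le_pow_left₀ (norm_nonneg _) h 2
  rwa [norm_smul, mul_pow, Real.norm_eq_abs, sq_abs, Real.sq_sqrt hc0] at h2

end StokesLame

namespace StokesLame

variable {d : ℕ}

/-! ### The energy space -/

/-- The energy space: fluid velocity, square root of the elastic energy density, displacement, and
solid velocity. -/
abbrev Energy (P : Geometry d) :=
  WithLp 2 (L2 P.fluid × WithLp 2 (L2Mat P.solid × WithLp 2 (L2 P.solid × L2 P.solid)))

/-- The fluid velocity of an element of the energy space. -/
noncomputable def energyFluid (P : Geometry d) : Energy P →L[ℝ] L2 P.fluid :=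
  WithLp.fstL 2 ℝ _ _

/-- The square root of the elastic energy density of an element of the energy space. -/
noncomputable def energyElastic (P : Geometry d) : Energy P →L[ℝ] L2Mat P.solid :=
  (WithLp.fstL 2 ℝ _ _).comp (WithLp.sndL 2 ℝ _ _)

/-- The displacement of an element of the energy space. -/
noncomputable def energyDisplacement (P : Geometry d) : Energy P →L[ℝ] L2 P.solid :=
  (WithLp.fstL 2 ℝ _ _).comp ((WithLp.sndL 2 ℝ _ _).comp (WithLp.sndL 2 ℝ _ _))

/-- The solid velocity of an element of the energy space. -/
noncomputable def energyVelocity (P : Geometry d) : Energy P →L[ℝ] L2 P.solid :=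
  (WithLp.sndL 2 ℝ _ _).comp ((WithLp.sndL 2 ℝ _ _).comp (WithLp.sndL 2 ℝ _ _))

theorem inner_energy (P : Geometry d) (x y : Energy P) :
    inner ℝ x y = inner ℝ (energyFluid P x) (energyFluid P y)
      + (inner ℝ (energyElastic P x) (energyElastic P y)
      + (inner ℝ (energyDisplacement P x) (energyDisplacement P y)
      + inner ℝ (energyVelocity P x) (energyVelocity P y))) := rfl

/-- The energy map, whose squared norm is twice the energy of a state. -/
noncomputable def energyMap (P : Geometry d) (lam mu : ℝ) : State P →L[ℝ] Energy P :=
  let a : State P →L[ℝ] L2 P.fluid := ContinuousLinearMap.fst ℝ _ _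
  let w : State P →L[ℝ] Jet P.solid :=
    (ContinuousLinearMap.fst ℝ _ _).comp (ContinuousLinearMap.snd ℝ _ _)
  let z : State P →L[ℝ] L2 P.solid :=
    (ContinuousLinearMap.snd ℝ _ _).comp (ContinuousLinearMap.snd ℝ _ _)
  let r : State P →L[ℝ] L2Mat P.solid :=
    (rootLp P.solid lam mu).comp ((ContinuousLinearMap.snd ℝ _ _).comp w)
  let b : State P →L[ℝ] WithLp 2 (L2 P.solid × L2 P.solid) :=
    ((WithLp.prodContinuousLinearEquiv 2 ℝ (L2 P.solid) (L2 P.solid)).symm :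
      L2 P.solid × L2 P.solid →L[ℝ] _).comp
      (((ContinuousLinearMap.fst ℝ _ _).comp w).prod z)
  let c : State P →L[ℝ] WithLp 2 (L2Mat P.solid × WithLp 2 (L2 P.solid × L2 P.solid)) :=
    ((WithLp.prodContinuousLinearEquiv 2 ℝ (L2Mat P.solid)
      (WithLp 2 (L2 P.solid × L2 P.solid))).symm : _ →L[ℝ] _).comp (r.prod b)
  ((WithLp.prodContinuousLinearEquiv 2 ℝ (L2 P.fluid)
    (WithLp 2 (L2Mat P.solid × WithLp 2 (L2 P.solid × L2 P.solid)))).symm : _ →L[ℝ] _).comp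
    (a.prod c)

theorem energyFluid_energyMap (P : Geometry d) (lam mu : ℝ) (y : State P) :
    energyFluid P (energyMap P lam mu y) = y.1 := rfl

theorem energyElastic_energyMap (P : Geometry d) (lam mu : ℝ) (y : State P) :
    energyElastic P (energyMap P lam mu y) = rootLp P.solid lam mu y.2.1.2 := rfl

theorem energyDisplacement_energyMap (P : Geometry d) (lam mu : ℝ) (y : State P) :
    energyDisplacement P (energyMap P lam mu y) = y.2.1.1 := rfl

theorem energyVelocity_energyMap (P : Geometry d) (lam mu : ℝ) (y : State P) :
    energyVelocity P (energyMap P lam mu y) = y.2.2 := rfl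

theorem norm_sq_energy (P : Geometry d) (x : Energy P) :
    ‖x‖ ^ 2 = ‖energyFluid P x‖ ^ 2 + (‖energyElastic P x‖ ^ 2
      + (‖energyDisplacement P x‖ ^ 2 + ‖energyVelocity P x‖ ^ 2)) := by
  simp only [← real_inner_self_eq_norm_sq]
  exact inner_energy P x x

/-! ### Green's formula in the energy space -/

/-- Jets with a trace on the interface that are admissible in Green's formula, together with test
fields supported inside the solid. -/
def IsGreenTest (P : Geometry d) (q : Jet P.solid × L2Surf P.interface) : Prop :=
  (IsH1 P.solid q.1 ∧ HasTrace P.solid P.interface q.1 q.2) ∨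
    ∃ (φ : Vec d → ℝ) (i : Fin d), IsTest P.solid φ ∧ q.2 = 0 ∧
      (∀ F : L2 P.solid, inner ℝ q.1.1 F = ∫ x in P.solid, F x i * φ x) ∧
      ∀ M : L2Mat P.solid, inner ℝ q.1.2 M = ∫ x in P.solid, ∑ j, M x (i, j) * partialDeriv j φ x

/-- The stress acting on square integrable matrix fields. -/
noncomputable def stressLp (D : Set (Vec d)) (lam mu : ℝ) : L2Mat D →L[ℝ] L2Mat D :=
  (LinearMap.toContinuousLinearMap
    { toFun := stress lam mu
      map_add' := fun G H => by
        ext ij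
        have h : ∀ kl, strain (G + H) kl = strain G kl + strain H kl := fun kl => by
          rw [← strainL_apply, map_add]; rfl
        simp only [stress, h, Finset.sum_add_distrib, PiLp.add_apply]
        ring
      map_smul' := fun c G => by
        ext ij
        have h : ∀ kl, strain (c • G) kl = c * strain G kl := fun kl => by
          rw [← strainL_apply, map_smul]; rfl
        simp only [stress, h, ← Finset.mul_sum, PiLp.smul_apply, smul_eq_mul, RingHom.id_apply]
        ring } : Mat d →L[ℝ] Mat d).compLpL 2 (volume.restrict D)

theorem coeFn_stressLp (D : Set (Vec d)) (lam mu : ℝ) (M : L2Mat D) :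
    stressLp D lam mu M =ᵐ[volume.restrict D] fun x => stress lam mu (M x) :=
  ContinuousLinearMap.coeFn_compLpL _ M

theorem inner_stressLp {lam mu : ℝ} (hd : 0 < d) (hmu : 0 < mu) (hlam : 0 < d * lam + 2 * mu)
    (D : Set (Vec d)) (M N : L2Mat D) :
    inner ℝ N (stressLp D lam mu M) = inner ℝ (rootLp D lam mu M) (rootLp D lam mu N) := by
  rw [inner_rootLp_eq_integral hd hmu hlam, MeasureTheory.L2.inner_def]
  refine integral_congr_ae ?_
  filter_upwards [coeFn_stressLp D lam mu M] with x hx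
  rw [hx]

/-- Merges the distributional divergence and Green's formula into one family of linear equations in
h, w and F, each of which depends on w only through `rootLp` and so survives limits in the energy
space. -/
theorem hasDivAndNormalStress_iff {P : Geometry d} {lam mu : ℝ} (hd : 0 < d) (hmu : 0 < mu)
    (hlam : 0 < d * lam + 2 * mu) (w : Jet P.solid) (F : L2 P.solid) (h : L2Surf P.interface) :
    HasDivAndNormalStress P lam mu w F h ↔ IsH1 P.solid w ∧ ∀ q, IsGreenTest P q →
      inner ℝ h q.2 = -inner ℝ (rootLp P.solid lam mu w.2) (rootLp P.solid lam mu q.1.2)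
        - inner ℝ F q.1.1 := by
  have hInteg : ∀ (i : Fin d) (φ : Vec d → ℝ),
      ∫ x in P.solid, ∑ j, stressLp P.solid lam mu w.2 x (i, j) * partialDeriv j φ x
        = ∫ x in P.solid, ∑ j, stress lam mu (w.2 x) (i, j) * partialDeriv j φ x := fun i φ => by
    refine integral_congr_ae ?_
    filter_upwards [coeFn_stressLp P.solid lam mu w.2] with x hx
    rw [hx]
  constructor
  · rintro ⟨h1, h2, h3⟩
    refine ⟨h1, ?_⟩
    rintro ⟨ψ, g⟩ (⟨hψ, hg⟩ | ⟨φ, i, hφ, hq, hF, hM⟩)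
    · have := h3 ψ g hψ hg
      rw [inner_rootLp hd hmu hlam, MeasureTheory.L2.inner_def, MeasureTheory.L2.inner_def]
      exact this
    · have h4 := h2 φ hφ i
      rw [← hInteg, ← hM, ← hF, inner_stressLp hd hmu hlam] at h4
      rw [hq, inner_zero_right, h4, real_inner_comm F]
      simp
  · rintro ⟨h1, h2⟩
    refine ⟨h1, fun φ hφ i => ?_, fun ψ g hψ hg => ?_⟩
    · obtain ⟨t, ht⟩ := exists_toLp_coord P.solid hφ.1.continuous hφ.2.1 i
      obtain ⟨s, hs⟩ := exists_toLp_row P.solid hφ.1 hφ.2.1 i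
      have h4 := h2 ((t, s), 0) (Or.inr ⟨φ, i, hφ, rfl, ht, hs⟩)
      rw [← hInteg, ← hs, ← ht, inner_stressLp hd hmu hlam]
      rw [inner_zero_right, real_inner_comm] at h4
      rw [real_inner_comm] at h4
      simp only at h4
      rw [real_inner_comm F t]
      linarith
    · have h4 := h2 (ψ, g) (Or.inl ⟨hψ, hg⟩)
      rw [inner_rootLp hd hmu hlam, MeasureTheory.L2.inner_def, MeasureTheory.L2.inner_def] at h4
      exact h4

end StokesLame

namespace StokesLame

variable {d : ℕ} {P : Geometry d} {lam mu : ℝ}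

/-! ### The generator as a dissipative relation -/

/-- Weak form of `f = 𝓐 y` with normal stress `h`; the auxiliary data `a` are the Jacobian of the
fluid velocity and its trace on the interface. -/
def IsWeakGeneratorWith (P : Geometry d) (lam mu : ℝ)
    (q : (State P × State P × L2Surf P.interface) × L2Mat P.fluid × L2Surf P.interface) : Prop :=
  InV P (q.1.1.1, q.2.1) ∧ HasTrace P.fluid P.interface (q.1.1.1, q.2.1) q.2.2 ∧
    HasTrace P.solid P.interface q.1.2.1.2.1 (q.2.2 + q.1.2.2) ∧
    IsH1 P.solid q.1.2.1.2.1 ∧ q.1.2.1.2.1.1 = q.1.1.2.2 ∧ IsH1 P.solid q.1.1.2.1 ∧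
    (∀ (φ : Jet P.fluid) (g : L2Surf P.interface), InV P φ ∧ HasTrace P.fluid P.interface φ g →
      inner ℝ φ.1 q.1.2.1.1 + inner ℝ (strainLp P.fluid φ.2) (strainLp P.fluid q.2.1)
        = inner ℝ g q.1.2.2) ∧
    ∀ p, IsGreenTest P p → inner ℝ p.2 q.1.2.2
      = -inner ℝ (rootLp P.solid lam mu p.1.2) (rootLp P.solid lam mu q.1.1.2.1.2)
        - inner ℝ p.1.1 (q.1.2.1.2.2 + q.1.1.2.1.1)

theorem isSubspace_fluid_eq (φ : Jet P.fluid) (g : L2Surf P.interface) :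
    IsSubspace fun q : (State P × State P × L2Surf P.interface) × L2Mat P.fluid ×
      L2Surf P.interface =>
      inner ℝ φ.1 q.1.2.1.1 + inner ℝ (strainLp P.fluid φ.2) (strainLp P.fluid q.2.1)
        = inner ℝ g q.1.2.2 := by
  refine ⟨by simp, fun a b ha hb => ?_, fun c a ha => ?_⟩
  · simp only [Prod.fst_add, Prod.snd_add, map_add, inner_add_right, ← ha, ← hb]
    ring
  · simp only [Prod.smul_fst, Prod.smul_snd, map_smul, real_inner_smul_right, ← ha]
    ring

theorem isSubspace_solid_eq (lam mu : ℝ) (p : Jet P.solid × L2Surf P.interface) :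
    IsSubspace fun q : (State P × State P × L2Surf P.interface) × L2Mat P.fluid ×
      L2Surf P.interface => inner ℝ p.2 q.1.2.2
      = -inner ℝ (rootLp P.solid lam mu p.1.2) (rootLp P.solid lam mu q.1.1.2.1.2)
        - inner ℝ p.1.1 (q.1.2.1.2.2 + q.1.1.2.1.1) := by
  refine ⟨by simp, fun a b ha hb => ?_, fun c a ha => ?_⟩
  · simp only [Prod.fst_add, Prod.snd_add, map_add, inner_add_right, ha, hb]
    ring
  · simp only [Prod.smul_fst, Prod.smul_snd, map_smul, real_inner_smul_right, ha, ← smul_add]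
    ring

theorem isSubspace_isWeakGeneratorWith (P : Geometry d) (lam mu : ℝ) :
    IsSubspace (IsWeakGeneratorWith P lam mu) := by
  have h5 : ∀ φ : Jet P.fluid, ∀ g : L2Surf P.interface,
      IsSubspace fun q : (State P × State P × L2Surf P.interface) × L2Mat P.fluid ×
        L2Surf P.interface => InV P φ ∧ HasTrace P.fluid P.interface φ g →
        inner ℝ φ.1 q.1.2.1.1 + inner ℝ (strainLp P.fluid φ.2) (strainLp P.fluid q.2.1)
          = inner ℝ g q.1.2.2 := fun φ g => IsSubspace.all fun _ => isSubspace_fluid_eq φ g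
  have h6 : ∀ p, IsSubspace fun q : (State P × State P × L2Surf P.interface) × L2Mat P.fluid ×
      L2Surf P.interface => IsGreenTest P p → inner ℝ p.2 q.1.2.2
        = -inner ℝ (rootLp P.solid lam mu p.1.2) (rootLp P.solid lam mu q.1.1.2.1.2)
          - inner ℝ p.1.1 (q.1.2.1.2.2 + q.1.1.2.1.1) :=
    fun p => IsSubspace.all fun _ => isSubspace_solid_eq lam mu p
  refine ⟨⟨(isSubspace_inV P).zero, (isSubspace_hasTrace P.fluid P.interface).zero, ?_,
    (isSubspace_isH1 P.solid).zero, rfl, (isSubspace_isH1 P.solid).zero,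
    fun φ g => (h5 φ g).zero, fun p => (h6 p).zero⟩, ?_, ?_⟩
  · have := (isSubspace_hasTrace P.solid P.interface).zero
    simp only [Prod.fst_zero, Prod.snd_zero, add_zero] at this ⊢
    exact this
  · rintro a b ⟨a1, a2, a3, a4, a5, a6, a7, a8⟩ ⟨b1, b2, b3, b4, b5, b6, b7, b8⟩
    refine ⟨(isSubspace_inV P).add _ _ a1 b1, (isSubspace_hasTrace P.fluid P.interface).add
      ((a.1.1.1, a.2.1), a.2.2) ((b.1.1.1, b.2.1), b.2.2) a2 b2, ?_,
      (isSubspace_isH1 P.solid).add _ _ a4 b4, ?_, (isSubspace_isH1 P.solid).add _ _ a6 b6,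
      fun φ g => (h5 φ g).add a b (a7 φ g) (b7 φ g), fun p => (h6 p).add a b (a8 p) (b8 p)⟩
    · have := (isSubspace_hasTrace P.solid P.interface).add (a.1.2.1.2.1, a.2.2 + a.1.2.2)
        (b.1.2.1.2.1, b.2.2 + b.1.2.2) a3 b3
      simp only [Prod.fst_add, Prod.snd_add] at this ⊢
      rwa [add_add_add_comm]
    · simp only [Prod.fst_add, Prod.snd_add, a5, b5]
  · rintro c a ⟨a1, a2, a3, a4, a5, a6, a7, a8⟩
    refine ⟨(isSubspace_inV P).smul c _ a1, (isSubspace_hasTrace P.fluid P.interface).smul c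
      ((a.1.1.1, a.2.1), a.2.2) a2, ?_,
      (isSubspace_isH1 P.solid).smul c _ a4, ?_, (isSubspace_isH1 P.solid).smul c _ a6,
      fun φ g => (h5 φ g).smul c a (a7 φ g), fun p => (h6 p).smul c a (a8 p)⟩
    · have := (isSubspace_hasTrace P.solid P.interface).smul c (a.1.2.1.2.1, a.2.2 + a.1.2.2) a3
      simp only [Prod.smul_fst, Prod.smul_snd, smul_add] at this ⊢
      exact this
    · simp only [Prod.smul_fst, Prod.smul_snd, a5]

/-- The graph of the generator, with the normal stress as output. -/
noncomputable def generatorGraph (P : Geometry d) (lam mu : ℝ) :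
    Submodule ℝ (State P × State P × L2Surf P.interface) :=
  (isSubspace_isWeakGeneratorWith P lam mu).exists_snd.toSubmodule

theorem mem_generatorGraph {y f : State P} {h : L2Surf P.interface} :
    (y, f, h) ∈ generatorGraph P lam mu ↔ ∃ a, IsWeakGeneratorWith P lam mu ((y, f, h), a) :=
  Iff.rfl

/-- Testing A(u - Nh) with φ in V, the Neumann map contributes exactly the boundary term ⟨h, φ⟩, so
both A and N disappear from the weak form. -/
theorem IsGenerator.exists_mem_generatorGraph (hd : 0 < d) (hmu : 0 < mu)
    (hlam : 0 < d * lam + 2 * mu) {y f : State P} (hyf : IsGenerator P lam mu y f) :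
    ∃ h, HasNormalStress P lam mu y.2.1 h ∧ (y, f, h) ∈ generatorGraph P lam mu := by
  obtain ⟨hY, Du, Dz, F, h, n, gu, gz, hV, hS, hz, hN, hgu, hgz, hgzu, hA, hf1, hf2⟩ := hyf
  refine ⟨h, ⟨F, hS⟩, mem_generatorGraph.2 ⟨(Du, gu), hV, hgu, ?_, ?_, ?_, hY.2, ?_, ?_⟩⟩
  · simp only [hf1, ← hgzu, sub_add_cancel]
    exact hgz
  · simp only [hf1]
    exact hz
  · simp only [hf1]
  · rintro φ g ⟨hφ, hg⟩
    have h1 := hA.2.2 φ hφ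
    have h2 := hN.2 φ g hφ hg
    rw [← MeasureTheory.L2.inner_def, ← inner_strainLp] at h1
    rw [← MeasureTheory.L2.inner_def, ← inner_strainLp] at h2
    simp only [Prod.snd_sub, map_sub, inner_sub_left] at h1
    rw [real_inner_comm] at h1
    rw [real_inner_comm (strainLp P.fluid Du), h1, real_inner_comm h g, ← h2]
    ring
  · intro p hp
    have h1 := ((hasDivAndNormalStress_iff hd hmu hlam _ _ _).1 hS).2 p hp
    simp only [hf2, sub_add_cancel]
    rw [real_inner_comm h p.2, h1, real_inner_comm (rootLp P.solid lam mu p.1.2),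
      real_inner_comm F]

/-- The energy identity. Test the fluid equation with u and Green's formula with z, whose trace is
that of u plus h; the boundary terms reduce to ⟨u, h⟩ - ⟨u + h, h⟩ = -‖h‖². -/
theorem inner_energyMap_of_isWeakGeneratorWith {y f : State P} {h : L2Surf P.interface}
    {a : L2Mat P.fluid × L2Surf P.interface}
    (H : IsWeakGeneratorWith P lam mu ((y, f, h), a)) :
    inner ℝ (energyMap P lam mu f) (energyMap P lam mu y)
      = -‖strainLp P.fluid a.1‖ ^ 2 - ‖h‖ ^ 2 := by
  obtain ⟨hV, hgu, hgz, hz, hzf, hw, hA, hS⟩ := H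
  have h1 := hA (y.1, a.1) a.2 ⟨hV, hgu⟩
  have h2 := hS (f.2.1, a.2 + h) (Or.inl ⟨hz, hgz⟩)
  simp only at h1 h2 hzf
  rw [inner_energy]
  simp only [energyFluid_energyMap, energyElastic_energyMap, energyDisplacement_energyMap,
    energyVelocity_energyMap]
  rw [hzf] at h2 ⊢
  rw [real_inner_self_eq_norm_sq] at h1
  rw [inner_add_left, real_inner_self_eq_norm_sq, inner_add_right] at h2
  rw [real_inner_comm y.1 f.1, real_inner_comm y.2.2 f.2.2]
  linarith

/-- The closure, in the energy space, of the graph of the generator. -/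
noncomputable def energyGraph (P : Geometry d) (lam mu : ℝ) :
    Submodule ℝ (Energy P × Energy P × L2Surf P.interface) :=
  ((generatorGraph P lam mu).map
    ((energyMap P lam mu).prodMap ((energyMap P lam mu).prodMap
      (ContinuousLinearMap.id ℝ (L2Surf P.interface)))).toLinearMap).topologicalClosure

theorem mem_energyGraph {y f : State P} {h : L2Surf P.interface}
    (H : (y, f, h) ∈ generatorGraph P lam mu) :
    (energyMap P lam mu y, energyMap P lam mu f, h) ∈ energyGraph P lam mu :=
  Submodule.le_topologicalClosure _ (Submodule.mem_map_of_mem H)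

theorem isClosed_energyGraph (P : Geometry d) (lam mu : ℝ) :
    IsClosed (energyGraph P lam mu : Set (Energy P × Energy P × L2Surf P.interface)) :=
  Submodule.isClosed_topologicalClosure _

/-- Sequential description of the closed graph. -/
theorem exists_seq_of_mem_energyGraph {x f : Energy P} {k : L2Surf P.interface}
    (H : (x, f, k) ∈ energyGraph P lam mu) :
    ∃ (y g : ℕ → State P) (h : ℕ → L2Surf P.interface),
      (∀ n, (y n, g n, h n) ∈ generatorGraph P lam mu) ∧
      Tendsto (fun n => energyMap P lam mu (y n)) atTop (𝓝 x) ∧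
      Tendsto (fun n => energyMap P lam mu (g n)) atTop (𝓝 f) ∧
      Tendsto h atTop (𝓝 k) := by
  obtain ⟨s, hs, hlim⟩ := mem_closure_iff_seq_limit.1 H
  choose q hq hqs using hs
  have hlim' : Tendsto (fun n => (energyMap P lam mu (q n).1, energyMap P lam mu (q n).2.1,
      (q n).2.2)) atTop (𝓝 (x, f, k)) := by
    refine hlim.congr fun n => ?_
    rw [← hqs n]
    rfl
  refine ⟨fun n => (q n).1, fun n => (q n).2.1, fun n => (q n).2.2, hq, ?_, ?_, ?_⟩
  · exact (Prod.tendsto_iff _ _).1 hlim' |>.1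
  · exact ((Prod.tendsto_iff _ _).1 ((Prod.tendsto_iff _ _).1 hlim').2).1
  · exact ((Prod.tendsto_iff _ _).1 ((Prod.tendsto_iff _ _).1 hlim').2).2

theorem isDissipative_energyGraph (P : Geometry d) (lam mu : ℝ) :
    DissipativeRelation.IsDissipative (energyGraph P lam mu) := by
  refine DissipativeRelation.IsDissipative.topologicalClosure ?_
  rintro x f k ⟨⟨y, g, h⟩, ⟨a, ha⟩, he⟩
  have e : (energyMap P lam mu y, energyMap P lam mu g, h) = (x, f, k) := he
  simp only [Prod.mk.injEq] at e
  obtain ⟨rfl, rfl, rfl⟩ := e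
  rw [inner_energyMap_of_isWeakGeneratorWith ha]
  nlinarith [sq_nonneg ‖strainLp P.fluid a.1‖]

/-- Green's formula passes to the closed graph. -/
theorem hasNormalStress_of_mem_energyGraph (hd : 0 < d) (hmu : 0 < mu)
    (hlam : 0 < d * lam + 2 * mu) {y : State P} {f : Energy P} {k : L2Surf P.interface}
    (hy : IsH1 P.solid y.2.1) (H : (energyMap P lam mu y, f, k) ∈ energyGraph P lam mu) :
    HasNormalStress P lam mu y.2.1 k := by
  obtain ⟨Y, g, h, hmem, h1, h2, h3⟩ := exists_seq_of_mem_energyGraph H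
  -- The last component of 𝓐y is div σ(w) - w, so the divergence is that component plus w.
  refine ⟨energyVelocity P f + y.2.1.1, (hasDivAndNormalStress_iff hd hmu hlam _ _ _).2
    ⟨hy, fun p hp => ?_⟩⟩
  have e : ∀ n, inner ℝ (h n) p.2
      = -inner ℝ (energyElastic P (energyMap P lam mu (Y n))) (rootLp P.solid lam mu p.1.2)
        - inner ℝ (energyVelocity P (energyMap P lam mu (g n))
          + energyDisplacement P (energyMap P lam mu (Y n))) p.1.1 := fun n => by
    obtain ⟨a, ha⟩ := mem_generatorGraph.1 (hmem n)
    have := ha.2.2.2.2.2.2.2 p hp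
    rw [real_inner_comm, this, real_inner_comm, real_inner_comm p.1.1]
    rfl
  have hl := h3.inner (tendsto_const_nhds (x := p.2)) (𝕜 := ℝ)
  have hr := ((((energyElastic P).continuous.tendsto _).comp h1).inner
    (tendsto_const_nhds (x := rootLp P.solid lam mu p.1.2)) (𝕜 := ℝ)).neg.sub
    (((((energyVelocity P).continuous.tendsto _).comp h2).add
      (((energyDisplacement P).continuous.tendsto _).comp h1)).inner
      (tendsto_const_nhds (x := p.1.1)) (𝕜 := ℝ))
  exact tendsto_nhds_unique hl (hr.congr fun n => (e n).symm)

end StokesLame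

theorem enorm_sq_eq_ofReal {E : Type*} [NormedAddCommGroup E] (x : E) :
    ‖x‖ₑ ^ 2 = ENNReal.ofReal (‖x‖ ^ 2) := by
  rw [← ofReal_norm, ENNReal.ofReal_pow (norm_nonneg _)]

namespace StokesLame

variable {d : ℕ} {P : Geometry d} {lam mu : ℝ}

/-! ### The `H^{1/2}` bound for the normal stress -/

theorem slobodeckij_sub_le {S : Set (Vec d)} [SFinite (surface S)] {s : ℝ} (a b : L2Surf S) :
    slobodeckij S s (a - b) ≤ 2 * slobodeckij S s a + 2 * slobodeckij S s b := by
  have hm : ∀ f : L2Surf S, Measurable fun q : Vec d × Vec d =>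
      ‖f q.1 - f q.2‖ₑ ^ 2 / ‖q.1 - q.2‖ₑ ^ ((d : ℝ) - 1 + 2 * s) := fun f =>
    measurable_slobodeckij_kernel (Lp.stronglyMeasurable f).measurable _
  have hmain := lintegral_lintegral_mul_add_mul (σ := surface S) (p := 2) (q := 2)
    (a := fun x y => ‖a x - a y‖ₑ ^ 2 / ‖x - y‖ₑ ^ ((d : ℝ) - 1 + 2 * s))
    (b := fun x y => ‖b x - b y‖ₑ ^ 2 / ‖x - y‖ₑ ^ ((d : ℝ) - 1 + 2 * s)) (hm a) (hm b)
  rw [slobodeckij, slobodeckij, slobodeckij, ← hmain]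
  refine lintegral_mono_ae ?_
  filter_upwards [Lp.coeFn_sub a b] with x hx
  refine lintegral_mono_ae ?_
  filter_upwards [Lp.coeFn_sub a b] with y hy
  rw [hx, hy, Pi.sub_apply, Pi.sub_apply, ← mul_div_assoc, ← mul_div_assoc,
    ENNReal.div_add_div_same]
  refine ENNReal.div_le_div_right ?_ _
  have e : a x - b x - (a y - b y) = (a x - a y) - (b x - b y) := by abel
  rw [e]
  refine (pow_le_pow_left₀ zero_le enorm_sub_le 2).trans (ENNReal.add_sq_le_two_mul _ _)

theorem eLpNorm_strain_eq (D : Set (Vec d)) (M : L2Mat D) :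
    eLpNorm (fun x => strain (M x)) 2 (volume.restrict D) = ‖strainLp D M‖ₑ := by
  rw [Lp.enorm_def]
  exact (eLpNorm_congr_ae (coeFn_strainLp D M)).symm

theorem norm_sq_le_energy_fluid (x : Energy P) : ‖energyFluid P x‖ ^ 2 ≤ ‖x‖ ^ 2 := by
  rw [norm_sq_energy P x]
  nlinarith [sq_nonneg ‖energyElastic P x‖, sq_nonneg ‖energyDisplacement P x‖,
    sq_nonneg ‖energyVelocity P x‖]

theorem norm_sq_le_energy_elastic (x : Energy P) : ‖energyElastic P x‖ ^ 2 ≤ ‖x‖ ^ 2 := by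
  rw [norm_sq_energy P x]
  nlinarith [sq_nonneg ‖energyFluid P x‖, sq_nonneg ‖energyDisplacement P x‖,
    sq_nonneg ‖energyVelocity P x‖]

theorem norm_sq_le_energy_velocity (x : Energy P) : ‖energyVelocity P x‖ ^ 2 ≤ ‖x‖ ^ 2 := by
  rw [norm_sq_energy P x]
  nlinarith [sq_nonneg ‖energyElastic P x‖, sq_nonneg ‖energyDisplacement P x‖,
    sq_nonneg ‖energyFluid P x‖]

/-- The energy identity bounds the fluid strain by |⟨f, y⟩|, although no norm of the graph contains
it directly. -/
theorem enorm_strainLp_fluid_sq_le {y f : State P} {h : L2Surf P.interface}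
    {a : L2Mat P.fluid × L2Surf P.interface}
    (H : IsWeakGeneratorWith P lam mu ((y, f, h), a)) :
    ‖strainLp P.fluid a.1‖ₑ ^ 2
      ≤ ‖energyMap P lam mu y‖ₑ ^ 2 + ‖energyMap P lam mu f‖ₑ ^ 2 := by
  have h1 := inner_energyMap_of_isWeakGeneratorWith H
  have h2 := abs_real_inner_le_norm (energyMap P lam mu f) (energyMap P lam mu y)
  have h3 := neg_abs_le (inner ℝ (energyMap P lam mu f) (energyMap P lam mu y))
  rw [enorm_sq_eq_ofReal, enorm_sq_eq_ofReal, enorm_sq_eq_ofReal,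
    ← ENNReal.ofReal_add (by positivity) (by positivity)]
  refine ENNReal.ofReal_le_ofReal ?_
  nlinarith [sq_nonneg (‖energyMap P lam mu f‖ - ‖energyMap P lam mu y‖), sq_nonneg ‖h‖,
    sq_nonneg ‖energyMap P lam mu f‖, sq_nonneg ‖energyMap P lam mu y‖]

theorem enorm_strainLp_solid_sq_le (hd : 0 < d) (hmu : 0 < mu) (hlam : 0 < d * lam + 2 * mu)
    (f : State P) :
    ‖strainLp P.solid f.2.1.2‖ₑ ^ 2
      ≤ ENNReal.ofReal (min (2 * mu) (d * lam + 2 * mu))⁻¹ * ‖energyMap P lam mu f‖ₑ ^ 2 := by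
  have hc : 0 < min (2 * mu) (d * lam + 2 * mu) := lt_min (by linarith) hlam
  rw [enorm_sq_eq_ofReal, enorm_sq_eq_ofReal, ← ENNReal.ofReal_mul (inv_nonneg.2 hc.le)]
  refine ENNReal.ofReal_le_ofReal ?_
  rw [inv_mul_eq_div, le_div_iff₀' hc]
  exact (min_mul_norm_strainLp_sq_le hd hmu hlam P.solid f.2.1.2).trans
    (norm_sq_le_energy_elastic (energyMap P lam mu f))

/-- On the interface h is the trace of z minus that of u, taken from the two sides. The strain of z
is seen by the elastic component of f, that of u by dissipation, and the L² norms by y. -/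
theorem exists_slobodeckij_le_of_mem_generatorGraph (hd : 2 ≤ d) (P : Geometry d) (hmu : 0 < mu)
    (hlam : 0 < d * lam + 2 * mu) :
    ∃ C : ℝ≥0∞, C ≠ ⊤ ∧ ∀ y f h, (y, f, h) ∈ generatorGraph P lam mu →
      slobodeckij P.interface (1 / 2) h
        ≤ C * (‖energyMap P lam mu y‖ₑ ^ 2 + ‖energyMap P lam mu f‖ₑ ^ 2) := by
  obtain ⟨Cs, hCs⟩ := exists_slobodeckij_trace_le hd P.isCompact_interface
    fun x hx => P.hasChart_solid hx
  obtain ⟨Cf, hCf⟩ := exists_slobodeckij_trace_le hd P.isCompact_interface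
    fun x hx => P.hasChart_fluid hx
  have hfinite := isFiniteMeasure_surface hd P.isCompact_interface fun x hx => P.hasChart_solid hx
  set c := ENNReal.ofReal (min (2 * mu) (d * lam + 2 * mu))⁻¹ with hc
  refine ⟨2 * Cs * (c + 1) + 4 * Cf, ?_, fun y f h hmem => ?_⟩
  · refine ENNReal.add_ne_top.2 ⟨ENNReal.mul_ne_top (ENNReal.mul_ne_top (by simp) (by simp))
      (ENNReal.add_ne_top.2 ⟨ENNReal.ofReal_ne_top, by simp⟩),
      ENNReal.mul_ne_top (by simp) (by simp)⟩
  obtain ⟨a, ha⟩ := mem_generatorGraph.1 hmem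
  have hz : slobodeckij P.interface (1 / 2) (a.2 + h) ≤ _ := hCs _ _ ha.2.2.1
  have hu : slobodeckij P.interface (1 / 2) a.2 ≤ _ := hCf _ _ ha.2.1
  have hzf : f.2.1.1 = y.2.2 := ha.2.2.2.2.1
  rw [eLpNorm_strain_eq] at hz hu
  set X := ‖energyMap P lam mu y‖ₑ ^ 2
  set Y := ‖energyMap P lam mu f‖ₑ ^ 2
  have h1 : ‖strainLp P.solid f.2.1.2‖ₑ ^ 2 ≤ c * Y :=
    enorm_strainLp_solid_sq_le (by omega) hmu hlam f
  have h2 : ‖strainLp P.fluid a.1‖ₑ ^ 2 ≤ X + Y := enorm_strainLp_fluid_sq_le ha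
  have h3 : ‖f.2.1.1‖ₑ ^ 2 ≤ X := by
    rw [hzf]
    simp only [X]
    rw [enorm_sq_eq_ofReal, enorm_sq_eq_ofReal]
    exact ENNReal.ofReal_le_ofReal (norm_sq_le_energy_velocity (energyMap P lam mu y))
  have h4 : ‖y.1‖ₑ ^ 2 ≤ X := by
    simp only [X]
    rw [enorm_sq_eq_ofReal, enorm_sq_eq_ofReal]
    exact ENNReal.ofReal_le_ofReal (norm_sq_le_energy_fluid (energyMap P lam mu y))
  have e : h = (a.2 + h) - a.2 := by abel
  rw [e]
  calc slobodeckij P.interface (1 / 2) ((a.2 + h) - a.2)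
      ≤ 2 * slobodeckij P.interface (1 / 2) (a.2 + h) + 2 * slobodeckij P.interface (1 / 2) a.2 :=
        slobodeckij_sub_le _ _
    _ ≤ 2 * (Cs * (c * Y + X)) + 2 * (Cf * ((X + Y) + X)) := by
        gcongr
        · exact hz.trans (mul_le_mul_right (add_le_add h1 h3) _)
        · exact hu.trans (mul_le_mul_right (add_le_add h2 h4) _)
    _ ≤ 2 * (Cs * ((c + 1) * (X + Y))) + 2 * (Cf * (2 * (X + Y))) := by
        gcongr
        · rw [add_mul, one_mul]
          gcongr
          · exact le_add_self
          · exact le_self_add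
        · rw [two_mul]
          gcongr
          exact le_self_add
    _ = _ := by ring

/-- Limits in the closed graph need not come from states, but the seminorm is lower semicontinuous.
-/
theorem exists_slobodeckij_le_of_mem_energyGraph (hd : 2 ≤ d) (P : Geometry d) (hmu : 0 < mu)
    (hlam : 0 < d * lam + 2 * mu) :
    ∃ C : ℝ≥0∞, C ≠ ⊤ ∧ ∀ x f k, (x, f, k) ∈ energyGraph P lam mu →
      slobodeckij P.interface (1 / 2) k ≤ C * (‖x‖ₑ ^ 2 + ‖f‖ₑ ^ 2) := by
  obtain ⟨C, hC, hbound⟩ := exists_slobodeckij_le_of_mem_generatorGraph hd P hmu hlam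
  have hfinite := isFiniteMeasure_surface hd P.isCompact_interface fun x hx => P.hasChart_solid hx
  refine ⟨C, hC, fun x f k hmem => ?_⟩
  obtain ⟨y, g, h, hn, h1, h2, h3⟩ := exists_seq_of_mem_energyGraph hmem
  refine slobodeckij_le_of_tendsto h3 ?_ fun n => hbound _ _ _ (hn n)
  refine ENNReal.Tendsto.const_mul ?_ (Or.inr hC)
  exact (((ENNReal.continuous_pow 2).tendsto _).comp h1.enorm).add
    (((ENNReal.continuous_pow 2).tendsto _).comp h2.enorm)

end StokesLame

/-! ### Weak derivatives in time -/

/-- Fubini on the triangle s ≤ t: integrating θ' from s to T gives -θ(s), since θ vanishes at the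
endpoints. -/
theorem integral_deriv_smul_eq_neg_of_primitive {Z : Type*} [NormedAddCommGroup Z]
    [NormedSpace ℝ Z] [CompleteSpace Z] {T : ℝ} (hT : 0 < T) {θ : ℝ → ℝ} (hθ : ContDiff ℝ ∞ θ)
    (hsupp : tsupport θ ⊆ Ioo 0 T) {h k : ℝ → Z} {c : Z} (hk : IntegrableOn k (Ioo 0 T))
    (hh : ∀ t ∈ Ioo 0 T, h t = c + ∫ s in (0 : ℝ)..t, k s) :
    ∫ t in Ioo 0 T, deriv θ t • h t = -∫ t in Ioo 0 T, θ t • k t := by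
  set μ := volume.restrict (Ioo 0 T) with hμ
  have h0 : θ 0 = 0 := image_eq_zero_of_notMem_tsupport fun h => lt_irrefl _ (hsupp h).1
  have h1 : θ T = 0 := image_eq_zero_of_notMem_tsupport fun h => lt_irrefl _ (hsupp h).2
  have hθ' : Continuous (deriv θ) := hθ.continuous_deriv (by simp)
  have hprim : ∀ s t : ℝ, ∫ r in s..t, deriv θ r = θ t - θ s := fun s t =>
    intervalIntegral.integral_deriv_eq_sub
      (fun x _ => (hθ.differentiable (by simp)) x) (hθ'.intervalIntegrable _ _)
  have hθint : Integrable (deriv θ) μ :=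
    (hθ'.integrableOn_Icc (a := 0) (b := T)).mono_set Ioo_subset_Icc_self
  have hF : Integrable (fun q : ℝ × ℝ => {q : ℝ × ℝ | q.2 ≤ q.1}.indicator
      (fun q => deriv θ q.1 • k q.2) q) (μ.prod μ) :=
    (hθint.smul_prod hk).indicator (measurableSet_le measurable_snd measurable_fst)
  have hleft : ∀ t ∈ Ioo 0 T, ∫ s, {q : ℝ × ℝ | q.2 ≤ q.1}.indicator
      (fun q => deriv θ q.1 • k q.2) (t, s) ∂μ = deriv θ t • ∫ s in (0 : ℝ)..t, k s :=
    fun t ht => by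
      have e : (fun s => {q : ℝ × ℝ | q.2 ≤ q.1}.indicator (fun q => deriv θ q.1 • k q.2) (t, s))
          = (Iic t).indicator fun s => deriv θ t • k s := by
        ext1 s
        simp only [indicator, mem_ofPred_eq, mem_Iic]
      rw [e, integral_indicator measurableSet_Iic, integral_smul, hμ,
        Measure.restrict_restrict measurableSet_Iic, intervalIntegral.integral_of_le ht.1.le]
      congr 3
      ext s
      simp only [mem_inter_iff, mem_Iic, mem_Ioo, mem_Ioc]
      exact ⟨fun h => ⟨h.2.1, h.1⟩, fun h => ⟨h.2, h.1, h.2.trans_lt ht.2⟩⟩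
  have hright : ∀ s ∈ Ioo 0 T, ∫ t, {q : ℝ × ℝ | q.2 ≤ q.1}.indicator
      (fun q => deriv θ q.1 • k q.2) (t, s) ∂μ = -(θ s • k s) :=
    fun s hs => by
      have e : (fun t => {q : ℝ × ℝ | q.2 ≤ q.1}.indicator (fun q => deriv θ q.1 • k q.2) (t, s))
          = (Ici s).indicator fun t => deriv θ t • k s := by
        ext1 t
        simp only [indicator, mem_ofPred_eq, mem_Ici]
      have e2 : Ici s ∩ Ioo 0 T = Ico s T := by
        ext t
        simp only [mem_inter_iff, mem_Ici, mem_Ioo, mem_Ico]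
        exact ⟨fun h => ⟨h.1, h.2.2⟩, fun h => ⟨h.1, hs.1.trans_le h.1, h.2⟩⟩
      rw [e, integral_indicator measurableSet_Ici, integral_smul_const, hμ,
        Measure.restrict_restrict measurableSet_Ici, e2, integral_Ico_eq_integral_Ioc,
        ← intervalIntegral.integral_of_le hs.2.le, hprim, h1, zero_sub, neg_smul]
  have hswap := integral_integral_swap (f := fun t s => {q : ℝ × ℝ | q.2 ≤ q.1}.indicator
    (fun q => deriv θ q.1 • k q.2) (t, s)) hF
  rw [setIntegral_congr_fun measurableSet_Ioo hleft,
    setIntegral_congr_fun measurableSet_Ioo hright, integral_neg] at hswap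
  have hsplit : ∀ t ∈ Ioo 0 T, deriv θ t • h t
      = deriv θ t • c + deriv θ t • ∫ s in (0 : ℝ)..t, k s := fun t ht => by
    rw [hh t ht, smul_add]
  rw [← hswap, setIntegral_congr_fun measurableSet_Ioo hsplit]
  have hi1 : Integrable (fun t => deriv θ t • c) μ := hθint.smul_const c
  have hi2 : Integrable (fun t => deriv θ t • ∫ s in (0 : ℝ)..t, k s) μ := by
    refine (hF.integral_prod_left).congr ?_
    filter_upwards [self_mem_ae_restrict measurableSet_Ioo] with t ht
    exact hleft t ht
  rw [integral_add hi1 hi2, integral_smul_const, ← integral_Ioc_eq_integral_Ioo,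
    ← intervalIntegral.integral_of_le hT.le, hprim, h0, h1, sub_zero, zero_smul, zero_add]

/-- By linearity the bound applies to the difference of the relations at two times. -/
theorem DissipativeRelation.tendsto_output_of_bound {E Z : Type*} [NormedAddCommGroup E]
    [InnerProductSpace ℝ E] [NormedAddCommGroup Z] [InnerProductSpace ℝ Z]
    {G : Submodule ℝ (E × E × Z)} {N : Z → ℝ≥0∞} {C : ℝ≥0∞} (hC : C ≠ ⊤)
    (hN : ∀ a f k, (a, f, k) ∈ G → N k ≤ C * (‖a‖ₑ ^ 2 + ‖f‖ₑ ^ 2)) {x x' : ℝ → E} {h : ℝ → Z}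
    (hx : Continuous x) (hx' : Continuous x') (hmem : ∀ t, 0 ≤ t → (x t, x' t, h t) ∈ G) {t : ℝ}
    (ht : 0 ≤ t) : Tendsto (fun τ => N (h τ - h t)) (𝓝[Ici 0] t) (𝓝 0) := by
  have hc : Continuous fun τ => ‖x τ - x t‖ₑ ^ 2 + ‖x' τ - x' t‖ₑ ^ 2 :=
    ((ENNReal.continuous_pow 2).comp (hx.sub continuous_const).enorm).add
      ((ENNReal.continuous_pow 2).comp (hx'.sub continuous_const).enorm)
  have hlim := ENNReal.Tendsto.const_mul (hc.tendsto t) (Or.inr hC)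
  simp only [sub_self, enorm_zero, ne_eq, OfNat.ofNat_ne_zero, not_false_eq_true, zero_pow,
    add_zero, mul_zero] at hlim
  refine tendsto_of_tendsto_of_tendsto_of_le_of_le' tendsto_const_nhds
    (hlim.mono_left nhdsWithin_le_nhds) (Eventually.of_forall fun _ => zero_le) ?_
  filter_upwards [self_mem_nhdsWithin] with τ hτ
  exact hN _ _ _ (G.sub_mem (hmem τ hτ) (hmem t ht))

namespace StokesLame

variable {d : ℕ} {P : Geometry d} {lam mu : ℝ}

open DissipativeRelation

/-! ### Semigroup solutions in the energy space -/

theorem IsSemigroupSolution.integral_displacement {y₀ : State P} {y : ℝ → State P}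
    (hy : IsSemigroupSolution P lam mu y₀ y) {t : ℝ} (ht : 0 ≤ t) :
    (∫ s in (0 : ℝ)..t, y s).2.1 = ∫ s in (0 : ℝ)..t, (y s).2.1 := by
  have hInteg : IntervalIntegrable y volume 0 t :=
    (hy.2.1.mono fun s hs => by rw [uIcc_of_le ht] at hs; exact hs.1).intervalIntegrable
  exact (((ContinuousLinearMap.fst ℝ (Jet P.solid) (L2 P.solid)).comp
    (ContinuousLinearMap.snd ℝ (L2 P.fluid) _)).intervalIntegral_comp_comm hInteg).symm

/-- The energy map is continuous and linear, so it commutes with the time integral and carries the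
mild equation over; constant extension to negative times makes the curve continuous on the line. -/
theorem IsSemigroupSolution.exists_isMild (hd : 0 < d) (hmu : 0 < mu)
    (hlam : 0 < d * lam + 2 * mu) {y₀ : State P} {y : ℝ → State P}
    (hy : IsSemigroupSolution P lam mu y₀ y) :
    ∃ K, IsMild (energyGraph P lam mu) (fun t => energyMap P lam mu (y (max t 0))) K ∧
      ∀ t, 0 ≤ t → HasNormalStress P lam mu (∫ s in (0 : ℝ)..t, (y s).2.1) (K t) := by
  choose! K hK using fun t ht => (hy.2.2.2 t ht).exists_mem_generatorGraph hd hmu hlam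
  refine ⟨K, ⟨?_, fun t ht => ?_⟩, fun t ht => ?_⟩
  · exact (energyMap P lam mu).continuous.comp (hy.2.1.comp_continuous
      (continuous_id.max continuous_const) fun t => mem_Ici.2 (le_max_right _ _))
  · have hInteg : IntervalIntegrable y volume 0 t :=
      (hy.2.1.mono fun s hs => by rw [uIcc_of_le ht] at hs; exact hs.1).intervalIntegrable
    have h1 : ∫ s in (0 : ℝ)..t, energyMap P lam mu (y (max s 0))
        = energyMap P lam mu (∫ s in (0 : ℝ)..t, y s) := by
      rw [← (energyMap P lam mu).intervalIntegral_comp_comm hInteg]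
      refine intervalIntegral.integral_congr fun s hs => ?_
      rw [uIcc_of_le ht] at hs
      simp only [max_eq_left hs.1]
    rw [h1, max_eq_left ht, max_self, hy.1, ← map_sub]
    exact mem_energyGraph (hK t ht).2
  · rw [← hy.integral_displacement ht]
    exact (hK t ht).1

theorem IsNormalStressOf.of_integral_eq {w : ℝ → Jet P.solid} {K h : ℝ → L2Surf P.interface}
    (hK : ∀ t, 0 ≤ t → HasNormalStress P lam mu (∫ s in (0 : ℝ)..t, w s) (K t))
    (hInteg : ∀ T, 0 < T → MemLp h 2 (volume.restrict (Ioo 0 T)))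
    (hh : ∀ t, 0 ≤ t → ∫ s in (0 : ℝ)..t, h s = K t) : IsNormalStressOf P lam mu w h :=
  ⟨fun T hT => (hInteg T hT).integrable (by norm_num), fun t ht => by rw [hh t ht]; exact hK t ht⟩

theorem memL2L2_of_isOutput {x : ℝ → Energy P} {K h : ℝ → L2Surf P.interface}
    (hx : IsMild (energyGraph P lam mu) x K) (hh : IsOutput K h) (T : ℝ) :
    MemL2L2 P.interface T h :=
  (hh.memLp (isDissipative_energyGraph P lam mu) hx).mono_measure
    (Measure.restrict_mono (fun _ ht => ht.1) le_rfl)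

/-! ### Regularity of the normal stress -/

theorem exists_normalStress_memL2L2 (hd : 0 < d) (hmu : 0 < mu) (hlam : 0 < d * lam + 2 * mu)
    {y₀ : State P} {y : ℝ → State P} (hy : IsSemigroupSolution P lam mu y₀ y) :
    ∃ h : ℝ → L2Surf P.interface, IsNormalStressOf P lam mu (fun t => (y t).2.1) h ∧
      ∀ T : ℝ, 0 < T → MemL2L2 P.interface T h := by
  obtain ⟨K, hx, hK⟩ := hy.exists_isMild hd hmu hlam
  have hG := isDissipative_energyGraph P lam mu
  obtain ⟨h, hh⟩ := hx.exists_isOutput hG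
  exact ⟨h, .of_integral_eq hK (fun T _ => memL2L2_of_isOutput hx hh T)
    fun t ht => hh.integral_eq hG hx ht, fun T _ => memL2L2_of_isOutput hx hh T⟩

theorem exists_normalStress_memCHs_memH1L2 (hd : 2 ≤ d) (hmu : 0 < mu)
    (hlam : 0 < d * lam + 2 * mu) {y₀ : State P} {y : ℝ → State P} (h₀ : InDomain P lam mu y₀)
    (hy : IsSemigroupSolution P lam mu y₀ y) :
    ∃ h : ℝ → L2Surf P.interface, IsNormalStressOf P lam mu (fun t => (y t).2.1) h ∧
      (∀ t : ℝ, 0 ≤ t → HasNormalStress P lam mu (y t).2.1 (h t)) ∧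
      ∀ T : ℝ, 0 < T → MemCHs P.interface T (1 / 2) h ∧ MemH1L2 P.interface T h := by
  have hd0 : 0 < d := by omega
  obtain ⟨K, hx, hK⟩ := hy.exists_isMild hd0 hmu hlam
  have hG := isDissipative_energyGraph P lam mu
  obtain ⟨C, hC, hN⟩ := exists_slobodeckij_le_of_mem_energyGraph hd P hmu hlam
  set x : ℝ → Energy P := fun t => energyMap P lam mu (y (max t 0)) with hxdef
  obtain ⟨f₀, hf₀⟩ := h₀
  obtain ⟨k₀, -, hk₀⟩ := hf₀.exists_mem_generatorGraph hd0 hmu hlam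
  have hx0 : x 0 = energyMap P lam mu y₀ := by simp only [hxdef, max_self, hy.1]
  obtain ⟨x', h, hx', hh, hmem, hInteg, hmild⟩ := hx.exists_deriv hG
    (isClosed_energyGraph P lam mu) (hx0 ▸ mem_energyGraph hk₀)
  -- The derivative x' is mild with integrated output h - h 0, so its output is the weak derivative
  -- of h.
  obtain ⟨h', hh'⟩ := hmild.exists_isOutput hG
  have hL2 : ∀ T, MemLp h 2 (volume.restrict (Ioo 0 T)) := fun T => by
    obtain ⟨B, hB⟩ := isCompact_Icc.exists_bound_of_continuousOn
      (hh.mono fun t (ht : t ∈ Icc 0 T) => ht.1)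
    refine MemLp.of_bound ((hh.mono fun t ht => ht.1.le).aestronglyMeasurable measurableSet_Ioo)
      B ?_
    filter_upwards [self_mem_ae_restrict measurableSet_Ioo] with t ht
    exact hB t (Ioo_subset_Icc_self ht)
  refine ⟨h, .of_integral_eq hK (fun T _ => hL2 T) hInteg, fun t ht => ?_, fun T hT =>
    ⟨⟨hh.mono fun t ht => ht.1, fun t ht => ⟨?_, ?_⟩⟩, hL2 T, h', memL2L2_of_isOutput hmild hh' T,
      fun θ hθ _ hsupp => ?_⟩⟩
  · have := hmem t ht
    simp only [hxdef, max_eq_left ht] at this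
    exact hasNormalStress_of_mem_energyGraph hd0 hmu hlam (hy.2.2.1 t ht).2 this
  · refine (hN _ _ _ (hmem t ht.1)).trans_lt (ENNReal.mul_lt_top hC.lt_top ?_)
    exact ENNReal.add_lt_top.2 ⟨ENNReal.pow_lt_top enorm_lt_top, ENNReal.pow_lt_top enorm_lt_top⟩
  · exact (tendsto_output_of_bound hC hN hx.cont hx' hmem ht.1).mono_left
      (nhdsWithin_mono t fun _ hτ => hτ.1)
  · refine integral_deriv_smul_eq_neg_of_primitive hT hθ hsupp (c := h 0)
      ((memL2L2_of_isOutput hmild hh' T).integrable (by norm_num)) fun t ht => ?_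
    rw [hh'.integral_eq hG hmild ht.1.le]
    abel

theorem exists_normalStress_memL2Hs_memHrL2 (hd : 2 ≤ d) (hmu : 0 < mu)
    (hlam : 0 < d * lam + 2 * mu) {ε : ℝ} (hε0 : 0 < ε) (hε1 : ε < 1) {y₀ : State P}
    {y : ℝ → State P} (h₀ : InFracDomain P lam mu ε y₀) (hy : IsSemigroupSolution P lam mu y₀ y) :
    ∃ h : ℝ → L2Surf P.interface, IsNormalStressOf P lam mu (fun t => (y t).2.1) h ∧
      ∀ T : ℝ, 0 < T → MemL2Hs P.interface T (ε / 2) h ∧ MemHrL2 P.interface T ε h := by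
  have hd0 : 0 < d := by omega
  obtain ⟨K, hx, hK⟩ := hy.exists_isMild hd0 hmu hlam
  have hG := isDissipative_energyGraph P lam mu
  obtain ⟨C, hC, hN⟩ := exists_slobodeckij_le_of_mem_energyGraph hd P hmu hlam
  obtain ⟨B, hB, hM⟩ := exists_slobodeckij_interpolation hd P.isCompact_interface
    (fun x hx => P.hasChart_solid hx) hε0 hε1
  obtain ⟨z, v, hv, hvint, hy₀⟩ := h₀
  obtain ⟨L, hvL, -⟩ := hv.exists_isMild hd0 hmu hlam
  obtain ⟨h, hh⟩ := hx.exists_isOutput hG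
  have hcongr : ∀ t ∈ Ioi (0 : ℝ), t ^ (ε - 1) • energyMap P lam mu (v (max t 0))
      = energyMap P lam mu (t ^ (ε - 1) • v t) := fun t ht => by
    rw [max_eq_left (le_of_lt ht), map_smul]
  have hInteg : IntegrableOn (fun t : ℝ => t ^ (ε - 1) • energyMap P lam mu (v (max t 0)))
      (Ioi 0) :=
    IntegrableOn.congr_fun ((energyMap P lam mu).integrable_comp hvint)
      (fun t ht => (hcongr t ht).symm) measurableSet_Ioi
  -- The energy map commutes with the moment integral, so the representation of y₀ by the negative
  -- fractional power persists in the energy space.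
  have hfin := hx.lintegral_modulus_lt_top hG hvL hε0 hε1 hInteg (c := (Real.Gamma ε)⁻¹) (by
    rw [max_self, hy.1, hy₀, map_smul, setIntegral_congr_fun measurableSet_Ioi hcongr,
      (energyMap P lam mu).integral_comp_comm hvint])
  refine ⟨h, .of_integral_eq hK (fun T _ => memL2L2_of_isOutput hx hh T)
    fun t ht => hh.integral_eq hG hx ht, fun T _ => ⟨⟨memL2L2_of_isOutput hx hh T, ?_⟩,
    memL2L2_of_isOutput hx hh T, ?_⟩⟩
  · exact hh.lintegral_interpolation_lt_top hG hx hε0 hε1 hfin hC hB hN hM T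
  · exact hh.lintegral_slobodeckij_lt_top hG hx hfin T

end StokesLame

open StokesLame
theorem proposition2p2 {d : ℕ} (hd : d = 2 ∨ d = 3) (P : Geometry d) (lam mu : ℝ)
    (hmu : 0 < mu) (hlam : 0 < d * lam + 2 * mu) :
    (∀ (y₀ : State P) (y : ℝ → State P), InY P y₀ → IsSemigroupSolution P lam mu y₀ y →
      ∃ h : ℝ → L2Surf P.interface,
        IsNormalStressOf P lam mu (fun t => (y t).2.1) h ∧
        ∀ T : ℝ, 0 < T → MemL2L2 P.interface T h) ∧
    (∀ (y₀ : State P) (y : ℝ → State P), InDomain P lam mu y₀ →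
      IsSemigroupSolution P lam mu y₀ y →
      ∃ h : ℝ → L2Surf P.interface,
        IsNormalStressOf P lam mu (fun t => (y t).2.1) h ∧
        (∀ t : ℝ, 0 ≤ t → HasNormalStress P lam mu (y t).2.1 (h t)) ∧
        ∀ T : ℝ, 0 < T → MemCHs P.interface T (1 / 2) h ∧ MemH1L2 P.interface T h) ∧
    (∀ ε : ℝ, 0 < ε → ε < 1 →
      ∀ (y₀ : State P) (y : ℝ → State P), InFracDomain P lam mu ε y₀ →
      IsSemigroupSolution P lam mu y₀ y →
      ∃ h : ℝ → L2Surf P.interface,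
        IsNormalStressOf P lam mu (fun t => (y t).2.1) h ∧
        ∀ T : ℝ, 0 < T → MemL2Hs P.interface T (ε / 2) h ∧ MemHrL2 P.interface T ε h) := by
  have hd2 : 2 ≤ d := by omega
  exact ⟨fun y₀ y _ hy => exists_normalStress_memL2L2 (by omega) hmu hlam hy,
    fun y₀ y h₀ hy => exists_normalStress_memCHs_memH1L2 hd2 hmu hlam h₀ hy,
    fun ε h0 h1 y₀ y h₀ hy => exists_normalStress_memL2Hs_memHrL2 hd2 hmu hlam h0 h1 h₀ hy⟩
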